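/- Let $0<q<1$, let $s\in\mathbb{Q}_{>0}$, and let $\kappa,\lambda,\upsilon,\varsigma$ be real. Write $q^x:=e^{x\log q}$ for $x\in\mathbb{C}$, $(u;p)_n:=\prod_{i=0}^{n-1}(1-up^i)$ for $0\le n\le\infty$, $(u_1,\dots,u_k;p)_n:=\prod_j(u_j;p)_n$, $\theta(u;p):=(u,p/u;p)_\infty$, $\theta(u_1,\dots,u_k;p):=\prod_j\theta(u_j;p)$ and $${}_8W_7(\alpha_0;\alpha_1,\dots,\alpha_5;p,t):=\sum_{r\ge0}\frac{1-\alpha_0p^{2r}}{1-\alpha_0}\,t^r\prod_{j=0}^5\frac{(\alpha_j;p)_r}{(p\alpha_0/\alpha_j;p)_r}.$$ Put $$(a,b,c_s,d)=(q^{\kappa+\lambda},-q^{\kappa-\lambda},q^{s/2+\upsilon+\varsigma},-q^{s/2+\upsilon-\varsigma}),\qquad(\tilde a,\tilde b,\tilde c,\tilde d)=(q^{\kappa+\upsilon},-q^{\kappa-\upsilon},q^{s/2+\lambda+\varsigma},-q^{s/2+\lambda-\varsigma}).$$ A superscript $d$ on a function means that $\lambda$ and $\upsilon$ are interchanged in its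 parameters. Let $$W(x,z)=q^{(\kappa+\lambda+x)(\kappa+\upsilon+z)/s},\qquad \mathrm{St}(x)=\bigl(q^{s+x}/a,q^{s+x}/b,q^{s+x}/c_s,q^{s+x}/d;q^s\bigr)_\infty,$$ $$c(x,z)=\frac{\theta\bigl(\tilde aq^{-z},\tilde bq^{-z},\tilde cq^{-z},dq^{x-z}/\tilde a;q^s\bigr)}{W(x,z)\,\theta\bigl(q^{-2z},dq^x;q^s\bigr)}.$$ Let $\mathcal D$ be the Askey–Wilson operator $$(\mathcal Df)(x)=A(x)(f(x+s)-f(x))+A(-x)(f(x-s)-f(x)),\qquad A(x)=\frac{(1-aq^x)(1-bq^x)(1-c_sq^x)(1-dq^x)}{\tilde a(1-q^{2x})(1-q^{s+2x})}.$$ Let $$\Phi(x,z)=\frac{W(x,z)}{\mathrm{St}(x)\,\mathrm{St}^d(z)}\sum_{r\ge0}\Gamma_r(z)q^{rx}$$ be its asymptotically free eigenfunction: the $\Gamma_r$ are the unique entire functions such that $\Gamma_0(z)=(q^{s+2z};q^s)_\infty$, the series converges normally on compacta of $\mathbb{C}\times\mathbb{C}$, and $\mathcal D_x\Phi=(q^z+q^{-z}-\tilde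 a-\tilde a^{-1})\Phi$. Let the Askey–Wilson function $\mathcal E$ be the meromorphic function on $\mathbb{C}\times\mathbb{C}$ that is given, for $|q^{s-z}/\tilde d|<1$, by $$\mathcal E(x,z)=\frac{\bigl(\tilde aq^{s+z-x}/d,\ \tilde aq^{s+z+x}/d,\ ab,\ ac_s,\ q^sa/d;\,q^s\bigr)_\infty}{\bigl(q^{s+x}/d,\ q^{s-x}/d,\ q^{s+z}/\tilde d,\ \tilde a\tilde b\tilde cq^z;\,q^s\bigr)_\infty}\;{}_8W_7\bigl(\tilde a\tilde b\tilde cq^{-s+z};\,aq^x,aq^{-x},\tilde aq^z,\tilde bq^z,\tilde cq^z;\,q^s,\,q^{s-z}/\tilde d\bigr).$$ Finally put $\tilde\Phi(x,z):=c(x,z)\Phi(x,z)$. Then, as identities of meromorphic functions of $(x,z)\in\mathbb{C}\times\mathbb{C}$: (i) If $\kappa/s,\lambda/s,\upsilon/s,\varsigma/s\in\tfrac12\mathbb{Z}$ and an even number of these four numbers are integers, then $c(x,z)=c^d(z,x)$. Moreover, for every $(\kappa,\lambda,\upsilon,\varsigma)\in\mathbb{R}^4$ such that $c(x,z)=c^d(z,x)$: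 (ii) $\tilde\Phi(x,z)=\tilde\Phi^d(z,x)$; (iii) $\tilde\Phi(-x,z)=\tilde\Phi(x,-z)$; (iv) $\mathcal E(x,z)=\tilde\Phi(x,z)+\tilde\Phi(-x,z)$. -/

import Mathlib

noncomputable section

namespace AskeyWilson

/-! ## Entire and meromorphic functions on `ℂ × ℂ` -/

/-- `h` is an entire function on `ℂ × ℂ` that is not identically zero. -/
def IsNonzeroEntire (h : ℂ × ℂ → ℂ) : Prop :=
  Differentiable ℂ h ∧ ∃ p, h p ≠ 0

/-- `F` represents a meromorphic function on `ℂ × ℂ`. Every such function is a global quotient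
`f / g` of entire functions with `g` not identically zero; the values of `F` on the zero set of
`g` are irrelevant. -/
def IsMeromorphic (F : ℂ → ℂ → ℂ) : Prop :=
  ∃ f g : ℂ × ℂ → ℂ, Differentiable ℂ f ∧ IsNonzeroEntire g ∧
    ∀ x z : ℂ, g (x, z) ≠ 0 → F x z = f (x, z) / g (x, z)

/-- Equality of `F` and `G` as meromorphic functions on `ℂ × ℂ`: they agree off the zero set of
some entire function that is not identically zero. -/
def MeroEq (F G : ℂ → ℂ → ℂ) : Prop :=
  ∃ h : ℂ × ℂ → ℂ, IsNonzeroEntire h ∧ ∀ x z : ℂ, h (x, z) ≠ 0 → F x z = G x z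

/-! ## `q`-analysis, in base `p` -/

/-- The finite `q`-shifted factorial `(a; p)_n`. -/
def qPoch (a p : ℂ) (n : ℕ) : ℂ := ∏ i ∈ Finset.range n, (1 - a * p ^ i)

/-- The infinite `q`-shifted factorial `(a; p)_∞`. -/
def qPochInf (a p : ℂ) : ℂ := ∏' i : ℕ, (1 - a * p ^ i)

/-- The modified Jacobi theta function `θ(u; p) = (u, p/u; p)_∞`. -/
def theta (u p : ℂ) : ℂ := qPochInf u p * qPochInf (p / u) p

/-- The very-well-poised series `₈W₇(α₀; α₁, α₂, α₃, α₄, α₅; p, t)`. -/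
def W87 (α : Fin 6 → ℂ) (p t : ℂ) : ℂ :=
  ∑' r : ℕ, (1 - α 0 * p ^ (2 * r)) / (1 - α 0) * t ^ r *
    ∏ j : Fin 6, qPoch (α j) p r / qPoch (p * α 0 / α j) p r

/-! ## Parameters -/

/-- The four real Hecke parameters, the deformation parameter `0 < q < 1` and the step size
`s ∈ ℚ_{>0}`. -/
structure Params where
  kap : ℝ
  lam : ℝ
  ups : ℝ
  sig : ℝ
  q : ℝ
  s : ℚ
  q_pos : 0 < q
  q_lt_one : q < 1
  s_pos : 0 < s

namespace Params

/-- The dual parameters: the second and third Hecke parameters are interchanged. -/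
def dual (P : Params) : Params where
  kap := P.kap
  lam := P.ups
  ups := P.lam
  sig := P.sig
  q := P.q
  s := P.s
  q_pos := P.q_pos
  q_lt_one := P.q_lt_one
  s_pos := P.s_pos

/-- `q ^ x = exp (x * log q)` for complex `x`. -/
def qexp (P : Params) (x : ℂ) : ℂ := (P.q : ℂ) ^ x

/-- The base `q ^ s`. -/
def base (P : Params) : ℂ := P.qexp (P.s : ℂ)

/-- The Askey–Wilson parameters `a_s, b_s, c_s, d_s`. The dual Askey–Wilson parameters are
`P.dual.a, P.dual.b, P.dual.c, P.dual.d`. -/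
def a (P : Params) : ℂ := P.qexp (P.kap + P.lam)
def b (P : Params) : ℂ := -P.qexp (P.kap - P.lam)
def c (P : Params) : ℂ := P.qexp (P.s / 2 + P.ups + P.sig)
def d (P : Params) : ℂ := -P.qexp (P.s / 2 + P.ups - P.sig)

/-- The rescaled Hecke parameters `κ/s, λ/s, υ/s, ς/s`. -/
def ratio (P : Params) : Fin 4 → ℝ :=
  ![P.kap / P.s, P.lam / P.s, P.ups / P.s, P.sig / P.s]

/-- All `κ/s, λ/s, υ/s, ς/s` lie in `½ℤ`, and an even number of them are integers. -/
def HalfIntegral (P : Params) : Prop :=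
  (∀ i, ∃ k : ℤ, P.ratio i = k / 2) ∧ Even {i : Fin 4 | ∃ n : ℤ, P.ratio i = n}.ncard

end Params

/-! ## The Askey–Wilson operator and its asymptotically free eigenfunction -/

/-- The coefficient `A(x)` of the Askey–Wilson operator. -/
def coeffA (P : Params) (x : ℂ) : ℂ :=
  (1 - P.a * P.qexp x) * (1 - P.b * P.qexp x) * (1 - P.c * P.qexp x) * (1 - P.d * P.qexp x) /
    (P.dual.a * (1 - P.qexp (2 * x)) * (1 - P.qexp (P.s + 2 * x)))

/-- The Askey–Wilson second order difference operator. -/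
def opD (P : Params) (f : ℂ → ℂ) (x : ℂ) : ℂ :=
  coeffA P x * (f (x + P.s) - f x) + coeffA P (-x) * (f (x - P.s) - f x)

/-- `W(x, z)`. -/
def W (P : Params) (x z : ℂ) : ℂ :=
  P.qexp ((P.kap + P.lam + x) * (P.kap + P.ups + z) / P.s)

/-- The singular term `St(x)`; its dual version is `St P.dual`. -/
def St (P : Params) (x : ℂ) : ℂ :=
  qPochInf (P.qexp (P.s + x) / P.a) P.base * qPochInf (P.qexp (P.s + x) / P.b) P.base *
    qPochInf (P.qexp (P.s + x) / P.c) P.base * qPochInf (P.qexp (P.s + x) / P.d) P.base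

/-- The power series `∑ r, Γ r z * q ^ (r x)`. -/
def seriesOf (P : Params) (Γ : ℕ → ℂ → ℂ) (x z : ℂ) : ℂ :=
  ∑' r : ℕ, Γ r z * P.qexp (r * x)

/-- `W(x,z) / (St(x) St^d(z)) * ∑ r, Γ r z * q ^ (r x)`. -/
def asymptOf (P : Params) (Γ : ℕ → ℂ → ℂ) (x z : ℂ) : ℂ :=
  W P x z / (St P x * St P.dual z) * seriesOf P Γ x z

/-- The conditions that determine the coefficients of the asymptotically free eigenfunction. -/
structure IsCoeffSeq (P : Params) (Γ : ℕ → ℂ → ℂ) : Prop where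
  holomorphic : ∀ r, Differentiable ℂ (Γ r)
  leading : ∀ z, Γ 0 z = qPochInf (P.qexp (P.s + 2 * z)) P.base
  /-- Normal convergence on compacta of `ℂ × ℂ`. -/
  normal : ∀ K : Set (ℂ × ℂ), IsCompact K → ∃ M : ℕ → ℝ, Summable M ∧
    ∀ r, ∀ y ∈ K, ‖Γ r y.2 * P.qexp (r * y.1)‖ ≤ M r
  eigen : MeroEq
    (fun x z => opD P (fun y => asymptOf P Γ y z) x +
      (-P.qexp z - P.qexp (-z) + P.dual.a + P.dual.a⁻¹) * asymptOf P Γ x z)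
    (fun _ _ => 0)

/-- The unique sequence of holomorphic functions `Γ_r` satisfying `IsCoeffSeq`. -/
def Gam (P : Params) : ℕ → ℂ → ℂ := Classical.epsilon (IsCoeffSeq P)

/-- The asymptotically free eigenfunction `Φ(x, z)`. -/
def Phi (P : Params) (x z : ℂ) : ℂ := asymptOf P (Gam P) x z

/-! ## The `c`-function and the Askey–Wilson function -/

/-- The normalized `c`-function `c(x, z)`. -/
def cfun (P : Params) (x z : ℂ) : ℂ :=
  theta (P.dual.a * P.qexp (-z)) P.base * theta (P.dual.b * P.qexp (-z)) P.base *
      theta (P.dual.c * P.qexp (-z)) P.base *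
      theta (P.d * P.qexp (x - z) / P.dual.a) P.base /
    (W P x z * (theta (P.qexp (-2 * z)) P.base * theta (P.d * P.qexp x) P.base))

/-- The explicit series expression of the Askey–Wilson function, for
`|q ^ (s - z) / d̃_s| < 1`. -/
def awSeries (P : Params) (x z : ℂ) : ℂ :=
  (qPochInf (P.dual.a * P.qexp (P.s + z - x) / P.d) P.base *
      qPochInf (P.dual.a * P.qexp (P.s + z + x) / P.d) P.base *
      qPochInf (P.a * P.b) P.base * qPochInf (P.a * P.c) P.base *
      qPochInf (P.base * P.a / P.d) P.base) /
    (qPochInf (P.qexp (P.s + x) / P.d) P.base * qPochInf (P.qexp (P.s - x) / P.d) P.base *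
      qPochInf (P.qexp (P.s + z) / P.dual.d) P.base *
      qPochInf (P.dual.a * P.dual.b * P.dual.c * P.qexp z) P.base) *
    W87 ![P.dual.a * P.dual.b * P.dual.c * P.qexp (-P.s + z),
        P.a * P.qexp x, P.a * P.qexp (-x),
        P.dual.a * P.qexp z, P.dual.b * P.qexp z, P.dual.c * P.qexp z]
      P.base (P.qexp (P.s - z) / P.dual.d)

/-- `E` represents the meromorphic function on `ℂ × ℂ` that is given by `awSeries` where
`|q ^ (s - z) / d̃_s| < 1`. -/
def IsAWFunction (P : Params) (E : ℂ → ℂ → ℂ) : Prop :=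
  IsMeromorphic E ∧ ∃ h : ℂ × ℂ → ℂ, IsNonzeroEntire h ∧
    ∀ x z : ℂ, ‖P.qexp (P.s - z) / P.dual.d‖ < 1 → h (x, z) ≠ 0 → E x z = awSeries P x z

/-- The Askey–Wilson function `𝓔(x, z)`; it is unique up to `MeroEq`. -/
def awFun (P : Params) : ℂ → ℂ → ℂ := Classical.epsilon (IsAWFunction P)

/-- The renormalization `Φ̃(x, z) = c(x, z) Φ(x, z)`. -/
def PhiTilde (P : Params) (x z : ℂ) : ℂ := cfun P x z * Phi P x z

end AskeyWilson

end

noncomputable section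
namespace AskeyWilson
open Filter Topology Finset

/-! ## Shifted factorials -/

section Finite

variable {p : ℂ}

/-! Write p = q^s, u = q^x, v = q^z. Conjugation by W / (St St^d) turns the eigenvalue equation into
a difference equation v² E(u) F(pu) + (1 - p u²) F(u/p) = (v L₁(u) + (v² + 1) L₀(u)) F(u) with
polynomial coefficients (`Params.opD_asymptOf`). Then Φ = W / (St St^d) · F(u, v), where F is the
power series solution in u with F(0, v) = (p v²; p)_∞. The recursion for its coefficients gives at
first only some disc of convergence. The equation itself improves the geometric rate of the
coefficients by the factor |p|, because its apparent singularities are removable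
(`Par.exists_improve`), so F is entire. A solution regular at u = 0 is determined by its value there
for generic v (`Par.eventually_eq_zero_of_difference_equation`), which makes the Γ_r unique.

The same uniqueness identifies F with a very-well-poised ₈W₇ (`Par.qPochInf_mul_F`): creative
telescoping shows that the ₈W₇ solves the equation, and the q-binomial theorem gives its value at u
= 0. Bailey's transformation of that series becomes F(u, v) = F^d(v, u) (`Par.F_eq_dual`). Hence
Φ(x, z) = Φ^d(z, x), and (ii) follows as soon as c is symmetric.

The three-term relation of ₈W₇ series gives the connection formula (`Par.aw_eq`), which reads 𝓔(x,
z) = c^d(-z, x) Φ(x, -z) + c^d(-z, -x) Φ(-x, -z). With c symmetric this is Φ̃(x, -z) + Φ̃(-x, -z).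
Two further applications of Bailey's transformation give 𝓔(x, z) = 𝓔^d(z, x) (`Par.awSum_dual`).
Expanding 𝓔^d(z, x) in the same way and using (ii) yields Φ̃(x, -z) + Φ̃(-x, -z) = Φ̃(-x, z) +
Φ̃(-x, -z), which is (iii). Inserting (iii) in the connection formula gives (iv).

For (i), all parameters are signed integral powers of r = q^(s/2). Quasi-periodicity reduces the
theta factors to the four factors of the duplication formula for θ(v^(-2); r²), so both sides of the
symmetry become explicit monomials times the same thetas (`theta_prod_of_even`).

Two points need care. The functions Γ and 𝓔 are fixed only by existence and uniqueness statements,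
so both have to be proved; identities are checked off zero sets of entire functions and extended by
the identity theorem. Moreover the series for 𝓔 degenerates when one of the constants ab, ac, pa/d
is a nonpositive integral power of p. The symmetry of c excludes this: evaluating it at zeros of
θ(v^(-2)) forces ac into p^(1/2) p^ℤ (`Params.exists_root_mul_zpow_of_cross`), and the other two
constants are negative reals.

The hypergeometric identities are derived from scratch: Jackson's summation from an explicit
antidifference, Bailey's transformation from a double sum in which both inner sums are Jackson sums,
and the three-term relation from the vanishing of a top coefficient in Lagrange interpolation. In
the last two cases the terminating identity is followed by a dominated limit. -/

@[simp] lemma qPoch_zero (a p : ℂ) : qPoch a p 0 = 1 := by simp [qPoch]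

lemma qPoch_succ (a p : ℂ) (n : ℕ) : qPoch a p (n + 1) = qPoch a p n * (1 - a * p ^ n) := by
  simp [qPoch, Finset.prod_range_succ]

lemma qPoch_add (a p : ℂ) (m n : ℕ) :
    qPoch a p (m + n) = qPoch a p m * qPoch (a * p ^ m) p n := by
  simp only [qPoch, Finset.prod_range_add, pow_add, mul_assoc]

lemma qPoch_one (a p : ℂ) : qPoch a p 1 = 1 - a := by simp [qPoch]

lemma qPoch_succ' (a p : ℂ) (n : ℕ) : qPoch a p (n + 1) = (1 - a) * qPoch (a * p) p n := by
  rw [add_comm, qPoch_add, qPoch_one, pow_one]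

lemma qPoch_ne_zero {a : ℂ} {n : ℕ} (h : ∀ i < n, a * p ^ i ≠ 1) : qPoch a p n ≠ 0 := by
  rw [qPoch, Finset.prod_ne_zero_iff]
  intro i hi
  exact sub_ne_zero.mpr (h i (Finset.mem_range.mp hi)).symm

lemma qPoch_zero_left (p : ℂ) (n : ℕ) : qPoch 0 p n = 1 := by simp [qPoch]

end Finite

section Infinite

variable {p : ℂ} (hp : ‖p‖ < 1)

include hp

lemma summable_norm_mul_pow (a : ℂ) : Summable fun i : ℕ => ‖-(a * p ^ i)‖ := by
  simp only [norm_neg, norm_mul, norm_pow]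
  exact (summable_geometric_of_lt_one (norm_nonneg _) hp).mul_left _

lemma multipliable_qPochInf (a : ℂ) : Multipliable fun i : ℕ => (1 - a * p ^ i) := by
  simpa [sub_eq_add_neg] using multipliable_one_add_of_summable (summable_norm_mul_pow hp a)

lemma tendsto_qPoch (a : ℂ) : Tendsto (qPoch a p) atTop (𝓝 (qPochInf a p)) :=
  (multipliable_qPochInf hp a).hasProd.tendsto_prod_nat

lemma qPochInf_eq_mul (a : ℂ) (n : ℕ) :
    qPochInf a p = qPoch a p n * qPochInf (a * p ^ n) p := by
  have h1 := (tendsto_qPoch hp (a * p ^ n)).const_mul (qPoch a p n)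
  have h2 : Tendsto (fun m => qPoch a p (n + m)) atTop (𝓝 (qPochInf a p)) := by
    simpa [add_comm, Function.comp_def] using (tendsto_qPoch hp a).comp (tendsto_add_atTop_nat n)
  simp only [qPoch_add] at h2
  exact tendsto_nhds_unique h2 h1

lemma qPochInf_eq_one_sub_mul (a : ℂ) : qPochInf a p = (1 - a) * qPochInf (a * p) p := by
  simpa [qPoch_one] using qPochInf_eq_mul hp a 1

lemma qPochInf_ne_zero {a : ℂ} (h : ∀ i : ℕ, a * p ^ i ≠ 1) : qPochInf a p ≠ 0 := by
  have := tprod_one_add_ne_zero_of_summable (f := fun i : ℕ => -(a * p ^ i))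
    (fun i => by rw [← sub_eq_add_neg]; exact sub_ne_zero.mpr (h i).symm)
    (summable_norm_mul_pow hp a)
  simpa [qPochInf, sub_eq_add_neg] using this

lemma qPochInf_eq_zero {a : ℂ} {i : ℕ} (h : a * p ^ i = 1) : qPochInf a p = 0 := by
  rw [qPochInf_eq_mul hp a (i + 1), qPoch_succ, h]; simp

lemma mul_pow_ne_one_of_qPochInf_ne_zero {a : ℂ} (h : qPochInf a p ≠ 0) (i : ℕ) :
    a * p ^ i ≠ 1 := fun h' => h (qPochInf_eq_zero hp h')

lemma qPoch_ne_zero_of_qPochInf_ne_zero {a : ℂ} (h : qPochInf a p ≠ 0) (n : ℕ) :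
    qPoch a p n ≠ 0 := fun h' => h (by rw [qPochInf_eq_mul hp a n, h', zero_mul])

lemma qPochInf_shift_ne_zero {a : ℂ} (h : qPochInf a p ≠ 0) (n : ℕ) :
    qPochInf (a * p ^ n) p ≠ 0 := fun h' => h (by rw [qPochInf_eq_mul hp a n, h', mul_zero])

lemma norm_mul_pow_lt_one {a : ℂ} (h : ‖a‖ < 1) (i : ℕ) : ‖a * p ^ i‖ < 1 := by
  rw [norm_mul, norm_pow]
  exact mul_lt_one_of_nonneg_of_lt_one_left (norm_nonneg _) h (pow_le_one₀ (norm_nonneg _) hp.le)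

lemma qPochInf_ne_zero_of_norm_lt {a : ℂ} (h : ‖a‖ < 1) : qPochInf a p ≠ 0 :=
  qPochInf_ne_zero hp fun i hi => by
    have := norm_mul_pow_lt_one hp h i
    rw [hi] at this; simp at this

lemma norm_qPoch_le {a : ℂ} {A : ℝ} (h : ‖a‖ ≤ A) (n : ℕ) :
    ‖qPoch a p n‖ ≤ Real.exp (A / (1 - ‖p‖)) := by
  have hA : 0 ≤ A := (norm_nonneg _).trans h
  rw [qPoch, norm_prod]
  calc ∏ i ∈ range n, ‖1 - a * p ^ i‖ ≤ ∏ i ∈ range n, Real.exp (A * ‖p‖ ^ i) := by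
        refine Finset.prod_le_prod (fun _ _ => norm_nonneg _) fun i _ => ?_
        calc ‖1 - a * p ^ i‖ ≤ 1 + A * ‖p‖ ^ i := by
              refine (norm_sub_le _ _).trans ?_
              rw [norm_one, norm_mul, norm_pow]
              gcongr
          _ ≤ _ := by rw [add_comm]; exact Real.add_one_le_exp _
    _ = Real.exp (A * ∑ i ∈ range n, ‖p‖ ^ i) := by rw [← Real.exp_sum, Finset.mul_sum]
    _ ≤ _ := by
        rw [Real.exp_le_exp, div_eq_mul_inv, ← tsum_geometric_of_lt_one (norm_nonneg _) hp]
        gcongr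
        exact (summable_geometric_of_lt_one (norm_nonneg _) hp).sum_le_tsum _
          fun _ _ => by positivity

lemma norm_qPochInf_le {a : ℂ} {A : ℝ} (h : ‖a‖ ≤ A) :
    ‖qPochInf a p‖ ≤ Real.exp (A / (1 - ‖p‖)) :=
  le_of_tendsto (tendsto_qPoch hp a).norm (Eventually.of_forall fun n => norm_qPoch_le hp h n)

/-- In (a; p)_∞ = (a; p)_n (a p^n; p)_∞ the second factor is bounded uniformly in n, so the first
cannot approach 0. This provides the domination of denominators in all later limits. -/
lemma exists_le_norm_qPoch {a : ℂ} (h : qPochInf a p ≠ 0) :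
    ∃ c > 0, ∀ n, c ≤ ‖qPoch a p n‖ := by
  have hc : 0 < Real.exp (‖a‖ / (1 - ‖p‖) ) := Real.exp_pos _
  set K := Real.exp (‖a‖ / (1 - ‖p‖))
  refine ⟨‖qPochInf a p‖ / K, by positivity, fun n => ?_⟩
  rw [div_le_iff₀ hc, qPochInf_eq_mul hp a n, norm_mul]
  gcongr
  refine norm_qPochInf_le hp ?_
  rw [norm_mul, norm_pow]
  exact mul_le_of_le_one_right (norm_nonneg _) (pow_le_one₀ (norm_nonneg _) hp.le)

lemma exists_norm_inv_qPoch_le {a : ℂ} (h : qPochInf a p ≠ 0) :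
    ∃ C > 0, ∀ n, ‖(qPoch a p n)⁻¹‖ ≤ C := by
  obtain ⟨c, hc, h⟩ := exists_le_norm_qPoch hp h
  refine ⟨c⁻¹, by positivity, fun n => ?_⟩
  rw [norm_inv]
  gcongr
  exact h n

lemma differentiable_qPochInf : Differentiable ℂ fun a => qPochInf a p := by
  have key : HasProdLocallyUniformlyOn (fun (i : ℕ) a => 1 - a * p ^ i)
      (fun a => qPochInf a p) Set.univ := by
    simp_rw [qPochInf, sub_eq_add_neg]
    apply hasProdLocallyUniformlyOn_of_forall_compact isOpen_univ
    intro K _ hcK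
    obtain ⟨R, hR⟩ := hcK.isBounded.exists_norm_le
    refine (((summable_geometric_of_lt_one (norm_nonneg _) hp).mul_left
      R)).hasProdUniformlyOn_nat_one_add hcK (.of_forall fun n x hx ↦ ?_) (fun _ ↦ by fun_prop)
    rw [norm_neg, norm_mul, norm_pow]
    gcongr
    exact hR x hx
  rw [← differentiableOn_univ]
  exact key.differentiableOn (.of_forall fun _ ↦ by
    simpa [Finset.prod_fn] using DifferentiableOn.finsetProd (fun _ _ ↦ by fun_prop)) isOpen_univ

omit hp in
lemma qPochInf_zero (p : ℂ) : qPochInf 0 p = 1 := by simp [qPochInf]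

end Infinite

end AskeyWilson

end

/-! ### Jackson's terminating summation -/

noncomputable section
namespace AskeyWilson
-- With Y = p^r this is the difference relation of `jackson_step` after division by the common
-- product of shifted factorials.
lemma jackson_certificate {a b c d e M : ℂ} (Y : ℂ) (ha : a ≠ 0) (hb : b ≠ 0) (hc : c ≠ 0)
    (hd : d ≠ 0) (hM : M ≠ 0) (he : e = a ^ 2 * M / (b * c * d)) :
    (1 - a / e) * (1 - a * M / b) * (1 - a * M / c) * (1 - a * M / d) * ((1 - 1 / M) * (1 - a * M)) *
        (Y * (1 - a * Y ^ 2) * ((1 - e * Y) * (1 - a * Y / e))) -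
      (1 - a * M) * (1 - a * M / (b * c)) * (1 - a * M / (b * d)) * (1 - a * M / (c * d)) *
        (-(a / e)) * ((1 - e) * (1 - a / e)) *
        (Y * (1 - a * Y ^ 2) * ((1 - Y / M) * (1 - a * M * Y))) =
      (1 - e * M) * (1 - a * M) * (1 - a / e) *
        ((1 - a * Y) * (1 - b * Y) * (1 - c * Y) * (1 - d * Y) * ((1 - e * Y) * (1 - Y / M)) -
         (1 - Y) * (1 - a * Y / b) * (1 - a * Y / c) * (1 - a * Y / d) *
          ((1 - a * Y / e) * (1 - a * M * Y))) := by
  subst he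
  field_simp
  ring

/-- The case Y = 1 after cancellation of factors such as 1 - e and 1 - 1/M. It is stated separately
because these factors may vanish. -/
lemma jackson_certificate_one {a b c d e M : ℂ} (ha : a ≠ 0) (hb : b ≠ 0) (hc : c ≠ 0)
    (hd : d ≠ 0) (hM : M ≠ 0) (he : e = a ^ 2 * M / (b * c * d)) :
    (1 - a / e) * (1 - a * M / b) * (1 - a * M / c) * (1 - a * M / d) -
      (1 - a * M) * (1 - a * M / (b * c)) * (1 - a * M / (b * d)) * (1 - a * M / (c * d)) *
        (-(a / e)) = (1 - e * M) * ((1 - b) * (1 - c) * (1 - d)) := by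
  subst he
  field_simp
  ring

/-- The summand of Jackson's terminating very-well-poised `₈φ₇`, where `M = p ^ (n + 1)`. -/
def jacksonTerm (p a b c d e M : ℂ) (r : ℕ) : ℂ :=
  (1 - a * (p ^ r) ^ 2) * (qPoch a p r * qPoch b p r * qPoch c p r * qPoch d p r * qPoch e p r *
    qPoch (p / M) p r) / (qPoch p p r * qPoch (a * p / b) p r * qPoch (a * p / c) p r *
    qPoch (a * p / d) p r * qPoch (a * p / e) p r * qPoch (a * M) p r) * p ^ r

/-- The antidifference that proves Jackson's summation formula. -/
def jacksonAnti (p a b c d e M : ℂ) (r : ℕ) : ℂ :=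
  (1 - e * M) * (1 - a * M) * (1 - a / e) *
    (qPoch a p (r + 1) * qPoch b p (r + 1) * qPoch c p (r + 1) * qPoch d p (r + 1) *
      qPoch (e * p) p r * qPoch (p / M) p r) /
    (qPoch p p r * qPoch (a * p / b) p r * qPoch (a * p / c) p r * qPoch (a * p / d) p r *
      qPoch (a / e) p (r + 1) * qPoch (a * M) p (r + 1))

/-- Passing from length n to n + 1 replaces (e, M) by (ep, Mp). A combination of the two summands,
with coefficients taken from the ratio of the closed forms, is a difference in r, so the closed form
follows by induction on n. -/
lemma jackson_step {p a b c d e M : ℂ} (hp0 : p ≠ 0) (ha : a ≠ 0) (hb : b ≠ 0) (hc : c ≠ 0)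
    (hd : d ≠ 0) (hM : M ≠ 0) (he : e = a ^ 2 * M / (b * c * d)) (r : ℕ)
    (h0 : qPoch p p (r + 1) ≠ 0) (h1 : qPoch (a * p / b) p (r + 1) ≠ 0)
    (h2 : qPoch (a * p / c) p (r + 1) ≠ 0) (h3 : qPoch (a * p / d) p (r + 1) ≠ 0)
    (h4 : qPoch (a / e) p (r + 2) ≠ 0) (h5 : qPoch (a * M) p (r + 2) ≠ 0) :
    (1 - a / e) * (1 - a * M / b) * (1 - a * M / c) * (1 - a * M / d) *
        jacksonTerm p a b c d (e * p) (M * p) (r + 1) -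
      (1 - a * M) * (1 - a * M / (b * c)) * (1 - a * M / (b * d)) * (1 - a * M / (c * d)) *
        (-(a / e)) * jacksonTerm p a b c d e M (r + 1) =
      jacksonAnti p a b c d e M (r + 1) - jacksonAnti p a b c d e M r := by
  have he0 : e ≠ 0 := by rw [he]; positivity
  obtain ⟨Y, hY⟩ : ∃ Y, Y = p ^ (r + 1) := ⟨_, rfl⟩
  -- T is the common factor of the four quantities below; each of them is T times a polynomial
  -- expression in Y.
  obtain ⟨T, hT⟩ : ∃ T, T = qPoch a p (r + 1) * qPoch b p (r + 1) * qPoch c p (r + 1) * qPoch d p (r + 1) *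
    qPoch (e * p) p r * qPoch (p / M) p r / (qPoch p p (r + 1) * qPoch (a * p / b) p (r + 1) *
    qPoch (a * p / c) p (r + 1) * qPoch (a * p / d) p (r + 1) * qPoch (a / e) p (r + 2) *
    qPoch (a * M) p (r + 2)) := ⟨_, rfl⟩
  have e1 : jacksonTerm p a b c d (e * p) (M * p) (r + 1) = T * ((1 - 1 / M) * (1 - a * M) *
      (Y * (1 - a * Y ^ 2) * ((1 - e * Y) * (1 - a * Y / e)))) := by
    have q1 : qPoch (e * p) p (r + 1) = qPoch (e * p) p r * (1 - e * Y) := by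
      rw [qPoch_succ, hY, pow_succ]; ring
    have q2 : qPoch (p / (M * p)) p (r + 1) = (1 - 1 / M) * qPoch (p / M) p r := by
      rw [qPoch_succ', show p / (M * p) = 1 / M by field_simp, show 1 / M * p = p / M by ring]
    have q3 : qPoch (a / e) p (r + 2) = qPoch (a * p / (e * p)) p (r + 1) * (1 - a * Y / e) := by
      rw [qPoch_succ, hY, show a * p / (e * p) = a / e by field_simp]; ring
    have q4 : qPoch (a * M) p (r + 2) = (1 - a * M) * qPoch (a * (M * p)) p (r + 1) := by
      rw [qPoch_succ', mul_assoc a M p]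
    rw [jacksonTerm, hT, ← hY, q1, q2, q3, q4]
    rw [q3] at h4
    rw [q4] at h5
    have h4' := right_ne_zero_of_mul h4
    have h4'' := left_ne_zero_of_mul h4
    have h5' := left_ne_zero_of_mul h5
    have h5'' := right_ne_zero_of_mul h5
    generalize 1 - e * Y = z1, 1 - 1 / M = z2, 1 - a * Y / e = z3 at *
    generalize 1 - a * M = z4, 1 - a * Y ^ 2 = z5 at *
    rw [div_mul_eq_mul_div, div_mul_eq_mul_div, div_eq_div_iff (by positivity) (by positivity)]
    ring
  have e2 : jacksonTerm p a b c d e M (r + 1) = T * ((1 - e) * (1 - a / e) *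
        (Y * (1 - a * Y ^ 2) * ((1 - Y / M) * (1 - a * M * Y)))) := by
    have q1 : qPoch e p (r + 1) = (1 - e) * qPoch (e * p) p r := qPoch_succ' _ _ _
    have q2 : qPoch (p / M) p (r + 1) = qPoch (p / M) p r * (1 - Y / M) := by
      rw [qPoch_succ, hY, pow_succ]; ring
    have q3 : qPoch (a / e) p (r + 2) = (1 - a / e) * qPoch (a * p / e) p (r + 1) := by
      rw [qPoch_succ', div_mul_eq_mul_div]
    have q4 : qPoch (a * M) p (r + 2) = qPoch (a * M) p (r + 1) * (1 - a * M * Y) := by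
      rw [qPoch_succ, ← hY]
    rw [jacksonTerm, hT, ← hY, q1, q2, q3, q4]
    rw [q3] at h4
    rw [q4] at h5
    have h4' := right_ne_zero_of_mul h4
    have h4'' := left_ne_zero_of_mul h4
    have h5' := left_ne_zero_of_mul h5
    have h5'' := right_ne_zero_of_mul h5
    generalize 1 - e = z1, 1 - Y / M = z2, 1 - a / e = z3 at *
    generalize 1 - a * M * Y = z4, 1 - a * Y ^ 2 = z5 at *
    rw [div_mul_eq_mul_div, div_mul_eq_mul_div, div_eq_div_iff (by positivity) (by positivity)]
    ring
  have e3 : jacksonAnti p a b c d e M (r + 1) = T * ((1 - e * M) * (1 - a * M) * (1 - a / e) *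
        ((1 - a * Y) * (1 - b * Y) * (1 - c * Y) * (1 - d * Y) * ((1 - e * Y) * (1 - Y / M)))) := by
    have q1 : qPoch (e * p) p (r + 1) = qPoch (e * p) p r * (1 - e * Y) := by
      rw [qPoch_succ, hY, pow_succ]; ring
    have q2 : qPoch (p / M) p (r + 1) = qPoch (p / M) p r * (1 - Y / M) := by
      rw [qPoch_succ, hY, pow_succ]; ring
    rw [jacksonAnti, hT, q1, q2, qPoch_succ a p (r + 1), qPoch_succ b p (r + 1),
      qPoch_succ c p (r + 1), qPoch_succ d p (r + 1), ← hY]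
    generalize 1 - e * Y = z1, 1 - Y / M = z2, 1 - a * Y = z3 at *
    generalize 1 - b * Y = z4, 1 - c * Y = z5, 1 - d * Y = z6 at *
    generalize 1 - a * M = z7, 1 - a / e = z8, 1 - e * M = z9 at *
    ring
  have e4 : jacksonAnti p a b c d e M r = T * ((1 - e * M) * (1 - a * M) * (1 - a / e) *
         ((1 - Y) * (1 - a * Y / b) * (1 - a * Y / c) * (1 - a * Y / d) *
          ((1 - a * Y / e) * (1 - a * M * Y)))) := by
    have q1 : qPoch p p (r + 1) = qPoch p p r * (1 - Y) := by
      rw [qPoch_succ, hY, pow_succ]; ring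
    have q2 : qPoch (a * p / b) p (r + 1) = qPoch (a * p / b) p r * (1 - a * Y / b) := by
      rw [qPoch_succ, hY, pow_succ]; ring
    have q3 : qPoch (a * p / c) p (r + 1) = qPoch (a * p / c) p r * (1 - a * Y / c) := by
      rw [qPoch_succ, hY, pow_succ]; ring
    have q4 : qPoch (a * p / d) p (r + 1) = qPoch (a * p / d) p r * (1 - a * Y / d) := by
      rw [qPoch_succ, hY, pow_succ]; ring
    have q5 : qPoch (a / e) p (r + 2) = qPoch (a / e) p (r + 1) * (1 - a * Y / e) := by
      rw [qPoch_succ, ← hY]; ring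
    have q6 : qPoch (a * M) p (r + 2) = qPoch (a * M) p (r + 1) * (1 - a * M * Y) := by
      rw [qPoch_succ, ← hY]
    rw [jacksonAnti, hT, q5, q6]
    rw [q1] at h0
    rw [q2] at h1
    rw [q3] at h2
    rw [q4] at h3
    rw [q5] at h4
    rw [q6] at h5
    simp only [q1, q2, q3, q4]
    simp only [mul_ne_zero_iff] at h0 h1 h2 h3 h4 h5
    obtain ⟨h0, h0'⟩ := h0
    obtain ⟨h1, h1'⟩ := h1
    obtain ⟨h2, h2'⟩ := h2
    obtain ⟨h3, h3'⟩ := h3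
    obtain ⟨h4, h4'⟩ := h4
    obtain ⟨h5, h5'⟩ := h5
    generalize 1 - a * Y / b = z1, 1 - a * Y / c = z2, 1 - a * Y / d = z3 at *
    generalize 1 - a * Y / e = z4, 1 - a * M * Y = z5, 1 - Y = z6 at *
    rw [div_mul_eq_mul_div, div_eq_div_iff (by positivity) (by positivity)]
    ring
  rw [e1, e2, e3, e4]
  have key := jackson_certificate Y ha hb hc hd hM he
  clear e1 e2 e3 e4 hT h0 h1 h2 h3 h4 h5
  generalize 1 - a * M / b = z1, 1 - a * M / c = z2, 1 - a * M / d = z3, 1 - 1 / M = z4 at *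
  generalize 1 - a * M / (b * c) = y1, 1 - a * M / (b * d) = y2, 1 - a * M / (c * d) = y3 at *
  generalize 1 - a * Y / b = x1, 1 - a * Y / c = x2, 1 - a * Y / d = x3, 1 - a * Y / e = x4 at *
  generalize 1 - a * Y = w1, 1 - b * Y = w2, 1 - c * Y = w3, 1 - d * Y = w4, 1 - e * Y = w5 at *
  generalize 1 - Y / M = v1, 1 - a * M * Y = v2, 1 - a * M = v3, 1 - e * M = v4, 1 - e = v5 at *
  generalize 1 - a * Y ^ 2 = v6, 1 - a / e = v7, 1 - Y = v8, -(a / e) = v9 at *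
  linear_combination T * key

/-- M is arbitrary here; it becomes a power of p only when the boundary term on the right is made to
vanish. -/
lemma jackson_telescope {p a b c d e M : ℂ} (hp0 : p ≠ 0) (ha : a ≠ 0) (hb : b ≠ 0) (hc : c ≠ 0)
    (hd : d ≠ 0) (hM : M ≠ 0) (he : e = a ^ 2 * M / (b * c * d)) (m : ℕ)
    (h0 : ∀ r, qPoch p p r ≠ 0) (h1 : ∀ r, qPoch (a * p / b) p r ≠ 0)
    (h2 : ∀ r, qPoch (a * p / c) p r ≠ 0) (h3 : ∀ r, qPoch (a * p / d) p r ≠ 0)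
    (h4 : ∀ r ≤ m, qPoch (a / e) p (r + 1) ≠ 0) (h5 : ∀ r, qPoch (a * M) p r ≠ 0) :
    ∑ r ∈ Finset.range (m + 1),
      ((1 - a / e) * (1 - a * M / b) * (1 - a * M / c) * (1 - a * M / d) *
        jacksonTerm p a b c d (e * p) (M * p) r -
      (1 - a * M) * (1 - a * M / (b * c)) * (1 - a * M / (b * d)) * (1 - a * M / (c * d)) *
        (-(a / e)) * jacksonTerm p a b c d e M r) = jacksonAnti p a b c d e M m := by
  induction m with
  | zero =>
    have h4' := h4 0 le_rfl
    have h5' := h5 1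
    have key := jackson_certificate_one ha hb hc hd hM he
    simp only [Finset.sum_range_one, jacksonTerm, jacksonAnti, zero_add, pow_zero,
      qPoch_zero, mul_one, div_one, one_pow, qPoch_one, one_mul] at h4' h5' ⊢
    have : (1 - e * M) * (1 - a * M) * (1 - a / e) * ((1 - a) * (1 - b) * (1 - c) * (1 - d)) /
        ((1 - a / e) * (1 - a * M)) = (1 - e * M) * ((1 - a) * (1 - b) * (1 - c) * (1 - d)) := by
      generalize 1 - a / e = x, 1 - a * M = y at *
      field_simp
    rw [this]
    linear_combination (1 - a) * key
  | succ m ih =>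
    rw [Finset.sum_range_succ, ih fun r hr => h4 r (by omega),
      jackson_step hp0 ha hb hc hd hM he m (h0 _) (h1 _) (h2 _) (h3 _) (h4 (m + 1) le_rfl) (h5 _)]
    ring

/-- Jackson's summation of a terminating balanced very-well-poised `₈φ₇` series. -/
theorem jackson_sum {p a b c d : ℂ} (hp0 : p ≠ 0) (ha : a ≠ 0) (hb : b ≠ 0) (hc : c ≠ 0)
    (hd : d ≠ 0) (hp1 : ∀ i : ℕ, p * p ^ i ≠ 1) (hap : ∀ i : ℕ, a * p * p ^ i ≠ 1)
    (hab : ∀ i : ℕ, a * p / b * p ^ i ≠ 1) (hac : ∀ i : ℕ, a * p / c * p ^ i ≠ 1)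
    (had : ∀ i : ℕ, a * p / d * p ^ i ≠ 1) (habcd : ∀ i : ℕ, a / (b * c * d) * p ^ i ≠ 1) (n : ℕ) :
    ∑ r ∈ Finset.range (n + 1),
      jacksonTerm p a b c d (a ^ 2 * p ^ (n + 1) / (b * c * d)) (p ^ (n + 1)) r =
    (1 - a) * (qPoch (a * p) p n * qPoch (a * p / (b * c)) p n * qPoch (a * p / (b * d)) p n *
      qPoch (a * p / (c * d)) p n) / (qPoch (a * p / b) p n * qPoch (a * p / c) p n *
      qPoch (a * p / d) p n * qPoch (a * p / (b * c * d)) p n) := by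
  induction n with
  | zero => simp [jacksonTerm]
  | succ n ih =>
    obtain ⟨M, hM⟩ : ∃ M, M = p ^ (n + 1) := ⟨_, rfl⟩
    rw [← hM] at ih
    have hM0 : M ≠ 0 := hM ▸ pow_ne_zero _ hp0
    obtain ⟨e, he⟩ : ∃ e, e = a ^ 2 * M / (b * c * d) := ⟨_, rfl⟩
    have he0 : e ≠ 0 := by rw [he]; positivity
    have hae : a / e = (a / (b * c * d) * M)⁻¹ := by rw [he]; field_simp
    -- By the balancing condition a/e is the inverse of (a/(bcd)) p^(n+1), so a vanishing factor
    -- would put a/(bcd) among the excluded powers.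
    have h4 : ∀ r ≤ n + 1, qPoch (a / e) p (r + 1) ≠ 0 := by
      intro r hr
      refine qPoch_ne_zero fun i hi h => habcd (n + 1 - i) ?_
      have hpi : p ^ (n + 1) = p ^ (n + 1 - i) * p ^ i := by rw [← pow_add]; congr 1; omega
      rw [hae, hM, hpi] at h
      field_simp at h ⊢
      linear_combination -h
    have h5 : ∀ r, qPoch (a * M) p r ≠ 0 := by
      refine fun r => qPoch_ne_zero fun i _ h => hap (n + i) ?_
      rw [← h, hM]; ring
    have key := jackson_telescope hp0 ha hb hc hd hM0 he (n + 1)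
      (fun r => qPoch_ne_zero fun i _ => hp1 i) (fun r => qPoch_ne_zero fun i _ => hab i)
      (fun r => qPoch_ne_zero fun i _ => hac i) (fun r => qPoch_ne_zero fun i _ => had i) h4 h5
    -- The numerator factor with i = n is 1 - p^(-n) p^n = 0. It kills both the boundary term and
    -- the surplus last summand of length n.
    have hpM : qPoch (p / M) p (n + 1) = 0 := by
      rw [qPoch_succ, hM]
      have : p / p ^ (n + 1) * p ^ n = 1 := by field_simp; ring
      rw [this]; simp
    have z1 : jacksonTerm p a b c d e M (n + 1) = 0 := by simp [jacksonTerm, hpM]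
    have z2 : jacksonAnti p a b c d e M (n + 1) = 0 := by simp [jacksonAnti, hpM]
    rw [z2, Finset.sum_sub_distrib, ← Finset.mul_sum, ← Finset.mul_sum,
      Finset.sum_range_succ (fun r => jacksonTerm p a b c d e M r), z1, add_zero, he, ih,
      ← he, show e * p = a ^ 2 * p ^ (n + 1 + 1) / (b * c * d) by
        rw [he, hM]; ring, show M * p = p ^ (n + 1 + 1) by rw [hM]; ring] at key
    have k1 : ∀ x : ℂ, qPoch (a * p / x) p (n + 1) = qPoch (a * p / x) p n * (1 - a * M / x) := by
      intro x; rw [qPoch_succ, hM]; ring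
    have k2 : qPoch (a * p) p (n + 1) = qPoch (a * p) p n * (1 - a * M) := by
      rw [qPoch_succ, hM]; ring
    have n1 : ∀ x r, (∀ i : ℕ, a * p / x * p ^ i ≠ 1) → qPoch (a * p / x) p r ≠ 0 :=
      fun x r h => qPoch_ne_zero fun i _ => h i
    have n2 : ∀ i : ℕ, a * p / (b * c * d) * p ^ i ≠ 1 := by
      intro i h
      refine habcd (i + 1) ?_
      rw [← h]; ring
    have m1 := n1 b (n + 1) hab
    have m2 := n1 c (n + 1) hac
    have m3 := n1 d (n + 1) had
    have m4 := n1 (b * c * d) (n + 1) n2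
    have hae' : 1 - a / e = -(a / e) * (1 - a * M / (b * c * d)) := by
      rw [hae]; field_simp; ring
    have hae0 : a / e ≠ 0 := div_ne_zero ha he0
    rw [hae'] at key
    rw [k1] at m1 m2 m3 m4
    rw [k1, k1, k1, k1, k1, k1, k1, k2]
    generalize ∑ r ∈ Finset.range (n + 1 + 1), jacksonTerm p a b c d
      (a ^ 2 * p ^ (n + 1 + 1) / (b * c * d)) (p ^ (n + 1 + 1)) r = S at *
    clear ih k1 k2 n1 hae hae' h4 h5
    generalize 1 - a * M / b = z1, 1 - a * M / c = z2, 1 - a * M / d = z3 at *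
    generalize 1 - a * M / (b * c) = y1, 1 - a * M / (b * d) = y2, 1 - a * M / (c * d) = y3 at *
    generalize 1 - a * M / (b * c * d) = y4, 1 - a * M = y5, a / e = y6, 1 - a = y7 at *
    simp only [mul_ne_zero_iff] at m1 m2 m3 m4
    obtain ⟨m1, m1'⟩ := m1
    obtain ⟨m2, m2'⟩ := m2
    obtain ⟨m3, m3'⟩ := m3
    obtain ⟨m4, m4'⟩ := m4
    rw [eq_div_iff (by positivity)]
    rw [sub_eq_zero, mul_div_assoc', eq_div_iff (by positivity)] at key
    have hy6 : y6 * (S * (qPoch (a * p / b) p n * z1 * (qPoch (a * p / c) p n * z2) *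
        (qPoch (a * p / d) p n * z3) * (qPoch (a * p / (b * c * d)) p n * y4))) = y6 *
        (y7 * (qPoch (a * p) p n * y5 * (qPoch (a * p / (b * c)) p n * y1) *
        (qPoch (a * p / (b * d)) p n * y2) * (qPoch (a * p / (c * d)) p n * y3))) := by
      linear_combination -key
    exact mul_left_cancel₀ hae0 hy6
end AskeyWilson

end

/-! ### Dominated limits of terminating series -/

noncomputable section
namespace AskeyWilson
open Filter Topology Finset

/-- The power of `p` produced by reversing the first `j` factors of `(y p ^ (-n); p)_j`. -/
def rev (p : ℂ) (n j : ℕ) : ℂ := ∏ m ∈ Finset.range j, (-(p ^ m / p ^ n))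

lemma rev_ne_zero {p : ℂ} (hp0 : p ≠ 0) (n j : ℕ) : rev p n j ≠ 0 := by
  rw [rev, Finset.prod_ne_zero_iff]
  intro i _
  simp [hp0]

/-- Each factor 1 - y p^(i-n) equals -y p^(i-n) times 1 - (p/y) p^(n-1-i). Reading the product
backwards gives factorials with a limit as n grows. -/
lemma qPoch_div_pow_of_le {p : ℂ} (hp0 : p ≠ 0) {y : ℂ} (hy : y ≠ 0) {n j : ℕ} (h : j ≤ n) :
    qPoch (y / p ^ n) p j = y ^ j * rev p n j * qPoch (p / y * p ^ (n - j)) p j := by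
  rw [qPoch, rev, qPoch, ← Finset.prod_range_reflect (fun i => 1 - p / y * p ^ (n - j) * p ^ i),
    show y ^ j = ∏ _i ∈ Finset.range j, y by simp,
    ← Finset.prod_mul_distrib, ← Finset.prod_mul_distrib]
  refine Finset.prod_congr rfl fun i hi => ?_
  have hi' := Finset.mem_range.mp hi
  have : p ^ n = p * p ^ (n - j) * p ^ (j - 1 - i) * p ^ i := by
    rw [← pow_succ', ← pow_add, ← pow_add]; congr 1; omega
  rw [this]
  field_simp
  ring

lemma qPoch_split_of_le (x p : ℂ) {n j : ℕ} (h : j ≤ n) :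
    qPoch x p n = qPoch x p (n - j) * qPoch (x * p ^ (n - j)) p j := by
  rw [← qPoch_add, Nat.sub_add_cancel h]

/-- The factor through which a terminating series depends on its length `n`. -/
def termFactor (p A G y : ℂ) (n r : ℕ) : ℂ :=
  qPoch (G * p ^ n) p r * qPoch (1 / p ^ n) p r * p ^ r /
    (qPoch (y / p ^ n) p r * qPoch (A * p * p ^ n) p r)

/-- The reversal powers of the two factorials with negative powers of p cancel. The geometric factor
(p/y)^r is left, times factorials that tend to 1 or are quotients with a common limit. -/
lemma termFactor_eq {p A G y : ℂ} (hp0 : p ≠ 0) (hp : ‖p‖ < 1) (hy : y ≠ 0)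
    (hA : qPochInf (A * p) p ≠ 0) (hyp : qPochInf (p / y) p ≠ 0) {n r : ℕ} (h : r ≤ n) :
    termFactor p A G y n r = (p / y) ^ r * (qPoch (G * p ^ n) p r * qPoch (p * p ^ (n - r)) p r *
      (qPoch (p / y) p (n - r) * (qPoch (p / y) p n)⁻¹) *
      (qPoch (A * p) p n * (qPoch (A * p) p (n + r))⁻¹)) := by
  have h1 := qPoch_ne_zero_of_qPochInf_ne_zero hp hyp n
  have h2 := qPoch_ne_zero_of_qPochInf_ne_zero hp hA (n + r)
  rw [termFactor, qPoch_div_pow_of_le hp0 hy h, qPoch_div_pow_of_le hp0 one_ne_zero h, div_one]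
  rw [qPoch_split_of_le (p / y) p h] at h1 ⊢
  rw [qPoch_add] at h2 ⊢
  have h3 := rev_ne_zero hp0 n r
  simp only [mul_ne_zero_iff] at h1 h2
  obtain ⟨h1, h1'⟩ := h1
  obtain ⟨h2, h2'⟩ := h2
  rw [div_pow]
  generalize qPoch (p / y) p (n - r) = z1, qPoch (p / y * p ^ (n - r)) p r = z2,
    qPoch (A * p) p n = z3, qPoch (A * p * p ^ n) p r = z4 at *
  field_simp
  simp

lemma tendsto_termFactor {p A G y : ℂ} (hp0 : p ≠ 0) (hp : ‖p‖ < 1) (hy : y ≠ 0)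
    (hA : qPochInf (A * p) p ≠ 0) (hyp : qPochInf (p / y) p ≠ 0) (r : ℕ) :
    Tendsto (fun n => termFactor p A G y n r) atTop (𝓝 ((p / y) ^ r)) := by
  have hpow : Tendsto (fun n : ℕ => p ^ n) atTop (𝓝 0) := tendsto_pow_atTop_nhds_zero_of_norm_lt_one hp
  have hsub : Tendsto (fun n : ℕ => n - r) atTop atTop := tendsto_sub_atTop_nat r
  have hadd : Tendsto (fun n : ℕ => n + r) atTop atTop := tendsto_add_atTop_nat r
  have hc : Continuous fun x => qPoch x p r := by unfold qPoch; fun_prop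
  have t1 : Tendsto (fun n : ℕ => qPoch (G * p ^ n) p r) atTop (𝓝 1) := by
    have := (hc.tendsto (G * 0)).comp (hpow.const_mul G)
    simpa [Function.comp_def, qPoch_zero_left] using this
  have t2 : Tendsto (fun n : ℕ => qPoch (p * p ^ (n - r)) p r) atTop (𝓝 1) := by
    have := (hc.tendsto (p * 0)).comp ((hpow.comp hsub).const_mul p)
    simpa [Function.comp_def, qPoch_zero_left] using this
  have t3 := ((tendsto_qPoch hp (p / y)).comp hsub).mul ((tendsto_qPoch hp (p / y)).inv₀ hyp)
  have t4 := (tendsto_qPoch hp (A * p)).mul (((tendsto_qPoch hp (A * p)).comp hadd).inv₀ hA)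
  have := (((t1.mul t2).mul t3).mul t4).const_mul ((p / y) ^ r)
  rw [mul_inv_cancel₀ hyp, mul_inv_cancel₀ hA] at this
  simp only [mul_one] at this
  refine this.congr' ?_
  filter_upwards [eventually_ge_atTop r] with n hn
  rw [termFactor_eq hp0 hp hy hA hyp hn]
  rfl

lemma norm_mul_pow_le {p : ℂ} (hp : ‖p‖ < 1) (x : ℂ) (n : ℕ) : ‖x * p ^ n‖ ≤ ‖x‖ := by
  rw [norm_mul, norm_pow]
  exact mul_le_of_le_one_right (norm_nonneg _) (pow_le_one₀ (norm_nonneg _) hp.le)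

/-- The bound does not depend on the length n; this is the domination for the limit. -/
lemma exists_norm_termFactor_le {p A y : ℂ} (G : ℂ) (hp0 : p ≠ 0) (hp : ‖p‖ < 1) (hy : y ≠ 0)
    (hA : qPochInf (A * p) p ≠ 0) (hyp : qPochInf (p / y) p ≠ 0) :
    ∃ C, ∀ n r, r ≤ n → ‖termFactor p A G y n r‖ ≤ C * ‖p / y‖ ^ r := by
  obtain ⟨C1, hC1, h1⟩ := exists_norm_inv_qPoch_le hp hA
  obtain ⟨C2, hC2, h2⟩ := exists_norm_inv_qPoch_le hp hyp
  let E : ℝ → ℝ := fun x => Real.exp (x / (1 - ‖p‖))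
  refine ⟨E ‖G‖ * E ‖p‖ * (E ‖p / y‖ * C2) * (E ‖A * p‖ * C1), fun n r hr => ?_⟩
  rw [termFactor_eq hp0 hp hy hA hyp hr, norm_mul, norm_pow, mul_comm]
  refine mul_le_mul_of_nonneg_right ?_ (pow_nonneg (norm_nonneg _) r)
  rw [norm_mul, norm_mul, norm_mul, norm_mul, norm_mul]
  dsimp only [E]
  gcongr
  · exact norm_qPoch_le hp (norm_mul_pow_le hp G n) r
  · exact norm_qPoch_le hp (norm_mul_pow_le hp p _) r
  · exact norm_qPoch_le hp le_rfl _
  · exact h2 n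
  · exact norm_qPoch_le hp le_rfl _
  · exact h1 _

/-- Tannery's theorem. The bound is required only for r ≤ n; the summands are extended by zero
beyond n. -/
lemma tendsto_sum_of_dominated {f : ℕ → ℕ → ℂ} {g : ℕ → ℂ} {C ρ : ℝ} (hρ0 : 0 ≤ ρ) (hρ : ρ < 1)
    (hb : ∀ n r, r ≤ n → ‖f n r‖ ≤ C * ρ ^ r)
    (ht : ∀ r, Tendsto (fun n => f n r) atTop (𝓝 (g r))) :
    Tendsto (fun n => ∑ r ∈ range (n + 1), f n r) atTop (𝓝 (∑' r, g r)) := by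
  have hC : 0 ≤ C := by simpa using (norm_nonneg _).trans (hb 0 0 le_rfl)
  have key := tendsto_tsum_of_dominated_convergence (𝓕 := atTop)
    (f := fun n r => if r ∈ range (n + 1) then f n r else 0) (g := g)
    (bound := fun r => C * ρ ^ r) ((summable_geometric_of_lt_one hρ0 hρ).mul_left C)
    (fun r => (ht r).congr' (by
      filter_upwards [eventually_ge_atTop r] with n hn
      rw [if_pos (by simp; omega)]))
    (Eventually.of_forall fun n r => by
      split_ifs with h
      · exact hb n r (by simp at h; omega)
      · simp; positivity)
  refine key.congr fun n => ?_
  rw [tsum_eq_sum (s := range (n + 1)) (fun r hr => by simp [hr])]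
  exact Finset.sum_congr rfl fun r hr => by simp [hr]

lemma tendsto_sum_termFactor {p A y : ℂ} (G : ℂ) (hp0 : p ≠ 0) (hp : ‖p‖ < 1) (hy : y ≠ 0)
    (hA : qPochInf (A * p) p ≠ 0) (hyp : qPochInf (p / y) p ≠ 0) (ht : ‖p / y‖ < 1)
    {X : ℕ → ℂ} {C : ℝ} (hX : ∀ r, ‖X r‖ ≤ C) :
    Tendsto (fun n => ∑ r ∈ range (n + 1), X r * termFactor p A G y n r) atTop
      (𝓝 (∑' r, X r * (p / y) ^ r)) := by
  obtain ⟨K, hK⟩ := exists_norm_termFactor_le G hp0 hp hy hA hyp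
  refine tendsto_sum_of_dominated (C := C * K) (norm_nonneg _) ht (fun n r hr => ?_)
    (fun r => (tendsto_termFactor hp0 hp hy hA hyp r).const_mul _)
  rw [norm_mul, mul_assoc]
  exact mul_le_mul (hX r) (hK n r hr) (norm_nonneg _) ((norm_nonneg _).trans (hX r))


/-! ## Bailey's transformation of very-well-poised series -/

/-- The part of the double sum in Bailey's transformation that does not depend on the length. -/
lemma bailey_kernel {p a l : ℂ} (hp0 : p ≠ 0) (ha : a ≠ 0) (hl : l ≠ 0) (j k : ℕ)
    (hp1 : ∀ i, qPoch p p i ≠ 0) (hal : ∀ i, qPoch (a / l) p i ≠ 0)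
    (hlp : ∀ i, qPoch (l * p) p i ≠ 0) :
    qPoch a p (j + k) * qPoch (a / l) p (j + k) / (qPoch p p (j + k) * qPoch (l * p) p (j + k)) *
      (qPoch (a * p ^ (j + k)) p j * qPoch (p / p ^ (j + k + 1)) p j /
        (qPoch (l * p / (a * p ^ (j + k))) p j * qPoch (l * p ^ (j + k + 1)) p j)) =
    qPoch a p (2 * j) / qPoch (l * p) p (2 * j) * (a / (l * p)) ^ j *
      (qPoch (a * p ^ (2 * j)) p k * qPoch (a / l) p k /
        (qPoch p p k * qPoch (l * p ^ (2 * j) * p) p k)) := by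
  have e1 : qPoch a p (j + k) * qPoch (a * p ^ (j + k)) p j =
      qPoch a p (2 * j) * qPoch (a * p ^ (2 * j)) p k := by
    rw [← qPoch_add, ← qPoch_add]; congr 1; ring
  have e2 : qPoch (l * p) p (j + k) * qPoch (l * p ^ (j + k + 1)) p j =
      qPoch (l * p) p (2 * j) * qPoch (l * p ^ (2 * j) * p) p k := by
    rw [show l * p ^ (j + k + 1) = l * p * p ^ (j + k) by ring,
      show l * p ^ (2 * j) * p = l * p * p ^ (2 * j) by ring, ← qPoch_add, ← qPoch_add]
    congr 1; ring
  have hjk : j + k - j = k := by omega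
  have e3 : qPoch (p / p ^ (j + k + 1)) p j = rev p (j + k) j * qPoch (p * p ^ k) p j := by
    rw [show p / p ^ (j + k + 1) = 1 / p ^ (j + k) by field_simp; ring,
      qPoch_div_pow_of_le hp0 one_ne_zero (by omega), hjk]
    simp
  have e4 : qPoch (l * p / (a * p ^ (j + k))) p j =
      (l * p / a) ^ j * rev p (j + k) j * qPoch (a / l * p ^ k) p j := by
    rw [show l * p / (a * p ^ (j + k)) = l * p / a / p ^ (j + k) by field_simp,
      qPoch_div_pow_of_le hp0 (by positivity) (by omega), hjk,
      show p / (l * p / a) = a / l by field_simp]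
  have e5 : qPoch p p (j + k) = qPoch p p k * qPoch (p * p ^ k) p j := by
    rw [add_comm, qPoch_add]
  have e6 : qPoch (a / l) p (j + k) = qPoch (a / l) p k * qPoch (a / l * p ^ k) p j := by
    rw [add_comm, qPoch_add]
  have n1 := hlp (j + k + j)
  rw [qPoch_add, show l * p * p ^ (j + k) = l * p ^ (j + k + 1) by ring] at n1
  have n2 := n1
  rw [e2] at n2
  have n3 := hp1 (j + k)
  have n4 := hal (j + k)
  have n5 := rev_ne_zero hp0 (j + k) j
  rw [e5] at n3
  rw [e6] at n4
  rw [e3, e4, e5, e6, div_pow, div_pow]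
  clear e3 e4 e5 e6 hp1 hal hlp
  generalize qPoch a p (j + k) = x1, qPoch (a * p ^ (j + k)) p j = x2, qPoch a p (2 * j) = x3,
    qPoch (a * p ^ (2 * j)) p k = x4, qPoch (l * p) p (j + k) = y1,
    qPoch (l * p ^ (j + k + 1)) p j = y2, qPoch (l * p) p (2 * j) = y3,
    qPoch (l * p ^ (2 * j) * p) p k = y4, qPoch p p k = z1, qPoch (p * p ^ k) p j = z2,
    qPoch (a / l) p k = z3, qPoch (a / l * p ^ k) p j = z4, rev p (j + k) j = z5 at *
  simp only [mul_ne_zero_iff] at n1 n2 n3 n4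
  obtain ⟨n1, n1'⟩ := n1
  obtain ⟨n2, n2'⟩ := n2
  obtain ⟨n3, n3'⟩ := n3
  obtain ⟨n4, n4'⟩ := n4
  have : x1 * x2 / (y1 * y2) = x3 * x4 / (y3 * y4) := by rw [e1, e2]
  have hpj : p ^ j ≠ 0 := pow_ne_zero _ hp0
  have hlj : l ^ j ≠ 0 := pow_ne_zero _ hl
  have haj : a ^ j ≠ 0 := pow_ne_zero _ ha
  rw [mul_pow]
  generalize p ^ j = q1, l ^ j = q2, a ^ j = q3 at *
  calc _ = (x1 * x2 / (y1 * y2)) * (q3 / (q2 * q1) * (z3 / z1)) := by field_simp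
    _ = _ := by rw [this]; field_simp

end AskeyWilson

end

/-! ### The double sum of Bailey's transformation -/

noncomputable section
namespace AskeyWilson
open Filter Topology Finset

/-- The summand of a very-well-poised series without the power of its argument. -/
def vwpTerm (p a b c d e f : ℂ) (r : ℕ) : ℂ :=
  (1 - a * (p ^ r) ^ 2) * (qPoch a p r * qPoch b p r * qPoch c p r * qPoch d p r * qPoch e p r *
    qPoch f p r) / (qPoch p p r * qPoch (a * p / b) p r * qPoch (a * p / c) p r *
    qPoch (a * p / d) p r * qPoch (a * p / e) p r * qPoch (a * p / f) p r)

/-- The nonvanishing conditions under which Bailey's transformation is proved. -/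
structure BaileyGeneric (p a b c d e f l : ℂ) : Prop where
  hp0 : p ≠ 0
  hp : ‖p‖ < 1
  ha : a ≠ 0
  hb : b ≠ 0
  hc : c ≠ 0
  hd : d ≠ 0
  he : e ≠ 0
  hf : f ≠ 0
  hl : l * (b * c * d) = p * a ^ 2
  hap : qPochInf (a * p) p ≠ 0
  hlp : qPochInf (l * p) p ≠ 0
  hab : qPochInf (a * p / b) p ≠ 0
  hac : qPochInf (a * p / c) p ≠ 0
  had : qPochInf (a * p / d) p ≠ 0
  hae : qPochInf (a * p / e) p ≠ 0
  haf : qPochInf (a * p / f) p ≠ 0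
  hle : qPochInf (l * p / e) p ≠ 0
  hlf : qPochInf (l * p / f) p ≠ 0
  haef : qPochInf (a / (e * f)) p ≠ 0
  hlef : qPochInf (l / (e * f)) p ≠ 0
  hal : qPochInf (a / (l * p)) p ≠ 0

namespace BaileyGeneric

variable {p a b c d e f l : ℂ} (H : BaileyGeneric p a b c d e f l)
include H

lemma l_ne_zero : l ≠ 0 := by
  intro h
  have := H.hl
  rw [h, zero_mul] at this
  exact mul_ne_zero H.hp0 (pow_ne_zero 2 H.ha) this.symm

lemma shift {x : ℂ} (h : qPochInf x p ≠ 0) : qPochInf (x * p) p ≠ 0 := by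
  simpa using qPochInf_shift_ne_zero H.hp h 1

lemma p_ne : qPochInf p p ≠ 0 := qPochInf_ne_zero_of_norm_lt H.hp H.hp

lemma fin {x : ℂ} (h : qPochInf x p ≠ 0) (n : ℕ) : qPoch x p n ≠ 0 :=
  qPoch_ne_zero_of_qPochInf_ne_zero H.hp h n

/-- The inner summation over `j`. -/
lemma sum_left (r : ℕ) :
    ∑ j ∈ range (r + 1), (qPoch (a * p ^ r) p j * qPoch (p / p ^ (r + 1)) p j /
        (qPoch (l * p / (a * p ^ r)) p j * qPoch (l * p ^ (r + 1)) p j)) *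
      ((1 - l * (p ^ j) ^ 2) * (qPoch l p j * qPoch (l * b / a) p j * qPoch (l * c / a) p j *
        qPoch (l * d / a) p j) / (qPoch p p j * qPoch (a * p / b) p j * qPoch (a * p / c) p j *
        qPoch (a * p / d) p j) * p ^ j) =
    (1 - l) * (qPoch (l * p) p r * qPoch b p r * qPoch c p r * qPoch d p r) /
      (qPoch (a * p / b) p r * qPoch (a * p / c) p r * qPoch (a * p / d) p r *
        qPoch (a / l) p r) := by
  obtain ⟨hp0, hp, ha, hb, hc, hd, he, hf, hl, -⟩ := id H
  have hl0 := H.l_ne_zero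
  have nz : ∀ {x : ℂ}, qPochInf x p ≠ 0 → ∀ i : ℕ, x * p ^ i ≠ 1 :=
    fun h => mul_pow_ne_one_of_qPochInf_ne_zero hp h
  have eb : l * p / (l * b / a) = a * p / b := by field_simp
  have ec : l * p / (l * c / a) = a * p / c := by field_simp
  have ed : l * p / (l * d / a) = a * p / d := by field_simp
  have ebc : l * p / (l * b / a * (l * c / a)) = d := by
    field_simp; linear_combination -hl
  have ebd : l * p / (l * b / a * (l * d / a)) = c := by
    field_simp; linear_combination -hl
  have ecd : l * p / (l * c / a * (l * d / a)) = b := by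
    field_simp; linear_combination -hl
  have ebcd : l / (l * b / a * (l * c / a) * (l * d / a)) = a / (l * p) := by
    field_simp; linear_combination -hl
  have ebcd' : l * p / (l * b / a * (l * c / a) * (l * d / a)) = a / l := by
    field_simp; linear_combination -hl
  -- The balanced fifth Jackson parameter is a p^r. Thus Jackson's sum with leading parameter l and
  -- length r produces the factorials of b, c and d in the outer summand.
  have ee : l ^ 2 * p ^ (r + 1) / (l * b / a * (l * c / a) * (l * d / a)) = a * p ^ r := by
    field_simp; linear_combination -p ^ r * hl
  have key := jackson_sum hp0 hl0 (b := l * b / a) (c := l * c / a) (d := l * d / a)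
    (by positivity) (by positivity) (by positivity) (nz H.p_ne) (nz H.hlp)
    (by rw [eb]; exact nz H.hab) (by rw [ec]; exact nz H.hac) (by rw [ed]; exact nz H.had)
    (by rw [ebcd]; exact nz H.hal) r
  rw [eb, ec, ed, ebc, ebd, ecd, ebcd', ee] at key
  rw [show qPoch (l * p) p r * qPoch b p r * qPoch c p r * qPoch d p r =
    qPoch (l * p) p r * qPoch d p r * qPoch c p r * qPoch b p r by ring, ← key]
  refine Finset.sum_congr rfl fun j _ => ?_
  rw [jacksonTerm, eb, ec, ed]
  simp only [div_eq_mul_inv, mul_inv]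
  ring

/-- The inner summation over `r`. -/
lemma sum_right {n j : ℕ} (hj : j ≤ n) :
    ∑ k ∈ range (n - j + 1), jacksonTerm p (a * p ^ (2 * j)) (e * p ^ j) (f * p ^ j) (a / l)
        (l * a * p / (e * f) * p ^ n * p ^ j) (p ^ (n - j + 1)) k =
      (1 - a * p ^ (2 * j)) * (qPoch (a * p ^ (2 * j) * p) p (n - j) *
        qPoch (a * p / (e * f)) p (n - j) * qPoch (l * p / e * p ^ j) p (n - j) *
        qPoch (l * p / f * p ^ j) p (n - j)) / (qPoch (a * p / e * p ^ j) p (n - j) *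
        qPoch (a * p / f * p ^ j) p (n - j) * qPoch (l * p * p ^ (2 * j)) p (n - j) *
        qPoch (l * p / (e * f)) p (n - j)) := by
  obtain ⟨hp0, hp, ha, hb, hc, hd, he, hf, hl, -⟩ := id H
  have hl0 := H.l_ne_zero
  have hpj : p ^ j ≠ 0 := pow_ne_zero _ hp0
  have nz : ∀ {x : ℂ}, qPochInf x p ≠ 0 → ∀ i : ℕ, x * p ^ i ≠ 1 :=
    fun h => mul_pow_ne_one_of_qPochInf_ne_zero hp h
  have nzs : ∀ {x : ℂ} (m : ℕ), qPochInf x p ≠ 0 → ∀ i : ℕ, x * p ^ m * p ^ i ≠ 1 :=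
    fun m h => nz (qPochInf_shift_ne_zero hp h m)
  have ep : p ^ (2 * j) = p ^ j * p ^ j := by rw [two_mul, pow_add]
  have ea : a * p ^ (2 * j) * p = a * p * p ^ (2 * j) := by ring
  have ee : a * p ^ (2 * j) * p / (e * p ^ j) = a * p / e * p ^ j := by rw [ep]; field_simp
  have ef : a * p ^ (2 * j) * p / (f * p ^ j) = a * p / f * p ^ j := by rw [ep]; field_simp
  have eal : a * p ^ (2 * j) * p / (a / l) = l * p * p ^ (2 * j) := by field_simp
  have eef : a * p ^ (2 * j) * p / (e * p ^ j * (f * p ^ j)) = a * p / (e * f) := by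
    rw [ep]; field_simp
  have eel : a * p ^ (2 * j) * p / (e * p ^ j * (a / l)) = l * p / e * p ^ j := by
    rw [ep]; field_simp
  have efl : a * p ^ (2 * j) * p / (f * p ^ j * (a / l)) = l * p / f * p ^ j := by
    rw [ep]; field_simp
  have eefl : a * p ^ (2 * j) / (e * p ^ j * (f * p ^ j) * (a / l)) = l / (e * f) := by
    rw [ep]; field_simp
  have eefl' : a * p ^ (2 * j) * p / (e * p ^ j * (f * p ^ j) * (a / l)) = l * p / (e * f) := by
    rw [ep]; field_simp
  -- After the shift r = j + k the remaining length is n - j, and the fifth parameter of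
  -- `termFactor` is the one that balances this sum.
  have eg : (a * p ^ (2 * j)) ^ 2 * p ^ (n - j + 1) / (e * p ^ j * (f * p ^ j) * (a / l)) =
      l * a * p / (e * f) * p ^ n * p ^ j := by
    have : p ^ n = p ^ (n - j) * p ^ j := by rw [← pow_add, Nat.sub_add_cancel hj]
    rw [this, ep]; field_simp; ring
  have key := jackson_sum hp0 (a := a * p ^ (2 * j)) (b := e * p ^ j) (c := f * p ^ j)
    (d := a / l) (by positivity) (by positivity) (by positivity) (by positivity) (nz H.p_ne)
    (by rw [ea]; exact nzs _ H.hap) (by rw [ee]; exact nzs _ H.hae)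
    (by rw [ef]; exact nzs _ H.haf) (by rw [eal]; exact nzs _ H.hlp)
    (by rw [eefl]; exact nz H.hlef) (n - j)
  rw [ee, ef, eal, eef, eel, efl, eefl', eg] at key
  exact key

lemma hal' : qPochInf (a / l) p ≠ 0 := by
  have hp0 := H.hp0
  have hl0 := H.l_ne_zero
  have := H.shift H.hal
  rwa [show a / (l * p) * p = a / l by field_simp] at this

lemma hlef' : qPochInf (l * p / (e * f)) p ≠ 0 := by
  have := H.shift H.hlef
  rwa [show l / (e * f) * p = l * p / (e * f) by ring] at this

lemma haef' : qPochInf (a * p / (e * f)) p ≠ 0 := by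
  have := H.shift H.haef
  rwa [show a / (e * f) * p = a * p / (e * f) by ring] at this

omit H in
lemma split_two_mul (x p : ℂ) {n j : ℕ} (hj : j ≤ n) :
    qPoch x p (2 * j) * qPoch (x * p ^ (2 * j)) p (n - j) =
      qPoch x p n * qPoch (x * p ^ n) p j := by
  rw [← qPoch_add, ← qPoch_add]
  congr 1; omega

omit H in
lemma split_le (x p : ℂ) {n j : ℕ} (hj : j ≤ n) :
    qPoch x p j * qPoch (x * p ^ j) p (n - j) = qPoch x p n := by
  rw [← qPoch_add]
  congr 1; omega

omit H in
lemma termFactor_add (p A G y : ℂ) (n j k : ℕ) :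
    termFactor p A G y n (j + k) = termFactor p A G y n j *
      (qPoch (G * p ^ n * p ^ j) p k * qPoch (1 / p ^ n * p ^ j) p k * p ^ k /
        (qPoch (y / p ^ n * p ^ j) p k * qPoch (A * p * p ^ n * p ^ j) p k)) := by
  simp only [termFactor, qPoch_add, pow_add, div_eq_mul_inv, mul_inv]
  ring

/-- The part of the double sum that depends on `r` only. -/
def outer (p a e f l : ℂ) (n r : ℕ) : ℂ :=
  (1 - a * (p ^ r) ^ 2) * (qPoch e p r * qPoch f p r) /
    (qPoch (a * p / e) p r * qPoch (a * p / f) p r) *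
      termFactor p a (l * a * p / (e * f)) (e * f / l) n r *
    (qPoch a p r * qPoch (a / l) p r / (qPoch p p r * qPoch (l * p) p r))

/-- The part of the double sum that depends on both indices. -/
def cross (p a l : ℂ) (r j : ℕ) : ℂ :=
  qPoch (a * p ^ r) p j * qPoch (p / p ^ (r + 1)) p j /
    (qPoch (l * p / (a * p ^ r)) p j * qPoch (l * p ^ (r + 1)) p j)

/-- The part of the double sum that depends on `j` only. -/
def inner (p a b c d l : ℂ) (j : ℕ) : ℂ :=
  (1 - l * (p ^ j) ^ 2) * (qPoch l p j * qPoch (l * b / a) p j * qPoch (l * c / a) p j *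
    qPoch (l * d / a) p j) / (qPoch p p j * qPoch (a * p / b) p j * qPoch (a * p / c) p j *
    qPoch (a * p / d) p j) * p ^ j

/-- The quotient of the factorials of b, c, d by those of ap/b, ap/c, ap/d is replaced by its
Jackson sum over j, which opens the double sum. -/
lemma double_left (n r : ℕ) :
    (1 - l) * (vwpTerm p a b c d e f r * termFactor p a (l * a * p / (e * f)) (e * f / l) n r) =
      ∑ j ∈ range (r + 1), outer p a e f l n r * (cross p a l r j * inner p a b c d l j) := by
  rw [← Finset.mul_sum]
  have key := H.sum_left r
  simp only [cross, inner]
  rw [key, vwpTerm, outer]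
  have n1 := H.fin H.hal' r
  have n2 := H.fin H.hlp r
  clear key H
  generalize termFactor p a (l * a * p / (e * f)) (e * f / l) n r = T
  generalize qPoch (a / l) p r = x1, qPoch (l * p) p r = x2, qPoch b p r = x3, qPoch c p r = x4,
    qPoch d p r = x5, qPoch e p r = x6, qPoch f p r = x7, qPoch a p r = x8, qPoch p p r = x9,
    qPoch (a * p / b) p r = y1, qPoch (a * p / c) p r = y2, qPoch (a * p / d) p r = y3,
    qPoch (a * p / e) p r = y4, qPoch (a * p / f) p r = y5, 1 - a * (p ^ r) ^ 2 = w,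
    1 - l = w' at *
  have e1 : x1 * x1⁻¹ = 1 := mul_inv_cancel₀ n1
  have e2 : x2 * x2⁻¹ = 1 := mul_inv_cancel₀ n2
  simp only [div_eq_mul_inv, mul_inv]
  linear_combination (-(w' * w * T * x3 * x4 * x5 * x6 * x7 * x8 * x9⁻¹ * y1⁻¹ * y2⁻¹ * y3⁻¹ *
    y4⁻¹ * y5⁻¹)) * (e1 * x2 * x2⁻¹ + e2)

/-- The substitution r = j + k separates the k-dependence; what depends on k is again a summand of
Jackson type, with leading parameter a p^(2j). -/
lemma double_term {n j : ℕ} (hj : j ≤ n) (k : ℕ) :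
    outer p a e f l n (j + k) * cross p a l (j + k) j =
      (qPoch e p j * qPoch f p j) / (qPoch (a * p / e) p j * qPoch (a * p / f) p j) *
        termFactor p a (l * a * p / (e * f)) (e * f / l) n j *
        (qPoch a p (2 * j) / qPoch (l * p) p (2 * j) * (a / (l * p)) ^ j) *
      jacksonTerm p (a * p ^ (2 * j)) (e * p ^ j) (f * p ^ j) (a / l)
        (l * a * p / (e * f) * p ^ n * p ^ j) (p ^ (n - j + 1)) k := by
  have hp0 := H.hp0
  have ha := H.ha
  have he := H.he
  have hf := H.hf
  have hl0 := H.l_ne_zero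
  have hpj : p ^ j ≠ 0 := pow_ne_zero _ hp0
  have hpn : p ^ n ≠ 0 := pow_ne_zero _ hp0
  have hn : p ^ (n - j) * p ^ j = p ^ n := by rw [← pow_add, Nat.sub_add_cancel hj]
  have hnj : p ^ (n - j) ≠ 0 := pow_ne_zero _ hp0
  have ep : p ^ (2 * j) = p ^ j * p ^ j := by rw [two_mul, pow_add]
  have bk := bailey_kernel hp0 ha hl0 j k (H.fin H.p_ne) (H.fin H.hal') (H.fin H.hlp)
  rw [outer, cross, termFactor_add, jacksonTerm]
  rw [show a * p ^ (2 * j) * p / (e * p ^ j) = a * p / e * p ^ j by rw [ep]; field_simp,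
    show a * p ^ (2 * j) * p / (f * p ^ j) = a * p / f * p ^ j by rw [ep]; field_simp,
    show a * p ^ (2 * j) * p / (a / l) = l * p ^ (2 * j) * p by field_simp,
    show a * p ^ (2 * j) * p / (l * a * p / (e * f) * p ^ n * p ^ j) = e * f / l / p ^ n * p ^ j by
      rw [ep]; field_simp,
    show a * p ^ (2 * j) * p ^ (n - j + 1) = a * p * p ^ n * p ^ j by rw [← hn, ep]; ring,
    show p / p ^ (n - j + 1) = 1 / p ^ n * p ^ j by rw [← hn]; field_simp; ring,
    show a * (p ^ (j + k)) ^ 2 = a * p ^ (2 * j) * (p ^ k) ^ 2 by ring,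
    qPoch_add e, qPoch_add f, qPoch_add (a * p / e), qPoch_add (a * p / f)]
  obtain ⟨X, hX⟩ : ∃ X, X = qPoch a p (j + k) * qPoch (a / l) p (j + k) /
    (qPoch p p (j + k) * qPoch (l * p) p (j + k)) := ⟨_, rfl⟩
  obtain ⟨Y, hY⟩ : ∃ Y, Y = qPoch (a * p ^ (j + k)) p j * qPoch (p / p ^ (j + k + 1)) p j /
        (qPoch (l * p / (a * p ^ (j + k))) p j * qPoch (l * p ^ (j + k + 1)) p j) := ⟨_, rfl⟩
  rw [← hX, ← hY] at bk
  rw [← hX, ← hY, mul_assoc, bk]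
  clear hX hY bk H
  simp only [div_eq_mul_inv, mul_inv]
  ring

/-- The sum over k is Jackson's sum of length n - j. Its value recombines with the j-dependent
factors to the summand of the transformed series, whose leading parameter is l. -/
lemma double_right {n j : ℕ} (hj : j ≤ n) :
    ∑ k ∈ range (n - j + 1), outer p a e f l n (j + k) *
        (cross p a l (j + k) j * inner p a b c d l j) =
      (1 - a) * (qPoch (a * p) p n * qPoch (a * p / (e * f)) p n * qPoch (l * p / e) p n *
        qPoch (l * p / f) p n / (qPoch (a * p / e) p n * qPoch (a * p / f) p n *
        qPoch (l * p) p n * qPoch (l * p / (e * f)) p n)) *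
      (vwpTerm p l (l * b / a) (l * c / a) (l * d / a) e f j *
        termFactor p l (l * a * p / (e * f)) (e * f / a) n j) := by
  simp only [← mul_assoc, H.double_term hj]
  rw [← Finset.sum_mul, ← Finset.mul_sum, H.sum_right hj]
  obtain ⟨hp0, hp, ha, hb, hc, hd, he, hf, hl, -⟩ := id H
  have hl0 := H.l_ne_zero
  have e1 : qPoch a p (2 * j) * ((1 - a * p ^ (2 * j)) * qPoch (a * p ^ (2 * j) * p) p (n - j)) =
      (1 - a) * (qPoch (a * p) p n * qPoch (a * p * p ^ n) p j) := by
    rw [← qPoch_add, ← qPoch_succ', ← qPoch_succ', ← qPoch_add]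
    congr 1; omega
  have e2 := split_two_mul (l * p) p hj
  have e3 := split_le (a * p / e) p hj
  have e4 := split_le (a * p / f) p hj
  have e5 := split_le (l * p / e) p hj
  have e6 := split_le (l * p / f) p hj
  have e7 := qPoch_split_of_le (a * p / (e * f)) p hj
  have e8 := qPoch_split_of_le (l * p / (e * f)) p hj
  have e9 : qPoch (e * f / l / p ^ n) p j =
      (e * f / l) ^ j * rev p n j * qPoch (l * p / (e * f) * p ^ (n - j)) p j := by
    rw [qPoch_div_pow_of_le hp0 (by positivity) hj,
      show p / (e * f / l) = l * p / (e * f) by field_simp]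
  have e10 : qPoch (e * f / a / p ^ n) p j =
      (e * f / a) ^ j * rev p n j * qPoch (a * p / (e * f) * p ^ (n - j)) p j := by
    rw [qPoch_div_pow_of_le hp0 (by positivity) hj,
      show p / (e * f / a) = a * p / (e * f) by field_simp]
  have b1 : l * p / (l * b / a) = a * p / b := by field_simp
  have b2 : l * p / (l * c / a) = a * p / c := by field_simp
  have b3 : l * p / (l * d / a) = a * p / d := by field_simp
  rw [vwpTerm, termFactor, termFactor, inner, e9, e10, b1, b2, b3, ← e3, ← e4, ← e5, ← e6, e7, e8]
  have n1 := H.fin H.hlp n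
  have n1' := H.fin (qPochInf_shift_ne_zero hp H.hlp n) j
  have n0 := H.fin (qPochInf_shift_ne_zero hp H.hlp (2 * j)) (n - j)
  have n2 := H.fin H.hlp (2 * j)
  have n3 := H.fin H.hle j
  have n4 := H.fin H.hlf j
  have n5 := H.fin (qPochInf_shift_ne_zero hp H.hap n) j
  have n6 := H.fin H.haef' (n - j)
  have n7 := H.fin (qPochInf_shift_ne_zero hp H.haef' (n - j)) j
  have n8 := rev_ne_zero hp0 n j
  have a1 : a ^ j ≠ 0 := pow_ne_zero _ ha
  have a2 : l ^ j ≠ 0 := pow_ne_zero _ hl0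
  have a3 : p ^ j ≠ 0 := pow_ne_zero _ hp0
  have a4 : (e * f) ^ j ≠ 0 := pow_ne_zero _ (mul_ne_zero he hf)
  rw [div_pow (e * f), div_pow (e * f), div_pow a, mul_pow l]
  clear b1 b2 b3 e9 e10 e8 e7 e6 e5 e4 e3 H
  generalize qPoch (l * p) p (2 * j) = x1, qPoch (l * p * p ^ (2 * j)) p (n - j) = x2,
    qPoch (l * p) p n = x3, qPoch (l * p * p ^ n) p j = x4, qPoch a p (2 * j) = x5,
    qPoch (a * p ^ (2 * j) * p) p (n - j) = x6, qPoch (a * p) p n = x7,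
    qPoch (a * p * p ^ n) p j = x8, qPoch (l * p / e) p j = x9, qPoch (l * p / f) p j = x10,
    qPoch (a * p / (e * f)) p (n - j) = x11, qPoch (a * p / (e * f) * p ^ (n - j)) p j = x12,
    qPoch (l * p / (e * f)) p (n - j) = x13, qPoch (l * p / (e * f) * p ^ (n - j)) p j = x14,
    qPoch (l * p / e * p ^ j) p (n - j) = x15, qPoch (l * p / f * p ^ j) p (n - j) = x16,
    qPoch (a * p / e * p ^ j) p (n - j) = y7, qPoch (a * p / f * p ^ j) p (n - j) = y8 at *
  generalize rev p n j = z, a ^ j = A, l ^ j = L, p ^ j = Q, (e * f) ^ j = E, 1 - a * p ^ (2 * j) = w1,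
    1 - a = w2 at *
  generalize qPoch e p j = y1, qPoch f p j = y2, qPoch (a * p / e) p j = y3,
    qPoch (a * p / f) p j = y4, qPoch (l * a * p / (e * f) * p ^ n) p j = y5,
    qPoch (1 / p ^ n) p j = y6, qPoch l p j = y9, qPoch (l * b / a) p j = y10,
    qPoch (l * c / a) p j = y11, qPoch (l * d / a) p j = y12, qPoch p p j = y13,
    qPoch (a * p / b) p j = y14, qPoch (a * p / c) p j = y15, qPoch (a * p / d) p j = y16,
    1 - l * Q ^ 2 = w3 at *
  have k1 : x5 * w1 * x6 / x8 = w2 * x7 := by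
    rw [div_eq_iff n5]; linear_combination e1
  have k2 : 1 / (x1 * x2) = 1 / (x3 * x4) := by rw [e2]
  have q1 : Q * Q⁻¹ = 1 := mul_inv_cancel₀ a3
  have q2 : L * L⁻¹ = 1 := mul_inv_cancel₀ a2
  have q3 : x9 * x9⁻¹ = 1 := mul_inv_cancel₀ n3
  have q4 : x10 * x10⁻¹ = 1 := mul_inv_cancel₀ n4
  have q5 : x12 * x12⁻¹ = 1 := mul_inv_cancel₀ n7
  obtain ⟨c, hc⟩ : ∃ c, c = y1 * y2 * y3⁻¹ * y4⁻¹ * y5 * y6 * Q * E⁻¹ * z⁻¹ * x14⁻¹ * A * x11 *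
    x15 * x16 * y7⁻¹ * y8⁻¹ * x13⁻¹ * w3 * y9 * y10 * y11 * y12 * y13⁻¹ * y14⁻¹ * y15⁻¹ *
    y16⁻¹ := ⟨_, rfl⟩
  trans c * (x5 * w1 * x6 / x8) * (1 / (x1 * x2)) * ((Q * Q⁻¹) * (L * L⁻¹))
  · rw [hc]
    simp only [div_eq_mul_inv, mul_inv, inv_inv]
    ring
  trans c * (w2 * x7) * (1 / (x3 * x4)) * ((x9 * x9⁻¹) * (x10 * x10⁻¹) * (x12 * x12⁻¹))
  · rw [k1, k2, q1, q2, q3, q4, q5, one_mul, one_mul]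
  · rw [hc]
    simp only [div_eq_mul_inv, mul_inv, inv_inv]
    ring

/-- Bailey's transformation of a terminating very-well-poised `₁₀φ₉` series. -/
theorem finite_transformation (n : ℕ) :
    (1 - l) * ∑ r ∈ range (n + 1), vwpTerm p a b c d e f r *
        termFactor p a (l * a * p / (e * f)) (e * f / l) n r =
      (1 - a) * (qPoch (a * p) p n * qPoch (a * p / (e * f)) p n * qPoch (l * p / e) p n *
        qPoch (l * p / f) p n / (qPoch (a * p / e) p n * qPoch (a * p / f) p n *
        qPoch (l * p) p n * qPoch (l * p / (e * f)) p n)) *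
      ∑ j ∈ range (n + 1), vwpTerm p l (l * b / a) (l * c / a) (l * d / a) e f j *
        termFactor p l (l * a * p / (e * f)) (e * f / a) n j := by
  rw [Finset.mul_sum, Finset.sum_congr rfl fun r _ => H.double_left n r]
  -- Exchange of the summations over the triangle j ≤ r ≤ n.
  have flip := Finset.sum_range_diag_flip (n + 1) fun j k =>
    outer p a e f l n (j + k) * (cross p a l (j + k) j * inner p a b c d l j)
  have e1 : ∀ m, ∑ j ∈ range (m + 1), outer p a e f l n (j + (m - j)) *
        (cross p a l (j + (m - j)) j * inner p a b c d l j) =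
      ∑ j ∈ range (m + 1), outer p a e f l n m * (cross p a l m j * inner p a b c d l j) := fun m =>
    Finset.sum_congr rfl fun j hj => by
      rw [Nat.add_sub_cancel' (Nat.lt_succ_iff.mp (Finset.mem_range.mp hj))]
  simp only [e1] at flip
  rw [flip, Finset.mul_sum]
  refine Finset.sum_congr rfl fun j hj => ?_
  have hj' := Nat.lt_succ_iff.mp (Finset.mem_range.mp hj)
  rw [← H.double_right hj', Nat.sub_add_comm hj']

omit H in
lemma exists_norm_qPoch_le {p : ℂ} (hp : ‖p‖ < 1) (x : ℂ) : ∃ C, 0 ≤ C ∧ ∀ r, ‖qPoch x p r‖ ≤ C :=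
  ⟨_, (Real.exp_pos _).le, fun r => norm_qPoch_le hp (le_refl ‖x‖) r⟩

omit H in
lemma exists_norm_vwpTerm_le {p a b c d e f : ℂ} (hp : ‖p‖ < 1)
    (hb : qPochInf (a * p / b) p ≠ 0) (hc : qPochInf (a * p / c) p ≠ 0)
    (hd : qPochInf (a * p / d) p ≠ 0) (he : qPochInf (a * p / e) p ≠ 0)
    (hf : qPochInf (a * p / f) p ≠ 0) :
    ∃ C, ∀ r, ‖vwpTerm p a b c d e f r‖ ≤ C := by
  obtain ⟨a1, h1, k1⟩ := exists_norm_qPoch_le hp a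
  obtain ⟨a2, h2, k2⟩ := exists_norm_qPoch_le hp b
  obtain ⟨a3, h3, k3⟩ := exists_norm_qPoch_le hp c
  obtain ⟨a4, h4, k4⟩ := exists_norm_qPoch_le hp d
  obtain ⟨a5, h5, k5⟩ := exists_norm_qPoch_le hp e
  obtain ⟨a6, h6, k6⟩ := exists_norm_qPoch_le hp f
  obtain ⟨b1, g1, l1⟩ := exists_norm_inv_qPoch_le hp (qPochInf_ne_zero_of_norm_lt hp hp)
  obtain ⟨b2, g2, l2⟩ := exists_norm_inv_qPoch_le hp hb
  obtain ⟨b3, g3, l3⟩ := exists_norm_inv_qPoch_le hp hc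
  obtain ⟨b4, g4, l4⟩ := exists_norm_inv_qPoch_le hp hd
  obtain ⟨b5, g5, l5⟩ := exists_norm_inv_qPoch_le hp he
  obtain ⟨b6, g6, l6⟩ := exists_norm_inv_qPoch_le hp hf
  refine ⟨(1 + ‖a‖) * (a1 * a2 * a3 * a4 * a5 * a6) * (b1 * b2 * b3 * b4 * b5 * b6), fun r => ?_⟩
  have h0 : ‖1 - a * (p ^ r) ^ 2‖ ≤ 1 + ‖a‖ := by
    rw [← pow_mul]
    refine (norm_sub_le _ _).trans ?_
    rw [norm_one]
    gcongr
    exact norm_mul_pow_le hp a _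
  simp only [vwpTerm, div_eq_mul_inv, mul_inv]
  simp only [norm_mul]
  simp only [div_eq_mul_inv] at l1 l2 l3 l4 l5 l6
  gcongr
  exacts [k1 r, k2 r, k3 r, k4 r, k5 r, k6 r, l1 r, l2 r, l3 r, l4 r, l5 r, l6 r]

/-- Limit of `finite_transformation` as n tends to infinity. The two `termFactor`s become
(lp/(ef))^r and (ap/(ef))^r, hence two convergence conditions. -/
theorem infinite_transformation (h1 : ‖l * p / (e * f)‖ < 1) (h2 : ‖a * p / (e * f)‖ < 1) :
    (1 - l) * ∑' r, vwpTerm p a b c d e f r * (l * p / (e * f)) ^ r =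
      (1 - a) * (qPochInf (a * p) p * qPochInf (a * p / (e * f)) p * qPochInf (l * p / e) p *
        qPochInf (l * p / f) p / (qPochInf (a * p / e) p * qPochInf (a * p / f) p *
        qPochInf (l * p) p * qPochInf (l * p / (e * f)) p)) *
      ∑' r, vwpTerm p l (l * b / a) (l * c / a) (l * d / a) e f r * (a * p / (e * f)) ^ r := by
  obtain ⟨hp0, hp, ha, hb, hc, hd, he, hf, hl, -⟩ := id H
  have hl0 := H.l_ne_zero
  have b1 : l * p / (l * b / a) = a * p / b := by field_simp
  have b2 : l * p / (l * c / a) = a * p / c := by field_simp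
  have b3 : l * p / (l * d / a) = a * p / d := by field_simp
  have y1 : p / (e * f / l) = l * p / (e * f) := by field_simp
  have y2 : p / (e * f / a) = a * p / (e * f) := by field_simp
  obtain ⟨C1, hC1⟩ := exists_norm_vwpTerm_le hp H.hab H.hac H.had H.hae H.haf
  obtain ⟨C2, hC2⟩ := exists_norm_vwpTerm_le (b := l * b / a) (c := l * c / a) (d := l * d / a) hp
    (by rw [b1]; exact H.hab) (by rw [b2]; exact H.hac) (by rw [b3]; exact H.had) H.hle H.hlf
  have t1 := tendsto_sum_termFactor (l * a * p / (e * f)) hp0 hp (y := e * f / l) (by positivity)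
    H.hap (by rw [y1]; exact H.hlef') (by rwa [y1]) hC1
  have t2 := tendsto_sum_termFactor (l * a * p / (e * f)) hp0 hp (y := e * f / a) (by positivity)
    H.hlp (by rw [y2]; exact H.haef') (by rwa [y2]) hC2
  rw [y1] at t1
  rw [y2] at t2
  have tq := ((((tendsto_qPoch hp (a * p)).mul (tendsto_qPoch hp (a * p / (e * f)))).mul
    (tendsto_qPoch hp (l * p / e))).mul (tendsto_qPoch hp (l * p / f))).div
    ((((tendsto_qPoch hp (a * p / e)).mul (tendsto_qPoch hp (a * p / f))).mul
    (tendsto_qPoch hp (l * p))).mul (tendsto_qPoch hp (l * p / (e * f))))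
    (mul_ne_zero (mul_ne_zero (mul_ne_zero H.hae H.haf) H.hlp) H.hlef')
  refine tendsto_nhds_unique (t1.const_mul (1 - l)) (((tq.const_mul (1 - a)).mul t2).congr ?_)
  intro n
  exact (H.finite_transformation n).symm

end BaileyGeneric

/-- The regularised very-well-poised series. -/
def vwp (p A b c d e f t : ℂ) : ℂ :=
  ∑' r : ℕ, (1 - A * (p ^ r) ^ 2) * qPoch A p r / qPoch p p r *
    (qPoch b p r * qPochInf (A * p / b * p ^ r) p) * (qPoch c p r * qPochInf (A * p / c * p ^ r) p) *
    (qPoch d p r * qPochInf (A * p / d * p ^ r) p) * (qPoch e p r * qPochInf (A * p / e * p ^ r) p) *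
    (qPoch f p r * qPochInf (A * p / f * p ^ r) p) * t ^ r

/-- Each pair (b)_r (Ap^(r+1)/b)_∞ of the regularised series is (Ap/b)_∞ times the usual quotient.
The regularised form avoids this division and is the natural one in transformation formulas. -/
lemma vwp_eq {p A b c d e f t : ℂ} (hp : ‖p‖ < 1)
    (hb : qPochInf (A * p / b) p ≠ 0) (hc : qPochInf (A * p / c) p ≠ 0)
    (hd : qPochInf (A * p / d) p ≠ 0) (he : qPochInf (A * p / e) p ≠ 0)
    (hf : qPochInf (A * p / f) p ≠ 0) :
    vwp p A b c d e f t = qPochInf (A * p / b) p * qPochInf (A * p / c) p * qPochInf (A * p / d) p *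
      qPochInf (A * p / e) p * qPochInf (A * p / f) p * ∑' r, vwpTerm p A b c d e f r * t ^ r := by
  rw [vwp, ← tsum_mul_left]
  refine tsum_congr fun r => ?_
  have key : ∀ {x : ℂ}, qPochInf x p ≠ 0 →
      qPochInf (x * p ^ r) p = qPochInf x p * (qPoch x p r)⁻¹ := fun {x} h => by
    rw [qPochInf_eq_mul hp x r]
    have := qPoch_ne_zero_of_qPochInf_ne_zero hp h r
    field_simp
  rw [key hb, key hc, key hd, key he, key hf, vwpTerm]
  simp only [div_eq_mul_inv, mul_inv]
  ring

/-- Bailey's transformation of nonterminating very-well-poised `₈φ₇` series. -/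
theorem BaileyGeneric.vwp_transformation {p a b c d e f l : ℂ} (H : BaileyGeneric p a b c d e f l)
    (h1 : ‖l * p / (e * f)‖ < 1) (h2 : ‖a * p / (e * f)‖ < 1) :
    qPochInf (l * p / (e * f)) p * qPochInf l p * vwp p a b c d e f (l * p / (e * f)) =
      qPochInf (a * p / (e * f)) p * qPochInf a p *
        vwp p l (l * b / a) (l * c / a) (l * d / a) e f (a * p / (e * f)) := by
  have key := H.infinite_transformation h1 h2
  obtain ⟨hp0, hp, ha, hb, hc, hd, he, hf, hl, -⟩ := id H
  have hl0 := H.l_ne_zero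
  have b1 : l * p / (l * b / a) = a * p / b := by field_simp
  have b2 : l * p / (l * c / a) = a * p / c := by field_simp
  have b3 : l * p / (l * d / a) = a * p / d := by field_simp
  rw [vwp_eq hp H.hab H.hac H.had H.hae H.haf, vwp_eq hp (by rw [b1]; exact H.hab)
    (by rw [b2]; exact H.hac) (by rw [b3]; exact H.had) H.hle H.hlf, b1, b2, b3,
    qPochInf_eq_one_sub_mul hp l, qPochInf_eq_one_sub_mul hp a]
  have n1 := H.hae
  have n2 := H.haf
  have n3 := H.hlp
  have n4 := H.hlef'
  generalize ∑' r, vwpTerm p a b c d e f r * (l * p / (e * f)) ^ r = S at *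
  generalize ∑' r, vwpTerm p l (l * b / a) (l * c / a) (l * d / a) e f r * (a * p / (e * f)) ^ r =
    S' at *
  clear b1 b2 b3 H h1 h2
  generalize qPochInf (l * p / (e * f)) p = x1, qPochInf (a * p / (e * f)) p = x2,
    qPochInf (a * p / b) p = x3, qPochInf (a * p / c) p = x4, qPochInf (a * p / d) p = x5,
    qPochInf (a * p / e) p = x6, qPochInf (a * p / f) p = x7, qPochInf (l * p / e) p = x8,
    qPochInf (l * p / f) p = x9, qPochInf (l * p) p = x10, qPochInf (a * p) p = x11,
    1 - l = w1, 1 - a = w2 at *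
  have key2 : w1 * S * (x6 * x7 * x10 * x1) = w2 * (x11 * x2 * x8 * x9) * S' := by
    rw [key]; field_simp
  linear_combination x3 * x4 * x5 * key2

end AskeyWilson

end

noncomputable section
namespace AskeyWilson
open Filter Topology Finset

/-! ## The three-term relation of very-well-poised series -/

/-- Lagrange interpolation at the points y + 1/(τ y): the coefficient of degree #s - 1 is the sum of
P(node) over the products of node differences, and it vanishes for P of smaller degree. The
difference of two such points splits into the two factors in the statement, up to a factor that
depends on j alone. -/
lemma sum_div_prod_eq_zero {ι : Type*} [DecidableEq ι] (s : Finset ι) (y : ι → ℂ) {τ : ℂ}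
    (hτ : τ ≠ 0) (hy : ∀ i, y i ≠ 0)
    (hne : ∀ i ∈ s, ∀ j ∈ s, i ≠ j → 1 - τ * y j * y i ≠ 0 ∧ 1 - y j / y i ≠ 0)
    (P : Polynomial ℂ) (hP : P.natDegree + 1 < #s) :
    ∑ i ∈ s, P.eval (y i + 1 / (τ * y i)) /
      (y i * ∏ j ∈ s.erase i, ((1 - τ * y j * y i) * (1 - y j / y i))) = 0 := by
  have hdiff : ∀ i j, y i + 1 / (τ * y i) - (y j + 1 / (τ * y j)) =
      (1 - τ * y j * y i) * (1 - y j / y i) * (-(τ * y j))⁻¹ := by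
    intro i j
    have := hy i
    have := hy j
    field_simp
    ring
  have hinj : Set.InjOn (fun i => y i + 1 / (τ * y i)) s := by
    intro i hi j hj hij
    by_contra h
    have h1 := hdiff i j
    rw [sub_eq_zero.mpr hij] at h1
    obtain ⟨h2, h3⟩ := hne i hi j hj h
    exact mul_ne_zero (mul_ne_zero h2 h3) (inv_ne_zero (neg_ne_zero.mpr (mul_ne_zero hτ (hy j))))
      h1.symm
  have hdeg : P.degree < #s :=
    (Polynomial.degree_le_natDegree).trans_lt (by exact_mod_cast (by omega : P.natDegree < #s))
  -- The formula for the coefficient of degree #s - 1; the degree bound makes its left-hand side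
  -- zero.
  have key := Lagrange.coeff_eq_sum hinj hdeg
  rw [Polynomial.coeff_eq_zero_of_natDegree_lt (by omega)] at key
  obtain ⟨D, hD⟩ : ∃ D, D = ∏ j ∈ s, (-(τ * y j))⁻¹ := ⟨_, rfl⟩
  have hD0 : D ≠ 0 := by
    rw [hD, Finset.prod_ne_zero_iff]
    exact fun j _ => inv_ne_zero (neg_ne_zero.mpr (mul_ne_zero hτ (hy j)))
  have h0 : (-τ * D) * ∑ i ∈ s, P.eval (y i + 1 / (τ * y i)) /
      ∏ j ∈ s.erase i, (y i + 1 / (τ * y i) - (y j + 1 / (τ * y j))) = 0 := by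
    rw [← key, mul_zero]
  rw [Finset.mul_sum] at h0
  rw [← h0]
  refine Finset.sum_congr rfl fun i hi => ?_
  simp only [hdiff]
  rw [Finset.prod_mul_distrib (g := fun j => (-(τ * y j))⁻¹)]
  have hDi : D = (-(τ * y i))⁻¹ * ∏ j ∈ s.erase i, (-(τ * y j))⁻¹ := by
    rw [hD, Finset.mul_prod_erase s (fun j => (-(τ * y j))⁻¹) hi]
  have h3 : ∏ j ∈ s.erase i, (-(τ * y j))⁻¹ ≠ 0 := by
    rw [Finset.prod_ne_zero_iff]
    exact fun j _ => inv_ne_zero (neg_ne_zero.mpr (mul_ne_zero hτ (hy j)))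
  have := hy i
  rw [hDi]
  generalize ∏ j ∈ s.erase i, (-(τ * y j))⁻¹ = z at *
  field_simp

lemma prod_fin_three (G : Fin 3 → ℂ) (k : Fin 3) :
    ∏ i, G i = G k * (G (k + 1) * G (k + 2)) := by
  rw [← Equiv.prod_comp (Equiv.addLeft k) G, Fin.prod_univ_three]
  simp [mul_assoc]

lemma prod_range_erase {p : ℂ} (hp0 : p ≠ 0) {N n : ℕ} (hn : n ≤ N) :
    ∏ m ∈ (range (N + 1)).erase n, (1 - p ^ m / p ^ n) = qPoch (1 / p ^ n) p n * qPoch p p (N - n) := by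
  have h1 : (range (N + 1)).erase n = range n ∪ (range (N - n)).image (fun i => n + 1 + i) := by
    ext m
    simp only [mem_erase, mem_range, mem_union, mem_image]
    constructor
    · rintro ⟨h1, h2⟩
      rcases lt_or_gt_of_ne h1 with h | h
      · exact Or.inl h
      · exact Or.inr ⟨m - (n + 1), by omega, by omega⟩
    · rintro (h | ⟨i, h, rfl⟩) <;> omega
  rw [h1, Finset.prod_union, Finset.prod_image (by intro a _ b _ h; simpa using h), qPoch, qPoch]
  · congr 1
    · exact Finset.prod_congr rfl fun i _ => by ring
    · refine Finset.prod_congr rfl fun i _ => ?_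
      rw [pow_add, pow_add]
      have := pow_ne_zero n hp0
      field_simp
  · rw [Finset.disjoint_left]
    intro a ha hb
    simp only [mem_range, mem_image] at ha hb
    omega

/-- The factor 1 - τ y² supplies the node missing from the first product and completes it to full
shifted factorials. In the second product the omitted factor is zero, so the gap at n stays and
splits the range. -/
lemma prod_nodes_erase {p τ : ℂ} (hp0 : p ≠ 0) (x : Fin 3 → ℂ) (hx : ∀ k, x k ≠ 0) (k : Fin 3)
    {N n : ℕ} (hn : n ≤ N) (y : ℂ) (hy : y = x k * p ^ n) :
    (∏ j ∈ (univ ×ˢ range (N + 1)).erase (k, n),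
      ((1 - τ * (x j.1 * p ^ j.2) * y) * (1 - x j.1 * p ^ j.2 / y))) * (1 - τ * y * y) =
    (qPoch (τ * x k * y) p (N + 1) * qPoch (τ * x (k + 1) * y) p (N + 1) *
      qPoch (τ * x (k + 2) * y) p (N + 1)) *
    (qPoch (x (k + 1) / y) p (N + 1) * qPoch (x (k + 2) / y) p (N + 1) *
      (qPoch (1 / p ^ n) p n * qPoch p p (N - n))) := by
  have hmem : (k, n) ∈ (univ : Finset (Fin 3)) ×ˢ range (N + 1) := by simp; omega
  have hpn := pow_ne_zero n hp0
  rw [Finset.prod_mul_distrib]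
  have e1 : (∏ j ∈ (univ ×ˢ range (N + 1)).erase (k, n), (1 - τ * (x j.1 * p ^ j.2) * y)) *
      (1 - τ * y * y) = qPoch (τ * x k * y) p (N + 1) * qPoch (τ * x (k + 1) * y) p (N + 1) *
      qPoch (τ * x (k + 2) * y) p (N + 1) := by
    rw [mul_comm]
    have := Finset.mul_prod_erase (univ ×ˢ range (N + 1))
      (fun j : Fin 3 × ℕ => 1 - τ * (x j.1 * p ^ j.2) * y) hmem
    simp only [← hy] at this
    rw [this, Finset.prod_product, prod_fin_three _ k, mul_assoc]
    simp only [qPoch]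
    congr 1
    · exact Finset.prod_congr rfl fun i _ => by ring
    · congr 1 <;> exact Finset.prod_congr rfl fun i _ => by ring
  have e2 : ∏ j ∈ (univ ×ˢ range (N + 1)).erase (k, n), (1 - x j.1 * p ^ j.2 / y) =
      qPoch (x (k + 1) / y) p (N + 1) * qPoch (x (k + 2) / y) p (N + 1) *
      (qPoch (1 / p ^ n) p n * qPoch p p (N - n)) := by
    let F : Fin 3 × ℕ → ℂ := fun j => if j = (k, n) then 1 else 1 - x j.1 * p ^ j.2 / y
    have : ∏ j ∈ (univ ×ˢ range (N + 1)).erase (k, n), (1 - x j.1 * p ^ j.2 / y) =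
        ∏ j ∈ univ ×ˢ range (N + 1), F j := by
      rw [← Finset.mul_prod_erase _ F hmem]
      simp only [F, if_true, one_mul]
      exact Finset.prod_congr rfl fun j hj => by rw [if_neg (Finset.ne_of_mem_erase hj)]
    rw [this, Finset.prod_product, prod_fin_three _ k, mul_comm]
    congr 1
    · congr 1
      · rw [qPoch]
        refine Finset.prod_congr rfl fun i _ => ?_
        simp only [F]
        rw [if_neg (by simp)]
        ring
      · rw [qPoch]
        refine Finset.prod_congr rfl fun i _ => ?_
        simp only [F]
        rw [if_neg (by simp)]
        ring
    · rw [← prod_range_erase hp0 hn, ← Finset.mul_prod_erase _ _ (show n ∈ range (N + 1) by simp; omega)]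
      simp only [F, if_true, one_mul]
      refine Finset.prod_congr rfl fun i hi => ?_
      rw [if_neg (by simpa using Finset.ne_of_mem_erase hi), hy]
      have := hx k
      field_simp
  rw [← e1, ← e2]
  ring

/-- The polynomial whose values at the nodes are products of shifted factorials. -/
def nodePoly (p τ : ℂ) (w : Fin 3 → ℂ) (N : ℕ) : Polynomial ℂ :=
  ∏ l : Fin 3, ∏ i ∈ range N, (Polynomial.C (1 + (p ^ (i + 1) / w l) ^ 2 / τ) -
    Polynomial.C (p ^ (i + 1) / w l) * Polynomial.X)

lemma natDegree_nodePoly_le (p τ : ℂ) (w : Fin 3 → ℂ) (N : ℕ) :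
    (nodePoly p τ w N).natDegree ≤ 3 * N := by
  have h1 : ∀ l : Fin 3, (∏ i ∈ range N, (Polynomial.C (1 + (p ^ (i + 1) / w l) ^ 2 / τ) -
    Polynomial.C (p ^ (i + 1) / w l) * Polynomial.X)).natDegree ≤ N := fun l => by
    refine (Polynomial.natDegree_prod_le _ _).trans ?_
    refine (Finset.sum_le_sum fun i _ => ?_ : _ ≤ ∑ i ∈ range N, 1).trans (by simp)
    refine (Polynomial.natDegree_sub_le _ _).trans ?_
    simp only [Polynomial.natDegree_C, zero_le, sup_of_le_right]
    exact (Polynomial.natDegree_C_mul_le _ _).trans Polynomial.natDegree_X_le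
  refine (Polynomial.natDegree_prod_le _ _).trans ?_
  refine (Finset.sum_le_sum fun l _ => h1 l).trans ?_
  simp

/-- With c = p^(i+1)/w, a linear factor takes the value (1 - cy)(1 - c/(τ y)) at y + 1/(τ y). -/
lemma eval_nodePoly {p τ y : ℂ} (hτ : τ ≠ 0) (hy : y ≠ 0) (w : Fin 3 → ℂ) (N : ℕ)
    (hw : ∀ l, w l ≠ 0) :
    (nodePoly p τ w N).eval (y + 1 / (τ * y)) =
      ∏ l, (qPoch (p * y / w l) p N * qPoch (p / (τ * w l * y)) p N) := by
  rw [nodePoly, Polynomial.eval_prod]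
  refine Finset.prod_congr rfl fun l _ => ?_
  rw [Polynomial.eval_prod, qPoch, qPoch, ← Finset.prod_mul_distrib]
  refine Finset.prod_congr rfl fun i _ => ?_
  have := hw l
  simp only [Polynomial.eval_sub, Polynomial.eval_C, Polynomial.eval_mul, Polynomial.eval_X]
  field_simp
  ring

/-- The contribution of the node `X p ^ n` to the finite three-term relation. -/
def nodeTerm (p τ X X' X'' : ℂ) (w : Fin 3 → ℂ) (N n : ℕ) : ℂ :=
  (∏ l, (qPoch (p * (X * p ^ n) / w l) p N * qPoch (p / (τ * w l * (X * p ^ n))) p N)) *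
    (1 - τ * (X * p ^ n) * (X * p ^ n)) / (X * p ^ n * ((qPoch (τ * X * (X * p ^ n)) p (N + 1) *
      qPoch (τ * X' * (X * p ^ n)) p (N + 1) * qPoch (τ * X'' * (X * p ^ n)) p (N + 1)) *
    (qPoch (X' / (X * p ^ n)) p (N + 1) * qPoch (X'' / (X * p ^ n)) p (N + 1) *
      (qPoch (1 / p ^ n) p n * qPoch p p (N - n)))))

/-- Interpolation at the 3(N+1) nodes coming from x_k p^n with n ≤ N, applied to `nodePoly`. Each of
the three geometric progressions becomes one series in the limit. -/
theorem finite_three_term {p τ : ℂ} (hp0 : p ≠ 0) (hp : ‖p‖ < 1) (hτ : τ ≠ 0) (x w : Fin 3 → ℂ)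
    (hx : ∀ k, x k ≠ 0) (hw : ∀ k, w k ≠ 0) (h1 : ∀ j k, qPochInf (τ * x j * x k) p ≠ 0)
    (h2 : ∀ j k, j ≠ k → qPochInf (x j / x k) p ≠ 0) (N : ℕ) :
    ∑ k : Fin 3, ∑ n ∈ range (N + 1), nodeTerm p τ (x k) (x (k + 1)) (x (k + 2)) w N n = 0 := by
  have hne1 : ∀ i j : Fin 3 × ℕ, 1 - τ * (x j.1 * p ^ j.2) * (x i.1 * p ^ i.2) ≠ 0 := by
    intro i j h
    refine mul_pow_ne_one_of_qPochInf_ne_zero hp (h1 j.1 i.1) (j.2 + i.2) ?_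
    rw [pow_add]
    linear_combination -h
  have hne2 : ∀ i j : Fin 3 × ℕ, i ≠ j → 1 - x j.1 * p ^ j.2 / (x i.1 * p ^ i.2) ≠ 0 := by
    intro i j hij h
    have hi := hx i.1
    have hj := hx j.1
    have hpi := pow_ne_zero i.2 hp0
    have hpj := pow_ne_zero j.2 hp0
    have h' : x j.1 * p ^ j.2 = x i.1 * p ^ i.2 := by field_simp at h; linear_combination -h
    -- If two nodes collided, cancelling the smaller power would make a ratio of the x's an inverse
    -- power of p, excluded by `h2`, or for equal k give p^m = 1 with m > 0.
    rcases le_total j.2 i.2 with hle | hle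
    · obtain ⟨m, hm⟩ := Nat.exists_eq_add_of_le hle
      have h3 : x i.1 / x j.1 * p ^ m = 1 := by
        rw [hm, pow_add] at h'
        field_simp
        exact mul_right_cancel₀ hpj (by linear_combination -h')
      by_cases hk : i.1 = j.1
      · rw [hk, div_self hj, one_mul] at h3
        rcases Nat.eq_zero_or_pos m with hm0 | hm0
        · exact hij (Prod.ext hk (by omega))
        · have := pow_lt_one₀ (norm_nonneg p) hp hm0.ne'
          rw [← norm_pow, h3, norm_one] at this
          exact lt_irrefl _ this
      · exact mul_pow_ne_one_of_qPochInf_ne_zero hp (h2 _ _ hk) m h3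
    · obtain ⟨m, hm⟩ := Nat.exists_eq_add_of_le hle
      have h3 : x j.1 / x i.1 * p ^ m = 1 := by
        rw [hm, pow_add] at h'
        field_simp
        exact mul_right_cancel₀ hpi (by linear_combination h')
      by_cases hk : i.1 = j.1
      · rw [hk, div_self hj, one_mul] at h3
        rcases Nat.eq_zero_or_pos m with hm0 | hm0
        · exact hij (Prod.ext hk (by omega))
        · have := pow_lt_one₀ (norm_nonneg p) hp hm0.ne'
          rw [← norm_pow, h3, norm_one] at this
          exact lt_irrefl _ this
      · exact mul_pow_ne_one_of_qPochInf_ne_zero hp (h2 _ _ (Ne.symm hk)) m h3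
  have key := sum_div_prod_eq_zero (univ ×ˢ range (N + 1)) (fun i : Fin 3 × ℕ => x i.1 * p ^ i.2) hτ
    (fun i => mul_ne_zero (hx _) (pow_ne_zero _ hp0)) (fun i _ j _ hij => ⟨hne1 i j, hne2 i j hij⟩)
    -- The count is 3N + 1 < 3(N + 1).
    (nodePoly p τ w N) (by
      have := natDegree_nodePoly_le p τ w N
      simp only [card_product, card_univ, Fintype.card_fin, card_range]
      omega)
  rw [← key, Finset.sum_product]
  refine Finset.sum_congr rfl fun k _ => Finset.sum_congr rfl fun n hn => ?_
  have hn' := Nat.lt_succ_iff.mp (Finset.mem_range.mp hn)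
  have hy : x k * p ^ n ≠ 0 := mul_ne_zero (hx _) (pow_ne_zero _ hp0)
  have h3 := hne1 (k, n) (k, n)
  dsimp only at h3 ⊢
  rw [eval_nodePoly hτ hy w N hw, nodeTerm, ← prod_nodes_erase hp0 x hx k hn' _ rfl,
    ← mul_assoc (x k * p ^ n), mul_div_mul_right _ _ h3]

lemma qPoch_split_pow {p : ℂ} (hp0 : p ≠ 0) {y : ℂ} (hy : y ≠ 0) {n N : ℕ} (hn : n ≤ N) :
    y ^ n * rev p n n * qPoch (p / y) p n * qPoch y p (N - n) = qPoch (y / p ^ n) p N := by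
  have h : qPoch (y / p ^ n) p n = y ^ n * rev p n n * qPoch (p / y) p n := by
    rw [qPoch_div_pow_of_le hp0 hy le_rfl]; simp
  rw [← h]
  have := pow_ne_zero n hp0
  conv_rhs => rw [← Nat.add_sub_cancel' hn, qPoch_add, div_mul_cancel₀ _ this]

/-- The part of a node term that does not depend on the length. -/
def nodeFix (p τ X X' X'' : ℂ) (w : Fin 3 → ℂ) (n : ℕ) : ℂ :=
  (1 - τ * X * X * (p ^ n) ^ 2) * qPoch (τ * X * X) p n * (qPoch p p n)⁻¹ *
    (qPoch (τ * X' * X) p n * (qPoch (p * X / X') p n)⁻¹) *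
    (qPoch (τ * X'' * X) p n * (qPoch (p * X / X'') p n)⁻¹) *
    ∏ l, qPoch (τ * w l * X) p n

/-- The part of a node term that depends on the length. -/
def nodeVar (p τ X X' X'' : ℂ) (w : Fin 3 → ℂ) (N n : ℕ) : ℂ :=
  (∏ l, (qPoch (p * X / w l * p ^ n) p N * qPoch (p / (τ * w l * X)) p (N - n))) *
    (qPoch (τ * X * X) p (n + (N + 1)))⁻¹ * (qPoch (τ * X' * X) p (n + (N + 1)))⁻¹ *
    (qPoch (τ * X'' * X) p (n + (N + 1)))⁻¹ * (qPoch (X' / X) p (N + 1 - n))⁻¹ *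
    (qPoch (X'' / X) p (N + 1 - n))⁻¹ * (qPoch p p (N - n))⁻¹

/-- Factorials with argument divided by p^n are reversed. Their reversal powers cancel, three
against three, which leaves a fixed summand, a geometric power, and a factor that converges as N
grows. -/
lemma nodeTerm_eq {p τ X X' X'' : ℂ} {w : Fin 3 → ℂ} (hp0 : p ≠ 0) (hp : ‖p‖ < 1) (hτ : τ ≠ 0)
    (hX : X ≠ 0) (hX' : X' ≠ 0) (hX'' : X'' ≠ 0) (hw : ∀ l, w l ≠ 0)
    (h0 : qPochInf (τ * X * X) p ≠ 0) (h0' : qPochInf (τ * X' * X) p ≠ 0)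
    (h0'' : qPochInf (τ * X'' * X) p ≠ 0) {N n : ℕ} (hn : n ≤ N) :
    nodeTerm p τ X X' X'' w N n =
      X⁻¹ * (nodeFix p τ X X' X'' w n * (p ^ 2 / (τ ^ 3 * (X * X' * X'' * ∏ l, w l))) ^ n *
        nodeVar p τ X X' X'' w N n) := by
  have hpn := pow_ne_zero n hp0
  have num : ∀ l, qPoch (p / (τ * w l * (X * p ^ n))) p N = (p / (τ * w l * X)) ^ n * rev p n n *
      qPoch (τ * w l * X) p n * qPoch (p / (τ * w l * X)) p (N - n) := by
    intro l
    have := hw l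
    rw [show p / (τ * w l * (X * p ^ n)) = p / (τ * w l * X) / p ^ n by field_simp,
      ← qPoch_split_pow hp0 (by positivity) hn,
      show p / (p / (τ * w l * X)) = τ * w l * X by field_simp]
  have den : ∀ Z, Z ≠ 0 → qPoch (Z / (X * p ^ n)) p (N + 1) = (Z / X) ^ n * rev p n n *
      qPoch (p * X / Z) p n * qPoch (Z / X) p (N + 1 - n) := by
    intro Z hZ
    rw [show Z / (X * p ^ n) = Z / X / p ^ n by field_simp,
      ← qPoch_split_pow hp0 (by positivity) (by omega), show p / (Z / X) = p * X / Z by field_simp]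
  have own : qPoch (1 / p ^ n) p n = rev p n n * qPoch p p n := by
    rw [qPoch_div_pow_of_le hp0 one_ne_zero le_rfl]; simp
  have shift : ∀ Z, qPochInf (τ * Z * X) p ≠ 0 → (qPoch (τ * Z * (X * p ^ n)) p (N + 1))⁻¹ =
      qPoch (τ * Z * X) p n * (qPoch (τ * Z * X) p (n + (N + 1)))⁻¹ := by
    intro Z hZ
    have := qPoch_ne_zero_of_qPochInf_ne_zero hp hZ n
    rw [qPoch_add (τ * Z * X) p n, show τ * Z * (X * p ^ n) = τ * Z * X * p ^ n by ring]
    generalize qPoch (τ * Z * X * p ^ n) p (N + 1) = z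
    field_simp
  rw [nodeTerm, div_eq_mul_inv]
  simp only [mul_inv]
  rw [den X' hX', den X'' hX'', own, shift X h0, shift X' h0', shift X'' h0'']
  simp only [num, Fin.prod_univ_three, nodeFix, nodeVar]
  rw [show 1 - τ * (X * p ^ n) * (X * p ^ n) = 1 - τ * X * X * (p ^ n) ^ 2 by ring]
  simp only [show ∀ l, p * (X * p ^ n) / w l = p * X / w l * p ^ n by intro l; ring]
  have hR := rev_ne_zero hp0 n n
  have hw0 := hw 0
  have hw1 := hw 1
  have hw2 := hw 2
  have pw : (p / (τ * w 0 * X)) ^ n * (p / (τ * w 1 * X)) ^ n * (p / (τ * w 2 * X)) ^ n *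
      ((X' / X) ^ n)⁻¹ * ((X'' / X) ^ n)⁻¹ * (p ^ n)⁻¹ =
      (p ^ 2 / (τ ^ 3 * (X * X' * X'' * (w 0 * w 1 * w 2)))) ^ n := by
    rw [← inv_pow, ← inv_pow, ← inv_pow, ← mul_pow, ← mul_pow, ← mul_pow, ← mul_pow, ← mul_pow]
    congr 1
    field_simp
  have r3 : rev p n n * (rev p n n)⁻¹ = 1 := mul_inv_cancel₀ hR
  rw [← pw]
  simp only [mul_inv]
  clear num den own shift pw hw h0 h0' h0''
  generalize (p / (τ * w 0 * X)) ^ n = a1, (p / (τ * w 1 * X)) ^ n = a2,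
    (p / (τ * w 2 * X)) ^ n = a3, (X' / X) ^ n = a4, (X'' / X) ^ n = a5 at *
  generalize p / (τ * w 0 * X) = c1, p / (τ * w 1 * X) = c2, p / (τ * w 2 * X) = c3, rev p n n = R at *
  generalize qPoch (p * X / w 0 * p ^ n) p N = b1, qPoch (p * X / w 1 * p ^ n) p N = b2,
    qPoch (p * X / w 2 * p ^ n) p N = b3, qPoch (p * X / X') p n = b4,
    qPoch (p * X / X'') p n = b5, qPoch (X' / X) p (N + 1 - n) = b6,
    qPoch (X'' / X) p (N + 1 - n) = b7, 1 - τ * X * X * (p ^ n) ^ 2 = b8 at *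
  generalize qPoch (τ * X * X) p n = d1, qPoch (τ * X * X) p (n + (N + 1)) = d2,
    qPoch (τ * X' * X) p n = d3, qPoch (τ * X' * X) p (n + (N + 1)) = d4,
    qPoch (τ * X'' * X) p n = d5, qPoch (τ * X'' * X) p (n + (N + 1)) = d6,
    qPoch (τ * w 0 * X) p n = d7, qPoch (τ * w 1 * X) p n = d8, qPoch (τ * w 2 * X) p n = d9 at *
  generalize qPoch c1 p (N - n) = e1, qPoch c2 p (N - n) = e2, qPoch c3 p (N - n) = e3,
    qPoch p p (N - n) = e4, qPoch p p n = e5, p ^ n = P at *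
  have r9 : (R * R⁻¹) * (R * R⁻¹) * (R * R⁻¹) = 1 := by rw [r3]; ring
  linear_combination X⁻¹ * b1 * b2 * b3 * b4⁻¹ * b5⁻¹ * b6⁻¹ * b7⁻¹ * b8 * d1 * d2⁻¹ * d3 * d4⁻¹ *
    d5 * d6⁻¹ * d7 * d8 * d9 * e1 * e2 * e3 * e4⁻¹ * e5⁻¹ * P⁻¹ * a1 * a2 * a3 * a4⁻¹ * a5⁻¹ * r9

/-- The contribution of the nodes `X p ^ n` to the three-term relation. -/
lemma tendsto_sum_nodeTerm {p τ X X' X'' : ℂ} {w : Fin 3 → ℂ} (hp0 : p ≠ 0) (hp : ‖p‖ < 1)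
    (hτ : τ ≠ 0) (hX : X ≠ 0) (hX' : X' ≠ 0) (hX'' : X'' ≠ 0) (hw : ∀ l, w l ≠ 0)
    (h0 : qPochInf (τ * X * X) p ≠ 0) (h0' : qPochInf (τ * X' * X) p ≠ 0)
    (h0'' : qPochInf (τ * X'' * X) p ≠ 0) (g' : qPochInf (X' / X) p ≠ 0)
    (g'' : qPochInf (X'' / X) p ≠ 0) (k' : qPochInf (X / X') p ≠ 0) (k'' : qPochInf (X / X'') p ≠ 0)
    (ht : ‖p ^ 2 / (τ ^ 3 * (X * X' * X'' * ∏ l, w l))‖ < 1) :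
    Tendsto (fun N => ∑ n ∈ range (N + 1), nodeTerm p τ X X' X'' w N n) atTop
      (𝓝 (vwp p (τ * X * X) (τ * X' * X) (τ * X'' * X) (τ * w 0 * X) (τ * w 1 * X) (τ * w 2 * X)
          (p ^ 2 / (τ ^ 3 * (X * X' * X'' * ∏ l, w l))) *
        (qPochInf (p / (τ * w 0 * X)) p * qPochInf (p / (τ * w 1 * X)) p *
          qPochInf (p / (τ * w 2 * X)) p) /
        (X * (qPochInf (τ * X * X) p * qPochInf (τ * X' * X) p * qPochInf (τ * X'' * X) p) *
          (qPochInf (X' / X) p * qPochInf (p * X / X') p) *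
          (qPochInf (X'' / X) p * qPochInf (p * X / X'') p) * qPochInf p p))) := by
  have hpp : qPochInf p p ≠ 0 := qPochInf_ne_zero_of_norm_lt hp hp
  have K' : qPochInf (p * X / X') p ≠ 0 := by
    have := qPochInf_shift_ne_zero hp k' 1
    rwa [show X / X' * p ^ 1 = p * X / X' by ring] at this
  have K'' : qPochInf (p * X / X'') p ≠ 0 := by
    have := qPochInf_shift_ne_zero hp k'' 1
    rwa [show X / X'' * p ^ 1 = p * X / X'' by ring] at this
  obtain ⟨t, hteq⟩ : ∃ t, t = p ^ 2 / (τ ^ 3 * (X * X' * X'' * ∏ l, w l)) := ⟨_, rfl⟩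
  rw [← hteq] at ht ⊢
  -- bound of the fixed part
  have bfix : ∃ C, ∀ n, ‖nodeFix p τ X X' X'' w n‖ ≤ C := by
    obtain ⟨a1, h1, k1⟩ := BaileyGeneric.exists_norm_qPoch_le hp (τ * X * X)
    obtain ⟨a2, h2, k2⟩ := BaileyGeneric.exists_norm_qPoch_le hp (τ * X' * X)
    obtain ⟨a3, h3, k3⟩ := BaileyGeneric.exists_norm_qPoch_le hp (τ * X'' * X)
    obtain ⟨a4, h4, k4⟩ := BaileyGeneric.exists_norm_qPoch_le hp (τ * w 0 * X)
    obtain ⟨a5, h5, k5⟩ := BaileyGeneric.exists_norm_qPoch_le hp (τ * w 1 * X)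
    obtain ⟨a6, h6, k6⟩ := BaileyGeneric.exists_norm_qPoch_le hp (τ * w 2 * X)
    obtain ⟨b1, g1, l1⟩ := exists_norm_inv_qPoch_le hp hpp
    obtain ⟨b2, g2, l2⟩ := exists_norm_inv_qPoch_le hp K'
    obtain ⟨b3, g3, l3⟩ := exists_norm_inv_qPoch_le hp K''
    refine ⟨(1 + ‖τ * X * X‖) * a1 * b1 * (a2 * b2) * (a3 * b3) * (a4 * a5 * a6), fun n => ?_⟩
    have h0 : ‖1 - τ * X * X * (p ^ n) ^ 2‖ ≤ 1 + ‖τ * X * X‖ := by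
      rw [← pow_mul]
      refine (norm_sub_le _ _).trans ?_
      rw [norm_one]
      gcongr
      exact norm_mul_pow_le hp _ _
    rw [nodeFix, Fin.prod_univ_three, norm_mul, norm_mul, norm_mul, norm_mul, norm_mul, norm_mul,
      norm_mul, norm_mul, norm_mul]
    gcongr
    exacts [k1 n, l1 n, k2 n, l2 n, k3 n, l3 n, k4 n, k5 n, k6 n]
  obtain ⟨C, hC⟩ := bfix
  have bvar : ∃ C, ∀ N n, ‖nodeVar p τ X X' X'' w N n‖ ≤ C := by
    obtain ⟨a1, h1, k1⟩ := exists_norm_inv_qPoch_le hp h0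
    obtain ⟨a2, h2, k2⟩ := exists_norm_inv_qPoch_le hp h0'
    obtain ⟨a3, h3, k3⟩ := exists_norm_inv_qPoch_le hp h0''
    obtain ⟨a4, h4, k4⟩ := exists_norm_inv_qPoch_le hp g'
    obtain ⟨a5, h5, k5⟩ := exists_norm_inv_qPoch_le hp g''
    obtain ⟨a6, h6, k6⟩ := exists_norm_inv_qPoch_le hp hpp
    refine ⟨(∏ l, (Real.exp (‖p * X / w l‖ / (1 - ‖p‖)) *
      Real.exp (‖p / (τ * w l * X)‖ / (1 - ‖p‖)))) * a1 * a2 * a3 * a4 * a5 * a6, fun N n => ?_⟩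
    rw [nodeVar, norm_mul, norm_mul, norm_mul, norm_mul, norm_mul, norm_mul, norm_prod]
    gcongr with l
    · rw [norm_mul]
      gcongr
      · exact norm_qPoch_le hp (norm_mul_pow_le hp _ _) _
      · exact norm_qPoch_le hp le_rfl _
    exacts [k1 _, k2 _, k3 _, k4 _, k5 _, k6 _]
  obtain ⟨C', hC'⟩ := bvar
  have lim : ∀ n, Tendsto (fun N => nodeVar p τ X X' X'' w N n) atTop
      (𝓝 ((∏ l, (qPochInf (p * X / w l * p ^ n) p * qPochInf (p / (τ * w l * X)) p)) *
    (qPochInf (τ * X * X) p)⁻¹ * (qPochInf (τ * X' * X) p)⁻¹ *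
    (qPochInf (τ * X'' * X) p)⁻¹ * (qPochInf (X' / X) p)⁻¹ *
    (qPochInf (X'' / X) p)⁻¹ * (qPochInf p p)⁻¹)) := by
    intro n
    have s1 : Tendsto (fun N : ℕ => N - n) atTop atTop := tendsto_sub_atTop_nat n
    have s2 : Tendsto (fun N : ℕ => N + 1 - n) atTop atTop :=
      (tendsto_sub_atTop_nat n).comp (tendsto_add_atTop_nat 1)
    have s3 : Tendsto (fun N : ℕ => n + (N + 1)) atTop atTop :=
      tendsto_atTop_mono (fun N => (by simp only [id]; omega : id N ≤ n + (N + 1))) tendsto_id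
    refine (((((((tendsto_finsetProd _ fun l _ => ?_).mul ?_).mul ?_).mul ?_).mul ?_).mul ?_).mul ?_)
    · exact (tendsto_qPoch hp _).mul ((tendsto_qPoch hp _).comp s1)
    · exact ((tendsto_qPoch hp _).comp s3).inv₀ h0
    · exact ((tendsto_qPoch hp _).comp s3).inv₀ h0'
    · exact ((tendsto_qPoch hp _).comp s3).inv₀ h0''
    · exact ((tendsto_qPoch hp _).comp s2).inv₀ g'
    · exact ((tendsto_qPoch hp _).comp s2).inv₀ g''
    · exact ((tendsto_qPoch hp _).comp s1).inv₀ hpp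
  have main := tendsto_sum_of_dominated
    (f := fun N n => if n ≤ N then nodeTerm p τ X X' X'' w N n else 0)
    (C := ‖X⁻¹‖ * C * C') (norm_nonneg t) ht (fun N n hn => by
      rw [if_pos hn, nodeTerm_eq hp0 hp hτ hX hX' hX'' hw h0 h0' h0'' hn, ← hteq, norm_mul, norm_mul,
        norm_mul, norm_pow]
      calc _ ≤ ‖X⁻¹‖ * (C * ‖t‖ ^ n * C') := by
            have : 0 ≤ C := (norm_nonneg _).trans (hC 0)
            gcongr
            exacts [hC n, hC' N n]
        _ = _ := by ring)
    (fun n => (((lim n).const_mul (nodeFix p τ X X' X'' w n * t ^ n)).const_mul X⁻¹).congr' (by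
      filter_upwards [eventually_ge_atTop n] with N hN
      rw [if_pos hN, nodeTerm_eq hp0 hp hτ hX hX' hX'' hw h0 h0' h0'' hN, ← hteq]))
  refine (main.congr fun N => Finset.sum_congr rfl fun n hn => ?_).trans (le_of_eq ?_)
  · rw [if_pos (Nat.lt_succ_iff.mp (Finset.mem_range.mp hn))]
  · congr 1
    rw [vwp, mul_div_assoc, ← tsum_mul_right]
    refine tsum_congr fun n => ?_
    have key : ∀ {x : ℂ}, qPochInf x p ≠ 0 →
        (qPoch x p n)⁻¹ = qPochInf (x * p ^ n) p * (qPochInf x p)⁻¹ := fun {x} h => by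
      have := qPochInf_shift_ne_zero hp h n
      rw [qPochInf_eq_mul hp x n]
      field_simp
    rw [nodeFix, key K', key K'']
    have c1 : ∀ Z : ℂ, Z ≠ 0 → τ * X * X * p / (τ * Z * X) = p * X / Z := fun Z hZ => by field_simp
    rw [c1 _ hX', c1 _ hX'', c1 _ (hw 0), c1 _ (hw 1), c1 _ (hw 2)]
    simp only [Fin.prod_univ_three]
    simp only [div_eq_mul_inv, mul_inv]
    ring

/-- The three-term relation of nonterminating very-well-poised `₈φ₇` series. -/
theorem three_term {p τ : ℂ} (hp0 : p ≠ 0) (hp : ‖p‖ < 1) (hτ : τ ≠ 0) (x w : Fin 3 → ℂ)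
    (hx : ∀ k, x k ≠ 0) (hw : ∀ k, w k ≠ 0) (h1 : ∀ j k, qPochInf (τ * x j * x k) p ≠ 0)
    (h2 : ∀ j k, j ≠ k → qPochInf (x j / x k) p ≠ 0) {t : ℂ}
    (ht : t * (τ ^ 3 * (x 0 * x 1 * x 2 * (w 0 * w 1 * w 2))) = p ^ 2) (ht1 : ‖t‖ < 1) :
    ∑ k : Fin 3, vwp p (τ * x k * x k) (τ * x (k + 1) * x k) (τ * x (k + 2) * x k) (τ * w 0 * x k)
          (τ * w 1 * x k) (τ * w 2 * x k) t *
        (qPochInf (p / (τ * w 0 * x k)) p * qPochInf (p / (τ * w 1 * x k)) p *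
          qPochInf (p / (τ * w 2 * x k)) p) /
        (x k * (qPochInf (τ * x k * x k) p * qPochInf (τ * x (k + 1) * x k) p *
          qPochInf (τ * x (k + 2) * x k) p) *
          (qPochInf (x (k + 1) / x k) p * qPochInf (p * x k / x (k + 1)) p) *
          (qPochInf (x (k + 2) / x k) p * qPochInf (p * x k / x (k + 2)) p) * qPochInf p p) = 0 := by
  have hxw : τ ^ 3 * (x 0 * x 1 * x 2 * (w 0 * w 1 * w 2)) ≠ 0 := by
    simp [hτ, hx, hw]
  have e : ∀ k : Fin 3, p ^ 2 / (τ ^ 3 * (x k * x (k + 1) * x (k + 2) * ∏ l, w l)) = t := by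
    intro k
    rw [Fin.prod_univ_three, ← ht, mul_assoc (x k), ← prod_fin_three, Fin.prod_univ_three,
      mul_div_assoc, div_self hxw, mul_one]
  have n1 : ∀ k : Fin 3, k + 1 ≠ k := by decide
  have n2 : ∀ k : Fin 3, k + 2 ≠ k := by decide
  have key := tendsto_finsetSum univ fun (k : Fin 3) _ =>
    tendsto_sum_nodeTerm hp0 hp hτ (hx k) (hx (k + 1)) (hx (k + 2)) hw (h1 _ _) (h1 _ _) (h1 _ _)
      (h2 _ _ (n1 k)) (h2 _ _ (n2 k)) (h2 _ _ (n1 k).symm) (h2 _ _ (n2 k).symm)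
      (by rw [e k]; exact ht1)
  simp only [finite_three_term hp0 hp hτ x w hx hw h1 h2, e] at key
  exact (tendsto_nhds_unique key tendsto_const_nhds)

end AskeyWilson

end

noncomputable section
namespace AskeyWilson
open Filter Topology Finset

/-! ## The difference equation of a very-well-poised series -/

/-- The rational identity behind the difference equation. -/
lemma telescoping_identity {p u y τ β₁ β₂ β₃ β₄ : ℂ} (hu2 : 1 - u ^ 2 ≠ 0)
    (h1 : 1 - p * u * y ≠ 0) (h2 : u - p * y ≠ 0) (h3 : p * u - τ * y ≠ 0)
    (h4 : p - τ * u * y ≠ 0) (h5 : 1 - τ * y ^ 2 ≠ 0) :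
    -(τ * y * ((1 - p * u * β₁) * (1 - p * u * β₂) * (1 - p * u * β₃) * (1 - p * u * β₄))) /
        ((1 - u ^ 2) * (1 - p * u * y) * (p * u - τ * y)) +
      (τ * y * ((u - p * β₁) * (u - p * β₂) * (u - p * β₃) * (u - p * β₄))) /
        ((1 - u ^ 2) * (u - p * y) * (p - τ * u * y)) +
      p ^ 2 * τ * (β₁ * β₂ * β₃ * β₄) - 1 =
    p ^ 2 * τ * u * ((β₁ - y) * (β₂ - y) * (β₃ - y) * (β₄ - y)) /
        ((1 - τ * y ^ 2) * (1 - p * u * y) * (u - p * y)) -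
      p ^ 2 * u * ((1 - τ * y * β₁) * (1 - τ * y * β₂) * (1 - τ * y * β₃) * (1 - τ * y * β₄)) /
        ((1 - τ * y ^ 2) * (p - τ * u * y) * (p * u - τ * y)) := by
  -- The identity is symmetric in the β's. Working with their elementary symmetric functions keeps
  -- the final polynomial identity small.
  obtain ⟨f1, hf1⟩ : ∃ f, f = β₁ + β₂ + β₃ + β₄ := ⟨_, rfl⟩
  obtain ⟨f2, hf2⟩ : ∃ f, f = β₁ * β₂ + β₁ * β₃ + β₁ * β₄ + β₂ * β₃ + β₂ * β₄ + β₃ * β₄ := ⟨_, rfl⟩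
  obtain ⟨f3, hf3⟩ : ∃ f, f = β₁ * β₂ * β₃ + β₁ * β₂ * β₄ + β₁ * β₃ * β₄ + β₂ * β₃ * β₄ := ⟨_, rfl⟩
  obtain ⟨f4, hf4⟩ : ∃ f, f = β₁ * β₂ * β₃ * β₄ := ⟨_, rfl⟩
  have e1 : ∀ X, (1 - X * β₁) * (1 - X * β₂) * (1 - X * β₃) * (1 - X * β₄) =
      1 - f1 * X + f2 * X ^ 2 - f3 * X ^ 3 + f4 * X ^ 4 := by
    intro X; rw [hf1, hf2, hf3, hf4]; ring
  have e2 : (u - p * β₁) * (u - p * β₂) * (u - p * β₃) * (u - p * β₄) =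
      u ^ 4 - f1 * p * u ^ 3 + f2 * p ^ 2 * u ^ 2 - f3 * p ^ 3 * u + f4 * p ^ 4 := by
    rw [hf1, hf2, hf3, hf4]; ring
  have e3 : (β₁ - y) * (β₂ - y) * (β₃ - y) * (β₄ - y) =
      f4 - f3 * y + f2 * y ^ 2 - f1 * y ^ 3 + y ^ 4 := by
    rw [hf1, hf2, hf3, hf4]; ring
  rw [e1, e1, e2, e3, ← hf4]
  clear e1 e2 e3 hf1 hf2 hf3 hf4
  obtain ⟨D1, hD1⟩ : ∃ D, D = 1 - p * u * y := ⟨_, rfl⟩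
  obtain ⟨D2, hD2⟩ : ∃ D, D = u - p * y := ⟨_, rfl⟩
  obtain ⟨D3, hD3⟩ : ∃ D, D = p * u - τ * y := ⟨_, rfl⟩
  obtain ⟨D4, hD4⟩ : ∃ D, D = p - τ * u * y := ⟨_, rfl⟩
  obtain ⟨D5, hD5⟩ : ∃ D, D = 1 - τ * y ^ 2 := ⟨_, rfl⟩
  obtain ⟨D6, hD6⟩ : ∃ D, D = 1 - u ^ 2 := ⟨_, rfl⟩
  rw [← hD1] at h1 ⊢
  rw [← hD2] at h2 ⊢
  rw [← hD3] at h3 ⊢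
  rw [← hD4] at h4 ⊢
  rw [← hD5] at h5 ⊢
  rw [← hD6] at hu2 ⊢
  have key : ∀ n1 n2 n3 n4 n5 : ℂ, n1 * (D2 * D4 * D5) + n2 * (D1 * D3 * D5) +
      n5 * (D6 * D1 * D2 * D3 * D4 * D5) - n3 * (D6 * D3 * D4) + n4 * (D6 * D1 * D2) = 0 →
      n1 / (D6 * D1 * D3) + n2 / (D6 * D2 * D4) + n5 = n3 / (D5 * D1 * D2) - n4 / (D5 * D4 * D3) := by
    intro n1 n2 n3 n4 n5 h
    rw [← sub_eq_zero]
    have : n1 / (D6 * D1 * D3) + n2 / (D6 * D2 * D4) + n5 -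
        (n3 / (D5 * D1 * D2) - n4 / (D5 * D4 * D3)) = (n1 * (D2 * D4 * D5) + n2 * (D1 * D3 * D5) +
      n5 * (D6 * D1 * D2 * D3 * D4 * D5) - n3 * (D6 * D3 * D4) + n4 * (D6 * D1 * D2)) /
        (D6 * D1 * D2 * D3 * D4 * D5) := by
      field_simp
      ring
    rw [this, h, zero_div]
  rw [add_sub_assoc]
  apply key
  rw [hD1, hD2, hD3, hD4, hD5, hD6]
  ring

/-- The summand of the very-well-poised series with parameters `τ, α₀ u, …, α₃ u`. -/
def eqTerm (p τ t : ℂ) (α : Fin 4 → ℂ) (u : ℂ) (r : ℕ) : ℂ :=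
  t ^ r * (qPoch τ p r / qPoch p p r) * (1 - τ * u ^ 2 * (p ^ r) ^ 2) *
    (qPochInf (p * u ^ 2 * p ^ r) p / qPochInf (τ * u ^ 2 * p ^ r) p) *
    ∏ i, (qPoch (α i * u) p r * qPochInf (p * τ * u / α i * p ^ r) p)

lemma exists_norm_eqTerm_le {p τ : ℂ} (t : ℂ) (α : Fin 4 → ℂ) {u : ℂ} (hp : ‖p‖ < 1)
    (hu : qPochInf (τ * u ^ 2) p ≠ 0) : ∃ C, ∀ r, ‖eqTerm p τ t α u r‖ ≤ C * ‖t‖ ^ r := by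
  obtain ⟨a1, h1, k1⟩ := BaileyGeneric.exists_norm_qPoch_le hp τ
  obtain ⟨a2, h2, k2⟩ := exists_norm_inv_qPoch_le hp (qPochInf_ne_zero_of_norm_lt hp hp)
  have h3 : ∀ r, ‖1 - τ * u ^ 2 * (p ^ r) ^ 2‖ ≤ 1 + ‖τ * u ^ 2‖ := by
    intro r
    rw [← pow_mul]
    refine (norm_sub_le _ _).trans ?_
    rw [norm_one]
    gcongr
    exact norm_mul_pow_le hp _ _
  have h4 : ∀ x r, ‖qPochInf (x * p ^ r) p‖ ≤ Real.exp (‖x‖ / (1 - ‖p‖)) := fun x r =>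
    norm_qPochInf_le hp (norm_mul_pow_le hp _ _)
  obtain ⟨a5, h5, k5⟩ := BaileyGeneric.exists_norm_qPoch_le hp (τ * u ^ 2)
  have h6 : ∀ r, ‖(qPochInf (τ * u ^ 2 * p ^ r) p)⁻¹‖ ≤ a5 * ‖(qPochInf (τ * u ^ 2) p)⁻¹‖ := by
    intro r
    have e : (qPochInf (τ * u ^ 2 * p ^ r) p)⁻¹ =
        qPoch (τ * u ^ 2) p r * (qPochInf (τ * u ^ 2) p)⁻¹ := by
      have := qPoch_ne_zero_of_qPochInf_ne_zero hp hu r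
      rw [qPochInf_eq_mul hp (τ * u ^ 2) r]
      field_simp
    rw [e, norm_mul]
    gcongr
    exact k5 r
  refine ⟨a1 * a2 * (1 + ‖τ * u ^ 2‖) * (Real.exp (‖p * u ^ 2‖ / (1 - ‖p‖)) *
    (a5 * ‖(qPochInf (τ * u ^ 2) p)⁻¹‖)) * ∏ i, (Real.exp (‖α i * u‖ / (1 - ‖p‖)) *
      Real.exp (‖p * τ * u / α i‖ / (1 - ‖p‖))), fun r => ?_⟩
  rw [eqTerm, div_eq_mul_inv, div_eq_mul_inv, norm_mul, norm_mul, norm_mul, norm_mul, norm_mul,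
    norm_mul, norm_pow, norm_prod]
  calc _ ≤ ‖t‖ ^ r * (a1 * a2) * (1 + ‖τ * u ^ 2‖) * (Real.exp (‖p * u ^ 2‖ / (1 - ‖p‖)) *
    (a5 * ‖(qPochInf (τ * u ^ 2) p)⁻¹‖)) * ∏ i, (Real.exp (‖α i * u‖ / (1 - ‖p‖)) *
      Real.exp (‖p * τ * u / α i‖ / (1 - ‖p‖))) := by
        gcongr with i
        · exact k1 r
        · exact k2 r
        · exact h3 r
        · exact h4 _ r
        · exact h6 r
        · rw [norm_mul]
          gcongr
          · exact norm_qPoch_le hp le_rfl r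
          · exact h4 _ r
    _ = _ := by ring

lemma summable_eqTerm {p τ t : ℂ} (α : Fin 4 → ℂ) {u : ℂ} (hp : ‖p‖ < 1) (ht : ‖t‖ < 1)
    (hu : qPochInf (τ * u ^ 2) p ≠ 0) : Summable (eqTerm p τ t α u) := by
  obtain ⟨C, hC⟩ := exists_norm_eqTerm_le t α hp hu
  exact Summable.of_norm_bounded ((summable_geometric_of_lt_one (norm_nonneg _) ht).mul_left C) hC

section Telescoping

variable {p τ v δ : ℂ} {α : Fin 4 → ℂ} {u : ℂ}

/-- The summand of index r at pu is a rational multiple of the summand of index r + 1 at u. This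
index shift makes creative telescoping work. -/
lemma eqTerm_shift_up (hp0 : p ≠ 0) (hp : ‖p‖ < 1) (hv : v ≠ 0) (hδ : δ ≠ 0)
    (h1 : qPochInf (p * u ^ 2) p ≠ 0) (h2 : qPochInf (τ * u ^ 2) p ≠ 0)
    (h3 : qPochInf τ p ≠ 0) (r : ℕ) :
    v * (∏ i, ((1 - α i * u) * (1 - p * u / α i))) / ((1 - u ^ 2) * (1 - p * u ^ 2)) *
        eqTerm p τ (p * v / δ) α (p * u) r =
      δ / p * (∏ i, (1 - p * u / α i)) / ((1 - u ^ 2) * (1 - p * u ^ 2)) *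
        ((1 - p ^ (r + 1)) * (1 - τ * u ^ 2 * p ^ (r + 1)) /
          ((1 - τ * p ^ (r + 1) / p) * (1 - p * u ^ 2 * p ^ (r + 1)))) *
        eqTerm p τ (p * v / δ) α u (r + 1) := by
  have e1 := qPochInf_eq_one_sub_mul hp (p * u ^ 2 * p ^ (r + 1))
  have e2 := qPochInf_eq_one_sub_mul hp (τ * u ^ 2 * p ^ (r + 1))
  have n1 : 1 - p * u ^ 2 * p ^ (r + 1) ≠ 0 :=
    sub_ne_zero.mpr (mul_pow_ne_one_of_qPochInf_ne_zero hp h1 _).symm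
  have n2 : 1 - τ * u ^ 2 * p ^ (r + 1) ≠ 0 :=
    sub_ne_zero.mpr (mul_pow_ne_one_of_qPochInf_ne_zero hp h2 _).symm
  have n3 : 1 - τ * p ^ r ≠ 0 := sub_ne_zero.mpr (mul_pow_ne_one_of_qPochInf_ne_zero hp h3 _).symm
  have n4 : 1 - p * p ^ r ≠ 0 := sub_ne_zero.mpr
    (mul_pow_ne_one_of_qPochInf_ne_zero hp (qPochInf_ne_zero_of_norm_lt hp hp) _).symm
  have n5 := qPochInf_shift_ne_zero hp h2 (r + 2)
  have n6 := qPoch_ne_zero_of_qPochInf_ne_zero hp (qPochInf_ne_zero_of_norm_lt hp hp) r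
  rw [eqTerm, eqTerm, e1, e2, qPoch_succ, qPoch_succ,
    show τ * p ^ (r + 1) / p = τ * p ^ r by field_simp; ring,
    show p * (p * u) ^ 2 * p ^ r = p * u ^ 2 * p ^ (r + 1) * p by ring,
    show τ * (p * u) ^ 2 * p ^ r = τ * u ^ 2 * p ^ (r + 2) by ring,
    show τ * u ^ 2 * p ^ (r + 1) * p = τ * u ^ 2 * p ^ (r + 2) by ring,
    show τ * (p * u) ^ 2 * (p ^ r) ^ 2 = τ * u ^ 2 * (p ^ (r + 1)) ^ 2 by ring,
    Finset.prod_mul_distrib]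
  have e3 : ∏ i, (qPoch (α i * u) p (r + 1) * qPochInf (p * τ * u / α i * p ^ (r + 1)) p) =
      (∏ i, (1 - α i * u)) * ∏ i, (qPoch (α i * (p * u)) p r *
        qPochInf (p * τ * (p * u) / α i * p ^ r) p) := by
    rw [← Finset.prod_mul_distrib]
    refine Finset.prod_congr rfl fun i _ => ?_
    rw [qPoch_succ', show α i * u * p = α i * (p * u) by ring,
      show p * τ * u / α i * p ^ (r + 1) = p * τ * (p * u) / α i * p ^ r by ring, mul_assoc]
  rw [e3]
  generalize ∏ i, (qPoch (α i * (p * u)) p r * qPochInf (p * τ * (p * u) / α i * p ^ r) p) = x1,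
    ∏ i, (1 - α i * u) = x2, ∏ i, (1 - p * u / α i) = x3,
    qPochInf (τ * u ^ 2 * p ^ (r + 2)) p = x4, qPochInf (p * u ^ 2 * p ^ (r + 1) * p) p = x5 at *
  rw [pow_succ' p r] at n1 n2 ⊢
  generalize hz1 : 1 - p * u ^ 2 * (p * p ^ r) = z1 at *
  generalize hz2 : 1 - τ * u ^ 2 * (p * p ^ r) = z2 at *
  generalize hz3 : 1 - τ * p ^ r = z3 at *
  generalize hz4 : 1 - p * p ^ r = z4 at *
  generalize qPoch τ p r = y1, qPoch p p r = y2, 1 - τ * u ^ 2 * (p * p ^ r) ^ 2 = y3,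
    (1 - u ^ 2) * (1 - p * u ^ 2) = y4 at *
  rw [pow_succ]
  generalize hT : (p * v / δ) ^ r = T
  clear hz1 hz2 hz3 hz4 e1 e2 e3 h1 h2 h3
  field_simp

/-- The opposite shift: index r + 1 at u/p is matched with index r at u. -/
lemma eqTerm_shift_down (hp0 : p ≠ 0) (hp : ‖p‖ < 1) (hv : v ≠ 0) (hδ : δ ≠ 0)
    (h2 : qPochInf (τ * u ^ 2 / p ^ 2) p ≠ 0) (r : ℕ) :
    1 / (v * ((1 - u ^ 2) * (1 - u ^ 2 / p))) * eqTerm p τ (p * v / δ) α (u / p) (r + 1) =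
      p / δ * (∏ i, (1 - α i * u / p)) / ((1 - u ^ 2) * (1 - u ^ 2 / p)) *
        ((1 - u ^ 2 * p ^ r) * (1 - τ * p ^ r) /
          ((1 - τ * u ^ 2 * p ^ r / p) * (1 - p * p ^ r))) *
        eqTerm p τ (p * v / δ) α u r := by
  have e1 := qPochInf_eq_one_sub_mul hp (u ^ 2 * p ^ r)
  have e2 := qPochInf_eq_one_sub_mul hp (τ * u ^ 2 * p ^ r / p)
  have n2 : 1 - τ * u ^ 2 * p ^ r / p ≠ 0 := by
    have := mul_pow_ne_one_of_qPochInf_ne_zero hp h2 (r + 1)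
    rw [show τ * u ^ 2 / p ^ 2 * p ^ (r + 1) = τ * u ^ 2 * p ^ r / p by field_simp; ring] at this
    exact sub_ne_zero.mpr this.symm
  have n4 : 1 - p * p ^ r ≠ 0 := sub_ne_zero.mpr
    (mul_pow_ne_one_of_qPochInf_ne_zero hp (qPochInf_ne_zero_of_norm_lt hp hp) _).symm
  have n5 := qPochInf_shift_ne_zero hp h2 (r + 2)
  rw [show τ * u ^ 2 / p ^ 2 * p ^ (r + 2) = τ * u ^ 2 * p ^ r by field_simp; ring] at n5
  have n6 := qPoch_ne_zero_of_qPochInf_ne_zero hp (qPochInf_ne_zero_of_norm_lt hp hp) r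
  rw [eqTerm, eqTerm, qPoch_succ, qPoch_succ,
    show p * (u / p) ^ 2 * p ^ (r + 1) = u ^ 2 * p ^ r by field_simp; ring,
    show τ * (u / p) ^ 2 * p ^ (r + 1) = τ * u ^ 2 * p ^ r / p by field_simp; ring,
    show τ * (u / p) ^ 2 * (p ^ (r + 1)) ^ 2 = τ * u ^ 2 * (p ^ r) ^ 2 by field_simp; ring,
    e1, e2, show u ^ 2 * p ^ r * p = p * u ^ 2 * p ^ r by ring,
    show τ * u ^ 2 * p ^ r / p * p = τ * u ^ 2 * p ^ r by field_simp]
  have e3 : ∏ i, (qPoch (α i * (u / p)) p (r + 1) * qPochInf (p * τ * (u / p) / α i * p ^ (r + 1)) p) =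
      (∏ i, (1 - α i * u / p)) * ∏ i, (qPoch (α i * u) p r *
        qPochInf (p * τ * u / α i * p ^ r) p) := by
    rw [← Finset.prod_mul_distrib]
    refine Finset.prod_congr rfl fun i _ => ?_
    rw [qPoch_succ', show α i * (u / p) * p = α i * u by field_simp,
      show p * τ * (u / p) / α i * p ^ (r + 1) = p * τ * u / α i * p ^ r by
        rw [pow_succ]; field_simp, mul_assoc, mul_div_assoc (α i)]
  rw [e3]
  generalize ∏ i, (qPoch (α i * u) p r * qPochInf (p * τ * u / α i * p ^ r) p) = x1,
    ∏ i, (1 - α i * u / p) = x2,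
    qPochInf (τ * u ^ 2 * p ^ r) p = x4, qPochInf (p * u ^ 2 * p ^ r) p = x5 at *
  generalize hz1 : 1 - u ^ 2 * p ^ r = z1 at *
  generalize hz2 : 1 - τ * u ^ 2 * p ^ r / p = z2 at *
  generalize hz3 : 1 - τ * p ^ r = z3 at *
  generalize hz4 : 1 - p * p ^ r = z4 at *
  generalize qPoch τ p r = y1, qPoch p p r = y2, 1 - τ * u ^ 2 * (p ^ r) ^ 2 = y3,
    (1 - u ^ 2) * (1 - u ^ 2 / p) = y4 at *
  rw [pow_succ]
  generalize hT : (p * v / δ) ^ r = T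
  clear hz1 hz2 hz3 hz4 e1 e2 e3 h2
  field_simp

/-- The quotient of the antidifference and the summand. -/
def eqAnti (p τ v : ℂ) (α : Fin 4 → ℂ) (u : ℂ) (r : ℕ) : ℂ :=
  (1 - τ / p) / v * (∏ i, (1 - τ * u * p ^ r / α i)) /
    ((1 - τ * u ^ 2 * (p ^ r) ^ 2) * (1 - τ * u ^ 2 * p ^ r / p) * (1 - τ * p ^ r / p))

/-- Expresses the next antidifference through the summand of index r, so that telescoping reduces to
a rational identity. -/
lemma eqAnti_succ (hp0 : p ≠ 0) (hp : ‖p‖ < 1)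
    (h2 : qPochInf (τ * u ^ 2) p ≠ 0) (h3 : qPochInf τ p ≠ 0) (r : ℕ) (t : ℂ)
    (h1 : qPochInf (p * u ^ 2) p ≠ 0) :
    eqAnti p τ v α u (r + 1) * eqTerm p τ t α u (r + 1) =
      (1 - τ / p) / v * t * (∏ i, (1 - α i * u * p ^ r)) /
        ((1 - τ * u ^ 2 * (p ^ r) ^ 2) * (1 - p * u ^ 2 * p ^ r) * (1 - p * p ^ r)) *
        eqTerm p τ t α u r := by
  have e1 := qPochInf_eq_one_sub_mul hp (p * u ^ 2 * p ^ r)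
  have e2 := qPochInf_eq_one_sub_mul hp (τ * u ^ 2 * p ^ r)
  have n1 : 1 - p * u ^ 2 * p ^ r ≠ 0 :=
    sub_ne_zero.mpr (mul_pow_ne_one_of_qPochInf_ne_zero hp h1 _).symm
  have n2 : 1 - τ * u ^ 2 * p ^ r ≠ 0 :=
    sub_ne_zero.mpr (mul_pow_ne_one_of_qPochInf_ne_zero hp h2 _).symm
  have n3 : 1 - τ * p ^ r ≠ 0 := sub_ne_zero.mpr (mul_pow_ne_one_of_qPochInf_ne_zero hp h3 _).symm
  have n4 : 1 - p * p ^ r ≠ 0 := sub_ne_zero.mpr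
    (mul_pow_ne_one_of_qPochInf_ne_zero hp (qPochInf_ne_zero_of_norm_lt hp hp) _).symm
  have n5 := qPochInf_shift_ne_zero hp h2 (r + 1)
  have n6 := qPoch_ne_zero_of_qPochInf_ne_zero hp (qPochInf_ne_zero_of_norm_lt hp hp) r
  have n7 : 1 - τ * u ^ 2 * (p ^ (r + 1)) ^ 2 ≠ 0 := by
    have := mul_pow_ne_one_of_qPochInf_ne_zero hp h2 ((r + 1) * 2)
    rw [pow_mul] at this
    exact sub_ne_zero.mpr this.symm
  have n8 : 1 - τ * u ^ 2 * (p ^ r) ^ 2 ≠ 0 := by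
    have := mul_pow_ne_one_of_qPochInf_ne_zero hp h2 (r * 2)
    rw [pow_mul] at this
    exact sub_ne_zero.mpr this.symm
  rw [eqTerm, eqTerm, eqAnti, e1, e2, qPoch_succ, qPoch_succ,
    show τ * p ^ (r + 1) / p = τ * p ^ r by field_simp; ring,
    show τ * u ^ 2 * p ^ (r + 1) / p = τ * u ^ 2 * p ^ r by field_simp; ring,
    show p * u ^ 2 * p ^ r * p = p * u ^ 2 * p ^ (r + 1) by ring,
    show τ * u ^ 2 * p ^ r * p = τ * u ^ 2 * p ^ (r + 1) by ring]
  have e3 : (∏ i, (1 - τ * u * p ^ (r + 1) / α i)) *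
      ∏ i, (qPoch (α i * u) p (r + 1) * qPochInf (p * τ * u / α i * p ^ (r + 1)) p) =
      (∏ i, (1 - α i * u * p ^ r)) * ∏ i, (qPoch (α i * u) p r *
        qPochInf (p * τ * u / α i * p ^ r) p) := by
    rw [← Finset.prod_mul_distrib, ← Finset.prod_mul_distrib]
    refine Finset.prod_congr rfl fun i _ => ?_
    rw [qPoch_succ, qPochInf_eq_one_sub_mul hp (p * τ * u / α i * p ^ r),
      show p * τ * u / α i * p ^ r * p = p * τ * u / α i * p ^ (r + 1) by ring,
      show p * τ * u / α i * p ^ r = τ * u * p ^ (r + 1) / α i by ring]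
    ring
  generalize ∏ i, (qPoch (α i * u) p r * qPochInf (p * τ * u / α i * p ^ r) p) = x1,
    ∏ i, (1 - τ * u * p ^ (r + 1) / α i) = x2, ∏ i, (1 - α i * u * p ^ r) = x3,
    ∏ i, (qPoch (α i * u) p (r + 1) * qPochInf (p * τ * u / α i * p ^ (r + 1)) p) = x6,
    qPochInf (τ * u ^ 2 * p ^ (r + 1)) p = x4, qPochInf (p * u ^ 2 * p ^ (r + 1)) p = x5 at *
  generalize 1 - p * u ^ 2 * p ^ r = z1, 1 - τ * u ^ 2 * p ^ r = z2, 1 - τ * p ^ r = z3,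
    1 - p * p ^ r = z4, 1 - τ * u ^ 2 * (p ^ (r + 1)) ^ 2 = z5,
    1 - τ * u ^ 2 * (p ^ r) ^ 2 = z6, qPoch τ p r = y1, qPoch p p r = y2 at *
  rw [pow_succ]
  generalize t ^ r = T, (1 - τ / p) / v = C
  clear h1 h2 h3 e1 e2
  field_simp
  linear_combination C * T * t * y1 * x5 * e3

/-- The difference equation divided by the summand of index r. The hypothesis on Λ is its limit as
p^r tends to 0; what remains is (1 - τ/p)/v times `telescoping_identity`. -/
lemma eqAnti_sub (hp0 : p ≠ 0) (hp : ‖p‖ < 1) (hv : v ≠ 0) (hδ : δ ≠ 0) (hu : u ≠ 0)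
    (hα : ∀ i, α i ≠ 0) (hαδ : ∏ i, α i = p * δ ^ 2) (hτ : τ = δ * v)
    (h1 : qPochInf (u ^ 2) p ≠ 0) (h2 : qPochInf (τ * u ^ 2 / p ^ 2) p ≠ 0)
    (h3 : qPochInf (τ / p) p ≠ 0) {Λ : ℂ}
    (hΛ : δ / p * (∏ i, (1 - p * u / α i)) / ((1 - u ^ 2) * (1 - p * u ^ 2)) +
      p / δ * (∏ i, (1 - α i * u / p)) / ((1 - u ^ 2) * (1 - u ^ 2 / p)) - Λ =
      (1 - τ / p) / v * (p * v / δ - 1)) (hp2 : 1 - u ^ 2 / p ≠ 0) (r : ℕ) :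
    δ / p * (∏ i, (1 - p * u / α i)) / ((1 - u ^ 2) * (1 - p * u ^ 2)) *
        ((1 - p ^ r) * (1 - τ * u ^ 2 * p ^ r) /
          ((1 - τ * p ^ r / p) * (1 - p * u ^ 2 * p ^ r))) +
      p / δ * (∏ i, (1 - α i * u / p)) / ((1 - u ^ 2) * (1 - u ^ 2 / p)) *
        ((1 - u ^ 2 * p ^ r) * (1 - τ * p ^ r) /
          ((1 - τ * u ^ 2 * p ^ r / p) * (1 - p * p ^ r))) - Λ =
      (1 - τ / p) / v * (p * v / δ) * (∏ i, (1 - α i * u * p ^ r)) /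
        ((1 - τ * u ^ 2 * (p ^ r) ^ 2) * (1 - p * u ^ 2 * p ^ r) * (1 - p * p ^ r)) -
      eqAnti p τ v α u r := by
  have nz : ∀ {x : ℂ}, qPochInf x p ≠ 0 → ∀ i : ℕ, 1 - x * p ^ i ≠ 0 :=
    fun h i => sub_ne_zero.mpr (mul_pow_ne_one_of_qPochInf_ne_zero hp h i).symm
  have m1 : 1 - u ^ 2 ≠ 0 := by simpa using nz h1 0
  have m2 : 1 - p * u ^ 2 ≠ 0 := by simpa [mul_comm] using nz h1 1
  have m3 : 1 - p * u ^ 2 * p ^ r ≠ 0 := by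
    have := nz h1 (r + 1)
    rwa [show u ^ 2 * p ^ (r + 1) = p * u ^ 2 * p ^ r by ring] at this
  have m4 : 1 - p * p ^ r ≠ 0 := nz (qPochInf_ne_zero_of_norm_lt hp hp) r
  have m5 : 1 - τ * p ^ r / p ≠ 0 := by
    have := nz h3 r
    rwa [show τ / p * p ^ r = τ * p ^ r / p by ring] at this
  have m6 : 1 - τ * u ^ 2 * p ^ r / p ≠ 0 := by
    have := nz h2 (r + 1)
    rwa [show τ * u ^ 2 / p ^ 2 * p ^ (r + 1) = τ * u ^ 2 * p ^ r / p by field_simp; ring] at this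
  have m7 : 1 - τ * u ^ 2 * (p ^ r) ^ 2 ≠ 0 := by
    have := nz h2 (2 + r * 2)
    rwa [show τ * u ^ 2 / p ^ 2 * p ^ (2 + r * 2) = τ * u ^ 2 * (p ^ r) ^ 2 by
      field_simp; ring] at this
  -- The identity is used at y = u p^r, with the β's equal to the inverses of the α's.
  have key := telescoping_identity (p := p) (u := u) (y := u * p ^ r) (τ := τ) (β₁ := (α 0)⁻¹)
    (β₂ := (α 1)⁻¹) (β₃ := (α 2)⁻¹) (β₄ := (α 3)⁻¹) m1
    (by convert m3 using 1; ring) (by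
      rw [show u - p * (u * p ^ r) = u * (1 - p * p ^ r) by ring]; exact mul_ne_zero hu m4)
    (by
      rw [show p * u - τ * (u * p ^ r) = p * u * (1 - τ * p ^ r / p) by field_simp]
      exact mul_ne_zero (mul_ne_zero hp0 hu) m5)
    (by
      rw [show p - τ * u * (u * p ^ r) = p * (1 - τ * u ^ 2 * p ^ r / p) by field_simp]
      exact mul_ne_zero hp0 m6)
    (by convert m7 using 1; ring)
  rw [eqAnti]
  simp only [Fin.prod_univ_four] at hΛ hαδ ⊢
  have a0 := hα 0
  have a1 := hα 1
  have a2 := hα 2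
  have a3 := hα 3
  rw [show 1 - p * u * (u * p ^ r) = 1 - p * u ^ 2 * p ^ r by ring,
    show u - p * (u * p ^ r) = u * (1 - p * p ^ r) by ring,
    show p * u - τ * (u * p ^ r) = p * u * (1 - τ * p ^ r / p) by field_simp,
    show p - τ * u * (u * p ^ r) = p * (1 - τ * u ^ 2 * p ^ r / p) by field_simp,
    show 1 - τ * (u * p ^ r) ^ 2 = 1 - τ * u ^ 2 * (p ^ r) ^ 2 by ring] at key
  -- The index-dependent quotient is written as 1 plus a remainder divisible by 1 - τ/p. The 1
  -- belongs to the hypothesis on Λ and the remainder to the rational identity; `B2` does the same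
  -- for the downward shift.
  have B1 : δ / p * ((1 - p * u / α 0) * (1 - p * u / α 1) * (1 - p * u / α 2) * (1 - p * u / α 3)) /
      ((1 - u ^ 2) * (1 - p * u ^ 2)) * ((1 - p ^ r) * (1 - τ * u ^ 2 * p ^ r) /
          ((1 - τ * p ^ r / p) * (1 - p * u ^ 2 * p ^ r))) =
      δ / p * ((1 - p * u / α 0) * (1 - p * u / α 1) * (1 - p * u / α 2) * (1 - p * u / α 3)) /
      ((1 - u ^ 2) * (1 - p * u ^ 2)) + (1 - τ / p) / v *
      (-(τ * (u * p ^ r) * ((1 - p * u * (α 0)⁻¹) * (1 - p * u * (α 1)⁻¹) * (1 - p * u * (α 2)⁻¹) *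
        (1 - p * u * (α 3)⁻¹))) /
        ((1 - u ^ 2) * (1 - p * u ^ 2 * p ^ r) * (p * u * (1 - τ * p ^ r / p)))) := by
    simp only [div_eq_mul_inv (p * u)]
    generalize (1 - p * u * (α 0)⁻¹) * (1 - p * u * (α 1)⁻¹) * (1 - p * u * (α 2)⁻¹) *
        (1 - p * u * (α 3)⁻¹) = Q
    have e : (1 - p ^ r) * (1 - τ * u ^ 2 * p ^ r) = (1 - τ * p ^ r / p) * (1 - p * u ^ 2 * p ^ r) -
        p ^ r * (1 - τ / p) * (1 - p * u ^ 2) := by field_simp; ring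
    rw [e, hτ]
    rw [hτ] at m5
    generalize 1 - δ * v * p ^ r / p = D1, 1 - p * u ^ 2 * p ^ r = D2, 1 - u ^ 2 = D3,
      1 - p * u ^ 2 = D4, 1 - δ * v / p = D5 at *
    field_simp
    ring
  have B2 : p / δ * ((1 - α 0 * u / p) * (1 - α 1 * u / p) * (1 - α 2 * u / p) * (1 - α 3 * u / p)) /
      ((1 - u ^ 2) * (1 - u ^ 2 / p)) * ((1 - u ^ 2 * p ^ r) * (1 - τ * p ^ r) /
          ((1 - τ * u ^ 2 * p ^ r / p) * (1 - p * p ^ r))) =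
      p / δ * ((1 - α 0 * u / p) * (1 - α 1 * u / p) * (1 - α 2 * u / p) * (1 - α 3 * u / p)) /
      ((1 - u ^ 2) * (1 - u ^ 2 / p)) + (1 - τ / p) / v *
      (τ * (u * p ^ r) * ((u - p * (α 0)⁻¹) * (u - p * (α 1)⁻¹) * (u - p * (α 2)⁻¹) *
        (u - p * (α 3)⁻¹)) /
        ((1 - u ^ 2) * (u * (1 - p * p ^ r)) * (p * (1 - τ * u ^ 2 * p ^ r / p)))) := by
    have e : (1 - u ^ 2 * p ^ r) * (1 - τ * p ^ r) =
        (1 - τ * u ^ 2 * p ^ r / p) * (1 - p * p ^ r) +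
        p * p ^ r * (1 - τ / p) * (1 - u ^ 2 / p) := by field_simp; ring
    have e' : (1 - α 0 * u / p) * (1 - α 1 * u / p) * (1 - α 2 * u / p) * (1 - α 3 * u / p) =
        δ ^ 2 / p ^ 3 * ((u - p * (α 0)⁻¹) * (u - p * (α 1)⁻¹) * (u - p * (α 2)⁻¹) *
        (u - p * (α 3)⁻¹)) := by
      rw [show δ ^ 2 / p ^ 3 = α 0 * α 1 * α 2 * α 3 / p ^ 4 by rw [hαδ]; field_simp]
      field_simp
      ring
    rw [e, e', hτ]
    rw [hτ] at m6
    generalize 1 - δ * v * u ^ 2 * p ^ r / p = D1, 1 - p * p ^ r = D2, 1 - u ^ 2 = D3,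
      1 - u ^ 2 / p = D4, 1 - δ * v / p = D5, (u - p * (α 0)⁻¹) * (u - p * (α 1)⁻¹) *
        (u - p * (α 2)⁻¹) * (u - p * (α 3)⁻¹) = Q at *
    field_simp
  have B3 : p * v / δ = p ^ 2 * τ * ((α 0)⁻¹ * (α 1)⁻¹ * (α 2)⁻¹ * (α 3)⁻¹) := by
    rw [← mul_inv, ← mul_inv, ← mul_inv, hαδ, hτ]; field_simp
  have R1 : (1 - τ / p) / v * (p * v / δ) * ((1 - α 0 * u * p ^ r) * (1 - α 1 * u * p ^ r) *
      (1 - α 2 * u * p ^ r) * (1 - α 3 * u * p ^ r)) /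
        ((1 - τ * u ^ 2 * (p ^ r) ^ 2) * (1 - p * u ^ 2 * p ^ r) * (1 - p * p ^ r)) =
      (1 - τ / p) / v * (p ^ 2 * τ * u * (((α 0)⁻¹ - u * p ^ r) * ((α 1)⁻¹ - u * p ^ r) *
        ((α 2)⁻¹ - u * p ^ r) * ((α 3)⁻¹ - u * p ^ r)) /
        ((1 - τ * u ^ 2 * (p ^ r) ^ 2) * (1 - p * u ^ 2 * p ^ r) * (u * (1 - p * p ^ r)))) := by
    rw [B3]
    generalize 1 - τ * u ^ 2 * (p ^ r) ^ 2 = D1, 1 - p * u ^ 2 * p ^ r = D2, 1 - p * p ^ r = D3,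
      (1 - τ / p) / v = D4 at *
    field_simp
  have R2 : (1 - τ / p) / v * ((1 - τ * u * p ^ r / α 0) * (1 - τ * u * p ^ r / α 1) *
      (1 - τ * u * p ^ r / α 2) * (1 - τ * u * p ^ r / α 3)) /
      ((1 - τ * u ^ 2 * (p ^ r) ^ 2) * (1 - τ * u ^ 2 * p ^ r / p) * (1 - τ * p ^ r / p)) =
      (1 - τ / p) / v * (p ^ 2 * u * ((1 - τ * (u * p ^ r) * (α 0)⁻¹) *
        (1 - τ * (u * p ^ r) * (α 1)⁻¹) * (1 - τ * (u * p ^ r) * (α 2)⁻¹) *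
        (1 - τ * (u * p ^ r) * (α 3)⁻¹)) / ((1 - τ * u ^ 2 * (p ^ r) ^ 2) *
        (p * (1 - τ * u ^ 2 * p ^ r / p)) * (p * u * (1 - τ * p ^ r / p)))) := by
    simp only [div_eq_mul_inv (τ * u * p ^ r), show τ * (u * p ^ r) = τ * u * p ^ r by ring]
    generalize 1 - τ * u ^ 2 * (p ^ r) ^ 2 = D1, 1 - τ * u ^ 2 * p ^ r / p = D2,
      1 - τ * p ^ r / p = D3, (1 - τ / p) / v = D4, (1 - τ * u * p ^ r * (α 0)⁻¹) *
        (1 - τ * u * p ^ r * (α 1)⁻¹) * (1 - τ * u * p ^ r * (α 2)⁻¹) *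
        (1 - τ * u * p ^ r * (α 3)⁻¹) = Q at *
    field_simp
  rw [B1, B2, R1, R2]
  rw [B3] at hΛ
  linear_combination hΛ + (1 - τ / p) / v * key

lemma tendsto_eqAnti (hp : ‖p‖ < 1) :
    Tendsto (eqAnti p τ v α u) atTop (𝓝 ((1 - τ / p) / v)) := by
  have h : Tendsto (fun r : ℕ => p ^ r) atTop (𝓝 0) :=
    tendsto_pow_atTop_nhds_zero_of_norm_lt_one hp
  have hc : ContinuousAt (fun X : ℂ => (1 - τ / p) / v * (∏ i, (1 - τ * u * X / α i)) /
    ((1 - τ * u ^ 2 * X ^ 2) * (1 - τ * u ^ 2 * X / p) * (1 - τ * X / p))) 0 := by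
    refine ContinuousAt.div (by fun_prop) (by fun_prop) (by simp)
  have := hc.tendsto.comp h
  change Tendsto (fun r => eqAnti p τ v α u r) atTop (𝓝 ((1 - τ / p) / v))
  simpa [Function.comp_def, eqAnti] using this

/-- The difference equation of the very-well-poised series. -/
theorem tsum_eqTerm_difference (hp0 : p ≠ 0) (hp : ‖p‖ < 1) (hv : v ≠ 0) (hδ : δ ≠ 0) (hu : u ≠ 0)
    (hα : ∀ i, α i ≠ 0) (hαδ : ∏ i, α i = p * δ ^ 2) (hτ : τ = δ * v) (ht : ‖p * v / δ‖ < 1)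
    (h1 : qPochInf (u ^ 2) p ≠ 0) (h2 : qPochInf (τ * u ^ 2 / p ^ 2) p ≠ 0)
    (h3 : qPochInf (τ / p) p ≠ 0) {Λ : ℂ}
    (hΛ : δ / p * (∏ i, (1 - p * u / α i)) / ((1 - u ^ 2) * (1 - p * u ^ 2)) +
      p / δ * (∏ i, (1 - α i * u / p)) / ((1 - u ^ 2) * (1 - u ^ 2 / p)) - Λ =
      (1 - τ / p) / v * (p * v / δ - 1)) (hp2 : 1 - u ^ 2 / p ≠ 0) :
    v * (∏ i, ((1 - α i * u) * (1 - p * u / α i))) / ((1 - u ^ 2) * (1 - p * u ^ 2)) *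
        ∑' r, eqTerm p τ (p * v / δ) α (p * u) r +
      1 / (v * ((1 - u ^ 2) * (1 - u ^ 2 / p))) * ∑' r, eqTerm p τ (p * v / δ) α (u / p) r =
      Λ * ∑' r, eqTerm p τ (p * v / δ) α u r := by
  have k1 : qPochInf (p * u ^ 2) p ≠ 0 := by
    simpa [mul_comm] using qPochInf_shift_ne_zero hp h1 1
  have k2 : qPochInf (τ * u ^ 2) p ≠ 0 := by
    have := qPochInf_shift_ne_zero hp h2 2
    rwa [show τ * u ^ 2 / p ^ 2 * p ^ 2 = τ * u ^ 2 by field_simp] at this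
  have k3 : qPochInf (τ * (p * u) ^ 2) p ≠ 0 := by
    have := qPochInf_shift_ne_zero hp k2 2
    rwa [show τ * u ^ 2 * p ^ 2 = τ * (p * u) ^ 2 by ring] at this
  have k4 : qPochInf (τ * (u / p) ^ 2) p ≠ 0 := by rwa [div_pow, ← mul_div_assoc]
  have k5 : qPochInf τ p ≠ 0 := by
    have := qPochInf_shift_ne_zero hp h3 1
    rwa [pow_one, div_mul_cancel₀ _ hp0] at this
  obtain ⟨t, hteq⟩ : ∃ t, t = p * v / δ := ⟨_, rfl⟩
  have s1 := (summable_eqTerm α hp ht k3).hasSum.tendsto_sum_nat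
  have s2 := (summable_eqTerm α hp ht k4).hasSum.tendsto_sum_nat
  have s3 := summable_eqTerm α hp ht k2
  have s4 := (tendsto_eqAnti (τ := τ) (v := v) (α := α) (u := u) hp).mul s3.tendsto_atTop_zero
  have s5 := s3.hasSum.tendsto_sum_nat
  rw [mul_zero] at s4
  obtain ⟨c, hc⟩ : ∃ c, c = v * (∏ i, ((1 - α i * u) * (1 - p * u / α i))) /
    ((1 - u ^ 2) * (1 - p * u ^ 2)) := ⟨_, rfl⟩
  obtain ⟨c', hc'⟩ : ∃ c, c = 1 / (v * ((1 - u ^ 2) * (1 - u ^ 2 / p))) := ⟨_, rfl⟩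
  -- The summand of index 0 at u/p has no partner under the downward shift; it is exactly the lower
  -- boundary term of the telescoping sum.
  have e0 : c' * eqTerm p τ (p * v / δ) α (u / p) 0 =
      eqAnti p τ v α u 0 * eqTerm p τ (p * v / δ) α u 0 := by
    have m1 : 1 - u ^ 2 ≠ 0 := by
      simpa using sub_ne_zero.mpr (mul_pow_ne_one_of_qPochInf_ne_zero hp h1 0).symm
    have m2 : 1 - τ * u ^ 2 / p ≠ 0 := by
      have := sub_ne_zero.mpr (mul_pow_ne_one_of_qPochInf_ne_zero hp h2 1).symm
      rwa [show τ * u ^ 2 / p ^ 2 * p ^ 1 = τ * u ^ 2 / p by field_simp] at this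
    have m3 : 1 - τ / p ≠ 0 := by
      simpa using sub_ne_zero.mpr (mul_pow_ne_one_of_qPochInf_ne_zero hp h3 0).symm
    have m4 : 1 - τ * u ^ 2 / p ^ 2 ≠ 0 := by
      simpa using sub_ne_zero.mpr (mul_pow_ne_one_of_qPochInf_ne_zero hp h2 0).symm
    have m5 : 1 - τ * u ^ 2 ≠ 0 := by
      simpa using sub_ne_zero.mpr (mul_pow_ne_one_of_qPochInf_ne_zero hp k2 0).symm
    have e3 : ∏ i, (qPoch (α i * (u / p)) p 0 * qPochInf (p * τ * (u / p) / α i * p ^ 0) p) =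
        (∏ i, (1 - τ * u * p ^ 0 / α i)) *
          ∏ i, (qPoch (α i * u) p 0 * qPochInf (p * τ * u / α i * p ^ 0) p) := by
      rw [← Finset.prod_mul_distrib]
      refine Finset.prod_congr rfl fun i _ => ?_
      rw [show p * τ * (u / p) / α i * p ^ 0 = τ * u / α i by field_simp,
        qPochInf_eq_one_sub_mul hp (τ * u / α i),
        show p * τ * u / α i * p ^ 0 = τ * u / α i * p by ring]
      simp [qPoch]
    rw [hc', eqTerm, eqTerm, eqAnti, e3,
      show p * (u / p) ^ 2 * p ^ 0 = u ^ 2 / p by field_simp,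
      qPochInf_eq_one_sub_mul hp (u ^ 2 / p), div_mul_cancel₀ _ hp0,
      qPochInf_eq_one_sub_mul hp (u ^ 2),
      show τ * (u / p) ^ 2 * p ^ 0 = τ * u ^ 2 / p ^ 2 by rw [pow_zero, mul_one]; ring,
      qPochInf_eq_one_sub_mul hp (τ * u ^ 2 / p ^ 2),
      show τ * u ^ 2 / p ^ 2 * p = τ * u ^ 2 / p by field_simp,
      qPochInf_eq_one_sub_mul hp (τ * u ^ 2 / p), div_mul_cancel₀ _ hp0,
      show τ * (u / p) ^ 2 * (p ^ 0) ^ 2 = τ * u ^ 2 / p ^ 2 by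
        rw [pow_zero, one_pow, mul_one]; ring]
    simp only [pow_zero, one_pow, mul_one]
    rw [show u ^ 2 * p = p * u ^ 2 by ring]
    generalize ∏ i, (1 - τ * u / α i) = x1,
      ∏ i, (qPoch (α i * u) p 0 * qPochInf (p * τ * u / α i) p) = x2, qPochInf (p * u ^ 2) p = x3,
      qPochInf (τ * u ^ 2) p = x4, 1 - τ * u ^ 2 / p ^ 2 = x5, 1 - τ * u ^ 2 / p = x6,
      1 - τ * u ^ 2 = x7, 1 - u ^ 2 = x8, 1 - u ^ 2 / p = x9, 1 - τ / p = x10,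
      qPoch τ p 0 / qPoch p p 0 = x11 at *
    clear e3 hc hc' hΛ
    field_simp
  -- The three partial sums have lengths N, N + 2 and N + 1 because the shifts in u move the index
  -- by one in opposite directions. The remaining boundary term tends to 0.
  have fin : ∀ N : ℕ, c * ∑ r ∈ range N, eqTerm p τ (p * v / δ) α (p * u) r +
      c' * ∑ r ∈ range (N + 2), eqTerm p τ (p * v / δ) α (u / p) r =
      Λ * ∑ r ∈ range (N + 1), eqTerm p τ (p * v / δ) α u r +
        eqAnti p τ v α u (N + 1) * eqTerm p τ (p * v / δ) α u (N + 1) := by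
    intro N
    have step : ∀ r, c' * eqTerm p τ (p * v / δ) α (u / p) (r + 1) +
        δ / p * (∏ i, (1 - p * u / α i)) / ((1 - u ^ 2) * (1 - p * u ^ 2)) *
        ((1 - p ^ r) * (1 - τ * u ^ 2 * p ^ r) /
          ((1 - τ * p ^ r / p) * (1 - p * u ^ 2 * p ^ r))) * eqTerm p τ (p * v / δ) α u r =
        Λ * eqTerm p τ (p * v / δ) α u r +
          (eqAnti p τ v α u (r + 1) * eqTerm p τ (p * v / δ) α u (r + 1) -
          eqAnti p τ v α u r * eqTerm p τ (p * v / δ) α u r) := by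
      intro r
      have q1 := eqTerm_shift_down (α := α) hp0 hp hv hδ h2 r
      have q2 := eqAnti_succ (v := v) (α := α) hp0 hp k2 k5 r (p * v / δ) k1
      have q3 := eqAnti_sub (α := α) hp0 hp hv hδ hu hα hαδ hτ h1 h2 h3 hΛ hp2 r
      rw [hc', q1, q2]
      linear_combination eqTerm p τ (p * v / δ) α u r * q3
    have up : ∀ r, c * eqTerm p τ (p * v / δ) α (p * u) r =
        δ / p * (∏ i, (1 - p * u / α i)) / ((1 - u ^ 2) * (1 - p * u ^ 2)) *
        ((1 - p ^ (r + 1)) * (1 - τ * u ^ 2 * p ^ (r + 1)) /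
          ((1 - τ * p ^ (r + 1) / p) * (1 - p * u ^ 2 * p ^ (r + 1)))) *
        eqTerm p τ (p * v / δ) α u (r + 1) := fun r => by
      rw [hc, eqTerm_shift_up (α := α) hp0 hp hv hδ k1 k2 k5 r]
    have step0 := step 0
    rw [pow_zero, sub_self, zero_mul, zero_div, mul_zero, zero_mul, add_zero] at step0
    induction N with
    | zero =>
      simp only [Finset.sum_range_succ, Finset.sum_range_zero, zero_add, mul_zero]
      linear_combination step0 + e0
    | succ N ih =>
      rw [Finset.sum_range_succ, Finset.sum_range_succ (eqTerm p τ (p * v / δ) α (u / p)) (N + 2),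
        Finset.sum_range_succ (eqTerm p τ (p * v / δ) α u) (N + 1)]
      linear_combination ih + up N + step (N + 1)
  have lim1 := (s1.const_mul c).add ((s2.comp (tendsto_add_atTop_nat 2)).const_mul c')
  have lim2 := ((s5.comp (tendsto_add_atTop_nat 1)).const_mul Λ).add
    (s4.comp (tendsto_add_atTop_nat 1))
  rw [add_zero] at lim2
  rw [← hc, ← hc']
  exact tendsto_nhds_unique lim1 (lim2.congr fun N => (fin N).symm)

end Telescoping

end AskeyWilson

end

noncomputable section
namespace AskeyWilson
open Filter Topology Finset

/-! ## Power series with geometric bounds -/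

/-- The coefficients of the product of a polynomial and a power series. -/
def conv (Q : Polynomial ℂ) (g : ℕ → ℂ) (r : ℕ) : ℂ :=
  ∑ j ∈ range (r + 1), g j * Q.coeff (r - j)

section Conv

variable {g : ℕ → ℂ} {C σ : ℝ}

lemma summable_norm_mul_pow_of_le (hg : ∀ r, ‖g r‖ ≤ C * σ ^ r) (hσ : 0 ≤ σ) {u : ℂ}
    (hu : σ * ‖u‖ < 1) : Summable fun r => ‖g r * u ^ r‖ := by
  refine Summable.of_nonneg_of_le (fun _ => norm_nonneg _) (fun r => ?_)
    ((summable_geometric_of_lt_one (by positivity) hu).mul_left C)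
  rw [norm_mul, norm_pow, mul_pow, ← mul_assoc]
  gcongr
  exact hg r

/-- Multiplication by a polynomial preserves a geometric rate. The constant B depends only on Q and
σ, which allows bounds uniform in the spectral parameter. -/
lemma exists_norm_conv_le (Q : Polynomial ℂ) (hσ : 0 < σ) :
    ∃ B, 0 ≤ B ∧ ∀ (g : ℕ → ℂ) (C : ℝ), (∀ r, ‖g r‖ ≤ C * σ ^ r) →
      ∀ r, ‖conv Q g r‖ ≤ B * C * σ ^ r := by
  have hs : Summable fun k => ‖Q.coeff k‖ * σ⁻¹ ^ k := by
    refine summable_of_ne_finset_zero (s := Q.support) fun k hk => ?_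
    simp [Polynomial.notMem_support_iff.mp hk]
  refine ⟨∑' k, ‖Q.coeff k‖ * σ⁻¹ ^ k, tsum_nonneg fun k => by positivity, fun g C hg r => ?_⟩
  have hC : 0 ≤ C := by simpa using (norm_nonneg _).trans (hg 0)
  calc ‖conv Q g r‖ ≤ ∑ j ∈ range (r + 1), ‖g j * Q.coeff (r - j)‖ := norm_sum_le _ _
    _ ≤ ∑ j ∈ range (r + 1), C * σ ^ r * (‖Q.coeff (r - j)‖ * σ⁻¹ ^ (r - j)) := by
        refine Finset.sum_le_sum fun j hj => ?_
        have hj' : j ≤ r := Nat.lt_succ_iff.mp (Finset.mem_range.mp hj)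
        have e : σ ^ r * σ⁻¹ ^ (r - j) = σ ^ j := by
          rw [← Nat.sub_add_cancel hj', pow_add, Nat.add_sub_cancel, mul_right_comm, ← mul_pow,
            mul_inv_cancel₀ hσ.ne', one_pow, one_mul]
        rw [norm_mul]
        calc _ ≤ C * σ ^ j * ‖Q.coeff (r - j)‖ := by gcongr; exact hg j
          _ = _ := by rw [← e]; ring
    _ = C * σ ^ r * ∑ k ∈ range (r + 1), ‖Q.coeff k‖ * σ⁻¹ ^ k := by
        rw [← Finset.mul_sum, ← Finset.sum_range_reflect (fun k => ‖Q.coeff k‖ * σ⁻¹ ^ k)]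
        simp
    _ ≤ C * σ ^ r * ∑' k, ‖Q.coeff k‖ * σ⁻¹ ^ k := by
        gcongr
        exact hs.sum_le_tsum _ fun k _ => by positivity
    _ = _ := by ring

lemma tsum_conv (Q : Polynomial ℂ) (hg : ∀ r, ‖g r‖ ≤ C * σ ^ r) (hσ : 0 ≤ σ) {u : ℂ}
    (hu : σ * ‖u‖ < 1) :
    ∑' r, conv Q g r * u ^ r = Q.eval u * ∑' r, g r * u ^ r := by
  have hs : Summable fun k => ‖Q.coeff k * u ^ k‖ := by
    refine summable_of_ne_finset_zero (s := Q.support) fun k hk => ?_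
    simp [Polynomial.notMem_support_iff.mp hk]
  have he : Q.eval u = ∑' k, Q.coeff k * u ^ k := by
    rw [tsum_eq_sum (s := Q.support) fun k hk => by simp [Polynomial.notMem_support_iff.mp hk],
      Polynomial.eval_eq_sum, Polynomial.sum]
  rw [he, mul_comm, tsum_mul_tsum_eq_tsum_sum_range_of_summable_norm
    (summable_norm_mul_pow_of_le hg hσ hu) hs]
  refine tsum_congr fun r => ?_
  rw [conv, Finset.sum_mul]
  refine Finset.sum_congr rfl fun j hj => ?_
  have hj' : j ≤ r := Nat.lt_succ_iff.mp (Finset.mem_range.mp hj)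
  calc _ = g j * Q.coeff (r - j) * (u ^ j * u ^ (r - j)) := by
        rw [← pow_add, Nat.add_sub_cancel' hj']
    _ = _ := by ring

end Conv

/-! ## The asymptotically free solution -/

/-- Complex Askey–Wilson parameters, with base `p` and first dual parameter `k`. -/
structure Par where
  p : ℂ
  a : ℂ
  b : ℂ
  c : ℂ
  d : ℂ
  k : ℂ
  hp0 : p ≠ 0
  hp : ‖p‖ < 1
  ha : a ≠ 0
  hb : b ≠ 0
  hc : c ≠ 0
  hd : d ≠ 0
  hk : k ≠ 0
  habcd : a * b * c * d = p * k ^ 2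

namespace Par

variable (D : Par)

/-- The polynomial that multiplies the forward shift. -/
def pE : Polynomial ℂ :=
  (1 - .C D.a * .X) * (1 - .C D.b * .X) * (1 - .C D.c * .X) * (1 - .C D.d * .X) *
    ((1 - .C (D.p / D.a) * .X) * (1 - .C (D.p / D.b) * .X) * (1 - .C (D.p / D.c) * .X) *
      (1 - .C (D.p / D.d) * .X)) * (1 - .C (1 / D.p) * .X ^ 2)

/-- The common denominator of the difference equation. -/
def pL0 : Polynomial ℂ := (1 - .X ^ 2) * (1 - .C D.p * .X ^ 2) * (1 - .C (1 / D.p) * .X ^ 2)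

/-- The part of the zeroth order coefficient that does not involve the spectral parameter. -/
def pL1 : Polynomial ℂ :=
  .C (1 / D.k) * ((1 - .C D.a * .X) * (1 - .C D.b * .X) * (1 - .C D.c * .X) * (1 - .C D.d * .X) *
    (1 - .C (1 / D.p) * .X ^ 2)) +
  .C D.k * ((1 - .C (1 / D.a) * .X) * (1 - .C (1 / D.b) * .X) * (1 - .C (1 / D.c) * .X) *
    (1 - .C (1 / D.d) * .X) * (1 - .C D.p * .X ^ 2)) - .C (D.k + 1 / D.k) * D.pL0

lemma coeff_zero_pE : D.pE.coeff 0 = 1 := by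
  rw [Polynomial.coeff_zero_eq_eval_zero]; simp [pE]

lemma coeff_zero_pL0 : D.pL0.coeff 0 = 1 := by
  rw [Polynomial.coeff_zero_eq_eval_zero]; simp [pL0]

lemma coeff_zero_pL1 : D.pL1.coeff 0 = 0 := by
  rw [Polynomial.coeff_zero_eq_eval_zero]; simp [pL1, pL0]; ring

lemma norm_pow_p_le (r : ℕ) : ‖D.p ^ r‖ ≤ 1 := by
  rw [norm_pow]; exact pow_le_one₀ (norm_nonneg _) D.hp.le

lemma one_sub_pow_ne_zero {r : ℕ} (hr : r ≠ 0) : 1 - D.p ^ r ≠ 0 := by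
  intro h
  have := pow_lt_one₀ (norm_nonneg _) D.hp hr
  rw [← norm_pow, ← sub_eq_zero.mp h, norm_one] at this
  exact lt_irrefl _ this

/-- The coefficients of the recursion. -/
def kappa (r j : ℕ) (v : ℂ) : ℂ :=
  D.p ^ r * (v * D.pL1.coeff (r - j) + (v ^ 2 + 1) * D.pL0.coeff (r - j) -
    v ^ 2 * (D.p ^ j * D.pE.coeff (r - j))) + if r - j = 2 then D.p ^ 3 else 0

/-- The polynomial numerators of the coefficients of the asymptotically free solution. -/
def num : ℕ → ℂ → ℂ
  | 0 => fun _ => 1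
  | r + 1 => fun v => (1 - D.p ^ (r + 1))⁻¹ * ∑ j : Fin (r + 1),
      D.kappa (r + 1) j v * qPoch (D.p ^ ((j : ℕ) + 1) * v ^ 2) D.p (r - j) * num j v
  termination_by r => r
  decreasing_by exact j.2

lemma num_zero (v : ℂ) : D.num 0 v = 1 := by rw [num]

lemma num_succ (r : ℕ) (v : ℂ) : D.num (r + 1) v = (1 - D.p ^ (r + 1))⁻¹ *
    ∑ j ∈ range (r + 1), D.kappa (r + 1) j v * qPoch (D.p ^ (j + 1) * v ^ 2) D.p (r - j) *
      D.num j v := by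
  rw [num, Finset.sum_range]

/-- The coefficients of the asymptotically free solution. -/
def gam (r : ℕ) (v : ℂ) : ℂ := D.num r v * qPochInf (D.p ^ (r + 1) * v ^ 2) D.p

lemma gam_zero (v : ℂ) : D.gam 0 v = qPochInf (D.p * v ^ 2) D.p := by
  rw [gam, num_zero, one_mul, zero_add, pow_one]

lemma differentiable_num (r : ℕ) : Differentiable ℂ (D.num r) := by
  induction r using Nat.strong_induction_on with
  | _ r ih =>
    cases r with
    | zero => simp only [show D.num 0 = fun _ => 1 from funext D.num_zero]; fun_prop
    | succ r =>
      rw [show D.num (r + 1) = _ from funext (D.num_succ r)]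
      refine Differentiable.const_mul (Differentiable.fun_sum fun j hj => ?_) _
      refine Differentiable.mul (Differentiable.mul ?_ ?_) (ih j (Finset.mem_range.mp hj))
      · unfold kappa; fun_prop
      · unfold qPoch; fun_prop

lemma differentiable_gam (r : ℕ) : Differentiable ℂ (D.gam r) := by
  refine (D.differentiable_num r).mul ((differentiable_qPochInf D.hp).comp ?_)
  fun_prop

/-- The zeroth order part of the difference equation, on coefficients. -/
def rhs (g : ℕ → ℂ) (v : ℂ) (r : ℕ) : ℂ :=
  v * conv D.pL1 g r + (v ^ 2 + 1) * conv D.pL0 g r - v ^ 2 * conv D.pE (fun j => D.p ^ j * g j) r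

/-- The recursion written with its diagonal term isolated. Only the constant terms 1, 1 and 0 of E,
L₀ and L₁ enter the diagonal. -/
lemma rhs_eq (g : ℕ → ℂ) (v : ℂ) (r : ℕ) :
    D.p ^ r * D.rhs g v r + (if 2 ≤ r then D.p ^ 3 * g (r - 2) else 0) =
      ∑ j ∈ range r, D.kappa r j v * g j +
        (D.p ^ r * (v ^ 2 + 1) - v ^ 2 * D.p ^ r * D.p ^ r) * g r := by
  have h1 : (if 2 ≤ r then D.p ^ 3 * g (r - 2) else 0) =
      ∑ j ∈ range r, (if r - j = 2 then D.p ^ 3 else 0) * g j := by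
    split_ifs with h
    · rw [Finset.sum_eq_single (r - 2)]
      · rw [if_pos (by omega)]
      · intro j hj hne
        have := Finset.mem_range.mp hj
        rw [if_neg (by omega), zero_mul]
      · intro h'
        simp at h'; omega
    · symm
      refine Finset.sum_eq_zero fun j hj => ?_
      rw [if_neg (by omega), zero_mul]
  rw [h1, rhs, conv, conv, conv, Finset.sum_range_succ, Finset.sum_range_succ _ r,
    Finset.sum_range_succ _ r, Nat.sub_self, coeff_zero_pE, coeff_zero_pL0, coeff_zero_pL1]
  have h3 : ∀ j, D.kappa r j v * g j = D.p ^ r * (v * D.pL1.coeff (r - j) +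
      (v ^ 2 + 1) * D.pL0.coeff (r - j) - v ^ 2 * (D.p ^ j * D.pE.coeff (r - j))) * g j +
      (if r - j = 2 then D.p ^ 3 else 0) * g j := fun j => by rw [kappa, add_mul]
  simp only [h3, Finset.sum_add_distrib]
  have h2 : ∑ j ∈ range r, D.p ^ r * (v * D.pL1.coeff (r - j) + (v ^ 2 + 1) * D.pL0.coeff (r - j) -
      v ^ 2 * (D.p ^ j * D.pE.coeff (r - j))) * g j = D.p ^ r *
      (v * ∑ j ∈ range r, g j * D.pL1.coeff (r - j) +
      (v ^ 2 + 1) * ∑ j ∈ range r, g j * D.pL0.coeff (r - j) -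
      v ^ 2 * ∑ j ∈ range r, D.p ^ j * g j * D.pE.coeff (r - j)) := by
    simp only [Finset.mul_sum]
    rw [← Finset.sum_add_distrib, ← Finset.sum_sub_distrib, Finset.mul_sum]
    exact Finset.sum_congr rfl fun j _ => by ring
  rw [h2]
  ring

/-- Moving the diagonal term to the left gives the factor (1 - p^r)(1 - v² p^r). The first factor is
inverted in `num`; the second is absorbed by the factor (p^(r+1) v²; p)_∞ of `gam`, so the
coefficients stay entire in v. -/
lemma gam_rec (r : ℕ) (v : ℂ) : D.gam r v = D.p ^ r * D.rhs (fun j => D.gam j v) v r +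
    if 2 ≤ r then D.p ^ 3 * D.gam (r - 2) v else 0 := by
  rw [D.rhs_eq (fun j => D.gam j v)]
  cases r with
  | zero => simp
  | succ r =>
    have h1 := D.one_sub_pow_ne_zero (Nat.succ_ne_zero r)
    have h2 : ∀ j ∈ range (r + 1), D.kappa (r + 1) j v * D.gam j v =
        D.kappa (r + 1) j v * qPoch (D.p ^ (j + 1) * v ^ 2) D.p (r - j) * D.num j v *
          ((1 - D.p ^ (r + 1) * v ^ 2) * qPochInf (D.p ^ (r + 1 + 1) * v ^ 2) D.p) := by
      intro j hj
      have hj' := Nat.lt_succ_iff.mp (Finset.mem_range.mp hj)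
      rw [gam, qPochInf_eq_mul D.hp _ (r - j),
        show D.p ^ (r + 1 + 1) * v ^ 2 = D.p ^ (r + 1) * v ^ 2 * D.p by ring,
        ← qPochInf_eq_one_sub_mul D.hp, show D.p ^ (j + 1) * v ^ 2 * D.p ^ (r - j) =
          D.p ^ (r + 1) * v ^ 2 by
            rw [mul_right_comm, ← pow_add]; congr 2; omega]
      ring
    rw [Finset.sum_congr rfl h2, ← Finset.sum_mul]
    have h3 : ∑ j ∈ range (r + 1), D.kappa (r + 1) j v *
        qPoch (D.p ^ (j + 1) * v ^ 2) D.p (r - j) * D.num j v =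
        (1 - D.p ^ (r + 1)) * D.num (r + 1) v := by
      rw [num_succ]
      rw [← mul_assoc, mul_inv_cancel₀ h1, one_mul]
    rw [h3, gam]
    ring

/-- A first geometric bound, from the recursion. -/
lemma exists_norm_gam_le_pow (V : ℝ) : ∃ σ > 0, ∃ C, ∀ v : ℂ, ‖v‖ ≤ V → ∀ r,
    ‖D.gam r v‖ ≤ C * σ ^ r := by
  by_cases hV : 0 ≤ V
  swap
  · exact ⟨1, one_pos, 0, fun v hv => absurd ((norm_nonneg v).trans hv) hV⟩
  have hpos : 0 < 1 - ‖D.p‖ := sub_pos.mpr D.hp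
  have hcoef : ∀ Q : Polynomial ℂ, ∃ B, ∀ k, ‖Q.coeff k‖ ≤ B := fun Q =>
    ⟨∑ i ∈ Q.support, ‖Q.coeff i‖, fun k => by
      by_cases hk : k ∈ Q.support
      · exact Finset.single_le_sum (f := fun i => ‖Q.coeff i‖) (fun i _ => norm_nonneg _) hk
      · rw [Polynomial.notMem_support_iff.mp hk, norm_zero]
        exact Finset.sum_nonneg fun i _ => norm_nonneg _⟩
  obtain ⟨B1, hB1⟩ := hcoef D.pL1
  obtain ⟨B0, hB0⟩ := hcoef D.pL0
  obtain ⟨BE, hBE⟩ := hcoef D.pE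
  have hkap : ∀ v : ℂ, ‖v‖ ≤ V → ∀ r j, ‖D.kappa r j v‖ ≤
      V * B1 + (V ^ 2 + 1) * B0 + V ^ 2 * BE + 1 := by
    intro v hv r j
    have := (norm_nonneg _).trans (hBE 0)
    rw [kappa]
    refine (norm_add_le _ _).trans (add_le_add ?_ ?_)
    · rw [norm_mul]
      refine (mul_le_of_le_one_left (norm_nonneg _) (D.norm_pow_p_le r)).trans ?_
      refine (norm_sub_le _ _).trans (add_le_add ((norm_add_le _ _).trans (add_le_add ?_ ?_)) ?_)
      · rw [norm_mul]; gcongr; exact hB1 _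
      · rw [norm_mul]
        gcongr
        · refine (norm_add_le _ _).trans ?_
          rw [norm_pow, norm_one]
          gcongr
        · exact hB0 _
      · rw [norm_mul, norm_mul, norm_pow]
        gcongr
        refine (mul_le_of_le_one_left (norm_nonneg _) (D.norm_pow_p_le j)).trans (hBE _)
    · split_ifs
      · exact D.norm_pow_p_le 3
      · simp
  have hq : ∀ v : ℂ, ‖v‖ ≤ V → ∀ j, ‖D.p ^ j * v ^ 2‖ ≤ V ^ 2 := fun v hv j => by
    rw [norm_mul, norm_pow v]
    exact (mul_le_of_le_one_left (by positivity) (D.norm_pow_p_le j)).trans (by gcongr)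
  obtain ⟨A, hA⟩ : ∃ A, A = (V * B1 + (V ^ 2 + 1) * B0 + V ^ 2 * BE + 1) := ⟨_, rfl⟩
  rw [← hA] at hkap
  have hA0 : 0 ≤ A := (norm_nonneg _).trans (hkap 0 (by simpa using hV) 0 0)
  obtain ⟨M, hM⟩ : ∃ M, M = (1 - ‖D.p‖)⁻¹ * (A * Real.exp (V ^ 2 / (1 - ‖D.p‖))) := ⟨_, rfl⟩
  have hM0 : 0 ≤ M := by rw [hM]; positivity
  -- Every coefficient is at most M times the sum of the preceding bounds, and the sum of M (1 +
  -- M)^j over j ≤ r is (1 + M)^(r+1) - 1.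
  have hnum : ∀ v : ℂ, ‖v‖ ≤ V → ∀ r, ‖D.num r v‖ ≤ (1 + M) ^ r := by
    intro v hv r
    induction r using Nat.strong_induction_on with
    | _ r ih =>
      cases r with
      | zero => simp [num_zero]
      | succ r =>
        have hinv : ‖(1 - D.p ^ (r + 1))⁻¹‖ ≤ (1 - ‖D.p‖)⁻¹ := by
          rw [norm_inv]
          gcongr
          have h1 : ‖D.p ^ (r + 1)‖ ≤ ‖D.p‖ := by
            rw [norm_pow]; exact pow_le_of_le_one (norm_nonneg _) D.hp.le (Nat.succ_ne_zero r)
          have h2 := norm_sub_norm_le 1 (D.p ^ (r + 1))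
          rw [norm_one] at h2
          linarith
        rw [num_succ, norm_mul]
        calc _ ≤ (1 - ‖D.p‖)⁻¹ * ∑ j ∈ range (r + 1),
              (A * Real.exp (V ^ 2 / (1 - ‖D.p‖)) * (1 + M) ^ j) := by
              gcongr
              refine (norm_sum_le _ _).trans (Finset.sum_le_sum fun j hj => ?_)
              rw [norm_mul, norm_mul]
              gcongr
              · exact hkap v hv _ _
              · exact norm_qPoch_le D.hp (hq v hv _) _
              · exact ih j (Finset.mem_range.mp hj)
          _ = (∑ j ∈ range (r + 1), (1 + M) ^ j) * (1 + M - 1) := by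
              rw [← Finset.mul_sum, hM]; ring
          _ ≤ (1 + M) ^ (r + 1) := by rw [geom_sum_mul]; linarith
  refine ⟨1 + M, by linarith, Real.exp (V ^ 2 / (1 - ‖D.p‖)), fun v hv r => ?_⟩
  rw [gam, norm_mul, mul_comm]
  gcongr
  · exact norm_qPochInf_le D.hp (hq v hv _)
  · exact hnum v hv r

end Par

end AskeyWilson

end

/-! ### Decay of the coefficients beyond every geometric rate -/

noncomputable section
namespace AskeyWilson
open Filter Topology Finset

namespace Par

variable (D : Par)

/-- The recursion of the coefficients of the asymptotically free solution. -/
def IsSol (v : ℂ) (g : ℕ → ℂ) : Prop :=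
  ∀ r, g r = D.p ^ r * D.rhs g v r + if 2 ≤ r then D.p ^ 3 * g (r - 2) else 0

lemma isSol_gam (v : ℂ) : D.IsSol v fun r => D.gam r v := fun r => D.gam_rec r v

variable {D} {v : ℂ} {g : ℕ → ℂ} {C σ : ℝ}

lemma norm_pow_mul_le (hg : ∀ r, ‖g r‖ ≤ C * σ ^ r) (r : ℕ) : ‖D.p ^ r * g r‖ ≤ C * σ ^ r := by
  rw [norm_mul]
  exact (mul_le_of_le_one_left (norm_nonneg _) (D.norm_pow_p_le r)).trans (hg r)

lemma hasSum_rhs (hσ : 0 < σ) (hg : ∀ r, ‖g r‖ ≤ C * σ ^ r) {u : ℂ} (hu : σ * ‖u‖ < 1) :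
    HasSum (fun r => D.rhs g v r * u ^ r) ((v * D.pL1.eval u + (v ^ 2 + 1) * D.pL0.eval u) *
      ∑' r, g r * u ^ r - v ^ 2 * D.pE.eval u * ∑' r, g r * (D.p * u) ^ r) := by
  have hc : ∀ (Q : Polynomial ℂ) (h : ℕ → ℂ), (∀ r, ‖h r‖ ≤ C * σ ^ r) →
      HasSum (fun r => conv Q h r * u ^ r) (Q.eval u * ∑' r, h r * u ^ r) := by
    intro Q h hh
    obtain ⟨B, -, hB⟩ := exists_norm_conv_le Q hσ
    rw [← tsum_conv Q hh hσ.le hu]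
    exact (summable_norm_mul_pow_of_le (hB h C hh) hσ.le hu).of_norm.hasSum
  have h1 := hc D.pL1 g hg
  have h0 := hc D.pL0 g hg
  have hE := hc D.pE _ (norm_pow_mul_le (D := D) hg)
  have e : ∑' r, D.p ^ r * g r * u ^ r = ∑' r, g r * (D.p * u) ^ r :=
    tsum_congr fun r => by ring
  rw [e] at hE
  have := ((h1.mul_left v).add (h0.mul_left (v ^ 2 + 1))).sub (hE.mul_left (v ^ 2))
  have e1 : (fun r => D.rhs g v r * u ^ r) = fun r => v * (conv D.pL1 g r * u ^ r) +
      (v ^ 2 + 1) * (conv D.pL0 g r * u ^ r) -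
        v ^ 2 * (conv D.pE (fun r => D.p ^ r * g r) r * u ^ r) := by
    funext r
    rw [rhs]
    ring
  rw [e1, show ∀ A B E X Y : ℂ, (v * A + (v ^ 2 + 1) * B) * X - v ^ 2 * E * Y =
    v * (A * X) + (v ^ 2 + 1) * (B * X) - v ^ 2 * (E * Y) from fun A B E X Y => by ring]
  exact this

/-- The recursion is the comparison of coefficients in this equation. It is stated inside the disc
of a known rate, since it serves to improve that rate. -/
lemma difference_equation_of_le (hsol : D.IsSol v g) (hσ : 0 < σ)
    (hg : ∀ r, ‖g r‖ ≤ C * σ ^ r) {u : ℂ} (hu : σ * ‖u / D.p‖ < 1) :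
    v ^ 2 * D.pE.eval u * ∑' r, g r * (D.p * u) ^ r +
      (1 - D.p * u ^ 2) * ∑' r, g r * (u / D.p) ^ r =
    (v * D.pL1.eval u + (v ^ 2 + 1) * D.pL0.eval u) * ∑' r, g r * u ^ r := by
  have hp0 := D.hp0
  have hu' : σ * ‖u‖ < 1 := by
    refine lt_of_le_of_lt ?_ hu
    gcongr
    rw [norm_div]
    exact le_div_self (norm_nonneg _) (norm_pos_iff.mpr hp0) D.hp.le
  have h1 := hasSum_rhs (D := D) (v := v) hσ hg hu'
  have h2 := (summable_norm_mul_pow_of_le hg hσ.le hu).of_norm.hasSum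
  have h3 : HasSum (fun r => if 2 ≤ r then D.p ^ 3 * g (r - 2) * (u / D.p) ^ r else 0)
      (D.p * u ^ 2 * ∑' r, g r * (u / D.p) ^ r) := by
    have := (hasSum_nat_add_iff (f := fun r => if 2 ≤ r then D.p ^ 3 * g (r - 2) * (u / D.p) ^ r
      else 0) (g := D.p * u ^ 2 * ∑' r, g r * (u / D.p) ^ r) 2).mp (by
        have e : (fun r => if 2 ≤ r + 2 then D.p ^ 3 * g (r + 2 - 2) * (u / D.p) ^ (r + 2) else 0) =
            fun r => D.p * u ^ 2 * (g r * (u / D.p) ^ r) := by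
          funext r
          simp only [Nat.le_add_left, if_true, Nat.add_sub_cancel, pow_add]
          field_simp
        rw [e]
        exact h2.mul_left (D.p * u ^ 2))
    simpa [Finset.sum_range_succ] using this
  have h4 := h1.add h3
  have h5 : (fun r => g r * (u / D.p) ^ r) = fun r => D.rhs g v r * u ^ r +
      (if 2 ≤ r then D.p ^ 3 * g (r - 2) * (u / D.p) ^ r else 0) := by
    funext r
    have hpr := pow_ne_zero r hp0
    have := hsol r
    conv_lhs => rw [this]
    rw [add_mul, div_pow]
    congr 1
    · field_simp
    · split_ifs <;> ring
  rw [← h5] at h4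
  have := h2.unique h4
  linear_combination this

/-- The identity that makes the apparent singularities of the continued solution removable. -/
lemma eval_mul_eval {w : ℂ} (hw : D.p * w ^ 2 = 1) :
    (v * D.pL1.eval w + (v ^ 2 + 1) * D.pL0.eval w) *
      (v * D.pL1.eval (D.p * w) + (v ^ 2 + 1) * D.pL0.eval (D.p * w)) =
      (1 - D.p ^ 2) * (v ^ 2 * D.pE.eval w) := by
  have hp0 := D.hp0
  have ha := D.ha
  have hb := D.hb
  have hc := D.hc
  have hd := D.hd
  have hk := D.hk
  have e0 : D.pL0.eval w = 0 := by
    simp [pL0, hw]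
  have e0' : D.pL0.eval (D.p * w) = 0 := by
    have : D.p⁻¹ * (D.p * w) ^ 2 = 1 := by
      rw [mul_pow, sq D.p]; field_simp; linear_combination hw
    simp [pL0, this]
  have e1 : D.pL1.eval w = 1 / D.k * ((1 - D.a * w) * (1 - D.b * w) * (1 - D.c * w) * (1 - D.d * w) *
      (1 - 1 / D.p * w ^ 2)) := by
    simp [pL1, hw, e0]
  have e1' : D.pL1.eval (D.p * w) = D.k * ((1 - 1 / D.a * (D.p * w)) * (1 - 1 / D.b * (D.p * w)) *
      (1 - 1 / D.c * (D.p * w)) * (1 - 1 / D.d * (D.p * w)) * (1 - D.p * (D.p * w) ^ 2)) := by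
    have : D.p⁻¹ * (D.p * w) ^ 2 = 1 := by
      rw [mul_pow, sq D.p]; field_simp; linear_combination hw
    simp [pL1, this, e0']
  have eE : D.pE.eval w = (1 - D.a * w) * (1 - D.b * w) * (1 - D.c * w) * (1 - D.d * w) *
      ((1 - D.p / D.a * w) * (1 - D.p / D.b * w) * (1 - D.p / D.c * w) * (1 - D.p / D.d * w)) *
      (1 - 1 / D.p * w ^ 2) := by
    simp [pE]
  rw [e0, e0', e1, e1', eE, show D.p * (D.p * w) ^ 2 = D.p ^ 2 by linear_combination D.p ^ 2 * hw]
  simp only [show ∀ x : ℂ, 1 / x * (D.p * w) = D.p / x * w from fun x => by ring]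
  generalize D.p / D.a * w = x1, D.p / D.b * w = x2, D.p / D.c * w = x3, D.p / D.d * w = x4,
    1 / D.p * w ^ 2 = x5
  field_simp
  ring

/-- The geometric rate of a solution improves by the factor `‖p‖`. -/
lemma exists_improve (D : Par) (hσ : 0 < σ) (hne : σ ^ 2 ≠ ‖D.p‖) (V : ℝ) : ∃ K, ∀ v : ℂ, ‖v‖ ≤ V →
    ∀ g, D.IsSol v g → ∀ C, (∀ r, ‖g r‖ ≤ C * σ ^ r) → ∀ r, ‖g r‖ ≤ K * C * (‖D.p‖ * σ) ^ r := by
  by_cases hV : 0 ≤ V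
  swap
  · exact ⟨0, fun v hv => absurd ((norm_nonneg v).trans hv) hV⟩
  have hp0 := D.hp0
  have hpn : 0 < ‖D.p‖ := norm_pos_iff.mpr hp0
  obtain ⟨B1, hB1, h1⟩ := exists_norm_conv_le D.pL1 hσ
  obtain ⟨B0, hB0, h0⟩ := exists_norm_conv_le D.pL0 hσ
  obtain ⟨BE, hBE, hE⟩ := exists_norm_conv_le D.pE hσ
  obtain ⟨B, hB⟩ : ∃ B, B = V * B1 + (V ^ 2 + 1) * B0 + V ^ 2 * BE := ⟨_, rfl⟩
  have hB' : 0 ≤ B := by rw [hB]; positivity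
  have hR : ∀ v : ℂ, ‖v‖ ≤ V → ∀ g C, (∀ r, ‖g r‖ ≤ C * σ ^ r) → ∀ r,
      ‖D.rhs g v r‖ ≤ B * C * σ ^ r := by
    intro v hv g C hg r
    have k1 := h1 g C hg r
    have k0 := h0 g C hg r
    have kE := hE _ C (norm_pow_mul_le (D := D) hg) r
    rw [rhs]
    calc _ ≤ ‖v‖ * ‖conv D.pL1 g r‖ + ‖v ^ 2 + 1‖ * ‖conv D.pL0 g r‖ +
          ‖v‖ ^ 2 * ‖conv D.pE (fun j => D.p ^ j * g j) r‖ := by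
          refine (norm_sub_le _ _).trans (add_le_add ((norm_add_le _ _).trans (le_of_eq ?_)) ?_)
          · rw [norm_mul, norm_mul]
          · rw [norm_mul, norm_pow]
      _ ≤ V * (B1 * C * σ ^ r) + (V ^ 2 + 1) * (B0 * C * σ ^ r) + V ^ 2 * (BE * C * σ ^ r) := by
          gcongr
          refine (norm_add_le _ _).trans ?_
          rw [norm_pow, norm_one]
          gcongr
      _ = _ := by rw [hB]; ring
  -- it suffices to bound the rescaled solution
  suffices h : ∃ K, ∀ v : ℂ, ‖v‖ ≤ V → ∀ g, D.IsSol v g → ∀ C, (∀ r, ‖g r‖ ≤ C * σ ^ r) →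
      ∀ r, ‖g r / D.p ^ r‖ ≤ K * C * σ ^ r by
    obtain ⟨K, hK⟩ := h
    refine ⟨K, fun v hv g hsol C hg r => ?_⟩
    have := hK v hv g hsol C hg r
    rw [norm_div, norm_pow, div_le_iff₀ (by positivity)] at this
    rw [mul_pow]
    linarith
  -- With h_r = g_r / p^r the recursion reads h_(r+2) = p h_r + rhs_(r+2). The homogeneous part
  -- grows like |p|^(r/2), so the comparison of σ² with |p| decides the direction of iteration.
  have hrec : ∀ v g, D.IsSol v g → ∀ r, g (r + 2) / D.p ^ (r + 2) =
      D.rhs g v (r + 2) + D.p * (g r / D.p ^ r) := by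
    intro v g hsol r
    have := hsol (r + 2)
    rw [if_pos (by omega), Nat.add_sub_cancel] at this
    have hpr := pow_ne_zero r hp0
    conv_lhs => rw [this]
    rw [pow_add]
    field_simp
  have hrec0 : ∀ v g, D.IsSol v g → ∀ r < 2, g r / D.p ^ r = D.rhs g v r := by
    intro v g hsol r hr
    have := hsol r
    rw [if_neg (by omega), add_zero] at this
    have hpr := pow_ne_zero r hp0
    conv_lhs => rw [this]
    field_simp
  rcases lt_or_gt_of_ne hne with hlt | hgt
  · -- the solution is determined by its behaviour at infinity
    obtain ⟨θ, hθ⟩ : ∃ θ, θ = σ ^ 2 / ‖D.p‖ := ⟨_, rfl⟩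
    have hθ0 : 0 ≤ θ := by rw [hθ]; positivity
    have hθ1 : θ < 1 := by rw [hθ, div_lt_one hpn]; exact hlt
    refine ⟨B * (θ / (1 - θ)), fun v hv g hsol C hg r => ?_⟩
    have hC : 0 ≤ C := by simpa using (norm_nonneg _).trans (hg 0)
    have hR' := hR v hv g C hg
    -- ±w are the zeros of 1 - p u², the possible poles of F(u/p) as continued by the equation. Here
    -- |w|² = 1/|p|, so they lie in the disc σ|u| < 1.
    obtain ⟨w, hw⟩ := IsAlgClosed.exists_pow_nat_eq D.p⁻¹ (n := 2) (by norm_num)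
    have hw2 : D.p * w ^ 2 = 1 := by rw [hw, mul_inv_cancel₀ hp0]
    have hwn : σ * ‖w‖ < 1 := by
      have e : ‖w‖ ^ 2 = ‖D.p‖⁻¹ := by rw [← norm_pow, hw, norm_inv]
      have : (σ * ‖w‖) ^ 2 < 1 := by
        rw [mul_pow, e, ← div_eq_mul_inv, ← hθ]; exact hθ1
      exact (sq_lt_one_iff₀ (by positivity)).mp this
    -- The numerator vanishes at the apparent pole: the equation at pw, where E is zero, relates the
    -- values at w and pw, and `eval_mul_eval` turns this into the required cancellation.
    have hzero : ∀ w : ℂ, D.p * w ^ 2 = 1 → σ * ‖w‖ < 1 →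
        (v * D.pL1.eval w + (v ^ 2 + 1) * D.pL0.eval w) * ∑' r, g r * w ^ r -
          v ^ 2 * D.pE.eval w * ∑' r, g r * (D.p * w) ^ r = 0 := by
      intro w hw hwn
      have hw1 : D.p * w / D.p = w := by field_simp
      have key := difference_equation_of_le (u := D.p * w) hsol hσ hg (by rwa [hw1])
      have hE0 : D.pE.eval (D.p * w) = 0 := by
        have : D.p⁻¹ * (D.p * w) ^ 2 = 1 := by
          rw [mul_pow, sq D.p]; field_simp; linear_combination hw
        simp [pE, this]
      rw [hE0, hw1, mul_zero, zero_mul, zero_add,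
        show D.p * (D.p * w) ^ 2 = D.p ^ 2 by linear_combination D.p ^ 2 * hw] at key
      have := eval_mul_eval (D := D) (v := v) hw
      have hp2 : 1 - D.p ^ 2 ≠ 0 := D.one_sub_pow_ne_zero two_ne_zero
      refine mul_left_cancel₀ hp2 ?_
      rw [mul_zero]
      linear_combination (v * D.pL1.eval w + (v ^ 2 + 1) * D.pL0.eval w) * key +
        (∑' r, g r * (D.p * w) ^ r) * this
    -- Since p w² = 1, the recursion for h makes the partial sums telescope to their two top terms.
    have hpart : ∀ w : ℂ, D.p * w ^ 2 = 1 → ∀ M, ∑ r ∈ range (M + 2), D.rhs g v r * w ^ r =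
        g (M + 1) / D.p ^ (M + 1) * w ^ (M + 1) + g M / D.p ^ M * w ^ M := by
      intro w hw M
      induction M with
      | zero =>
        rw [Finset.sum_range_succ, Finset.sum_range_one, hrec0 v g hsol 0 (by norm_num),
          hrec0 v g hsol (0 + 1) (by norm_num)]
        ring
      | succ M ih =>
        rw [Finset.sum_range_succ, ih, hrec v g hsol M]
        linear_combination (-(g M / D.p ^ M * w ^ M)) * hw
    have hlim : ∀ w : ℂ, D.p * w ^ 2 = 1 → σ * ‖w‖ < 1 → Tendsto (fun M =>
        g (M + 1) / D.p ^ (M + 1) * w ^ (M + 1) + g M / D.p ^ M * w ^ M) atTop (𝓝 0) := by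
      intro w hw hwn
      have := (hasSum_rhs (D := D) (v := v) hσ hg hwn).tendsto_sum_nat
      rw [hzero w hw hwn] at this
      refine (this.comp (tendsto_add_atTop_nat 2)).congr fun M => ?_
      exact hpart w hw M
    -- Adding or subtracting the limits at w and -w, according to the parity of M, isolates h_M w^M.
    have hlim0 : Tendsto (fun M => g M / D.p ^ M * w ^ M) atTop (𝓝 0) := by
      have l1 := hlim w hw2 hwn
      have l2 := hlim (-w) (by rw [neg_sq, hw2]) (by rwa [norm_neg])
      rw [tendsto_zero_iff_norm_tendsto_zero] at l1 l2 ⊢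
      have l3 := l1.add l2
      rw [add_zero] at l3
      refine squeeze_zero (fun _ => norm_nonneg _) (fun M => ?_) l3
      have e : 2 * ‖g M / D.p ^ M * w ^ M‖ ≤
          ‖g (M + 1) / D.p ^ (M + 1) * w ^ (M + 1) + g M / D.p ^ M * w ^ M‖ +
          ‖g (M + 1) / D.p ^ (M + 1) * (-w) ^ (M + 1) + g M / D.p ^ M * (-w) ^ M‖ := by
        rcases Nat.even_or_odd M with hM | hM
        · rw [hM.neg_pow, (hM.add_one).neg_pow]
          refine le_trans (le_of_eq ?_) (norm_add_le _ _)
          rw [← Complex.norm_ofNat 2, ← norm_mul]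
          congr 1
          ring
        · rw [hM.neg_pow, (hM.add_one).neg_pow]
          refine le_trans (le_of_eq ?_) (norm_sub_le _ _)
          rw [← Complex.norm_ofNat 2, ← norm_mul]
          congr 1
          ring
      have := norm_nonneg (g M / D.p ^ M * w ^ M)
      linarith
    -- Backward iteration of h_r = w² (h_(r+2) - rhs_(r+2)). The term from infinity vanishes in the
    -- limit, and the rest is a geometric series with ratio σ²/|p| < 1.
    have hiter : ∀ K, g r / D.p ^ r = w ^ (2 * K) * (g (r + 2 * K) / D.p ^ (r + 2 * K)) -
        ∑ k ∈ range K, w ^ (2 * (k + 1)) * D.rhs g v (r + 2 * (k + 1)) := by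
      intro K
      induction K with
      | zero => simp
      | succ K ih =>
        rw [Finset.sum_range_succ, show r + 2 * (K + 1) = r + 2 * K + 2 by ring,
          hrec v g hsol (r + 2 * K), ih]
        generalize g (r + 2 * K) / D.p ^ (r + 2 * K) = y
        linear_combination (-(w ^ (2 * K) * y)) * hw2
    have hw0 : w ≠ 0 := by rintro rfl; simp at hw2
    have hl : Tendsto (fun K => w ^ (2 * K) * (g (r + 2 * K) / D.p ^ (r + 2 * K))) atTop (𝓝 0) := by
      have h2K : Tendsto (fun K : ℕ => r + 2 * K) atTop atTop :=
        tendsto_atTop_mono (fun K => (by simp only [id]; omega : id K ≤ r + 2 * K)) tendsto_id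
      have := (hlim0.comp h2K).const_mul (w ^ r)⁻¹
      rw [mul_zero] at this
      refine this.congr fun K => ?_
      have hwr := pow_ne_zero r hw0
      simp only [Function.comp, pow_add]
      field_simp
    have hbound : ∀ K, ‖g r / D.p ^ r‖ ≤ ‖w ^ (2 * K) * (g (r + 2 * K) / D.p ^ (r + 2 * K))‖ +
        B * (θ / (1 - θ)) * C * σ ^ r := by
      intro K
      rw [hiter K]
      refine (norm_sub_le _ _).trans (add_le_add le_rfl ?_)
      have hwk : ∀ k, ‖w ^ (2 * k)‖ * σ ^ (2 * k) = θ ^ k := by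
        intro k
        rw [norm_pow, pow_mul, pow_mul, ← mul_pow, ← norm_pow, hw, norm_inv, hθ]
        congr 1
        field_simp
      calc _ ≤ ∑ k ∈ range K, B * C * σ ^ r * (θ * θ ^ k) := by
            refine (norm_sum_le _ _).trans (Finset.sum_le_sum fun k _ => ?_)
            rw [norm_mul, ← pow_succ', ← hwk (k + 1)]
            calc _ ≤ ‖w ^ (2 * (k + 1))‖ * (B * C * σ ^ (r + 2 * (k + 1))) := by
                  gcongr; exact hR' _
              _ = _ := by rw [pow_add]; ring
        _ = B * C * σ ^ r * θ * ∑ k ∈ range K, θ ^ k := by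
            rw [Finset.mul_sum]; exact Finset.sum_congr rfl fun k _ => by ring
        _ ≤ B * C * σ ^ r * θ * (1 - θ)⁻¹ := by
            gcongr
            rw [← tsum_geometric_of_lt_one hθ0 hθ1]
            exact (summable_geometric_of_lt_one hθ0 hθ1).sum_le_tsum _ fun k _ => by positivity
        _ = _ := by ring
    have := (hl.norm.add_const (B * (θ / (1 - θ)) * C * σ ^ r))
    rw [norm_zero, zero_add] at this
    exact ge_of_tendsto this (Eventually.of_forall hbound)
  -- For σ² > |p| the forward recursion is stable and plain induction suffices.
  · obtain ⟨θ, hθ⟩ : ∃ θ, θ = ‖D.p‖ / σ ^ 2 := ⟨_, rfl⟩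
    have hθ1 : 0 < 1 - θ := by rw [hθ, sub_pos, div_lt_one (by positivity)]; exact hgt
    have hθ0 : 0 ≤ θ := by rw [hθ]; positivity
    refine ⟨B * (1 - θ)⁻¹, fun v hv g hsol C hg r => ?_⟩
    have hC : 0 ≤ C := by simpa using (norm_nonneg _).trans (hg 0)
    have hR' := hR v hv g C hg
    induction r using Nat.strong_induction_on with
    | _ r ih =>
      by_cases hr : r < 2
      · rw [hrec0 v g hsol r hr]
        refine (hR' r).trans ?_
        have : 1 ≤ (1 - θ)⁻¹ := (one_le_inv₀ hθ1).mpr (by linarith)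
        calc B * C * σ ^ r = B * C * σ ^ r * 1 := by ring
          _ ≤ B * C * σ ^ r * (1 - θ)⁻¹ := by gcongr
          _ = _ := by ring
      · obtain ⟨m, rfl⟩ := Nat.exists_eq_add_of_le' (not_lt.mp hr)
        rw [hrec v g hsol m]
        refine (norm_add_le _ _).trans ?_
        rw [norm_mul]
        calc _ ≤ B * C * σ ^ (m + 2) + ‖D.p‖ * (B * (1 - θ)⁻¹ * C * σ ^ m) := by
              gcongr
              · exact hR' _
              · exact ih m (by omega)
          _ = B * C * σ ^ (m + 2) * (1 + θ * (1 - θ)⁻¹) := by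
              have : ‖D.p‖ = θ * σ ^ 2 := by rw [hθ]; field_simp
              rw [this]; ring
          _ = _ := by
              have : 1 + θ * (1 - θ)⁻¹ = (1 - θ)⁻¹ := by field_simp; ring
              rw [this]; ring

/-- The coefficients of the asymptotically free solution decay faster than any geometric rate. -/
theorem exists_norm_gam_le (D : Par) (V : ℝ) {σ : ℝ} (hσ : 0 < σ) : ∃ C, ∀ v : ℂ, ‖v‖ ≤ V → ∀ r,
    ‖D.gam r v‖ ≤ C * σ ^ r := by
  obtain ⟨σ₀, hσ₀, C₀, h₀⟩ := D.exists_norm_gam_le_pow V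
  have hpn : 0 < ‖D.p‖ := norm_pos_iff.mpr D.hp0
  let P : ℝ → Prop := fun σ => ∃ C, ∀ v : ℂ, ‖v‖ ≤ V → ∀ r, ‖D.gam r v‖ ≤ C * σ ^ r
  have mono : ∀ σ τ : ℝ, 0 < σ → σ ≤ τ → P σ → P τ := by
    rintro σ τ hσ hle ⟨C, hC⟩
    refine ⟨|C|, fun v hv r => (hC v hv r).trans ?_⟩
    gcongr
    exact le_abs_self C
  have step : ∀ s : ℝ, 0 < s → (∀ σ, s < σ → P σ) → ∀ σ, ‖D.p‖ * s < σ → P σ := by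
    intro s hs h σ hσ
    -- The exceptional rate with τ² = |p| is avoided by taking a slightly smaller τ, which is why
    -- the induction quantifies over all rates above s.
    obtain ⟨τ, hτ1, hτ2, hτ3⟩ : ∃ τ, s < τ ∧ ‖D.p‖ * τ ≤ σ ∧ τ ^ 2 ≠ ‖D.p‖ := by
      have h1 : s < σ / ‖D.p‖ := by rw [lt_div_iff₀ hpn]; linarith
      by_cases h2 : (σ / ‖D.p‖) ^ 2 = ‖D.p‖
      · refine ⟨(s + σ / ‖D.p‖) / 2, by linarith, ?_, ?_⟩
        · have : ‖D.p‖ * (σ / ‖D.p‖) = σ := by field_simp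
          nlinarith
        · intro h3
          have h4 := h3.trans h2.symm
          rw [sq_eq_sq₀ (by linarith) (by linarith)] at h4
          linarith
      · exact ⟨σ / ‖D.p‖, h1, le_of_eq (by field_simp), h2⟩
    have hτ0 : 0 < τ := hs.trans hτ1
    obtain ⟨C, hC⟩ := h τ hτ1
    obtain ⟨K, hK⟩ := exists_improve D hτ0 hτ3 V
    exact mono (‖D.p‖ * τ) σ (by positivity) hτ2
      ⟨K * C, fun v hv r => hK v hv _ (D.isSol_gam v) C (hC v hv) r⟩
  -- Each improvement multiplies the threshold by |p|, so the threshold tends to 0.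
  have all : ∀ n : ℕ, ∀ σ, ‖D.p‖ ^ n * σ₀ < σ → P σ := by
    intro n
    induction n with
    | zero =>
      intro σ h
      rw [pow_zero, one_mul] at h
      exact mono σ₀ σ hσ₀ h.le ⟨C₀, h₀⟩
    | succ n ih =>
      intro σ h
      exact step _ (by positivity) ih σ (by rw [← mul_assoc, ← pow_succ']; exact h)
  have : Tendsto (fun n : ℕ => ‖D.p‖ ^ n * σ₀) atTop (𝓝 0) := by
    simpa using (tendsto_pow_atTop_nhds_zero_of_lt_one hpn.le D.hp).mul_const σ₀
  obtain ⟨n, hn⟩ := (this.eventually (gt_mem_nhds hσ)).exists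
  exact all n σ hn

end Par

end AskeyWilson

end

noncomputable section
namespace AskeyWilson
open Filter Topology Finset

/-! ## The `q`-binomial theorem -/

/-- The sum h satisfies (1 - y) h(y) = (1 - a y) h(yp); iteration drives the argument to 0, where h
tends to 1. -/
lemma tsum_qPoch_div_mul_pow {p a z : ℂ} (hp : ‖p‖ < 1) (hz : ‖z‖ < 1) :
    qPochInf z p * ∑' r, qPoch a p r / qPoch p p r * z ^ r = qPochInf (a * z) p := by
  have hpp : qPochInf p p ≠ 0 := qPochInf_ne_zero_of_norm_lt hp hp
  obtain ⟨C1, h1, k1⟩ := BaileyGeneric.exists_norm_qPoch_le hp a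
  obtain ⟨C2, h2, k2⟩ := exists_norm_inv_qPoch_le hp hpp
  have hb : ∀ r, ‖qPoch a p r / qPoch p p r‖ ≤ C1 * C2 * 1 ^ r := fun r => by
    rw [one_pow, mul_one, div_eq_mul_inv, norm_mul]
    gcongr
    exacts [k1 r, k2 r]
  have hs : ∀ {y : ℂ}, ‖y‖ < 1 → Summable fun r => qPoch a p r / qPoch p p r * y ^ r := fun hy =>
    (summable_norm_mul_pow_of_le hb zero_le_one (by rwa [one_mul])).of_norm
  let h : ℂ → ℂ := fun y => ∑' r, qPoch a p r / qPoch p p r * y ^ r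
  have step : ∀ y : ℂ, ‖y‖ < 1 → (1 - y) * h y = (1 - a * y) * h (y * p) := by
    intro y hy
    have hy' := norm_mul_pow_lt_one hp hy 1
    rw [pow_one] at hy'
    have e : ∀ r, qPoch a p (r + 1) / qPoch p p (r + 1) * (y ^ (r + 1) - (y * p) ^ (r + 1)) =
        y * (qPoch a p r / qPoch p p r * y ^ r) - a * y * (qPoch a p r / qPoch p p r * (y * p) ^ r) := by
      intro r
      have n1 : 1 - p * p ^ r ≠ 0 :=
        sub_ne_zero.mpr (mul_pow_ne_one_of_qPochInf_ne_zero hp hpp r).symm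
      have n2 := qPoch_ne_zero_of_qPochInf_ne_zero hp hpp r
      rw [qPoch_succ, qPoch_succ, mul_pow, mul_pow,
        show y ^ (r + 1) - y ^ (r + 1) * p ^ (r + 1) = y * y ^ r * (1 - p * p ^ r) by ring]
      generalize 1 - p * p ^ r = w at *
      field_simp
    have d1 : h y - h (y * p) = y * h y - a * y * h (y * p) := by
      rw [← (hs hy).tsum_sub (hs hy'), ((hs hy).sub (hs hy')).tsum_eq_zero_add]
      simp only [← mul_sub, e, pow_zero, sub_self, zero_add]
      rw [((hs hy).mul_left y).tsum_sub ((hs hy').mul_left (a * y)), tsum_mul_left, tsum_mul_left]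
    linear_combination d1
  have iter : ∀ n : ℕ, qPoch z p n * h z = qPoch (a * z) p n * h (z * p ^ n) := by
    intro n
    induction n with
    | zero => simp [qPoch]
    | succ n ih =>
      have := step (z * p ^ n) (norm_mul_pow_lt_one hp hz n)
      rw [mul_assoc z, ← pow_succ] at this
      rw [qPoch_succ, qPoch_succ]
      linear_combination (1 - z * p ^ n) * ih + qPoch (a * z) p n * this
  have hcont : Tendsto (fun n : ℕ => h (z * p ^ n)) atTop (𝓝 1) := by
    have key := tendsto_tsum_of_dominated_convergence (𝓕 := atTop)
      (f := fun (n : ℕ) r => qPoch a p r / qPoch p p r * (z * p ^ n) ^ r)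
      (g := fun r => if r = 0 then 1 else 0) (bound := fun r => C1 * C2 * ‖z‖ ^ r)
      ((summable_geometric_of_lt_one (norm_nonneg _) hz).mul_left _) (fun r => by
        rcases Nat.eq_zero_or_pos r with rfl | hr
        · simp [qPoch]
        · rw [if_neg hr.ne']
          have : Tendsto (fun n : ℕ => (z * p ^ n) ^ r) atTop (𝓝 0) := by
            have := ((tendsto_pow_atTop_nhds_zero_of_norm_lt_one hp).const_mul z).pow r
            rwa [mul_zero, zero_pow hr.ne'] at this
          simpa using this.const_mul (qPoch a p r / qPoch p p r))
      (Eventually.of_forall fun n r => by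
        have hr := hb r
        rw [one_pow, mul_one] at hr
        rw [norm_mul, norm_pow]
        gcongr
        exact norm_mul_pow_le hp z n)
    simpa using key
  have l1 := (tendsto_qPoch hp z).mul_const (h z)
  have l2 := (tendsto_qPoch hp (a * z)).mul hcont
  rw [mul_one] at l2
  exact tendsto_nhds_unique l1 (l2.congr fun n => (iter n).symm)

/-! ## The very-well-poised series as an entire function -/

/-- The summand of a very-well-poised series in a form without denominators in `u`. -/
def eqNum (p τ t : ℂ) (α : Fin 4 → ℂ) (u : ℂ) (r : ℕ) : ℂ :=
  t ^ r * (qPoch τ p r / qPoch p p r) * (1 - τ * u ^ 2 * (p ^ r) ^ 2) *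
    (qPochInf (p * u ^ 2 * p ^ r) p * qPoch (τ * u ^ 2) p r) *
    ∏ i, (qPoch (α i * u) p r * qPochInf (p * τ * u / α i * p ^ r) p)

lemma eqNum_eq {p τ t : ℂ} {α : Fin 4 → ℂ} {u : ℂ} (hp : ‖p‖ < 1)
    (hu : qPochInf (τ * u ^ 2) p ≠ 0) (r : ℕ) :
    eqNum p τ t α u r = qPochInf (τ * u ^ 2) p * eqTerm p τ t α u r := by
  have h2 := qPochInf_shift_ne_zero hp hu r
  rw [eqNum, eqTerm, qPochInf_eq_mul hp (τ * u ^ 2) r]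
  generalize qPochInf (τ * u ^ 2 * p ^ r) p = y at *
  field_simp

lemma exists_norm_eqNum_le {p : ℂ} (τ t : ℂ) (α : Fin 4 → ℂ) (hp : ‖p‖ < 1) (U : ℝ) :
    ∃ C, ∀ u : ℂ, ‖u‖ ≤ U → ∀ r, ‖eqNum p τ t α u r‖ ≤ C * ‖t‖ ^ r := by
  obtain ⟨a1, h1, k1⟩ := BaileyGeneric.exists_norm_qPoch_le hp τ
  obtain ⟨a2, h2, k2⟩ := exists_norm_inv_qPoch_le hp (qPochInf_ne_zero_of_norm_lt hp hp)
  let E : ℝ → ℝ := fun x => Real.exp (x / (1 - ‖p‖))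
  have hE : ∀ x, 0 ≤ E x := fun x => (Real.exp_pos _).le
  refine ⟨a1 * a2 * (1 + ‖τ‖ * U ^ 2) * (E (‖p‖ * U ^ 2) * E (‖τ‖ * U ^ 2)) *
    ∏ i, (E (‖α i‖ * U) * E (‖p * τ / α i‖ * U)), fun u hu r => ?_⟩
  have hU : 0 ≤ U := (norm_nonneg u).trans hu
  have hsq : ∀ x : ℂ, ‖x * u ^ 2‖ ≤ ‖x‖ * U ^ 2 := fun x => by
    rw [norm_mul, norm_pow]; gcongr
  have hlin : ∀ x : ℂ, ‖x * u‖ ≤ ‖x‖ * U := fun x => by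
    rw [norm_mul]; gcongr
  have h3 : ‖1 - τ * u ^ 2 * (p ^ r) ^ 2‖ ≤ 1 + ‖τ‖ * U ^ 2 := by
    rw [← pow_mul]
    refine (norm_sub_le _ _).trans ?_
    rw [norm_one]
    gcongr
    exact (norm_mul_pow_le hp _ _).trans (hsq τ)
  have h4 : ‖qPochInf (p * u ^ 2 * p ^ r) p‖ ≤ E (‖p‖ * U ^ 2) :=
    norm_qPochInf_le hp ((norm_mul_pow_le hp _ _).trans (hsq p))
  have h5 : ‖qPoch (τ * u ^ 2) p r‖ ≤ E (‖τ‖ * U ^ 2) := norm_qPoch_le hp (hsq τ) r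
  have h6 : ∀ i, ‖qPoch (α i * u) p r * qPochInf (p * τ * u / α i * p ^ r) p‖ ≤
      E (‖α i‖ * U) * E (‖p * τ / α i‖ * U) := fun i => by
    rw [norm_mul]
    gcongr
    · exact norm_qPoch_le hp (hlin _) r
    · refine norm_qPochInf_le hp ((norm_mul_pow_le hp _ _).trans ?_)
      rw [show p * τ * u / α i = p * τ / α i * u by ring]
      exact hlin _
  rw [eqNum, div_eq_mul_inv, norm_mul, norm_mul, norm_mul, norm_mul, norm_mul, norm_mul, norm_pow,
    norm_prod]
  have hprod : ∏ i, ‖qPoch (α i * u) p r * qPochInf (p * τ * u / α i * p ^ r) p‖ ≤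
      ∏ i, (E (‖α i‖ * U) * E (‖p * τ / α i‖ * U)) :=
    Finset.prod_le_prod (fun i _ => norm_nonneg _) fun i _ => h6 i
  have k1r := k1 r
  have k2r := k2 r
  have e1 := hE (‖p‖ * U ^ 2)
  have e2 := hE (‖τ‖ * U ^ 2)
  calc _ ≤ ‖t‖ ^ r * (a1 * a2) * (1 + ‖τ‖ * U ^ 2) * (E (‖p‖ * U ^ 2) * E (‖τ‖ * U ^ 2)) *
    ∏ i, (E (‖α i‖ * U) * E (‖p * τ / α i‖ * U)) := by
        gcongr
    _ = _ := by ring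

lemma differentiable_tsum_eqNum {p t : ℂ} (τ : ℂ) (α : Fin 4 → ℂ) (hp : ‖p‖ < 1) (ht : ‖t‖ < 1) :
    Differentiable ℂ fun u => ∑' r, eqNum p τ t α u r := by
  intro u
  obtain ⟨C, hC⟩ := exists_norm_eqNum_le τ t α hp (‖u‖ + 1)
  have := Complex.differentiableOn_tsum_of_summable_norm (F := fun r u => eqNum p τ t α u r)
    ((summable_geometric_of_lt_one (norm_nonneg _) ht).mul_left C) (fun r => ?_)
    (Metric.isOpen_ball : IsOpen (Metric.ball (0 : ℂ) (‖u‖ + 1))) (fun r w hw => hC w (by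
      simpa using (Metric.mem_ball.mp hw).le) r)
  · exact this.differentiableAt (Metric.isOpen_ball.mem_nhds (by simp))
  · have hd : ∀ f : ℂ → ℂ, Differentiable ℂ f → Differentiable ℂ fun w => qPochInf (f w) p :=
      fun f hf => (differentiable_qPochInf hp).comp hf
    have h1 := hd (fun u => p * u ^ 2 * p ^ r) (by fun_prop)
    have h2 : ∀ i, Differentiable ℂ fun u => qPochInf (p * τ * u / α i * p ^ r) p := fun i =>
      hd (fun u => p * τ * u / α i * p ^ r) (by fun_prop)
    have h3 : ∀ x : ℂ, Differentiable ℂ fun u => qPoch (x * u) p r := fun x => by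
      unfold qPoch; fun_prop
    have h4 : Differentiable ℂ fun u => qPoch (τ * u ^ 2) p r := by
      unfold qPoch; fun_prop
    refine Differentiable.differentiableOn ?_
    unfold eqNum
    refine Differentiable.mul (Differentiable.mul (by fun_prop) (h1.mul h4)) ?_
    exact Differentiable.fun_finsetProd fun i _ => (h3 _).mul (h2 i)

/-- The leading parameter τ u² together with the parameter τ produces the factor (p u² p^r)_∞, since
τ u² p / τ = p u². -/
lemma vwp_eq_tsum_eqNum {p τ t : ℂ} {α : Fin 4 → ℂ} {u : ℂ} (hτ : τ ≠ 0) (hα : ∀ i, α i ≠ 0)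
    (hu : u ≠ 0) : vwp p (τ * u ^ 2) τ (α 0 * u) (α 1 * u) (α 2 * u) (α 3 * u) t =
      ∑' r, eqNum p τ t α u r := by
  rw [vwp]
  refine tsum_congr fun r => ?_
  have e : ∀ i, τ * u ^ 2 * p / (α i * u) = p * τ * u / α i := fun i => by
    have := hα i
    field_simp
  rw [eqNum, Fin.prod_univ_four, e, e, e, e, show τ * u ^ 2 * p / τ = p * u ^ 2 by field_simp]
  simp only [div_eq_mul_inv]
  ring

namespace Par

variable (D : Par)

/-! ## Uniqueness -/

/-- Frobenius argument at u = 0. If u^n is the leading power of f, then n > 0 and comparison of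
leading coefficients gives (1 - p^n)(1 - v² p^n) = 0, which is excluded. -/
lemma eventually_eq_zero_of_difference_equation {v : ℂ} (hv : ∀ n : ℕ, v ^ 2 * D.p ^ (n + 1) ≠ 1)
    {f : ℂ → ℂ} (hf : AnalyticAt ℂ f 0) (h0 : f 0 = 0)
    (heq : ∀ᶠ u in 𝓝[≠] 0, v ^ 2 * D.pE.eval u * f (D.p * u) + (1 - D.p * u ^ 2) * f (u / D.p) =
      (v * D.pL1.eval u + (v ^ 2 + 1) * D.pL0.eval u) * f u) :
    ∀ᶠ u in 𝓝 0, f u = 0 := by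
  by_contra hne
  obtain ⟨n, φ, hφ, hφ0, hev⟩ := hf.exists_eventuallyEq_pow_smul_nonzero_iff.mpr hne
  simp only [sub_zero, smul_eq_mul] at hev
  have hp0 := D.hp0
  have hn : n ≠ 0 := by
    rintro rfl
    have := hev.self_of_nhds
    rw [h0, pow_zero, one_mul] at this
    exact hφ0 this.symm
  have t1 : Tendsto (fun u : ℂ => D.p * u) (𝓝 0) (𝓝 0) := by
    simpa using (continuous_const_mul D.p).tendsto 0
  have t2 : Tendsto (fun u : ℂ => u / D.p) (𝓝 0) (𝓝 0) := by
    simpa using (continuous_id.div_const D.p).tendsto 0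
  have hφeq : ∀ᶠ u in 𝓝[≠] (0 : ℂ), v ^ 2 * D.pE.eval u * (D.p ^ n * φ (D.p * u)) +
      (1 - D.p * u ^ 2) * (φ (u / D.p) / D.p ^ n) -
      (v * D.pL1.eval u + (v ^ 2 + 1) * D.pL0.eval u) * φ u = 0 := by
    filter_upwards [heq, nhdsWithin_le_nhds hev, nhdsWithin_le_nhds (t1.eventually hev),
      nhdsWithin_le_nhds (t2.eventually hev), self_mem_nhdsWithin] with u e1 e2 e3 e4 hu
    have hun : u ^ n ≠ 0 := pow_ne_zero n hu
    rw [e2, e3, e4, mul_pow, div_pow] at e1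
    refine mul_left_cancel₀ hun ?_
    rw [mul_zero]
    linear_combination e1
  have hlim : Tendsto (fun u : ℂ => v ^ 2 * D.pE.eval u * (D.p ^ n * φ (D.p * u)) +
      (1 - D.p * u ^ 2) * (φ (u / D.p) / D.p ^ n) -
      (v * D.pL1.eval u + (v ^ 2 + 1) * D.pL0.eval u) * φ u) (𝓝 0)
      (𝓝 (v ^ 2 * D.pE.eval 0 * (D.p ^ n * φ 0) + (1 - D.p * 0 ^ 2) * (φ 0 / D.p ^ n) -
      (v * D.pL1.eval 0 + (v ^ 2 + 1) * D.pL0.eval 0) * φ 0)) := by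
    have k3 := hφ.continuousAt.tendsto
    have k1 := k3.comp t1
    have k2 := k3.comp t2
    have q1 := D.pE.continuous.tendsto 0
    have q2 := D.pL1.continuous.tendsto 0
    have q3 := D.pL0.continuous.tendsto 0
    have q4 : Tendsto (fun u : ℂ => 1 - D.p * u ^ 2) (𝓝 0) (𝓝 (1 - D.p * 0 ^ 2)) :=
      Continuous.tendsto (by fun_prop) 0
    exact (((q1.const_mul (v ^ 2)).mul (k1.const_mul (D.p ^ n))).add
      (q4.mul (k2.div_const (D.p ^ n)))).sub
      (((q2.const_mul v).add (q3.const_mul (v ^ 2 + 1))).mul k3)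
  have hz := tendsto_nhds_unique ((hlim.mono_left nhdsWithin_le_nhds).congr' hφeq)
    tendsto_const_nhds
  rw [← Polynomial.coeff_zero_eq_eval_zero, ← Polynomial.coeff_zero_eq_eval_zero,
    ← Polynomial.coeff_zero_eq_eval_zero, coeff_zero_pE, coeff_zero_pL0, coeff_zero_pL1] at hz
  obtain ⟨m, rfl⟩ := Nat.exists_eq_add_one_of_ne_zero hn
  have h1 := D.one_sub_pow_ne_zero (Nat.succ_ne_zero m)
  have h2 : 1 - v ^ 2 * D.p ^ (m + 1) ≠ 0 := sub_ne_zero.mpr (hv m).symm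
  have hpm := pow_ne_zero (m + 1) hp0
  -- This is v² p^n + p^(-n) - (v² + 1) = 0, with n = m + 1, multiplied by p^n and by the leading
  -- coefficient.
  have h3 : (1 - D.p ^ (m + 1)) * (1 - v ^ 2 * D.p ^ (m + 1)) * φ 0 = 0 := by
    field_simp at hz
    linear_combination hz
  exact mul_ne_zero (mul_ne_zero h1 h2) hφ0 h3

end Par

end AskeyWilson

end

noncomputable section
namespace AskeyWilson
open Filter Topology Finset

namespace Par

variable (D : Par)

/-! ## The asymptotically free solution -/

/-- The asymptotically free solution, without its prefactor. -/
def F (u v : ℂ) : ℂ := ∑' r, D.gam r v * u ^ r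

lemma exists_norm_gam_mul_pow_le (U V : ℝ) : ∃ C, ∀ u v : ℂ, ‖u‖ ≤ U → ‖v‖ ≤ V → ∀ r,
    ‖D.gam r v * u ^ r‖ ≤ C * (1 / 2) ^ r := by
  have hU : 0 < |U| + 1 := by positivity
  obtain ⟨C, hC⟩ := D.exists_norm_gam_le V (σ := (2 * (|U| + 1))⁻¹) (by positivity)
  refine ⟨C, fun u v hu hv r => ?_⟩
  rw [norm_mul, norm_pow]
  calc ‖D.gam r v‖ * ‖u‖ ^ r ≤ C * (2 * (|U| + 1))⁻¹ ^ r * (|U| + 1) ^ r := by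
        gcongr
        · exact (norm_nonneg _).trans (hC v hv r)
        · exact hC v hv r
        · exact hu.trans ((le_abs_self U).trans (by linarith))
    _ = C * (1 / 2) ^ r := by
        rw [mul_assoc, ← mul_pow]
        congr 2
        field_simp

lemma summable_norm_gam_mul_pow (u v : ℂ) : Summable fun r => ‖D.gam r v * u ^ r‖ := by
  obtain ⟨C, hC⟩ := D.exists_norm_gam_mul_pow_le ‖u‖ ‖v‖
  exact Summable.of_nonneg_of_le (fun _ => norm_nonneg _) (hC u v le_rfl le_rfl)
    ((summable_geometric_of_lt_one (by norm_num) (by norm_num)).mul_left C)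

lemma F_zero (v : ℂ) : D.F 0 v = qPochInf (D.p * v ^ 2) D.p := by
  rw [F, tsum_eq_single 0 (fun r hr => by rw [zero_pow hr, mul_zero]), pow_zero, mul_one, gam_zero]

lemma differentiable_F_left (v : ℂ) : Differentiable ℂ fun u => D.F u v := by
  intro u
  obtain ⟨C, hC⟩ := D.exists_norm_gam_mul_pow_le (‖u‖ + 1) ‖v‖
  have := Complex.differentiableOn_tsum_of_summable_norm (F := fun r u => D.gam r v * u ^ r)
    ((summable_geometric_of_lt_one (by norm_num) (by norm_num : (1 / 2 : ℝ) < 1)).mul_left C)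
    (fun r => by fun_prop) (Metric.isOpen_ball : IsOpen (Metric.ball (0 : ℂ) (‖u‖ + 1)))
    (fun r w hw => hC w v (by simpa using (Metric.mem_ball.mp hw).le) le_rfl r)
  exact this.differentiableAt (Metric.isOpen_ball.mem_nhds (by simp))

lemma differentiable_F_right (u : ℂ) : Differentiable ℂ fun v => D.F u v := by
  intro v
  obtain ⟨C, hC⟩ := D.exists_norm_gam_mul_pow_le ‖u‖ (‖v‖ + 1)
  have := Complex.differentiableOn_tsum_of_summable_norm (F := fun r v => D.gam r v * u ^ r)
    ((summable_geometric_of_lt_one (by norm_num) (by norm_num : (1 / 2 : ℝ) < 1)).mul_left C)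
    (fun r => ((D.differentiable_gam r).mul_const _).differentiableOn)
    (Metric.isOpen_ball : IsOpen (Metric.ball (0 : ℂ) (‖v‖ + 1)))
    (fun r w hw => hC u w le_rfl (by simpa using (Metric.mem_ball.mp hw).le) r)
  exact this.differentiableAt (Metric.isOpen_ball.mem_nhds (by simp))

/-- Because the coefficients decay faster than every rate, a σ can be chosen for each u, so the
equation holds everywhere. -/
lemma F_difference_equation (u v : ℂ) : v ^ 2 * D.pE.eval u * D.F (D.p * u) v +
    (1 - D.p * u ^ 2) * D.F (u / D.p) v =
    (v * D.pL1.eval u + (v ^ 2 + 1) * D.pL0.eval u) * D.F u v := by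
  have h : 0 < ‖u / D.p‖ + 1 := by positivity
  obtain ⟨C, hC⟩ := D.exists_norm_gam_le ‖v‖ (σ := (‖u / D.p‖ + 1)⁻¹) (by positivity)
  refine difference_equation_of_le (D.isSol_gam v) (by positivity) (hC v le_rfl) ?_
  rw [inv_mul_lt_one₀ h]
  linarith

/-! ## The identification with a very-well-poised series -/

/-- The parameters `a, d, p / b, p / c` of the very-well-poised series. -/
def alp : Fin 4 → ℂ := ![D.a, D.d, D.p / D.b, D.p / D.c]

lemma alp_ne_zero (i : Fin 4) : D.alp i ≠ 0 := by
  have := D.hp0; have := D.ha; have := D.hb; have := D.hc; have := D.hd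
  fin_cases i <;> simp [alp, *]

lemma prod_alp : ∏ i, D.alp i = D.p * (D.a * D.d / D.k) ^ 2 := by
  have := D.hp0; have := D.ha; have := D.hb; have := D.hc; have := D.hd; have := D.hk
  have h := D.habcd
  simp only [Fin.prod_univ_four, alp, Matrix.cons_val_zero, Matrix.cons_val_one, Matrix.cons_val]
  field_simp
  linear_combination - h

/-- After division by L₀(u) this is the hypothesis on Λ in `tsum_eqTerm_difference`, with δ = ad/k.
It matches the two forms of the zeroth order coefficient. -/
lemma symbol_identity (u v : ℂ) (hv : v ≠ 0) : D.a * D.d / D.k / D.p *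
      (∏ i, (1 - D.p * u / D.alp i)) * (1 - u ^ 2 / D.p) +
      D.p / (D.a * D.d / D.k) * (∏ i, (1 - D.alp i * u / D.p)) * (1 - D.p * u ^ 2) -
      D.pL1.eval u - (v + 1 / v) * D.pL0.eval u =
    (D.p / (D.a * D.d / D.k) + D.a * D.d / D.k / D.p - 1 / v - v) * D.pL0.eval u := by
  have h0 := D.hp0; have h1 := D.ha; have h2 := D.hb; have h3 := D.hc; have h4 := D.hk
  have h : D.d = D.p * D.k ^ 2 / (D.a * D.b * D.c) := by
    rw [eq_div_iff (by simp [*])]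
    linear_combination D.habcd
  simp only [Fin.prod_univ_four, alp, Matrix.cons_val_zero, Matrix.cons_val_one, Matrix.cons_val,
    pL0, pL1, Polynomial.eval_add, Polynomial.eval_sub, Polynomial.eval_mul, Polynomial.eval_C,
    Polynomial.eval_X, Polynomial.eval_pow, Polynomial.eval_one]
  rw [h]
  generalize D.p = p at *
  generalize D.a = a at *
  generalize D.b = b at *
  generalize D.c = c at *
  generalize D.k = k at *
  field_simp
  ring


/-- The very-well-poised series solves the difference equation. -/
lemma tsum_eqTerm_difference_equation {u v δ τ t : ℂ} (hδ : δ = D.a * D.d / D.k)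
    (hτ : τ = δ * v) (htt : t = D.p * v / δ) (hv : v ≠ 0) (hu : u ≠ 0) (ht : ‖t‖ < 1)
    (h3 : qPochInf (τ / D.p) D.p ≠ 0) (n1 : qPochInf (u ^ 2) D.p ≠ 0)
    (n0 : qPochInf (τ * u ^ 2 / D.p ^ 2) D.p ≠ 0) (n2 : 1 - u ^ 2 / D.p ≠ 0) :
    v ^ 2 * D.pE.eval u * ∑' r, eqTerm D.p τ t D.alp (D.p * u) r +
      (1 - D.p * u ^ 2) * ∑' r, eqTerm D.p τ t D.alp (u / D.p) r =
    (v * D.pL1.eval u + (v ^ 2 + 1) * D.pL0.eval u) * ∑' r, eqTerm D.p τ t D.alp u r := by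
  have hp := D.hp
  have hp0 := D.hp0
  have hδ0 : δ ≠ 0 := by
    have ha := D.ha; have hd := D.hd; have hk := D.hk
    simp [*]
  have hprod := D.prod_alp
  have hs := D.symbol_identity u v hv
  have hE : D.pE.eval u = (∏ i, ((1 - D.alp i * u) * (1 - D.p * u / D.alp i))) *
      (1 - u ^ 2 / D.p) := by
    have hb := D.hb; have hc := D.hc
    simp only [Fin.prod_univ_four, alp, Matrix.cons_val_zero, Matrix.cons_val_one, Matrix.cons_val,
      pE, Polynomial.eval_sub, Polynomial.eval_mul, Polynomial.eval_C, Polynomial.eval_X,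
      Polynomial.eval_pow, Polynomial.eval_one]
    field_simp
  rw [← hδ] at hprod hs
  have n3 : 1 - u ^ 2 ≠ 0 := by
    have := mul_pow_ne_one_of_qPochInf_ne_zero hp n1 0
    rw [pow_zero, mul_one] at this
    exact sub_ne_zero.mpr this.symm
  have n4 : 1 - D.p * u ^ 2 ≠ 0 := by
    have := mul_pow_ne_one_of_qPochInf_ne_zero hp n1 1
    rw [pow_one, mul_comm] at this
    exact sub_ne_zero.mpr this.symm
  have hL0 : D.pL0.eval u = (1 - u ^ 2) * (1 - D.p * u ^ 2) * (1 - u ^ 2 / D.p) := by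
    simp only [pL0, Polynomial.eval_sub, Polynomial.eval_mul, Polynomial.eval_C, Polynomial.eval_X,
      Polynomial.eval_pow, Polynomial.eval_one]
    ring
  have T3 := tsum_eqTerm_difference hp0 hp hv hδ0 hu D.alp_ne_zero hprod hτ (htt ▸ ht) n1 n0 h3
    (Λ := (v * D.pL1.eval u + (v ^ 2 + 1) * D.pL0.eval u) / (v * D.pL0.eval u)) ?_ n2
  · rw [← htt, hL0] at T3
    rw [hL0, hE]
    generalize ∑' r, eqTerm D.p τ t D.alp (D.p * u) r = S1 at *
    generalize ∑' r, eqTerm D.p τ t D.alp (u / D.p) r = S2 at *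
    generalize ∑' r, eqTerm D.p τ t D.alp u r = S3 at *
    generalize ∏ i, ((1 - D.alp i * u) * (1 - D.p * u / D.alp i)) = Q at *
    generalize D.pL1.eval u = X at *
    clear hs hE hL0 n1 n0 h3
    generalize 1 - u ^ 2 / D.p = y1 at *
    generalize 1 - u ^ 2 = y2 at *
    generalize 1 - D.p * u ^ 2 = y3 at *
    field_simp at T3
    linear_combination T3
  · rw [hL0] at hs ⊢
    rw [hτ]
    generalize ∏ i, (1 - D.p * u / D.alp i) = Q1 at *
    generalize ∏ i, (1 - D.alp i * u / D.p) = Q2 at *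
    generalize D.pL1.eval u = X at *
    clear hE hL0 n1 n0 h3
    have e4 : ∀ y : ℂ, y ≠ 0 → (1 - δ * v / D.p) / v * (D.p * v / δ - 1) =
      (D.p / δ + δ / D.p - 1 / v - v) * y / y := fun y hy => by
      field_simp
      ring
    rw [e4 _ (mul_ne_zero (mul_ne_zero n3 n4) n2), ← hs]
    clear hs e4
    generalize 1 - u ^ 2 / D.p = y1 at *
    generalize 1 - u ^ 2 = y2 at *
    generalize 1 - D.p * u ^ 2 = y3 at *
    field_simp
    ring

/-- Both sides, divided by (τ u²)_∞, solve the same equation near u = 0 and agree at 0, hence they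
agree near 0. Both sides as stated are entire in u, so they agree everywhere. -/
lemma qPochInf_mul_F_aux {u v δ τ t : ℂ} (hδ : δ = D.a * D.d / D.k)
    (hτ : τ = δ * v) (htt : t = D.p * v / δ) (hv : v ≠ 0) (ht : ‖t‖ < 1)
    (h3 : qPochInf (τ / D.p) D.p ≠ 0) (h4 : qPochInf (D.p * v ^ 2) D.p ≠ 0) :
    qPochInf (τ * u ^ 2) D.p * D.F u v = qPochInf t D.p * ∑' r, eqNum D.p τ t D.alp u r := by
  have hp := D.hp
  have hp0 := D.hp0
  have dS : Differentiable ℂ fun u => qPochInf t D.p * ∑' r, eqNum D.p τ t D.alp u r :=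
    (differentiable_tsum_eqNum τ D.alp hp ht).const_mul _
  have dτ : Differentiable ℂ fun u : ℂ => qPochInf (τ * u ^ 2) D.p :=
    (differentiable_qPochInf hp).comp (by fun_prop : Differentiable ℂ fun u : ℂ => τ * u ^ 2)
  have dF := D.differentiable_F_left v
  have small : ∀ f : ℂ → ℂ, Continuous f → f 0 = 0 → ∀ᶠ u in 𝓝[≠] (0 : ℂ), ‖f u‖ < 1 := by
    intro f hf h0
    refine nhdsWithin_le_nhds ?_
    have := hf.norm.tendsto 0
    rw [h0, norm_zero] at this
    exact this.eventually_lt_const one_pos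
  have hpn : ∀ n : ℕ, v ^ 2 * D.p ^ (n + 1) ≠ 1 := by
    intro n
    have := mul_pow_ne_one_of_qPochInf_ne_zero hp h4 n
    rwa [mul_comm D.p, mul_assoc, ← pow_succ'] at this
  have ev := D.eventually_eq_zero_of_difference_equation hpn
    (f := fun u => D.F u v - qPochInf t D.p * (∑' r, eqNum D.p τ t D.alp u r) /
      qPochInf (τ * u ^ 2) D.p) ?_ ?_ ?_
  · have e2 : ∀ᶠ u in 𝓝 (0 : ℂ), qPochInf (τ * u ^ 2) D.p * D.F u v =
        qPochInf t D.p * ∑' r, eqNum D.p τ t D.alp u r := by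
      have h0 : ∀ᶠ u in 𝓝 (0 : ℂ), qPochInf (τ * u ^ 2) D.p ≠ 0 := by
        refine dτ.continuous.continuousAt.eventually_ne ?_
        simp [qPochInf_zero]
      filter_upwards [ev, h0] with u hu h
      rw [sub_eq_zero.mp hu, mul_div_cancel₀ _ h]
    have l1 : AnalyticOnNhd ℂ (fun u => qPochInf (τ * u ^ 2) D.p * D.F u v) Set.univ :=
      fun x _ => (dτ.mul dF).analyticAt x
    have l2 : AnalyticOnNhd ℂ (fun u => qPochInf t D.p * ∑' r, eqNum D.p τ t D.alp u r) Set.univ :=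
      fun x _ => dS.analyticAt x
    exact congrFun (l1.eq_of_eventuallyEq l2 e2) u
  · have l0 : qPochInf (τ * 0 ^ 2) D.p ≠ 0 := by simp [qPochInf_zero]
    exact (dF.analyticAt 0).sub ((dS.analyticAt 0).div (dτ.analyticAt 0) l0)
  -- At u = 0 the series is the q-binomial series in t with parameter τ, and τ t = p v² yields the
  -- prescribed value of F.
  · have hδ0 : δ ≠ 0 := by
      have ha := D.ha; have hd := D.hd; have hk := D.hk
      simp [*]
    have hτt : τ * t = D.p * v ^ 2 := by
      rw [hτ, htt]
      field_simp
    have e : ∀ r, eqNum D.p τ t D.alp 0 r = qPoch τ D.p r / qPoch D.p D.p r * t ^ r := fun r => by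
      simp [eqNum, qPochInf_zero, qPoch_zero_left, mul_comm]
    simp only [e, tsum_qPoch_div_mul_pow hp ht, hτt, F_zero]
    simp [qPochInf_zero]
  · filter_upwards [small (fun u => u ^ 2) (by fun_prop) (by simp),
      small (fun u => τ * u ^ 2 / D.p ^ 2) (by fun_prop) (by simp),
      small (fun u => u ^ 2 / D.p) (by fun_prop) (by simp), self_mem_nhdsWithin] with u a1 a2 a3 hu
    have n0 := qPochInf_ne_zero_of_norm_lt hp a2
    have n1 := qPochInf_ne_zero_of_norm_lt hp a1
    have n2 : 1 - u ^ 2 / D.p ≠ 0 := by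
      have := mul_pow_ne_one_of_qPochInf_ne_zero hp (qPochInf_ne_zero_of_norm_lt hp a3) 0
      rw [pow_zero, mul_one] at this
      exact sub_ne_zero.mpr this.symm
    have m1 : qPochInf (τ * (u / D.p) ^ 2) D.p ≠ 0 := by rwa [div_pow, ← mul_div_assoc]
    have m2 : qPochInf (τ * u ^ 2) D.p ≠ 0 := by
      have := qPochInf_shift_ne_zero hp n0 2
      rwa [div_mul_cancel₀ _ (pow_ne_zero 2 hp0)] at this
    have m3 : qPochInf (τ * (D.p * u) ^ 2) D.p ≠ 0 := by
      have := qPochInf_shift_ne_zero hp m2 2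
      rwa [show τ * u ^ 2 * D.p ^ 2 = τ * (D.p * u) ^ 2 by ring] at this
    have q : ∀ w, qPochInf (τ * w ^ 2) D.p ≠ 0 → qPochInf t D.p *
        (∑' r, eqNum D.p τ t D.alp w r) / qPochInf (τ * w ^ 2) D.p =
        qPochInf t D.p * ∑' r, eqTerm D.p τ t D.alp w r := by
      intro w hw
      simp only [eqNum_eq hp hw, tsum_mul_left]
      field_simp
    rw [q _ m1, q _ m2, q _ m3]
    linear_combination D.F_difference_equation u v - qPochInf t D.p *
      D.tsum_eqTerm_difference_equation hδ hτ htt hv hu ht h3 n1 n0 n2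

lemma qPochInf_mul_F {u v : ℂ} (hu : u ≠ 0) (hv : v ≠ 0)
    (ht : ‖D.p * v / (D.a * D.d / D.k)‖ < 1)
    (h3 : qPochInf (D.a * D.d / D.k * v / D.p) D.p ≠ 0) (h4 : qPochInf (D.p * v ^ 2) D.p ≠ 0) :
    qPochInf (D.a * D.d / D.k * v * u ^ 2) D.p * D.F u v =
      qPochInf (D.p * v / (D.a * D.d / D.k)) D.p *
        vwp D.p (D.a * D.d / D.k * v * u ^ 2) (D.a * D.d / D.k * v) (D.a * u) (D.d * u)
          (D.p / D.b * u) (D.p / D.c * u) (D.p * v / (D.a * D.d / D.k)) := by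
  have ha := D.ha; have hd := D.hd; have hk := D.hk
  rw [D.qPochInf_mul_F_aux rfl rfl rfl hv ht h3 h4,
    ← vwp_eq_tsum_eqNum (by simp [*]) D.alp_ne_zero hu]
  rfl

/-! ## Duality -/

/-- The dual parameters. -/
def dual : Par where
  p := D.p
  a := D.k
  b := D.a * D.b / D.k
  c := D.a * D.c / D.k
  d := D.a * D.d / D.k
  k := D.a
  hp0 := D.hp0
  hp := D.hp
  ha := D.hk
  hb := div_ne_zero (mul_ne_zero D.ha D.hb) D.hk
  hc := div_ne_zero (mul_ne_zero D.ha D.hc) D.hk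
  hd := div_ne_zero (mul_ne_zero D.ha D.hd) D.hk
  hk := D.ha
  habcd := by
    have := D.hk
    have h := D.habcd
    field_simp
    linear_combination D.a ^ 2 * h

/-- For small v, and then u small depending on v, every condition of Bailey's transformation holds.
The order matters because one of them bounds a multiple of u/v. -/
lemma F_eq_dual_of_small : ∀ᶠ v in 𝓝[≠] (0 : ℂ), ∀ᶠ u in 𝓝[≠] (0 : ℂ),
    D.F u v = D.dual.F v u := by
  have hp0 := D.hp0; have hp := D.hp; have ha := D.ha; have hb := D.hb; have hc := D.hc
  have hd := D.hd; have hk := D.hk; have h := D.habcd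
  have small : ∀ f : ℂ → ℂ, Continuous f → f 0 = 0 → ∀ᶠ u in 𝓝[≠] (0 : ℂ), ‖f u‖ < 1 := by
    intro f hf h0
    refine nhdsWithin_le_nhds ?_
    have := hf.norm.tendsto 0
    rw [h0, norm_zero] at this
    exact this.eventually_lt_const one_pos
  obtain ⟨δ, hδ⟩ : ∃ δ, δ = D.a * D.d / D.k := ⟨_, rfl⟩
  have hδ0 : δ ≠ 0 := by simp [*]
  have hδ' : D.dual.a * D.dual.d / D.dual.k = D.d := by
    simp only [dual]
    field_simp
  filter_upwards [small (fun v => D.p * v / δ) (by fun_prop) (by simp),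
    small (fun v => δ * v / D.p) (by fun_prop) (by simp),
    small (fun v => D.p * v ^ 2) (by fun_prop) (by simp),
    small (fun v => v / δ) (by fun_prop) (by simp), self_mem_nhdsWithin] with v a1 a2 a3 a4 hv
  filter_upwards [small (fun u => D.p * u / D.d) (by fun_prop) (by simp),
    small (fun u => D.d * u / D.p) (by fun_prop) (by simp),
    small (fun u => D.p * u ^ 2) (by fun_prop) (by simp),
    small (fun u => δ * u / (D.d * v * D.p)) (by fun_prop) (by simp),
    small (fun u => u / D.d) (by fun_prop) (by simp),
    small (fun u => δ * v * u ^ 2) (by fun_prop) (by simp),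
    small (fun u => D.d * u * v ^ 2) (by fun_prop) (by simp),
    small (fun u => D.p * δ * v / D.a * u) (by fun_prop) (by simp),
    small (fun u => δ * v * D.b * u) (by fun_prop) (by simp),
    small (fun u => δ * v * D.c * u) (by fun_prop) (by simp),
    small (fun u => D.p * δ * v / D.d * u) (by fun_prop) (by simp),
    small (fun u => D.d * v * D.p / δ * u) (by fun_prop) (by simp),
    self_mem_nhdsWithin] with u b1 b2 b3 b4 b5 b6 b7 b8 b9 b10 b11 b12 hu
  have hv : v ≠ 0 := hv
  have hu : u ≠ 0 := hu
  have nz : ∀ {x y : ℂ}, ‖x‖ < 1 → y = x → qPochInf y D.p ≠ 0 := fun hx hy =>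
    hy ▸ qPochInf_ne_zero_of_norm_lt hp hx
  have hl : D.d * u * v ^ 2 * (D.a * u * (D.p / D.b * u) * (D.p / D.c * u)) =
      D.p * (δ * v * u ^ 2) ^ 2 := by
    rw [hδ]
    field_simp
    linear_combination (-1 : ℂ) * h
  have n1 : qPochInf (δ * v * u ^ 2) D.p ≠ 0 := nz b6 rfl
  have n2 : qPochInf (D.d * u * v ^ 2) D.p ≠ 0 := nz b7 rfl
  -- The parameters δv and du are kept. The leading parameters δ v u² and d u v² are exchanged, as
  -- the duality exchanges u with v and δ with d.
  have T := BaileyGeneric.vwp_transformation (p := D.p) (a := δ * v * u ^ 2) (b := D.a * u)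
    (c := D.p / D.b * u) (d := D.p / D.c * u) (e := δ * v) (f := D.d * u) (l := D.d * u * v ^ 2)
    { hp0 := hp0, hp := hp, ha := by simp [*], hb := by simp [*], hc := by simp [*],
      hd := by simp [*], he := by simp [*], hf := by simp [*], hl := hl,
      hap := nz (norm_mul_pow_lt_one hp b6 1) (by rw [pow_one]),
      hlp := nz (norm_mul_pow_lt_one hp b7 1) (by rw [pow_one]),
      hab := nz b8 (by field_simp), hac := nz b9 (by field_simp), had := nz b10 (by field_simp),
      hae := nz b3 (by field_simp), haf := nz b11 (by field_simp),
      hle := nz b12 (by field_simp), hlf := nz a3 (by field_simp),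
      haef := nz b5 (by field_simp), hlef := nz a4 (by field_simp),
      hal := nz b4 (by field_simp) }
  have e1 : D.d * u * v ^ 2 * D.p / (δ * v * (D.d * u)) = D.p * v / δ := by field_simp
  have e2 : δ * v * u ^ 2 * D.p / (δ * v * (D.d * u)) = D.p * u / D.d := by field_simp
  rw [e1, e2] at T
  have G1 := D.qPochInf_mul_F hu hv (hδ ▸ a1) (hδ ▸ nz a2 rfl) (nz a3 rfl)
  have G2 := D.dual.qPochInf_mul_F (u := v) (v := u) hv hu (hδ' ▸ b1) (hδ' ▸ nz b2 rfl) (nz b3 rfl)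
  rw [hδ'] at G2
  rw [← hδ] at G1
  simp only [show D.dual.p = D.p from rfl, show D.dual.a = D.k from rfl,
    show D.dual.d = D.a * D.d / D.k from rfl, ← hδ] at G2
  have f1 : D.d * u * v ^ 2 * (D.a * u) / (δ * v * u ^ 2) = D.k * v := by
    rw [hδ]; field_simp
  have f2 : D.d * u * v ^ 2 * (D.p / D.b * u) / (δ * v * u ^ 2) = D.p / D.dual.b * v := by
    rw [hδ, show D.dual.b = D.a * D.b / D.k from rfl]; field_simp
  have f3 : D.d * u * v ^ 2 * (D.p / D.c * u) / (δ * v * u ^ 2) = D.p / D.dual.c * v := by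
    rw [hδ, show D.dual.c = D.a * D.c / D.k from rfl]; field_simp
  rw [f1, f2, f3] at T
  have T' := T a1 b1
  have p1 : ∀ A b c d e f t, vwp D.p A b c d e f t = vwp D.p A e b f c d t :=
    fun A b c d e f t => tsum_congr fun r => by ring
  have p2 : ∀ A b c d e f t, vwp D.p A b c d e f t = vwp D.p A f b e c d t :=
    fun A b c d e f t => tsum_congr fun r => by ring
  rw [p1 (δ * v * u ^ 2), p2 (D.d * u * v ^ 2)] at T'
  rw [show D.d * u * v ^ 2 = D.d * u * v ^ 2 from rfl] at G2
  refine mul_left_cancel₀ (mul_ne_zero n1 n2) ?_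
  linear_combination qPochInf (D.d * u * v ^ 2) D.p * G1 - qPochInf (δ * v * u ^ 2) D.p * G2 + T'

/-- The identity theorem is applied in u for each small v ≠ 0, and then in v; separate holomorphy
suffices. -/
theorem F_eq_dual (u v : ℂ) : D.F u v = D.dual.F v u := by
  have h1 : ∀ᶠ v in 𝓝[≠] (0 : ℂ), ∀ u, D.F u v = D.dual.F v u := by
    filter_upwards [D.F_eq_dual_of_small] with v hv u
    have l1 : AnalyticOnNhd ℂ (fun u => D.F u v) Set.univ :=
      fun x _ => (D.differentiable_F_left v).analyticAt x
    have l2 : AnalyticOnNhd ℂ (fun u => D.dual.F v u) Set.univ :=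
      fun x _ => (D.dual.differentiable_F_right v).analyticAt x
    exact congrFun (l1.eq_of_frequently_eq l2 hv.frequently) u
  have l1 : AnalyticOnNhd ℂ (fun v => D.F u v) Set.univ :=
    fun x _ => (D.differentiable_F_right u).analyticAt x
  have l2 : AnalyticOnNhd ℂ (fun v => D.dual.F v u) Set.univ :=
    fun x _ => (D.dual.differentiable_F_left u).analyticAt x
  exact congrFun (l1.eq_of_frequently_eq l2 (h1.mono fun v hv => hv u).frequently) v

end Par

end AskeyWilson

end

noncomputable section
namespace AskeyWilson
open Filter Topology Finset

/-! ## Generic points of `ℂ × ℂ` -/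

lemma eventually_ne_zero_of_differentiable {f : ℂ → ℂ} (hf : Differentiable ℂ f) {t : ℂ}
    (h : f t ≠ 0) (x : ℂ) : ∀ᶠ y in 𝓝[≠] x, f y ≠ 0 := by
  rcases (hf.analyticAt x).eventually_eq_zero_or_eventually_ne_zero with h0 | h0
  · have l1 : AnalyticOnNhd ℂ f Set.univ := fun y _ => hf.analyticAt y
    have l2 : AnalyticOnNhd ℂ (fun _ : ℂ => (0 : ℂ)) Set.univ := fun y _ => analyticAt_const
    exact absurd (congrFun (l1.eq_of_eventuallyEq l2 h0) t) h
  · exact h0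

/-- The restriction of a function on `ℂ × ℂ` to a complex line. -/
lemma differentiable_line {h : ℂ × ℂ → ℂ} (hh : Differentiable ℂ h) (y w : ℂ × ℂ) :
    Differentiable ℂ fun t : ℂ => h (y + t • (w - y)) :=
  hh.comp (by fun_prop)

lemma eq_zero_of_eventually_eq_zero {h : ℂ × ℂ → ℂ} (hh : Differentiable ℂ h) {y : ℂ × ℂ}
    (h0 : ∀ᶠ w in 𝓝 y, h w = 0) (w : ℂ × ℂ) : h w = 0 := by
  by_contra hw
  have h1 := eventually_ne_zero_of_differentiable (differentiable_line hh y w) (t := 1)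
    (by simpa using hw) 0
  have h2 : Tendsto (fun t : ℂ => y + t • (w - y)) (𝓝[≠] 0) (𝓝 y) := by
    refine tendsto_nhdsWithin_of_tendsto_nhds ?_
    have : Continuous fun t : ℂ => y + t • (w - y) := by fun_prop
    simpa using this.tendsto 0
  obtain ⟨t, ht1, ht2⟩ := (h1.and (h2.eventually h0)).exists
  exact ht1 ht2

/-- On the complex line through a point with f ≠ 0 and a point with g ≠ 0, both restrictions are
nonzero entire functions of one variable, so their zeros are isolated. -/
lemma IsNonzeroEntire.mul {f g : ℂ × ℂ → ℂ} (hf : IsNonzeroEntire f) (hg : IsNonzeroEntire g) :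
    IsNonzeroEntire fun y => f y * g y := by
  obtain ⟨df, y, hy⟩ := hf
  obtain ⟨dg, w, hw⟩ := hg
  refine ⟨df.mul dg, ?_⟩
  have h1 := eventually_ne_zero_of_differentiable (differentiable_line df y w) (t := 0)
    (by simpa using hy) 0
  have h2 := eventually_ne_zero_of_differentiable (differentiable_line dg y w) (t := 1)
    (by simpa using hw) 0
  obtain ⟨t, ht1, ht2⟩ := (h1.and h2).exists
  exact ⟨_, mul_ne_zero ht1 ht2⟩

/-- The filter generated by the complements of zero sets of nonzero entire functions. -/
def generic : Filter (ℂ × ℂ) where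
  sets := {S | ∃ h, IsNonzeroEntire h ∧ ∀ y, h y ≠ 0 → y ∈ S}
  univ_sets := ⟨fun _ => 1, ⟨by fun_prop, 0, one_ne_zero⟩, fun _ _ => trivial⟩
  sets_of_superset := fun ⟨h, hh, hS⟩ hST => ⟨h, hh, fun y hy => hST (hS y hy)⟩
  inter_sets := fun ⟨f, hf, hS⟩ ⟨g, hg, hT⟩ => ⟨_, hf.mul hg, fun y hy =>
    ⟨hS y (left_ne_zero_of_mul hy), hT y (right_ne_zero_of_mul hy)⟩⟩

lemma meroEq_iff {F G : ℂ → ℂ → ℂ} :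
    MeroEq F G ↔ ∀ᶠ y in generic, F y.1 y.2 = G y.1 y.2 :=
  ⟨fun ⟨h, hh, H⟩ => ⟨h, hh, fun y hy => H y.1 y.2 hy⟩,
    fun ⟨h, hh, H⟩ => ⟨h, hh, fun x z hy => H (x, z) hy⟩⟩

lemma IsNonzeroEntire.eventually_ne_zero {h : ℂ × ℂ → ℂ} (hh : IsNonzeroEntire h) :
    ∀ᶠ y in generic, h y ≠ 0 := ⟨h, hh, fun _ hy => hy⟩

/-- The right inverse ψ guarantees that a nonzero entire function stays nonzero after composition
with φ. -/
lemma tendsto_generic {φ ψ : ℂ × ℂ → ℂ × ℂ} (hφ : Differentiable ℂ φ) (hψ : ∀ y, φ (ψ y) = y) :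
    Tendsto φ generic generic := by
  rintro S ⟨h, ⟨dh, y, hy⟩, hS⟩
  exact ⟨h ∘ φ, ⟨dh.comp hφ, ψ y, by simpa [hψ] using hy⟩, fun w hw => hS _ hw⟩

lemma tendsto_swap_generic : Tendsto (fun y : ℂ × ℂ => (y.2, y.1)) generic generic :=
  tendsto_generic (by fun_prop) (ψ := fun y => (y.2, y.1)) fun _ => rfl

lemma tendsto_neg_left_generic : Tendsto (fun y : ℂ × ℂ => (-y.1, y.2)) generic generic :=
  tendsto_generic (by fun_prop) (ψ := fun y => (-y.1, y.2)) fun _ => by simp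

lemma tendsto_neg_right_generic : Tendsto (fun y : ℂ × ℂ => (y.1, -y.2)) generic generic :=
  tendsto_generic (by fun_prop) (ψ := fun y => (y.1, -y.2)) fun _ => by simp

/-- An entire function that vanishes at the generic points of a nonempty open set is zero. -/
lemma eq_zero_of_generic_of_isOpen {f : ℂ × ℂ → ℂ} (hf : Differentiable ℂ f) {U : Set (ℂ × ℂ)}
    (hU : IsOpen U) (hU' : U.Nonempty) (h : ∀ᶠ y in generic, y ∈ U → f y = 0) (y : ℂ × ℂ) :
    f y = 0 := by
  by_contra hy
  obtain ⟨g, hg, H⟩ := h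
  obtain ⟨d, w, hw⟩ := hg.mul ⟨hf, y, hy⟩
  obtain ⟨x, hx⟩ := hU'
  refine hw (eq_zero_of_eventually_eq_zero d (y := x) ?_ w)
  filter_upwards [hU.mem_nhds hx] with v hv
  by_cases hgv : g v = 0
  · rw [hgv, zero_mul]
  · rw [H v hgv hv, mul_zero]

lemma eq_zero_of_generic {f : ℂ × ℂ → ℂ} (hf : Differentiable ℂ f)
    (h : ∀ᶠ y in generic, f y = 0) (y : ℂ × ℂ) : f y = 0 :=
  eq_zero_of_generic_of_isOpen hf isOpen_univ Set.univ_nonempty (h.mono fun _ hy _ => hy) y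

/-- The identity theorem for meromorphic functions. -/
lemma IsMeromorphic.meroEq_of_isOpen {F G : ℂ → ℂ → ℂ} (hF : IsMeromorphic F)
    (hG : IsMeromorphic G) {U : Set (ℂ × ℂ)} (hU : IsOpen U) (hU' : U.Nonempty)
    (h : ∀ᶠ y in generic, y ∈ U → F y.1 y.2 = G y.1 y.2) : MeroEq F G := by
  obtain ⟨f1, g1, df1, hg1, H1⟩ := hF
  obtain ⟨f2, g2, df2, hg2, H2⟩ := hG
  have key : ∀ y, f1 y * g2 y - f2 y * g1 y = 0 := by
    refine eq_zero_of_generic_of_isOpen ((df1.mul hg2.1).sub (df2.mul hg1.1)) hU hU' ?_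
    filter_upwards [h, hg1.eventually_ne_zero, hg2.eventually_ne_zero] with y hy n1 n2 hyU
    have := hy hyU
    rw [H1 y.1 y.2 n1, H2 y.1 y.2 n2, Prod.mk.eta, div_eq_div_iff n1 n2] at this
    linear_combination this
  rw [meroEq_iff]
  filter_upwards [hg1.eventually_ne_zero, hg2.eventually_ne_zero] with y n1 n2
  rw [H1 y.1 y.2 n1, H2 y.1 y.2 n2, Prod.mk.eta, div_eq_div_iff n1 n2]
  linear_combination key y

/-! ## The base and the parameters -/

namespace Params

variable (P : Params)

lemma q_ne_zero : (P.q : ℂ) ≠ 0 := by exact_mod_cast P.q_pos.ne'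

lemma qexp_ne_zero (x : ℂ) : P.qexp x ≠ 0 := by
  simp [qexp, Complex.cpow_eq_zero_iff, P.q_pos.ne']

lemma qexp_add (x y : ℂ) : P.qexp (x + y) = P.qexp x * P.qexp y :=
  Complex.cpow_add _ _ P.q_ne_zero

lemma qexp_sub (x y : ℂ) : P.qexp (x - y) = P.qexp x / P.qexp y :=
  Complex.cpow_sub _ _ P.q_ne_zero

lemma qexp_neg (x : ℂ) : P.qexp (-x) = (P.qexp x)⁻¹ := Complex.cpow_neg _ _

lemma qexp_nat_mul (n : ℕ) (x : ℂ) : P.qexp (n * x) = P.qexp x ^ n := by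
  rw [qexp, qexp, Complex.cpow_nat_mul]

lemma qexp_two_mul (x : ℂ) : P.qexp (2 * x) = P.qexp x ^ 2 := by
  exact_mod_cast P.qexp_nat_mul 2 x

lemma qexp_int_mul (n : ℤ) (x : ℂ) : P.qexp (n * x) = P.qexp x ^ n := by
  rw [qexp, qexp, Complex.cpow_int_mul]

lemma qexp_ofReal (x : ℝ) : P.qexp x = ((P.q ^ x : ℝ) : ℂ) := by
  rw [qexp, Complex.ofReal_cpow P.q_pos.le]

lemma norm_qexp (x : ℂ) : ‖P.qexp x‖ = P.q ^ x.re := by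
  rw [qexp, Complex.norm_cpow_eq_rpow_re_of_pos P.q_pos]

lemma differentiable_qexp : Differentiable ℂ P.qexp := by
  intro x
  have h : DifferentiableAt ℂ (fun y : ℂ => (P.q : ℂ) ^ y) x :=
    (differentiableAt_id).const_cpow (Or.inl P.q_ne_zero)
  exact h

lemma log_q_ne_zero : Complex.log P.q ≠ 0 := by
  rw [← Complex.ofReal_log P.q_pos.le]
  exact_mod_cast (Real.log_neg P.q_pos P.q_lt_one).ne

lemma exists_qexp_eq {u : ℂ} (hu : u ≠ 0) : ∃ x, P.qexp x = u :=
  ⟨Complex.log u / Complex.log P.q, by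
    rw [qexp, Complex.cpow_def_of_ne_zero P.q_ne_zero, mul_div_cancel₀ _ P.log_q_ne_zero,
      Complex.exp_log hu]⟩

lemma base_ne_zero : P.base ≠ 0 := P.qexp_ne_zero _

lemma norm_base_lt_one : ‖P.base‖ < 1 := by
  rw [base, norm_qexp]
  refine Real.rpow_lt_one P.q_pos.le P.q_lt_one ?_
  simpa using P.s_pos

/-- The parameters in multiplicative form. -/
def par : Par where
  p := P.base
  a := P.a
  b := P.b
  c := P.c
  d := P.d
  k := P.dual.a
  hp0 := P.base_ne_zero
  hp := P.norm_base_lt_one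
  ha := P.qexp_ne_zero _
  hb := neg_ne_zero.mpr (P.qexp_ne_zero _)
  hc := P.qexp_ne_zero _
  hd := neg_ne_zero.mpr (P.qexp_ne_zero _)
  hk := P.qexp_ne_zero _
  habcd := by
    have e : ∀ x, P.dual.qexp x = P.qexp x := fun _ => rfl
    rw [a, b, c, d, base, a, e]
    simp only [mul_neg, neg_mul, neg_neg, ← qexp_two_mul, ← qexp_add]
    congr 1
    simp only [dual]
    ring

lemma dual_b : P.dual.b = P.a * P.b / P.dual.a := by
  have e : ∀ x, P.dual.qexp x = P.qexp x := fun _ => rfl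
  rw [a, b, a, b, e, e, mul_neg, neg_div, ← qexp_add, ← qexp_sub]
  congr 2
  simp only [dual]
  ring

lemma dual_c : P.dual.c = P.a * P.c / P.dual.a := by
  have e : ∀ x, P.dual.qexp x = P.qexp x := fun _ => rfl
  rw [a, c, a, c, e, e, ← qexp_add, ← qexp_sub]
  congr 1
  simp only [dual]
  ring

lemma dual_d : P.dual.d = P.a * P.d / P.dual.a := by
  have e : ∀ x, P.dual.qexp x = P.qexp x := fun _ => rfl
  rw [a, d, a, d, e, e, mul_neg, neg_div, ← qexp_add, ← qexp_sub]
  congr 2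
  simp only [dual]
  ring

lemma par_dual : P.dual.par = P.par.dual := by
  simp only [par, Par.dual, dual_b, dual_c, dual_d]
  rfl

end Params

end AskeyWilson

end

noncomputable section
namespace AskeyWilson
open Filter Topology Finset

namespace Par

variable (D : Par)

/-! ## Joint holomorphy -/

/-- Termwise differentiation as a function of two variables. Cauchy estimates on unit circles turn
the bounds for the terms into summable bounds for their derivatives. -/
lemma differentiable_F : Differentiable ℂ fun y : ℂ × ℂ => D.F y.1 y.2 := by
  intro y
  obtain ⟨C, hC⟩ := D.exists_norm_gam_mul_pow_le (‖y‖ + 2) (‖y‖ + 2)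
  have hball : ∀ w ∈ Metric.ball (0 : ℂ × ℂ) (‖y‖ + 1), ∀ x ∈ Metric.sphere w.1 1, ∀ r,
      ‖D.gam r w.2 * x ^ r‖ ≤ C * (1 / 2) ^ r := by
    intro w hw x hx r
    have hw' : ‖w‖ < ‖y‖ + 1 := by simpa using hw
    have h1 := norm_fst_le w
    have h2 := norm_snd_le w
    have h3 : ‖x - w.1‖ = 1 := by simpa [dist_eq_norm] using hx
    have h4 := norm_le_norm_add_norm_sub' x w.1
    exact hC _ _ (by linarith) (by linarith) r
  have hball' : ∀ w ∈ Metric.ball (0 : ℂ × ℂ) (‖y‖ + 1), ∀ x ∈ Metric.sphere w.2 1, ∀ r,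
      ‖D.gam r x * w.1 ^ r‖ ≤ C * (1 / 2) ^ r := by
    intro w hw x hx r
    have hw' : ‖w‖ < ‖y‖ + 1 := by simpa using hw
    have h1 := norm_fst_le w
    have h2 := norm_snd_le w
    have h3 : ‖x - w.2‖ = 1 := by simpa [dist_eq_norm] using hx
    have h4 := norm_le_norm_add_norm_sub' x w.2
    exact hC _ _ (by linarith) (by linarith) r
  let f' : ℕ → ℂ × ℂ → (ℂ × ℂ →L[ℂ] ℂ) := fun r w =>
    deriv (fun x => D.gam r w.2 * x ^ r) w.1 • ContinuousLinearMap.fst ℂ ℂ ℂ +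
      deriv (fun x => D.gam r x * w.1 ^ r) w.2 • ContinuousLinearMap.snd ℂ ℂ ℂ
  have hu : Summable fun r => 2 * (C * (1 / 2 : ℝ) ^ r) :=
    ((summable_geometric_of_lt_one (by norm_num) (by norm_num)).mul_left C).mul_left 2
  have hf : ∀ r, ∀ w ∈ Metric.ball (0 : ℂ × ℂ) (‖y‖ + 1),
      HasFDerivAt (fun w : ℂ × ℂ => D.gam r w.2 * w.1 ^ r) (f' r w) w := by
    intro r w _
    have h1 : HasFDerivAt (fun w : ℂ × ℂ => D.gam r w.2)
        (deriv (D.gam r) w.2 • ContinuousLinearMap.snd ℂ ℂ ℂ) w :=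
      ((D.differentiable_gam r w.2).hasDerivAt).comp_hasFDerivAt w hasFDerivAt_snd
    have h2 : HasFDerivAt (fun w : ℂ × ℂ => w.1 ^ r)
        (((r : ℂ) * w.1 ^ (r - 1)) • ContinuousLinearMap.fst ℂ ℂ ℂ) w :=
      (hasDerivAt_pow r w.1).comp_hasFDerivAt w hasFDerivAt_fst
    have h3 := h1.mul h2
    have e : f' r w = D.gam r w.2 • ((r : ℂ) * w.1 ^ (r - 1)) • ContinuousLinearMap.fst ℂ ℂ ℂ +
        w.1 ^ r • deriv (D.gam r) w.2 • ContinuousLinearMap.snd ℂ ℂ ℂ := by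
      simp only [f']
      rw [deriv_const_mul_field, deriv_mul_const_field, deriv_pow_field, smul_smul, smul_smul,
        mul_comm (w.1 ^ r)]
    rw [e]
    exact h3
  have hf' : ∀ r, ∀ w ∈ Metric.ball (0 : ℂ × ℂ) (‖y‖ + 1), ‖f' r w‖ ≤ 2 * (C * (1 / 2) ^ r) := by
    intro r w hw
    have d1 : ‖deriv (fun x => D.gam r w.2 * x ^ r) w.1‖ ≤ C * (1 / 2) ^ r / 1 :=
      Complex.norm_deriv_le_of_forall_mem_sphere_norm_le one_pos
        (Differentiable.diffContOnCl (by fun_prop)) fun x hx => hball w hw x hx r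
    have d2 : ‖deriv (fun x => D.gam r x * w.1 ^ r) w.2‖ ≤ C * (1 / 2) ^ r / 1 :=
      Complex.norm_deriv_le_of_forall_mem_sphere_norm_le one_pos
        (Differentiable.diffContOnCl ((D.differentiable_gam r).mul_const _))
        fun x hx => hball' w hw x hx r
    rw [div_one] at d1 d2
    refine (norm_add_le _ _).trans ?_
    rw [norm_smul, norm_smul, two_mul]
    refine add_le_add ?_ ?_
    · refine (mul_le_of_le_one_right (norm_nonneg _) ?_).trans d1
      exact ContinuousLinearMap.norm_fst_le ..
    · refine (mul_le_of_le_one_right (norm_nonneg _) ?_).trans d2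
      exact ContinuousLinearMap.norm_snd_le ..
  exact (hasFDerivAt_tsum_of_isPreconnected hu Metric.isOpen_ball
    (convex_ball _ _).isPreconnected hf hf' (x₀ := 0) (by simp; positivity)
    (D.summable_norm_gam_mul_pow 0 0).of_norm (by simp)).differentiableAt

end Par

/-! ## The Askey–Wilson operator in multiplicative form -/

namespace Params

variable (P : Params)

lemma coeffA_eq (x : ℂ) : coeffA P x = (1 - P.a * P.qexp x) * (1 - P.b * P.qexp x) *
    (1 - P.c * P.qexp x) * (1 - P.d * P.qexp x) /
      (P.dual.a * ((1 - P.qexp x ^ 2) * (1 - P.base * P.qexp x ^ 2))) := by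
  rw [coeffA, P.qexp_add, P.qexp_two_mul, ← base, mul_assoc P.dual.a]

lemma coeffA_neg (x : ℂ) : coeffA P (-x) = P.dual.a * ((1 - P.qexp x / P.a) *
    (1 - P.qexp x / P.b) * (1 - P.qexp x / P.c) * (1 - P.qexp x / P.d)) /
      ((1 - P.qexp x ^ 2) * (1 - P.qexp x ^ 2 / P.base)) := by
  have hu := P.qexp_ne_zero x
  have h := P.par.habcd
  have ha := P.par.ha; have hb := P.par.hb; have hc := P.par.hc; have hd := P.par.hd
  have hk := P.par.hk; have hp := P.par.hp0
  simp only [par] at h ha hb hc hd hk hp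
  rw [coeffA_eq, qexp_neg]
  generalize P.qexp x = u at *
  have e : ∀ y : ℂ, y ≠ 0 → 1 - y * u⁻¹ = -(y / u) * (1 - u / y) := fun y hy => by
    field_simp
    ring
  have e1 : 1 - u⁻¹ ^ 2 = -(1 / u ^ 2) * (1 - u ^ 2) := by field_simp; ring
  have e2 : 1 - P.base * u⁻¹ ^ 2 = -(P.base / u ^ 2) * (1 - u ^ 2 / P.base) := by
    field_simp; ring
  rw [e _ ha, e _ hb, e _ hc, e _ hd, e1, e2]
  generalize 1 - u / P.a = y1
  generalize 1 - u / P.b = y2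
  generalize 1 - u / P.c = y3
  generalize 1 - u / P.d = y4
  generalize 1 - u ^ 2 / P.base = y5
  generalize 1 - u ^ 2 = y6
  have n : P.dual.a * (-(1 / u ^ 2) * (-(P.base / u ^ 2))) ≠ 0 := by simp [*]
  rw [show P.dual.a * (-(1 / u ^ 2) * y6 * (-(P.base / u ^ 2) * y5)) =
    P.dual.a * (-(1 / u ^ 2) * (-(P.base / u ^ 2))) * (y6 * y5) by ring,
    show -(P.a / u) * y1 * (-(P.b / u) * y2) * (-(P.c / u) * y3) * (-(P.d / u) * y4) =
    P.dual.a * (-(1 / u ^ 2) * (-(P.base / u ^ 2))) * (P.dual.a * (y1 * y2 * y3 * y4)) by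
      linear_combination (y1 * y2 * y3 * y4 / u ^ 4) * h, mul_div_mul_left _ _ n]

lemma W_add (x z : ℂ) : W P (x + P.s) z = W P x z * (P.dual.a * P.qexp z) := by
  have hs : (P.s : ℂ) ≠ 0 := by exact_mod_cast P.s_pos.ne'
  have e : ∀ x, P.dual.qexp x = P.qexp x := fun _ => rfl
  rw [W, W, a, e, ← P.qexp_add, ← P.qexp_add]
  congr 1
  simp only [dual]
  field_simp
  ring

lemma W_ne_zero (x z : ℂ) : W P x z ≠ 0 := P.qexp_ne_zero _

lemma W_dual (x z : ℂ) : W P.dual z x = W P x z := by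
  rw [W, W, show ∀ x, P.dual.qexp x = P.qexp x from fun _ => rfl]
  simp only [dual]
  rw [mul_comm]

lemma W_sub (x z : ℂ) : W P (x - P.s) z = W P x z / (P.dual.a * P.qexp z) := by
  have hk : P.dual.a ≠ 0 := P.par.hk
  rw [eq_div_iff (mul_ne_zero hk (P.qexp_ne_zero z)), ← P.W_add, sub_add_cancel]

lemma St_eq (x : ℂ) : St P x = qPochInf (P.base * P.qexp x / P.a) P.base *
    qPochInf (P.base * P.qexp x / P.b) P.base * qPochInf (P.base * P.qexp x / P.c) P.base *
      qPochInf (P.base * P.qexp x / P.d) P.base := by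
  rw [St, qexp_add, ← base]

lemma St_sub (x : ℂ) : St P (x - P.s) = (1 - P.qexp x / P.a) * (1 - P.qexp x / P.b) *
    (1 - P.qexp x / P.c) * (1 - P.qexp x / P.d) * St P x := by
  have hp := P.norm_base_lt_one
  have e : ∀ y, qPochInf (P.base * (P.qexp x / P.base) / y) P.base =
      (1 - P.qexp x / y) * qPochInf (P.base * P.qexp x / y) P.base := fun y => by
    rw [mul_div_cancel₀ _ P.base_ne_zero, qPochInf_eq_one_sub_mul hp, mul_comm (P.qexp x / y),
      mul_div_assoc]
  rw [St_eq, St_eq, qexp_sub, ← base, e, e, e, e]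
  ring

/-- W gains the factor ã q^z under x → x + s, and St loses four linear factors. Hence the
Askey–Wilson operator becomes the polynomial difference equation of `Par.F`, up to a prefactor. -/
lemma opD_asymptOf (Γ : ℕ → ℂ → ℂ) {x z : ℂ} (hS : St P (x - P.s) ≠ 0)
    (h0 : P.par.pL0.eval (P.qexp x) ≠ 0) :
    opD P (fun y => asymptOf P Γ y z) x +
      (-P.qexp z - P.qexp (-z) + P.dual.a + P.dual.a⁻¹) * asymptOf P Γ x z =
    W P x z / (St P x * St P.dual z) / (P.qexp z * P.par.pL0.eval (P.qexp x)) *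
      (P.qexp z ^ 2 * P.par.pE.eval (P.qexp x) * seriesOf P Γ (x + P.s) z +
        (1 - P.base * P.qexp x ^ 2) * seriesOf P Γ (x - P.s) z -
        (P.qexp z * P.par.pL1.eval (P.qexp x) + (P.qexp z ^ 2 + 1) * P.par.pL0.eval (P.qexp x)) *
          seriesOf P Γ x z) := by
  have hu := P.qexp_ne_zero x
  have hv := P.qexp_ne_zero z
  have hk := P.par.hk
  simp only [par] at hk
  have q1 := P.St_sub x
  have q2 := P.St_sub (x + P.s)
  rw [add_sub_cancel_right, qexp_add, ← base] at q2
  rw [opD, asymptOf, asymptOf, asymptOf, coeffA_eq, coeffA_neg, W_add, W_sub, qexp_neg]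
  have hE : P.par.pE.eval (P.qexp x) = ((1 - P.a * P.qexp x) * (1 - P.b * P.qexp x) *
      (1 - P.c * P.qexp x) * (1 - P.d * P.qexp x)) * ((1 - P.qexp x * P.base / P.a) *
      (1 - P.qexp x * P.base / P.b) * (1 - P.qexp x * P.base / P.c) *
      (1 - P.qexp x * P.base / P.d)) * (1 - P.qexp x ^ 2 / P.base) := by
    simp [Par.pE, par]
    ring
  have hL0 : P.par.pL0.eval (P.qexp x) = (1 - P.qexp x ^ 2) * (1 - P.base * P.qexp x ^ 2) *
      (1 - P.qexp x ^ 2 / P.base) := by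
    simp only [Par.pL0, par, Polynomial.eval_sub, Polynomial.eval_mul, Polynomial.eval_C,
      Polynomial.eval_X, Polynomial.eval_pow, Polynomial.eval_one]
    ring
  have hL1 : P.par.pL1.eval (P.qexp x) = 1 / P.dual.a * ((1 - P.a * P.qexp x) *
      (1 - P.b * P.qexp x) * (1 - P.c * P.qexp x) * (1 - P.d * P.qexp x)) *
      (1 - P.qexp x ^ 2 / P.base) + P.dual.a * ((1 - P.qexp x / P.a) * (1 - P.qexp x / P.b) *
      (1 - P.qexp x / P.c) * (1 - P.qexp x / P.d)) * (1 - P.base * P.qexp x ^ 2) -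
      (P.dual.a + 1 / P.dual.a) * P.par.pL0.eval (P.qexp x) := by
    simp only [Par.pL1, par, Polynomial.eval_add, Polynomial.eval_sub, Polynomial.eval_mul,
      Polynomial.eval_C, Polynomial.eval_X, Polynomial.eval_pow, Polynomial.eval_one]
    ring
  rw [hE, hL1]
  rw [hL0] at h0 ⊢
  generalize (1 - P.qexp x / P.a) * (1 - P.qexp x / P.b) * (1 - P.qexp x / P.c) *
    (1 - P.qexp x / P.d) = E2 at *
  generalize (1 - P.qexp x * P.base / P.a) * (1 - P.qexp x * P.base / P.b) *
    (1 - P.qexp x * P.base / P.c) * (1 - P.qexp x * P.base / P.d) = E3 at *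
  generalize (1 - P.a * P.qexp x) * (1 - P.b * P.qexp x) *
      (1 - P.c * P.qexp x) * (1 - P.d * P.qexp x) = E1 at *
  generalize 1 - P.qexp x ^ 2 / P.base = y1 at *
  generalize 1 - P.base * P.qexp x ^ 2 = y3 at *
  generalize 1 - P.qexp x ^ 2 = y2 at *
  generalize St P (x + P.s) = S at *
  rw [q2] at q1 ⊢
  rw [q1] at hS ⊢
  generalize W P x z = w at *
  generalize seriesOf P Γ (x + P.s) z = G1 at *
  generalize seriesOf P Γ (x - P.s) z = G2 at *
  generalize seriesOf P Γ x z = G3 at *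
  generalize P.qexp z = v at *
  generalize P.dual.a = k at *
  clear q1 q2 hE hL0 hL1 hu
  have n1 := left_ne_zero_of_mul hS
  have n2 := left_ne_zero_of_mul (right_ne_zero_of_mul hS)
  have n3 := right_ne_zero_of_mul (right_ne_zero_of_mul hS)
  have m1 := right_ne_zero_of_mul h0
  have m2 := left_ne_zero_of_mul (left_ne_zero_of_mul h0)
  have m3 := right_ne_zero_of_mul (left_ne_zero_of_mul h0)
  simp only [show ∀ A B C : ℂ, A / (B * C) = A / B * C⁻¹ from fun A B C => by
    rw [div_mul_eq_div_div, div_eq_mul_inv _ C]]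
  generalize (St P.dual z)⁻¹ = X
  field_simp
  ring

end Params

end AskeyWilson

end

noncomputable section
namespace AskeyWilson
open Filter Topology Finset

namespace Params

variable (P : Params)

/-! ## Generic nonvanishing -/

lemma exists_norm_mul_qexp_lt_one (c : ℂ) : ∃ t : ℂ, ‖c * P.qexp t‖ < 1 := by
  have h : Tendsto (fun t : ℝ => ‖c‖ * P.q ^ t) atTop (𝓝 (‖c‖ * 0)) :=
    (tendsto_rpow_atTop_of_base_lt_one _ (by linarith [P.q_pos]) P.q_lt_one).const_mul _
  rw [mul_zero] at h
  obtain ⟨t, ht⟩ := (h.eventually_lt_const one_pos).exists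
  exact ⟨t, by rwa [norm_mul, norm_qexp, Complex.ofReal_re]⟩

lemma isNonzeroEntire_qPochInf (c : ℂ) {L : ℂ × ℂ → ℂ} (hL : Differentiable ℂ L)
    (hs : ∀ t, ∃ y, L y = t) :
    IsNonzeroEntire fun y => qPochInf (c * P.qexp (L y)) P.base := by
  have hp := P.norm_base_lt_one
  refine ⟨(differentiable_qPochInf hp).comp ((P.differentiable_qexp.comp hL).const_mul c), ?_⟩
  obtain ⟨t, ht⟩ := P.exists_norm_mul_qexp_lt_one c
  obtain ⟨y, rfl⟩ := hs t
  exact ⟨y, qPochInf_ne_zero_of_norm_lt hp ht⟩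

lemma eventually_qPochInf_ne_zero (c : ℂ) {L : ℂ × ℂ → ℂ} (hL : Differentiable ℂ L)
    (hs : ∀ t, ∃ y, L y = t) : ∀ᶠ y in generic, qPochInf (c * P.qexp (L y)) P.base ≠ 0 :=
  (P.isNonzeroEntire_qPochInf c hL hs).eventually_ne_zero

lemma eventually_qPochInf_fst_ne_zero (c : ℂ) :
    ∀ᶠ y : ℂ × ℂ in generic, qPochInf (c * P.qexp y.1) P.base ≠ 0 :=
  P.eventually_qPochInf_ne_zero c (by fun_prop) fun t => ⟨(t, 0), rfl⟩

lemma eventually_qPochInf_fst_sq_ne_zero (c : ℂ) :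
    ∀ᶠ y : ℂ × ℂ in generic, qPochInf (c * P.qexp y.1 ^ 2) P.base ≠ 0 := by
  simpa only [qexp_two_mul] using P.eventually_qPochInf_ne_zero c (L := fun y => 2 * y.1)
    (by fun_prop) fun t => ⟨(t / 2, 0), by ring⟩

lemma eventually_qPochInf_snd_sq_ne_zero (c : ℂ) :
    ∀ᶠ y : ℂ × ℂ in generic, qPochInf (c * P.qexp y.2 ^ 2) P.base ≠ 0 := by
  simpa only [qexp_two_mul] using P.eventually_qPochInf_ne_zero c (L := fun y => 2 * y.2)
    (by fun_prop) fun t => ⟨(0, t / 2), by ring⟩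

lemma one_sub_ne_zero_of_qPochInf_ne_zero {x : ℂ} (h : qPochInf x P.base ≠ 0) : 1 - x ≠ 0 := by
  have := mul_pow_ne_one_of_qPochInf_ne_zero P.norm_base_lt_one h 0
  rw [pow_zero, mul_one] at this
  exact sub_ne_zero.mpr this.symm

lemma eventually_St_fst_ne_zero : ∀ᶠ y : ℂ × ℂ in generic, St P (y.1 - P.s) ≠ 0 := by
  filter_upwards [P.eventually_qPochInf_fst_ne_zero P.a⁻¹, P.eventually_qPochInf_fst_ne_zero P.b⁻¹,
    P.eventually_qPochInf_fst_ne_zero P.c⁻¹, P.eventually_qPochInf_fst_ne_zero P.d⁻¹]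
    with y h1 h2 h3 h4
  have e : ∀ w, P.base * P.qexp (y.1 - P.s) / w = w⁻¹ * P.qexp y.1 := fun w => by
    rw [qexp_sub, ← base, mul_div_cancel₀ _ P.base_ne_zero, div_eq_inv_mul]
  rw [St_eq, e, e, e, e]
  simp [*]

lemma St_ne_zero_of_sub {x : ℂ} (h : St P (x - P.s) ≠ 0) : St P x ≠ 0 := by
  rw [St_sub] at h
  exact right_ne_zero_of_mul h

lemma eventually_pL0_ne_zero :
    ∀ᶠ y : ℂ × ℂ in generic, P.par.pL0.eval (P.qexp y.1) ≠ 0 := by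
  filter_upwards [P.eventually_qPochInf_fst_sq_ne_zero 1, P.eventually_qPochInf_fst_sq_ne_zero P.base,
    P.eventually_qPochInf_fst_sq_ne_zero (1 / P.base)] with y h1 h2 h3
  have n1 := P.one_sub_ne_zero_of_qPochInf_ne_zero h1
  have n2 := P.one_sub_ne_zero_of_qPochInf_ne_zero h2
  have n3 := P.one_sub_ne_zero_of_qPochInf_ne_zero h3
  simp only [Par.pL0, par, Polynomial.eval_sub, Polynomial.eval_mul, Polynomial.eval_C,
    Polynomial.eval_X, Polynomial.eval_pow, Polynomial.eval_one]
  rw [one_mul] at n1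
  exact mul_ne_zero (mul_ne_zero n1 n2) n3

/-! ## The coefficients of the asymptotically free eigenfunction -/

lemma seriesOf_eq (Γ : ℕ → ℂ → ℂ) (x z : ℂ) :
    seriesOf P Γ x z = ∑' r, Γ r z * P.qexp x ^ r :=
  tsum_congr fun r => by rw [qexp_nat_mul]

lemma qexp_add_s (x : ℂ) : P.qexp (x + P.s) = P.base * P.qexp x := by
  rw [qexp_add, mul_comm]; rfl

lemma qexp_sub_s (x : ℂ) : P.qexp (x - P.s) = P.qexp x / P.base := by
  rw [qexp_sub]; rfl

/-- Existence, which the choice of `Gam` requires before any of its properties can be used. -/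
lemma isCoeffSeq_gam : IsCoeffSeq P fun r z => P.par.gam r (P.qexp z) where
  holomorphic r := (P.par.differentiable_gam r).comp P.differentiable_qexp
  leading z := by
    rw [Par.gam_zero, qexp_add, qexp_two_mul]; rfl
  normal K hK := by
    have hq := P.differentiable_qexp.continuous
    obtain ⟨U, hU⟩ := hK.exists_bound_of_continuousOn (f := fun y => P.qexp y.1)
      (hq.comp continuous_fst).continuousOn
    obtain ⟨V, hV⟩ := hK.exists_bound_of_continuousOn (f := fun y => P.qexp y.2)
      (hq.comp continuous_snd).continuousOn
    obtain ⟨C, hC⟩ := P.par.exists_norm_gam_mul_pow_le U V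
    refine ⟨fun r => C * (1 / 2) ^ r,
      (summable_geometric_of_lt_one (by norm_num) (by norm_num)).mul_left C, fun r y hy => ?_⟩
    rw [qexp_nat_mul]
    exact hC _ _ (hU y hy) (hV y hy) r
  eigen := by
    rw [meroEq_iff]
    filter_upwards [P.eventually_St_fst_ne_zero, P.eventually_pL0_ne_zero] with y h1 h2
    have := P.par.F_difference_equation (P.qexp y.1) (P.qexp y.2)
    have e : P.par.p = P.base := rfl
    rw [P.opD_asymptOf _ h1 h2]
    simp only [seriesOf_eq, qexp_add_s, qexp_sub_s]
    simp only [Par.F, e] at this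
    rw [this, sub_self, mul_zero]

variable {P} {Γ : ℕ → ℂ → ℂ}

lemma summable_norm_of_isCoeffSeq (h : IsCoeffSeq P Γ) (z : ℂ) {U : ℝ} (hU : 0 < U) :
    Summable fun r => ‖Γ r z‖ * U ^ r := by
  obtain ⟨x, hx⟩ := P.exists_qexp_eq (u := (U : ℂ)) (by exact_mod_cast hU.ne')
  obtain ⟨M, hM, hle⟩ := h.normal {(x, z)} isCompact_singleton
  refine Summable.of_nonneg_of_le (fun r => by positivity) (fun r => ?_) hM
  have := hle r (x, z) rfl
  rwa [qexp_nat_mul, hx, norm_mul, norm_pow, Complex.norm_of_nonneg hU.le] at this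

lemma summable_of_isCoeffSeq (h : IsCoeffSeq P Γ) (z u : ℂ) :
    Summable fun r => Γ r z * u ^ r := by
  refine Summable.of_norm (Summable.of_nonneg_of_le (fun r => norm_nonneg _) (fun r => ?_)
    (summable_norm_of_isCoeffSeq h z (U := ‖u‖ + 1) (by positivity)))
  rw [norm_mul, norm_pow]
  gcongr
  linarith

lemma differentiable_of_isCoeffSeq (h : IsCoeffSeq P Γ) (z : ℂ) :
    Differentiable ℂ fun u : ℂ => ∑' r, Γ r z * u ^ r := by
  intro u
  have := Complex.differentiableOn_tsum_of_summable_norm (F := fun r (u : ℂ) => Γ r z * u ^ r)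
    (summable_norm_of_isCoeffSeq h z (U := ‖u‖ + 1) (by positivity))
    (fun r => by fun_prop) (Metric.isOpen_ball : IsOpen (Metric.ball (0 : ℂ) (‖u‖ + 1)))
    (fun r w hw => by
      have hw' : ‖w‖ < ‖u‖ + 1 := by simpa using hw
      rw [norm_mul, norm_pow]
      gcongr)
  exact this.differentiableAt (Metric.isOpen_ball.mem_nhds (by simp))

lemma coeff_eq_of_eventually_eq {g1 g2 : ℕ → ℂ} (h1 : ∀ u, Summable fun r => g1 r * u ^ r)
    (h2 : ∀ u, Summable fun r => g2 r * u ^ r)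
    (h : ∀ᶠ u in 𝓝 (0 : ℂ), ∑' r, g1 r * u ^ r = ∑' r, g2 r * u ^ r) (r : ℕ) : g1 r = g2 r := by
  have k : ∀ g : ℕ → ℂ, (∀ u, Summable fun r => g r * u ^ r) → HasFPowerSeriesAt
      (fun u => ∑' r, g r * u ^ r) (FormalMultilinearSeries.ofScalars ℂ g) 0 := fun g hg => by
    rw [hasFPowerSeriesAt_iff]
    refine Eventually.of_forall fun u => ?_
    rw [zero_add]
    simp only [FormalMultilinearSeries.coeff_ofScalars, smul_eq_mul, mul_comm (u ^ _)]
    exact (hg u).hasSum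
  have := (k g1 h1).eq_formalMultilinearSeries_of_eventually (k g2 h2) h
  have := congrArg (fun q => q.coeff r) this
  simpa only [FormalMultilinearSeries.coeff_ofScalars] using this

/-- The eigenvalue equation holds only off a zero set. It is extended to all x for z near a generic
point, where the series is then determined by its value at u = 0; the coefficients are entire in z,
so equality spreads to all z. -/
lemma eq_gam_of_isCoeffSeq (h : IsCoeffSeq P Γ) (r : ℕ) (z : ℂ) :
    Γ r z = P.par.gam r (P.qexp z) := by
  obtain ⟨g, ⟨dg, y0, hy0⟩, H⟩ : ∀ᶠ y : ℂ × ℂ in generic,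
      P.qexp y.2 ^ 2 * P.par.pE.eval (P.qexp y.1) * seriesOf P Γ (y.1 + P.s) y.2 +
        (1 - P.base * P.qexp y.1 ^ 2) * seriesOf P Γ (y.1 - P.s) y.2 -
        (P.qexp y.2 * P.par.pL1.eval (P.qexp y.1) +
          (P.qexp y.2 ^ 2 + 1) * P.par.pL0.eval (P.qexp y.1)) *
          seriesOf P Γ y.1 y.2 = 0 ∧ qPochInf (P.base * P.qexp y.2 ^ 2) P.base ≠ 0 := by
    filter_upwards [meroEq_iff.mp h.eigen, P.eventually_St_fst_ne_zero, P.eventually_pL0_ne_zero,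
      tendsto_swap_generic.eventually P.dual.eventually_St_fst_ne_zero,
      P.eventually_qPochInf_snd_sq_ne_zero P.base] with y h1 h2 h3 h4 h5
    have n1 := P.St_ne_zero_of_sub h2
    have n2 := P.dual.St_ne_zero_of_sub h4
    have n3 := P.W_ne_zero y.1 y.2
    have n4 := P.qexp_ne_zero y.2
    rw [P.opD_asymptOf _ h2 h3] at h1
    refine ⟨(mul_eq_zero.mp h1).resolve_left ?_, h5⟩
    simp [*]
  -- By continuity g(y0.1, z) ≠ 0 for z near y0.2, so the generic information is available on an
  -- open set of z.
  have hgen : ∀ᶠ z in 𝓝 y0.2, Γ r z = P.par.gam r (P.qexp z) := by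
    have hz : ∀ᶠ z in 𝓝 y0.2, g (y0.1, z) ≠ 0 :=
      ContinuousAt.eventually_ne (g := fun z => g (y0.1, z))
        (dg.continuous.comp (by fun_prop : Continuous fun z => (y0.1, z))).continuousAt hy0
    filter_upwards [hz] with z hz
    have df := differentiable_of_isCoeffSeq h z
    have dF := P.par.differentiable_F_left (P.qexp z)
    have dq := P.differentiable_qexp
    obtain ⟨f, hf⟩ : ∃ f : ℂ → ℂ, f = fun u => ∑' r, Γ r z * u ^ r := ⟨_, rfl⟩
    rw [← hf] at df
    have hser : ∀ x, seriesOf P Γ x z = f (P.qexp x) := fun x => by rw [seriesOf_eq, hf]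
    simp only [Prod.forall] at H
    -- For fixed z the left-hand side is entire in x and vanishes near y0.1.
    have eqx : ∀ x, P.qexp z ^ 2 * P.par.pE.eval (P.qexp x) * f (P.base * P.qexp x) +
        (1 - P.base * P.qexp x ^ 2) * f (P.qexp x / P.base) -
        (P.qexp z * P.par.pL1.eval (P.qexp x) +
          (P.qexp z ^ 2 + 1) * P.par.pL0.eval (P.qexp x)) * f (P.qexp x) = 0 := by
      intro x
      have dd : Differentiable ℂ fun u =>
          P.qexp z ^ 2 * P.par.pE.eval u * f (P.base * u) +
          (1 - P.base * u ^ 2) * f (u / P.base) -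
          (P.qexp z * P.par.pL1.eval u + (P.qexp z ^ 2 + 1) * P.par.pL0.eval u) * f u := by
        have d1 := P.par.pE.differentiable
        have d2 := P.par.pL1.differentiable
        have d3 := P.par.pL0.differentiable
        fun_prop
      have l1 : AnalyticOnNhd ℂ (fun x => P.qexp z ^ 2 * P.par.pE.eval (P.qexp x) *
          f (P.base * P.qexp x) + (1 - P.base * P.qexp x ^ 2) * f (P.qexp x / P.base) -
        (P.qexp z * P.par.pL1.eval (P.qexp x) +
          (P.qexp z ^ 2 + 1) * P.par.pL0.eval (P.qexp x)) * f (P.qexp x)) Set.univ :=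
        fun x _ => (dd.comp dq).analyticAt x
      have l2 : AnalyticOnNhd ℂ (fun _ : ℂ => (0 : ℂ)) Set.univ := fun y _ => analyticAt_const
      refine congrFun (l1.eq_of_eventuallyEq (z₀ := y0.1) l2 ?_) x
      have hx : ∀ᶠ x in 𝓝 y0.1, g (x, z) ≠ 0 :=
        ContinuousAt.eventually_ne (g := fun x => g (x, z))
          (dg.continuous.comp (by fun_prop : Continuous fun x => (x, z))).continuousAt hz
      filter_upwards [hx] with x hx
      have := (H x z hx).1
      simpa only [hser, qexp_add_s, qexp_sub_s] using this
    have hv := (H y0.1 z hz).2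
    refine coeff_eq_of_eventually_eq (g1 := fun r => Γ r z)
      (g2 := fun r => P.par.gam r (P.qexp z)) (summable_of_isCoeffSeq h z)
      (fun u => (P.par.summable_norm_gam_mul_pow u _).of_norm) ?_ r
    have hpn : ∀ n : ℕ, P.qexp z ^ 2 * P.par.p ^ (n + 1) ≠ 1 := by
      intro n
      have := mul_pow_ne_one_of_qPochInf_ne_zero P.norm_base_lt_one hv n
      rwa [mul_comm P.base, mul_assoc, ← pow_succ'] at this
    have := P.par.eventually_eq_zero_of_difference_equation hpn
      (f := fun u => f u - P.par.F u (P.qexp z)) ((df.sub dF).analyticAt 0) ?_ ?_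
    · filter_upwards [this] with u hu
      rw [hf] at hu
      exact sub_eq_zero.mp hu
    · rw [hf, Par.F_zero]
      simp only
      rw [tsum_eq_single 0 (fun r hr => by rw [zero_pow hr, mul_zero]), pow_zero, mul_one,
        h.leading, qexp_add, qexp_two_mul]
      exact sub_self _
    · filter_upwards [self_mem_nhdsWithin] with u hu
      obtain ⟨x, rfl⟩ := P.exists_qexp_eq hu
      have e1 := eqx x
      have e2 := P.par.F_difference_equation (P.qexp x) (P.qexp z)
      have e : P.par.p = P.base := rfl
      rw [e] at e2 ⊢
      linear_combination e1 - e2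
  have l1 : AnalyticOnNhd ℂ (Γ r) Set.univ := fun x _ => (h.holomorphic r).analyticAt x
  have l2 : AnalyticOnNhd ℂ (fun z => P.par.gam r (P.qexp z)) Set.univ :=
    fun x _ => ((P.par.differentiable_gam r).comp P.differentiable_qexp).analyticAt x
  exact congrFun (l1.eq_of_eventuallyEq l2 hgen) z

variable (P)

/-- By uniqueness the choice of `Gam` is immaterial. -/
lemma Gam_eq (r : ℕ) (z : ℂ) : Gam P r z = P.par.gam r (P.qexp z) :=
  eq_gam_of_isCoeffSeq (Classical.epsilon_spec ⟨_, P.isCoeffSeq_gam⟩) r z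

lemma Phi_eq (x z : ℂ) : Phi P x z =
    W P x z / (St P x * St P.dual z) * P.par.F (P.qexp x) (P.qexp z) := by
  rw [Phi, asymptOf, seriesOf_eq]
  simp only [Gam_eq]
  rfl

/-- The asymptotically free eigenfunction is self-dual. -/
theorem Phi_dual (x z : ℂ) : Phi P.dual z x = Phi P x z := by
  rw [Phi_eq, Phi_eq P, W_dual, par_dual, P.par.F_eq_dual (P.qexp x), mul_comm (St P.dual z)]
  rfl

end Params

end AskeyWilson

end

noncomputable section
namespace AskeyWilson
open Filter Topology Finset

/-! ## Theta functions -/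

section Theta

variable {p : ℂ}

lemma theta_div (hp0 : p ≠ 0) (X : ℂ) : theta (p / X) p = theta X p := by
  rw [theta, theta, div_div_cancel₀ hp0, mul_comm]

lemma theta_mul (hp0 : p ≠ 0) (hp : ‖p‖ < 1) {X : ℂ} (hX : X ≠ 0) :
    theta (p * X) p = -X⁻¹ * theta X p := by
  rw [theta, theta, qPochInf_eq_one_sub_mul hp X, qPochInf_eq_one_sub_mul hp (p / (p * X)),
    show p / (p * X) = X⁻¹ by field_simp, mul_comm p X, show X⁻¹ * p = p / X by field_simp]
  field_simp
  ring

lemma theta_inv (hp0 : p ≠ 0) (hp : ‖p‖ < 1) {X : ℂ} (hX : X ≠ 0) :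
    theta X⁻¹ p = -X⁻¹ * theta X p := by
  rw [← theta_mul hp0 hp hX, ← theta_div hp0 X⁻¹, div_inv_eq_mul]

lemma theta_one (hp : ‖p‖ < 1) : theta 1 p = 0 := by
  rw [theta, qPochInf_eq_zero hp (i := 0) (by simp), zero_mul]

/-- A zero of the theta function is an integral power of the base. -/
lemma exists_zpow_eq_of_theta_eq_zero (hp0 : p ≠ 0) (hp : ‖p‖ < 1) {X : ℂ}
    (h : theta X p = 0) : ∃ n : ℤ, X = p ^ n := by
  have key : ∀ {x : ℂ}, qPochInf x p = 0 → ∃ i : ℕ, x * p ^ i = 1 := fun hx => by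
    by_contra! hne
    exact qPochInf_ne_zero hp hne hx
  rcases mul_eq_zero.mp h with h | h
  · obtain ⟨i, hi⟩ := key h
    exact ⟨-i, by rw [zpow_neg, zpow_natCast]; exact eq_inv_of_mul_eq_one_left hi⟩
  · obtain ⟨i, hi⟩ := key h
    refine ⟨i + 1, ?_⟩
    have hX : X ≠ 0 := by
      rintro rfl
      simp at hi
    rw [zpow_add₀ hp0, zpow_natCast, zpow_one]
    field_simp at hi
    rw [← hi, mul_comm]

/-- Iterated quasi-periodicity. The root r of p turns the exponent N(N-1)/2 of p into an integral
exponent, and induction runs in both directions of N. -/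
lemma theta_zpow_mul (hp0 : p ≠ 0) (hp : ‖p‖ < 1) {r X : ℂ} (hr : r ^ 2 = p) (hX : X ≠ 0)
    (N : ℤ) : theta (p ^ N * X) p = (-1) ^ N * X ^ (-N) * r ^ (-(N * (N - 1))) * theta X p := by
  have hr0 : r ≠ 0 := by
    rintro rfl
    exact hp0 (by rw [← hr]; simp)
  have hpz : ∀ n : ℤ, p ^ n = r ^ (2 * n) := fun n => by
    rw [← hr, zpow_mul]; norm_cast
  have step : ∀ n : ℤ, theta (p ^ (n + 1) * X) p =
      -(r ^ (-(2 * n)) * X⁻¹) * theta (p ^ n * X) p := by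
    intro n
    rw [show p ^ (n + 1) * X = p * (p ^ n * X) by rw [zpow_add_one₀ hp0]; ring,
      theta_mul hp0 hp (mul_ne_zero (zpow_ne_zero n hp0) hX), mul_inv, ← zpow_neg, hpz (-n), mul_neg]
  have hrat : ∀ n : ℤ, (-1 : ℂ) ^ (n + 1) * X ^ (-(n + 1)) * r ^ (-((n + 1) * (n + 1 - 1))) =
      -(r ^ (-(2 * n)) * X⁻¹) * ((-1) ^ n * X ^ (-n) * r ^ (-(n * (n - 1)))) := by
    intro n
    rw [zpow_add_one₀ (by norm_num : (-1 : ℂ) ≠ 0), show -(n + 1) = -n + -1 by ring,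
      zpow_add₀ hX, zpow_neg_one, show -((n + 1) * (n + 1 - 1)) = -(2 * n) + -(n * (n - 1)) by ring,
      zpow_add₀ hr0]
    ring
  induction N using Int.induction_on with
  | zero => simp
  | succ n ih => rw [step, ih, hrat]; ring
  | pred n ih =>
    have h1 := step (-(n : ℤ) - 1)
    have h2 := hrat (-(n : ℤ) - 1)
    rw [sub_add_cancel] at h1 h2
    rw [h1, h2, mul_assoc] at ih
    exact mul_left_cancel₀ (neg_ne_zero.mpr (mul_ne_zero (zpow_ne_zero _ hr0) (inv_ne_zero hX))) ih

lemma qPoch_sq {r : ℂ} (x : ℂ) (n : ℕ) : qPoch (x ^ 2) (r ^ 2) n =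
    qPoch x r n * qPoch (-x) r n := by
  simp only [qPoch, ← Finset.prod_mul_distrib]
  exact Finset.prod_congr rfl fun i _ => by ring

lemma qPoch_two_mul {r : ℂ} (x : ℂ) (n : ℕ) : qPoch x r (2 * n) =
    qPoch x (r ^ 2) n * qPoch (r * x) (r ^ 2) n := by
  induction n with
  | zero => simp [qPoch]
  | succ n ih =>
    rw [show 2 * (n + 1) = 2 * n + 1 + 1 by ring, qPoch_succ, qPoch_succ, ih, qPoch_succ, qPoch_succ]
    ring

/-- First (x²; r²) splits into (x; r)(-x; r); each factor then splits according to the parity of the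
index. -/
lemma qPochInf_sq {r : ℂ} (hr : ‖r‖ < 1) (x : ℂ) : qPochInf (x ^ 2) (r ^ 2) =
    qPochInf x (r ^ 2) * qPochInf (-x) (r ^ 2) * qPochInf (r * x) (r ^ 2) *
      qPochInf (-(r * x)) (r ^ 2) := by
  have hr2 : ‖r ^ 2‖ < 1 := by
    rw [norm_pow]; exact pow_lt_one₀ (norm_nonneg _) hr two_ne_zero
  have h1 : ∀ y, qPochInf y r = qPochInf y (r ^ 2) * qPochInf (r * y) (r ^ 2) := fun y => by
    have l1 := (tendsto_qPoch hr y).comp (tendsto_id.const_mul_atTop' (two_pos : 0 < 2))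
    have l2 := (tendsto_qPoch hr2 y).mul (tendsto_qPoch hr2 (r * y))
    exact tendsto_nhds_unique l1 (l2.congr fun n => (qPoch_two_mul y n).symm)
  have l1 := tendsto_qPoch hr2 (x ^ 2)
  have l2 := (tendsto_qPoch hr x).mul (tendsto_qPoch hr (-x))
  rw [tendsto_nhds_unique l1 (l2.congr fun n => (qPoch_sq x n).symm), h1, h1, mul_neg]
  ring

lemma theta_sq {r : ℂ} (hr0 : r ≠ 0) (hr : ‖r‖ < 1) {x : ℂ} (hx : x ≠ 0) :
    theta (x ^ 2) (r ^ 2) =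
    theta x (r ^ 2) * theta (-x) (r ^ 2) * theta (r * x) (r ^ 2) * theta (-(r * x)) (r ^ 2) := by
  simp only [theta]
  rw [qPochInf_sq hr, show r ^ 2 / x ^ 2 = (r / x) ^ 2 by ring, qPochInf_sq hr,
    show r ^ 2 / (r * x) = r / x by field_simp, show r ^ 2 / -(r * x) = -(r / x) by field_simp,
    show r * (r / x) = r ^ 2 / x by ring, show r ^ 2 / -x = -(r ^ 2 / x) by rw [div_neg]]
  ring

end Theta

/-! ## The three-term relation with explicit nodes -/

/-- A summand of the three-term relation. -/
def vwpNode (p A b c d e f t y1 y2 y3 x z2 z3 s1 s2 s3 s4 : ℂ) : ℂ :=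
  vwp p A b c d e f t * (qPochInf y1 p * qPochInf y2 p * qPochInf y3 p) /
    (x * (qPochInf A p * qPochInf z2 p * qPochInf z3 p) * (qPochInf s1 p * qPochInf s2 p) *
      (qPochInf s3 p * qPochInf s4 p) * qPochInf p p)

lemma vwpNode_def (p A b c d e f t y1 y2 y3 x z2 z3 s1 s2 s3 s4 : ℂ) :
    vwpNode p A b c d e f t y1 y2 y3 x z2 z3 s1 s2 s3 s4 =
      vwp p A b c d e f t * (qPochInf y1 p * qPochInf y2 p * qPochInf y3 p) /
        (x * (qPochInf A p * qPochInf z2 p * qPochInf z3 p) * (qPochInf s1 p * qPochInf s2 p) *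
          (qPochInf s3 p * qPochInf s4 p) * qPochInf p p) := rfl

lemma vwpNode_congr {p A b c d e f t y1 y2 y3 x z2 z3 s1 s2 s3 s4
    A' b' c' d' e' f' t' y1' y2' y3' x' z2' z3' s1' s2' s3' s4' : ℂ}
    (h_A : A = A') (h_b : b = b') (h_c : c = c') (h_d : d = d') (h_e : e = e') (h_f : f = f') (h_t : t = t') (h_y1 : y1 = y1') (h_y2 : y2 = y2')
    (h_y3 : y3 = y3') (h_x : x = x') (h_z2 : z2 = z2') (h_z3 : z3 = z3') (h_s1 : s1 = s1') (h_s2 : s2 = s2') (h_s3 : s3 = s3') (h_s4 : s4 = s4') :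
    vwpNode p A b c d e f t y1 y2 y3 x z2 z3 s1 s2 s3 s4 =
      vwpNode p A' b' c' d' e' f' t' y1' y2' y3' x' z2' z3' s1' s2' s3' s4' := by
  subst h_A h_b h_c h_d h_e h_f h_t h_y1 h_y2 h_y3 h_x h_z2 h_z3 h_s1 h_s2 h_s3 h_s4
  rfl

lemma vwpNode_swap (p A b c d e f t y1 y2 y3 x z2 z3 s1 s2 s3 s4 : ℂ) :
    vwpNode p A b c d e f t y1 y2 y3 x z2 z3 s1 s2 s3 s4 =
      vwpNode p A c b d e f t y1 y2 y3 x z3 z2 s3 s4 s1 s2 := by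
  have : vwp p A b c d e f t = vwp p A c b d e f t := tsum_congr fun r => by ring
  rw [vwpNode, vwpNode, this]
  congr 1
  ring

/-- The nodes are u, 1/u and a/τ. The first two give the series of F(u, ·) and F(1/u, ·), and the
third the series of the Askey–Wilson function. -/
lemma three_term_explicit {p τ u a d β γ t : ℂ} (hp0 : p ≠ 0) (hp : ‖p‖ < 1) (hτ : τ ≠ 0)
    (hu : u ≠ 0) (ha : a ≠ 0) (hd : d ≠ 0) (hβ : β ≠ 0) (hγ : γ ≠ 0)
    (ht : t * (a * d * β * γ) = p ^ 2 * τ) (ht1 : ‖t‖ < 1)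
    (h1 : qPochInf (τ * u ^ 2) p ≠ 0) (h2 : qPochInf (τ / u ^ 2) p ≠ 0) (h3 : qPochInf τ p ≠ 0)
    (h4 : qPochInf (a * u) p ≠ 0) (h5 : qPochInf (a / u) p ≠ 0) (h6 : qPochInf (a ^ 2 / τ) p ≠ 0)
    (k1 : qPochInf (u ^ 2) p ≠ 0) (k2 : qPochInf (1 / u ^ 2) p ≠ 0)
    (k3 : qPochInf (a / (τ * u)) p ≠ 0) (k4 : qPochInf (a * u / τ) p ≠ 0)
    (k5 : qPochInf (τ / (a * u)) p ≠ 0) (k6 : qPochInf (τ * u / a) p ≠ 0) :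
    vwpNode p (τ * u ^ 2) τ (a * u) (d * u) (β * u) (γ * u) t (p / (d * u)) (p / (β * u))
        (p / (γ * u)) u τ (a * u) (1 / u ^ 2) (p * u ^ 2) (a / (τ * u)) (p * τ * u / a) +
      vwpNode p (τ / u ^ 2) τ (a / u) (d / u) (β / u) (γ / u) t (p * u / d) (p * u / β)
        (p * u / γ) (1 / u) τ (a / u) (u ^ 2) (p / u ^ 2) (a * u / τ) (p * τ / (a * u)) +
      vwpNode p (a ^ 2 / τ) (a * u) (a / u) (a * d / τ) (a * β / τ) (a * γ / τ) t
        (p * τ / (a * d)) (p * τ / (a * β)) (p * τ / (a * γ)) (a / τ) (a * u) (a / u)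
        (τ * u / a) (p * a / (τ * u)) (τ / (a * u)) (p * a * u / τ) = 0 := by
  have key := three_term hp0 hp hτ ![u, u⁻¹, a / τ] ![d / τ, β / τ, γ / τ] ?_ ?_ ?_ ?_ (t := t) ?_ ht1
  · rw [Fin.sum_univ_three] at key
    simp only [show (0 : Fin 3) + 1 = 1 from rfl, show (1 : Fin 3) + 1 = 2 from rfl,
      show (2 : Fin 3) + 1 = 0 from rfl, show (0 : Fin 3) + 2 = 2 from rfl,
      show (1 : Fin 3) + 2 = 0 from rfl, show (2 : Fin 3) + 2 = 1 from rfl,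
      Matrix.cons_val_zero, Matrix.cons_val_one, Matrix.cons_val] at key
    simp only [← vwpNode_def] at key
    -- The cyclic order of the nodes puts a/u before τ in the second summand; the swap restores the
    -- order shared with the first.
    rw [← key, vwpNode_swap p (τ * u⁻¹ * u⁻¹)]
    refine congrArg₂ (· + ·) (congrArg₂ (· + ·) ?_ ?_) ?_ <;>
      refine vwpNode_congr ?_ ?_ ?_ ?_ ?_ ?_ ?_ ?_ ?_ ?_ ?_ ?_ ?_ ?_ ?_ ?_ ?_ <;>
      first | with_reducible rfl | field_simp
  · intro k; fin_cases k <;> simp [*]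
  · intro k; fin_cases k <;> simp [*]
  · have e1 : τ * u * u = τ * u ^ 2 := by ring
    have e2 : τ * u⁻¹ * u⁻¹ = τ / u ^ 2 := by field_simp
    have e3 : τ * u * u⁻¹ = τ := by field_simp
    have e4 : τ * u⁻¹ * u = τ := by field_simp
    have e5 : τ * u * (a / τ) = a * u := by field_simp
    have e6 : τ * (a / τ) * u = a * u := by field_simp
    have e7 : τ * u⁻¹ * (a / τ) = a / u := by field_simp
    have e8 : τ * (a / τ) * u⁻¹ = a / u := by field_simp
    have e9 : τ * (a / τ) * (a / τ) = a ^ 2 / τ := by field_simp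
    intro j k
    fin_cases j <;> fin_cases k <;>
      simp only [Fin.zero_eta, Fin.mk_one, Fin.reduceFinMk, Matrix.cons_val_zero,
        Matrix.cons_val_one, Matrix.cons_val, e1, e2, e3, e4, e5, e6, e7, e8, e9] <;> assumption
  · have e1 : u / u⁻¹ = u ^ 2 := by field_simp
    have e2 : u⁻¹ / u = 1 / u ^ 2 := by field_simp
    have e3 : u / (a / τ) = τ * u / a := by field_simp
    have e4 : u⁻¹ / (a / τ) = τ / (a * u) := by field_simp
    have e5 : a / τ / u = a / (τ * u) := by field_simp
    have e6 : a / τ / u⁻¹ = a * u / τ := by field_simp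
    intro j k hjk
    fin_cases j <;> fin_cases k <;> first | exact absurd rfl hjk | skip
    all_goals
      simp only [Fin.zero_eta, Fin.mk_one, Fin.reduceFinMk, Matrix.cons_val_zero,
        Matrix.cons_val_one, Matrix.cons_val, e1, e2, e3, e4, e5, e6]
      assumption
  · simp only [Matrix.cons_val_zero, Matrix.cons_val_one, Matrix.cons_val]
    field_simp
    linear_combination ht

end AskeyWilson

end

noncomputable section
namespace AskeyWilson
open Filter Topology Finset

namespace Par

variable (D : Par)

/-! ## The `c`-function and the Askey–Wilson function in multiplicative form -/

/-- The numerator of the `c`-function. -/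
def cnum (u v : ℂ) : ℂ :=
  theta (D.k / v) D.p * theta (D.dual.b / v) D.p * theta (D.dual.c / v) D.p *
    theta (D.d * (u / v) / D.k) D.p

/-- The denominator of the `c`-function, without its exponential factor. -/
def cden (u v : ℂ) : ℂ := theta (1 / v ^ 2) D.p * theta (D.d * u) D.p

/-- The `c`-function without its exponential factor. -/
def cth (u v : ℂ) : ℂ := D.cnum u v / D.cden u v

/-- The singular term. -/
def stp (u : ℂ) : ℂ := qPochInf (D.p * u / D.a) D.p * qPochInf (D.p * u / D.b) D.p *
  qPochInf (D.p * u / D.c) D.p * qPochInf (D.p * u / D.d) D.p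

/-- The Askey–Wilson function, up to shifted factorials. -/
def awSum (u v : ℂ) : ℂ := vwp D.p (D.a * D.k / D.d * v) (D.a * u) (D.a / u) (D.k * v)
  (D.dual.b * v) (D.dual.c * v) (D.p / (D.dual.d * v))

/-- The Askey–Wilson function. -/
def aw (u v : ℂ) : ℂ := D.awSum u v / (qPochInf (D.a * D.k / D.d * v) D.p *
  (qPochInf (D.p * u / D.d) D.p * qPochInf (D.p / (D.d * u)) D.p *
    qPochInf (D.p * v / D.dual.d) D.p))

lemma dual_dual_b : D.dual.dual.b = D.b := by
  have := D.hk; have := D.ha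
  simp only [dual]
  field_simp

lemma dual_dual_c : D.dual.dual.c = D.c := by
  have := D.hk; have := D.ha
  simp only [dual]
  field_simp

lemma dual_dual_d : D.dual.dual.d = D.d := by
  have := D.hk; have := D.ha
  simp only [dual]
  field_simp

/-- Bookkeeping for the connection formula: all three terms share one nonzero factor, which is
cancelled. -/
lemma connection_algebra {u aτ x1 x2 x3 x1' x2' x3' g y1 y2 y3 t0 t1 m n A F0 F1 H Θ1 Θ2 Θ3 Θ4 Pp : ℂ}
    (hu : u ≠ 0) (haτ : aτ ≠ 0) (n1 : x1 ≠ 0) (n1' : x1' ≠ 0) (hg : g ≠ 0) (hy1 : y1 ≠ 0)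
    (hy2 : y2 ≠ 0) (hy3 : y3 ≠ 0) (h0 : t0 ≠ 0) (h1 : t1 ≠ 0) (hm : m ≠ 0) (hn : n ≠ 0)
    (hA : A ≠ 0) (k1 : Θ1 ≠ 0) (k2 : Θ2 ≠ 0) (k3 : Θ3 ≠ 0) (k4 : Θ4 ≠ 0) (hPp : Pp ≠ 0)
    (key : F0 * (x1 * x2 * x3) / (g * u * t0 * m * Θ3 * (-(aτ / u) * Θ1) * Pp) +
      F1 * (x1' * x2' * x3') / (g * (1 / u) * t0 * n * Θ4 * (-(aτ * u) * Θ2) * Pp) +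
      H * (y1 * y2 * y3) / (aτ * A * m * n * Θ1 * Θ2 * Pp) = 0) :
    H / (A * (x1' * x1 * t1)) = n * x2 * x3 * Θ2 * F0 / (Θ3 * (t0 * t1) * x1' * (y1 * y3 * y2 * g)) +
      m * x2' * x3' * Θ1 * F1 / (Θ4 * (t0 * t1) * x1 * (y1 * y3 * y2 * g)) := by
  have e1 : F0 * (x1 * x2 * x3) / (g * u * t0 * m * Θ3 * (-(aτ / u) * Θ1) * Pp) =
      -(n * x2 * x3 * Θ2 * F0 / (Θ3 * (t0 * t1) * x1' * (y1 * y3 * y2 * g))) *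
        ((y1 * y2 * y3 * x1 * x1' * t1) / (aτ * m * n * Θ1 * Θ2 * Pp)) := by
    field_simp
  have e2 : F1 * (x1' * x2' * x3') / (g * (1 / u) * t0 * n * Θ4 * (-(aτ * u) * Θ2) * Pp) =
      -(m * x2' * x3' * Θ1 * F1 / (Θ4 * (t0 * t1) * x1 * (y1 * y3 * y2 * g))) *
        ((y1 * y2 * y3 * x1 * x1' * t1) / (aτ * m * n * Θ1 * Θ2 * Pp)) := by
    field_simp
  have e3 : H * (y1 * y2 * y3) / (aτ * A * m * n * Θ1 * Θ2 * Pp) =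
      H / (A * (x1' * x1 * t1)) *
        ((y1 * y2 * y3 * x1 * x1' * t1) / (aτ * m * n * Θ1 * Θ2 * Pp)) := by
    field_simp
  rw [e1, e2, e3] at key
  have n0 : (y1 * y2 * y3 * x1 * x1' * t1) / (aτ * m * n * Θ1 * Θ2 * Pp) ≠ 0 := by simp [*]
  generalize (y1 * y2 * y3 * x1 * x1' * t1) / (aτ * m * n * Θ1 * Θ2 * Pp) = N at *
  refine mul_right_cancel₀ n0 ?_
  linear_combination key

/-- The connection formula: the Askey–Wilson function in terms of asymptotically free solutions. -/
theorem aw_eq {u w τ : ℂ} (hτ : τ = D.dual.d * w) (hu : u ≠ 0) (hw : w ≠ 0)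
    (ht : ‖D.p * w / D.dual.d‖ < 1)
    (hf1 : qPochInf (τ / D.p) D.p ≠ 0) (hf2 : qPochInf (D.p * w ^ 2) D.p ≠ 0)
    (h1 : qPochInf (τ * u ^ 2) D.p ≠ 0) (h2 : qPochInf (τ / u ^ 2) D.p ≠ 0)
    (h3 : qPochInf τ D.p ≠ 0) (h3' : qPochInf (D.p / τ) D.p ≠ 0)
    (h4 : qPochInf (D.a * u) D.p ≠ 0)
    (h5 : qPochInf (D.a / u) D.p ≠ 0) (h6 : qPochInf (D.a ^ 2 / τ) D.p ≠ 0)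
    (k1 : theta (u ^ 2) D.p ≠ 0) (k2 : theta (1 / u ^ 2) D.p ≠ 0)
    (k3 : theta (τ / (D.a * u)) D.p ≠ 0) (k4 : theta (τ * u / D.a) D.p ≠ 0)
    (hS : D.stp u ≠ 0) (hS' : D.stp u⁻¹ ≠ 0) (hSd : D.dual.stp w ≠ 0) :
    D.aw u w⁻¹ = D.dual.cth w u * D.F u w / (D.stp u * D.dual.stp w) +
      D.dual.cth w u⁻¹ * D.F u⁻¹ w / (D.stp u⁻¹ * D.dual.stp w) := by
  have hp0 := D.hp0; have hp := D.hp; have ha := D.ha; have hb := D.hb; have hc := D.hc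
  have hd := D.hd; have hk := D.hk; have h := D.habcd
  have hδ : D.dual.d = D.a * D.d / D.k := rfl
  have hδ0 := D.dual.hd
  have hτ0 : τ ≠ 0 := hτ ▸ mul_ne_zero hδ0 hw
  have hp2 : qPochInf D.p D.p ≠ 0 := qPochInf_ne_zero_of_norm_lt hp hp
  have ttl : ∀ {X : ℂ}, theta X D.p ≠ 0 → qPochInf X D.p ≠ 0 := fun h => left_ne_zero_of_mul h
  have i1 : theta (D.a / (τ * u)) D.p = -(D.a / τ / u) * theta (τ * u / D.a) D.p := by
    have := theta_inv hp0 hp (div_ne_zero (mul_ne_zero hτ0 hu) ha)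
    rwa [inv_div, show -(D.a / (τ * u)) = -(D.a / τ / u) by rw [div_div]] at this
  have i2 : theta (D.a * u / τ) D.p = -(D.a / τ * u) * theta (τ / (D.a * u)) D.p := by
    have := theta_inv hp0 hp (div_ne_zero hτ0 (mul_ne_zero ha hu))
    rwa [inv_div, show -(D.a * u / τ) = -(D.a / τ * u) by ring] at this
  have haτ : D.a / τ ≠ 0 := div_ne_zero ha hτ0
  have k3' : theta (D.a * u / τ) D.p ≠ 0 := by
    rw [i2]
    exact mul_ne_zero (neg_ne_zero.mpr (mul_ne_zero haτ hu)) k3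
  have k4' : theta (D.a / (τ * u)) D.p ≠ 0 := by
    rw [i1]
    exact mul_ne_zero (neg_ne_zero.mpr (div_ne_zero haτ hu)) k4
  -- With β = p/b, γ = p/c and t = pw/d̃ the balancing condition amounts to abcd = pk².
  have key := three_term_explicit (t := D.p * w / D.dual.d) (β := D.p / D.b) (γ := D.p / D.c)
    hp0 hp hτ0 hu ha hd (by simp [*]) (by simp [*]) (by
      rw [hτ, hδ]; field_simp; linear_combination (-1 : ℂ) * h) ht h1 h2 h3 h4 h5 h6 (ttl k1)
    (ttl k2) (ttl k4') (ttl k3') (ttl k3) (ttl k4)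
  have hS1 := hS; have hS2 := hS'; have hS3 := hSd
  simp only [stp, mul_ne_zero_iff] at hS1 hS2 hS3
  have G0 := D.qPochInf_mul_F hu hw ht (by rwa [← hδ, ← hτ]) hf2
  have G1 := D.qPochInf_mul_F (inv_ne_zero hu) hw ht (by rwa [← hδ, ← hτ]) hf2
  rw [← hδ, ← hτ] at G0 G1
  rw [inv_pow, ← div_eq_mul_inv, ← div_eq_mul_inv, ← div_eq_mul_inv, ← div_eq_mul_inv,
    ← div_eq_mul_inv] at G1
  have hg : qPochInf (D.p * w / D.dual.d) D.p ≠ 0 := qPochInf_ne_zero_of_norm_lt hp ht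
  have e0 : ∀ X Y : ℂ, Y = D.p / X → qPochInf X D.p * qPochInf Y D.p = theta X D.p :=
    fun X Y hXY => by rw [theta, hXY]
  rw [vwpNode, vwpNode, vwpNode, e0 (1 / u ^ 2) (D.p * u ^ 2) (by field_simp),
    e0 (D.a / (τ * u)) (D.p * τ * u / D.a) (by field_simp),
    e0 (u ^ 2) (D.p / u ^ 2) (by field_simp), e0 (D.a * u / τ) (D.p * τ / (D.a * u)) (by field_simp),
    e0 (τ * u / D.a) (D.p * D.a / (τ * u)) (by field_simp),
    e0 (τ / (D.a * u)) (D.p * D.a * u / τ) (by field_simp), i1, i2] at key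
  have V0 : vwp D.p (τ * u ^ 2) τ (D.a * u) (D.d * u) (D.p / D.b * u) (D.p / D.c * u)
      (D.p * w / D.dual.d) = qPochInf (τ * u ^ 2) D.p * D.F u w /
        qPochInf (D.p * w / D.dual.d) D.p := by
    rw [eq_div_iff hg, G0, mul_comm]
  have V1 : vwp D.p (τ / u ^ 2) τ (D.a / u) (D.d / u) (D.p / D.b / u) (D.p / D.c / u)
      (D.p * w / D.dual.d) = qPochInf (τ / u ^ 2) D.p * D.F u⁻¹ w /
        qPochInf (D.p * w / D.dual.d) D.p := by
    rw [eq_div_iff hg, G1, mul_comm]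
  -- The node a/τ gives the leading parameter a²/τ = (ak/d) w⁻¹, hence the Askey–Wilson series at
  -- the inverted spectral variable.
  have V2 : vwp D.p (D.a ^ 2 / τ) (D.a * u) (D.a / u) (D.a * D.d / τ) (D.a * (D.p / D.b) / τ)
      (D.a * (D.p / D.c) / τ) (D.p * w / D.dual.d) = D.awSum u w⁻¹ := by
    rw [awSum, show D.a * D.k / D.d * w⁻¹ = D.a ^ 2 / τ by rw [hτ, hδ]; field_simp,
      show D.p / (D.dual.d * w⁻¹) = D.p * w / D.dual.d by field_simp,
      show D.k * w⁻¹ = D.a * D.d / τ by rw [hτ, hδ]; field_simp,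
      show D.dual.c * w⁻¹ = D.a * (D.p / D.b) / τ by
        rw [hτ, hδ, show D.dual.c = D.a * D.c / D.k from rfl]; field_simp; linear_combination h,
      show D.dual.b * w⁻¹ = D.a * (D.p / D.c) / τ by
        rw [hτ, hδ, show D.dual.b = D.a * D.b / D.k from rfl]; field_simp; linear_combination h]
    exact tsum_congr fun r => by ring
  rw [V0, V1, V2] at key
  have alg := connection_algebra (u := u) (aτ := D.a / τ)
    (x1 := qPochInf (D.p / (D.d * u)) D.p) (x2 := qPochInf (D.b / u) D.p)
    (x3 := qPochInf (D.c / u) D.p) (x1' := qPochInf (D.p * u / D.d) D.p)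
    (x2' := qPochInf (D.b * u) D.p) (x3' := qPochInf (D.c * u) D.p)
    (g := qPochInf (D.p * w / D.dual.d) D.p) (y1 := qPochInf (D.p * w / D.dual.a) D.p)
    (y2 := qPochInf (D.p * w / D.dual.c) D.p) (y3 := qPochInf (D.p * w / D.dual.b) D.p)
    (t0 := qPochInf τ D.p) (t1 := qPochInf (D.p / τ) D.p) (m := qPochInf (D.a * u) D.p)
    (n := qPochInf (D.a / u) D.p) (A := qPochInf (D.a ^ 2 / τ) D.p) (F0 := D.F u w)
    (F1 := D.F u⁻¹ w) (H := D.awSum u w⁻¹) (Θ1 := theta (τ * u / D.a) D.p)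
    (Θ2 := theta (τ / (D.a * u)) D.p) (Θ3 := theta (1 / u ^ 2) D.p) (Θ4 := theta (u ^ 2) D.p)
    (Pp := qPochInf D.p D.p) hu haτ
    (by have := hS2.2; rwa [← div_eq_mul_inv, div_div, mul_comm u] at this) hS1.2 hg
    hS3.1.1.1 hS3.1.2 hS3.1.1.2 h3 h3' h4 h5 h6 k4 k3 k2 k1 hp2 ?_
  · rw [aw, show D.a * D.k / D.d * w⁻¹ = D.a ^ 2 / τ by rw [hτ, hδ]; field_simp,
      show D.p * w⁻¹ / D.dual.d = D.p / τ by rw [hτ]; field_simp, alg]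
    rw [cth, cth, cnum, cnum, cden, cden, dual_dual_b, dual_dual_c, show D.dual.p = D.p from rfl,
      show D.dual.k = D.a from rfl, ← hτ]
    have q : ∀ X : ℂ, X ≠ 0 → theta (X / u) D.p = qPochInf (X / u) D.p * qPochInf (D.p * u / X) D.p :=
      fun X hX => by rw [theta, div_div_eq_mul_div]
    have q' : ∀ X : ℂ, X ≠ 0 → theta (X / u⁻¹) D.p =
        qPochInf (X * u) D.p * qPochInf (D.p * u⁻¹ / X) D.p := fun X hX => by
      rw [theta, div_inv_eq_mul, show D.p / (X * u) = D.p * u⁻¹ / X by field_simp]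
    rw [q _ ha, q _ hb, q _ hc, q' _ ha, q' _ hb, q' _ hc,
      show D.dual.d * (w / u) / D.a = τ / (D.a * u) by rw [hτ]; field_simp,
      show D.dual.d * (w / u⁻¹) / D.a = τ * u / D.a by rw [hτ]; field_simp,
      show 1 / u⁻¹ ^ 2 = u ^ 2 by field_simp, show theta τ D.p =
        qPochInf τ D.p * qPochInf (D.p / τ) D.p from rfl]
    simp only [stp, show D.dual.p = D.p from rfl]
    rw [show D.p * u⁻¹ / D.d = D.p / (D.d * u) by field_simp]
    obtain ⟨⟨⟨z1, z2⟩, z3⟩, z4⟩ := hS1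
    obtain ⟨⟨⟨z1', z2'⟩, z3'⟩, z4'⟩ := hS2
    generalize qPochInf (D.p * u / D.a) D.p = Z1 at *
    generalize qPochInf (D.p * u / D.b) D.p = Z2 at *
    generalize qPochInf (D.p * u / D.c) D.p = Z3 at *
    generalize qPochInf (D.p * u⁻¹ / D.a) D.p = Z1' at *
    generalize qPochInf (D.p * u⁻¹ / D.b) D.p = Z2' at *
    generalize qPochInf (D.p * u⁻¹ / D.c) D.p = Z3' at *
    clear alg key V0 V1 V2 G0 G1
    congr 1
    · field_simp
    · field_simp
  · refine Eq.trans ?_ key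
    rw [show D.p / (D.p / D.b * u) = D.b / u by field_simp,
      show D.p / (D.p / D.c * u) = D.c / u by field_simp,
      show D.p * u / (D.p / D.b) = D.b * u by field_simp,
      show D.p * u / (D.p / D.c) = D.c * u by field_simp,
      show D.p * τ / (D.a * D.d) = D.p * w / D.dual.a by
        rw [hτ, hδ, show D.dual.a = D.k from rfl]; field_simp,
      show D.p * τ / (D.a * (D.p / D.b)) = D.p * w / D.dual.c by
        rw [hτ, hδ, show D.dual.c = D.a * D.c / D.k from rfl]; field_simp; linear_combination h,
      show D.p * τ / (D.a * (D.p / D.c)) = D.p * w / D.dual.b by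
        rw [hτ, hδ, show D.dual.b = D.a * D.b / D.k from rfl]; field_simp; linear_combination h]
    generalize qPochInf (τ * u ^ 2) D.p = W1 at *
    generalize qPochInf (τ / u ^ 2) D.p = W2 at *
    clear V0 V1 V2 G0 G1
    congr 1
    · congr 1
      · field_simp
      · field_simp
    · field_simp

end Par

end AskeyWilson

end

/-! ### Self-duality of the Askey–Wilson function -/

noncomputable section
namespace AskeyWilson
open Filter Topology Finset

namespace Par

variable (D : Par)

/-- Two applications of Bailey's transformation to the Askey–Wilson function. -/
lemma awSum_dual {u v : ℂ} (hu : u ≠ 0) (hv : v ≠ 0)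
    (g1 : qPochInf (D.p * D.a / D.d) D.p ≠ 0) (g2 : qPochInf (D.a * D.c) D.p ≠ 0)
    (g3 : qPochInf (D.a * D.b) D.p ≠ 0) (g4 : qPochInf (D.p * D.c / D.d) D.p ≠ 0)
    (g5 : qPochInf (D.b * D.c) D.p ≠ 0) (g6 : qPochInf (D.dual.c / (D.k * D.p)) D.p ≠ 0)
    (k1 : qPochInf (D.a * D.k / D.d * v) D.p ≠ 0) (k2 : qPochInf (D.a * D.c / D.d * u) D.p ≠ 0)
    (k3 : qPochInf (D.k * D.a / D.dual.d * u) D.p ≠ 0)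
    (k4 : qPochInf (D.p * D.k / D.d * (u * v)) D.p ≠ 0)
    (k5 : qPochInf (D.p * D.k / D.d * (v / u)) D.p ≠ 0)
    (k6 : qPochInf (D.p * D.k / D.d * (u / v)) D.p ≠ 0)
    (k7 : qPochInf (D.b / (D.p * u)) D.p ≠ 0) (k8 : qPochInf (1 / (D.dual.d * v)) D.p ≠ 0)
    (k9 : qPochInf (D.k / (D.c * D.p) * (v / u)) D.p ≠ 0)
    (k10 : qPochInf (1 / (D.d * u)) D.p ≠ 0)
    (t1 : ‖D.p / (D.dual.d * v)‖ < 1) (t2 : ‖D.b / u‖ < 1) (t3 : ‖D.p / (D.d * u)‖ < 1) :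
    qPochInf (D.p / (D.dual.d * v)) D.p * qPochInf (D.k * D.a / D.dual.d * u) D.p * D.awSum u v =
      qPochInf (D.a * D.k / D.d * v) D.p * qPochInf (D.p / (D.d * u)) D.p * D.dual.awSum v u := by
  have hp0 := D.hp0; have hp := D.hp; have ha := D.ha; have hb := D.hb; have hc := D.hc
  have hd := D.hd; have hk := D.hk; have h := D.habcd
  have hδ : D.dual.d = D.a * D.d / D.k := rfl
  have hct : D.dual.c = D.a * D.c / D.k := rfl
  have hbt : D.dual.b = D.a * D.b / D.k := rfl
  have hδ0 := D.dual.hd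
  have hct0 := D.dual.hc
  have hbt0 := D.dual.hb
  have nz : ∀ {x y : ℂ}, qPochInf x D.p ≠ 0 → y = x → qPochInf y D.p ≠ 0 := fun hx hy => hy ▸ hx
  have sh : ∀ {x y : ℂ}, qPochInf x D.p ≠ 0 → y = x * D.p → qPochInf y D.p ≠ 0 := fun hx hy => by
    have := qPochInf_shift_ne_zero hp hx 1
    rwa [pow_one, ← hy] at this
  have ehl : D.a * D.c / D.d * u * (D.a / u * (D.k * v) * (D.dual.b * v)) =
      D.p * (D.a * D.k / D.d * v) ^ 2 := by
    rw [hbt]; field_simp; linear_combination h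
  have ehl2 : D.k * D.a / D.dual.d * u * (D.dual.c * v * (D.dual.c / v) * (D.p * u / D.d)) =
      D.p * (D.a * D.c / D.d * u) ^ 2 := by
    rw [hct, hδ]; field_simp
  have y1 : D.a * D.k / D.d * v * D.p / (D.a / u) = D.p * D.k / D.d * (u * v) := by field_simp
  have y2 : D.a * D.k / D.d * v * D.p / (D.k * v) = D.p * D.a / D.d := by field_simp
  have y3 : D.a * D.k / D.d * v * D.p / (D.dual.b * v) = D.a * D.c := by
    rw [hbt]; field_simp; linear_combination -h
  have y4 : D.a * D.k / D.d * v * D.p / (D.a * u) = D.p * D.k / D.d * (v / u) := by field_simp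
  have y5 : D.a * D.k / D.d * v * D.p / (D.dual.c * v) = D.a * D.b := by
    rw [hct]; field_simp; linear_combination -h
  have y6 : D.a * D.c / D.d * u * D.p / (D.a * u) = D.p * D.c / D.d := by field_simp
  have y7 : D.a * D.c / D.d * u * D.p / (D.dual.c * v) = D.p * D.k / D.d * (u / v) := by
    rw [hct]; field_simp
  have y8 : D.a * D.k / D.d * v / (D.a * u * (D.dual.c * v)) = D.b / (D.p * u) := by
    rw [hct]; field_simp; linear_combination -h
  have y9 : D.a * D.c / D.d * u / (D.a * u * (D.dual.c * v)) = 1 / (D.dual.d * v) := by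
    rw [hct, hδ]; field_simp
  have y10 : D.a * D.k / D.d * v / (D.a * D.c / D.d * u * D.p) = D.k / (D.c * D.p) * (v / u) := by
    field_simp
  have z1 : D.a * D.c / D.d * u * D.p / (D.dual.c / v) = D.p * D.k / D.d * (u * v) := by
    rw [hct]; field_simp
  have z2 : D.a * D.c / D.d * u * D.p / (D.p * u / D.d) = D.a * D.c := by field_simp
  have z3 : D.a * D.c / D.d * u * D.p / (D.c * u) = D.p * D.a / D.d := by field_simp
  have z4 : D.k * D.a / D.dual.d * u * D.p / (D.a * u) = D.b * D.c := by
    rw [hδ]; field_simp; linear_combination -h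
  have z5 : D.k * D.a / D.dual.d * u * D.p / (D.c * u) = D.a * D.b := by
    rw [hδ]; field_simp; linear_combination -h
  have z6 : D.a * D.c / D.d * u / (D.a * u * (D.c * u)) = 1 / (D.d * u) := by field_simp
  have z7 : D.k * D.a / D.dual.d * u / (D.a * u * (D.c * u)) = D.b / (D.p * u) := by
    rw [hδ]; field_simp; linear_combination -h
  have z8 : D.a * D.c / D.d * u / (D.k * D.a / D.dual.d * u * D.p) = D.dual.c / (D.k * D.p) := by
    rw [hδ, hct]; field_simp
  have e1 : D.a * D.c / D.d * u * D.p / (D.a * u * (D.dual.c * v)) = D.p / (D.dual.d * v) := by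
    rw [hct, hδ]; field_simp
  have e2 : D.a * D.k / D.d * v * D.p / (D.a * u * (D.dual.c * v)) = D.b / u := by
    rw [hct]; field_simp; linear_combination -h
  have e3 : D.k * D.a / D.dual.d * u * D.p / (D.a * u * (D.c * u)) = D.b / u := by
    rw [hδ]; field_simp; linear_combination -h
  have e4 : D.a * D.c / D.d * u * D.p / (D.a * u * (D.c * u)) = D.p / (D.d * u) := by field_simp
  -- The first transformation keeps au and c̃v and leads to the intermediate parameter (ac/d)u, with
  -- argument b/u.
  have T1 := BaileyGeneric.vwp_transformation (p := D.p) (a := D.a * D.k / D.d * v) (b := D.a / u)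
    (c := D.k * v) (d := D.dual.b * v) (e := D.a * u) (f := D.dual.c * v)
    (l := D.a * D.c / D.d * u)
    { hp0 := hp0, hp := hp, ha := by positivity, hb := by positivity, hc := by positivity,
      hd := by positivity, he := by positivity, hf := by positivity, hl := ehl,
      hap := sh k1 rfl, hlp := sh k2 rfl, hab := nz k4 y1, hac := nz g1 y2, had := nz g2 y3,
      hae := nz k5 y4, haf := nz g3 y5, hle := nz g4 y6, hlf := nz k6 y7, haef := nz k7 y8,
      hlef := nz k8 y9, hal := nz k9 y10 }
  -- The second keeps au and cu and arrives at the dual series. The intermediate argument b/u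
  -- disappears from the result.
  have T2 := BaileyGeneric.vwp_transformation (p := D.p) (a := D.a * D.c / D.d * u)
    (b := D.dual.c * v) (c := D.dual.c / v) (d := D.p * u / D.d) (e := D.a * u) (f := D.c * u)
    (l := D.k * D.a / D.dual.d * u)
    { hp0 := hp0, hp := hp, ha := by positivity, hb := by positivity, hc := by positivity,
      hd := by positivity, he := by positivity, hf := by positivity, hl := ehl2,
      hap := sh k2 rfl, hlp := sh k3 rfl, hab := nz k6 y7, hac := nz k4 z1, had := nz g2 z2,
      hae := nz g4 y6, haf := nz g1 z3, hle := nz g5 z4, hlf := nz g3 z5, haef := nz k10 z6,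
      hlef := nz k7 z7, hal := nz g6 z8 }
  rw [e1, e2] at T1
  rw [e3, e4] at T2
  have T1' := T1 t1 t2
  have T2' := T2 t2 t3
  rw [show D.a * D.c / D.d * u * (D.a / u) / (D.a * D.k / D.d * v) = D.dual.c / v by
      rw [hct]; field_simp,
    show D.a * D.c / D.d * u * (D.k * v) / (D.a * D.k / D.d * v) = D.c * u by field_simp,
    show D.a * D.c / D.d * u * (D.dual.b * v) / (D.a * D.k / D.d * v) = D.p * u / D.d by
      rw [hbt]; field_simp; linear_combination h] at T1'
  rw [show D.k * D.a / D.dual.d * u * (D.dual.c * v) / (D.a * D.c / D.d * u) = D.k * v by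
      rw [hct, hδ]; field_simp,
    show D.k * D.a / D.dual.d * u * (D.dual.c / v) / (D.a * D.c / D.d * u) = D.k / v by
      rw [hct, hδ]; field_simp,
    show D.k * D.a / D.dual.d * u * (D.p * u / D.d) / (D.a * D.c / D.d * u) = D.b * u by
      rw [hδ]; field_simp; linear_combination -h] at T2'
  have s1 : vwp D.p (D.a * D.k / D.d * v) (D.a / u) (D.k * v) (D.dual.b * v) (D.a * u)
      (D.dual.c * v) (D.p / (D.dual.d * v)) = D.awSum u v := tsum_congr fun r => by ring
  have s2 : vwp D.p (D.k * D.a / D.dual.d * u) (D.k * v) (D.k / v) (D.b * u) (D.a * u)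
      (D.c * u) (D.p / (D.d * u)) = D.dual.awSum v u := by
    rw [awSum, dual_dual_b, dual_dual_c, dual_dual_d]
    exact tsum_congr fun r => by simp only [dual]; ring
  have s3 : vwp D.p (D.a * D.c / D.d * u) (D.dual.c / v) (D.c * u) (D.p * u / D.d) (D.a * u)
      (D.dual.c * v) (D.b / u) = vwp D.p (D.a * D.c / D.d * u) (D.dual.c * v) (D.dual.c / v)
      (D.p * u / D.d) (D.a * u) (D.c * u) (D.b / u) := tsum_congr fun r => by ring
  rw [s1, s3] at T1'
  rw [s2] at T2'
  refine mul_left_cancel₀ k2 ?_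
  linear_combination qPochInf (D.k * D.a / D.dual.d * u) D.p * T1' +
    qPochInf (D.a * D.k / D.d * v) D.p * T2'

end Par

end AskeyWilson

end

noncomputable section
namespace AskeyWilson
open Filter Topology Finset

lemma IsNonzeroEntire.comp {h : ℂ × ℂ → ℂ} (hh : IsNonzeroEntire h) {φ ψ : ℂ × ℂ → ℂ × ℂ}
    (hφ : Differentiable ℂ φ) (hψ : ∀ y, φ (ψ y) = y) : IsNonzeroEntire fun y => h (φ y) := by
  obtain ⟨dh, y, hy⟩ := hh
  exact ⟨dh.comp hφ, ψ y, by simpa [hψ] using hy⟩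

namespace Params

variable (P : Params)

/-! ## Translation to multiplicative form -/

lemma St_eq_stp (x : ℂ) : St P x = P.par.stp (P.qexp x) := St_eq P x

lemma St_dual_eq_stp (z : ℂ) : St P.dual z = P.par.dual.stp (P.qexp z) := by
  rw [St_eq_stp, par_dual]; rfl

lemma cfun_eq (x z : ℂ) : cfun P x z = P.par.cth (P.qexp x) (P.qexp z) / W P x z := by
  have e1 : P.par.dual.b = P.dual.b := P.dual_b.symm
  have e2 : P.par.dual.c = P.dual.c := P.dual_c.symm
  rw [cfun, Par.cth, Par.cnum, Par.cden, e1, e2, div_div, mul_comm (W P x z),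
    show -2 * z = -(2 * z) by ring, qexp_sub, qexp_neg, qexp_neg, qexp_two_mul]
  simp only [div_eq_mul_inv, one_mul]
  rfl

/-- The exponential W of Φ cancels the one in the denominator of c, which leaves functions of u and
v alone. -/
lemma PhiTilde_eq (x z : ℂ) : PhiTilde P x z =
    P.par.cth (P.qexp x) (P.qexp z) * P.par.F (P.qexp x) (P.qexp z) /
      (P.par.stp (P.qexp x) * P.par.dual.stp (P.qexp z)) := by
  have := P.W_ne_zero x z
  rw [PhiTilde, cfun_eq, Phi_eq, St_eq_stp, St_dual_eq_stp]
  generalize W P x z = w at *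
  field_simp

/-! ## Generic nonvanishing of shifted factorials and theta functions -/

lemma qexp_zpow_mul (i j : ℤ) (y : ℂ × ℂ) :
    P.qexp y.1 ^ i * P.qexp y.2 ^ j = P.qexp (i * y.1 + j * y.2) := by
  rw [qexp_add, qexp_int_mul, qexp_int_mul]

/-- Since i and j are not both zero, ix + jz takes every complex value, so the argument can be made
smaller than 1. -/
lemma isNonzeroEntire_qPochInf_zpow (c : ℂ) {i j : ℤ} (h : i ≠ 0 ∨ j ≠ 0) :
    IsNonzeroEntire fun y : ℂ × ℂ =>
      qPochInf (c * (P.qexp y.1 ^ i * P.qexp y.2 ^ j)) P.base := by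
  simp only [qexp_zpow_mul]
  refine P.isNonzeroEntire_qPochInf c (L := fun y => i * y.1 + j * y.2) (by fun_prop) fun t => ?_
  rcases h with h | h
  · have : (i : ℂ) ≠ 0 := by exact_mod_cast h
    exact ⟨(t / i, 0), by field_simp; ring⟩
  · have : (j : ℂ) ≠ 0 := by exact_mod_cast h
    exact ⟨(0, t / j), by field_simp; ring⟩

lemma isNonzeroEntire_theta_zpow (c : ℂ) {i j : ℤ} (h : i ≠ 0 ∨ j ≠ 0) :
    IsNonzeroEntire fun y : ℂ × ℂ =>
      theta (c * (P.qexp y.1 ^ i * P.qexp y.2 ^ j)) P.base := by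
  have e : ∀ y : ℂ × ℂ, P.base / (c * (P.qexp y.1 ^ i * P.qexp y.2 ^ j)) =
      P.base / c * (P.qexp y.1 ^ (-i) * P.qexp y.2 ^ (-j)) := fun y => by
    rw [zpow_neg, zpow_neg, div_mul_eq_div_div, div_eq_mul_inv _ (_ * _), mul_inv]
  simp only [theta, e]
  exact (P.isNonzeroEntire_qPochInf_zpow c h).mul
    (P.isNonzeroEntire_qPochInf_zpow _ (by simpa using h))

lemma eventually_qPochInf_zpow_ne_zero (c : ℂ) (i j : ℤ) (h : i ≠ 0 ∨ j ≠ 0) :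
    ∀ᶠ y : ℂ × ℂ in generic, qPochInf (c * (P.qexp y.1 ^ i * P.qexp y.2 ^ j)) P.base ≠ 0 :=
  (P.isNonzeroEntire_qPochInf_zpow c h).eventually_ne_zero

lemma eventually_theta_zpow_ne_zero (c : ℂ) (i j : ℤ) (h : i ≠ 0 ∨ j ≠ 0) :
    ∀ᶠ y : ℂ × ℂ in generic, theta (c * (P.qexp y.1 ^ i * P.qexp y.2 ^ j)) P.base ≠ 0 :=
  (P.isNonzeroEntire_theta_zpow c h).eventually_ne_zero

lemma isNonzeroEntire_stp_fst : IsNonzeroEntire fun y : ℂ × ℂ => P.par.stp (P.qexp y.1) := by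
  have e : ∀ (c : ℂ) (y : ℂ × ℂ), P.base * P.qexp y.1 / c =
      P.base / c * (P.qexp y.1 ^ (1 : ℤ) * P.qexp y.2 ^ (0 : ℤ)) := fun c y => by
    rw [zpow_one, zpow_zero]; ring
  have k := fun c => P.isNonzeroEntire_qPochInf_zpow (P.base / c) (i := 1) (j := 0) (by norm_num)
  simp only [Par.stp, show P.par.p = P.base from rfl, e]
  exact (((k _).mul (k _)).mul (k _)).mul (k _)

lemma isNonzeroEntire_dual_stp_snd :
    IsNonzeroEntire fun y : ℂ × ℂ => P.par.dual.stp (P.qexp y.2) := by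
  have := P.dual.isNonzeroEntire_stp_fst
  rw [par_dual] at this
  exact this.comp (φ := fun y => (y.2, y.1)) (ψ := fun y => (y.2, y.1))
    (by fun_prop) fun _ => rfl

lemma isNonzeroEntire_cden :
    IsNonzeroEntire fun y : ℂ × ℂ => P.par.cden (P.qexp y.1) (P.qexp y.2) := by
  have e1 : ∀ y : ℂ × ℂ, 1 / P.qexp y.2 ^ 2 =
      1 * (P.qexp y.1 ^ (0 : ℤ) * P.qexp y.2 ^ (-2 : ℤ)) := fun y => by
    rw [zpow_zero, one_mul, one_mul, one_div, zpow_neg]; norm_cast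
  have e2 : ∀ y : ℂ × ℂ, P.par.d * P.qexp y.1 =
      P.par.d * (P.qexp y.1 ^ (1 : ℤ) * P.qexp y.2 ^ (0 : ℤ)) := fun y => by
    rw [zpow_zero, zpow_one, mul_one]
  simp only [Par.cden, e1, e2]
  exact (P.isNonzeroEntire_theta_zpow 1 (by norm_num)).mul
    (P.isNonzeroEntire_theta_zpow _ (by norm_num))

lemma differentiable_cnum :
    Differentiable ℂ fun y : ℂ × ℂ => P.par.cnum (P.qexp y.1) (P.qexp y.2) := by
  have e1 : ∀ (c : ℂ) (y : ℂ × ℂ), c / P.qexp y.2 =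
      c * (P.qexp y.1 ^ (0 : ℤ) * P.qexp y.2 ^ (-1 : ℤ)) := fun c y => by
    rw [zpow_zero, one_mul, zpow_neg_one, div_eq_mul_inv]
  have e2 : ∀ y : ℂ × ℂ, P.par.d * (P.qexp y.1 / P.qexp y.2) / P.par.k =
      P.par.d / P.par.k * (P.qexp y.1 ^ (1 : ℤ) * P.qexp y.2 ^ (-1 : ℤ)) := fun y => by
    rw [zpow_one, zpow_neg_one]; ring
  have k := fun c => P.isNonzeroEntire_theta_zpow c (i := 0) (j := -1) (by norm_num)
  simp only [Par.cnum, e2]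
  simp only [e1]
  exact ((((k _).mul (k _)).mul (k _)).mul
    (P.isNonzeroEntire_theta_zpow _ (by norm_num))).1

lemma differentiable_F :
    Differentiable ℂ fun y : ℂ × ℂ => P.par.F (P.qexp y.1) (P.qexp y.2) := by
  have d := P.differentiable_qexp
  exact P.par.differentiable_F.comp
    (g := fun w : ℂ × ℂ => P.par.F w.1 w.2) (f := fun y : ℂ × ℂ => (P.qexp y.1, P.qexp y.2))
    ((d.comp differentiable_fst).prodMk (d.comp differentiable_snd))

lemma isMeromorphic_PhiTilde : IsMeromorphic (PhiTilde P) := by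
  refine ⟨fun y => P.par.cnum (P.qexp y.1) (P.qexp y.2) * P.par.F (P.qexp y.1) (P.qexp y.2),
    fun y => P.par.cden (P.qexp y.1) (P.qexp y.2) *
      (P.par.stp (P.qexp y.1) * P.par.dual.stp (P.qexp y.2)),
    P.differentiable_cnum.mul P.differentiable_F, P.isNonzeroEntire_cden.mul
      (P.isNonzeroEntire_stp_fst.mul P.isNonzeroEntire_dual_stp_snd), fun x z _ => ?_⟩
  rw [PhiTilde_eq, Par.cth, div_mul_eq_mul_div, div_div]

end Params

lemma IsMeromorphic.comp {F : ℂ → ℂ → ℂ} (hF : IsMeromorphic F) {φ ψ : ℂ × ℂ → ℂ × ℂ}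
    (hφ : Differentiable ℂ φ) (hψ : ∀ y, φ (ψ y) = y) :
    IsMeromorphic fun x z => F (φ (x, z)).1 (φ (x, z)).2 := by
  obtain ⟨f, g, df, hg, h⟩ := hF
  exact ⟨fun y => f (φ y), fun y => g (φ y), df.comp hφ, hg.comp hφ hψ,
    fun x z hxz => h _ _ hxz⟩

lemma IsMeromorphic.add {F G : ℂ → ℂ → ℂ} (hF : IsMeromorphic F) (hG : IsMeromorphic G) :
    IsMeromorphic fun x z => F x z + G x z := by
  obtain ⟨f1, g1, df1, hg1, h1⟩ := hF
  obtain ⟨f2, g2, df2, hg2, h2⟩ := hG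
  refine ⟨fun y => f1 y * g2 y + g1 y * f2 y, fun y => g1 y * g2 y,
    (df1.mul hg2.1).add (hg1.1.mul df2), hg1.mul hg2, fun x z hxz => ?_⟩
  have n1 := left_ne_zero_of_mul hxz
  have n2 := right_ne_zero_of_mul hxz
  show F x z + G x z = _
  rw [h1 x z n1, h2 x z n2, div_add_div _ _ n1 n2]

namespace Params

variable (P : Params)

/-! ## The `c`-function -/

/-- After cross-multiplication both sides are entire, so the symmetry of c holds at every point,
also at zeros of the denominators, where it will be evaluated. -/
lemma cross_of_meroEq (h : MeroEq (cfun P) fun x z => cfun P.dual z x) {u v : ℂ} (hu : u ≠ 0)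
    (hv : v ≠ 0) : P.par.cnum u v * P.par.dual.cden v u =
      P.par.dual.cnum v u * P.par.cden u v := by
  obtain ⟨x, rfl⟩ := P.exists_qexp_eq hu
  obtain ⟨z, rfl⟩ := P.exists_qexp_eq hv
  have sw : Differentiable ℂ fun y : ℂ × ℂ => (y.2, y.1) := by fun_prop
  have d1 := P.dual.isNonzeroEntire_cden
  have d2 := P.dual.differentiable_cnum
  rw [par_dual] at d1 d2
  have d1' := d1.comp sw (ψ := fun y => (y.2, y.1)) fun _ => rfl
  have d2' := d2.comp sw
  have := eq_zero_of_generic ((P.differentiable_cnum.mul d1'.1).sub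
    (d2'.mul P.isNonzeroEntire_cden.1)) ?_ (x, z)
  · exact sub_eq_zero.mp this
  · filter_upwards [meroEq_iff.mp h, P.isNonzeroEntire_cden.eventually_ne_zero,
      d1'.eventually_ne_zero] with y hy n1 n2
    rw [cfun_eq, cfun_eq, W_dual, div_left_inj' (P.W_ne_zero _ _), par_dual, Par.cth, Par.cth] at hy
    exact sub_eq_zero.mpr ((div_eq_div_iff n1 n2).mp hy)

lemma meroEq_of_cross (h : ∀ u v : ℂ, u ≠ 0 → v ≠ 0 → P.par.cnum u v * P.par.dual.cden v u =
      P.par.dual.cnum v u * P.par.cden u v) : MeroEq (cfun P) fun x z => cfun P.dual z x := by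
  have sw : Differentiable ℂ fun y : ℂ × ℂ => (y.2, y.1) := by fun_prop
  have d1 := P.dual.isNonzeroEntire_cden
  rw [par_dual] at d1
  have d1' := d1.comp sw (ψ := fun y => (y.2, y.1)) fun _ => rfl
  rw [meroEq_iff]
  filter_upwards [P.isNonzeroEntire_cden.eventually_ne_zero, d1'.eventually_ne_zero] with y n1 n2
  rw [cfun_eq, cfun_eq, W_dual, div_left_inj' (P.W_ne_zero _ _), par_dual, Par.cth, Par.cth]
  exact (div_eq_div_iff n1 n2).mpr (h _ _ (P.qexp_ne_zero _) (P.qexp_ne_zero _))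

lemma eventually_cth_eq (h : MeroEq (cfun P) fun x z => cfun P.dual z x) :
    ∀ᶠ y : ℂ × ℂ in generic, P.par.cth (P.qexp y.1) (P.qexp y.2) =
      P.par.dual.cth (P.qexp y.2) (P.qexp y.1) := by
  filter_upwards [meroEq_iff.mp h] with y hy
  rwa [cfun_eq, cfun_eq, W_dual, div_left_inj' (P.W_ne_zero _ _), par_dual] at hy

end Params

end AskeyWilson

end

noncomputable section
namespace AskeyWilson
open Filter Topology Finset

/-! ## Real parameters -/

/-- A negative real is never an inverse power of a positive base. The negative signs of b and d make
many factors harmless in this way. -/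
lemma qPochInf_ofReal_ne_zero {x ρ : ℝ} (hρ : 0 < ρ) (hρ1 : ρ < 1) (hx : x < 0) :
    qPochInf (x : ℂ) (ρ : ℂ) ≠ 0 := by
  refine qPochInf_ne_zero (by rwa [Complex.norm_of_nonneg hρ.le]) fun i hi => ?_
  have h : x * ρ ^ i = 1 := by exact_mod_cast hi
  have := mul_neg_of_neg_of_pos hx (pow_pos hρ i)
  linarith

lemma theta_ofReal_ne_zero {x ρ : ℝ} (hρ : 0 < ρ) (hρ1 : ρ < 1) (hx : x < 0) :
    theta (x : ℂ) (ρ : ℂ) ≠ 0 := by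
  refine mul_ne_zero (qPochInf_ofReal_ne_zero hρ hρ1 hx) ?_
  rw [← Complex.ofReal_div]
  exact qPochInf_ofReal_ne_zero hρ hρ1 (div_neg_of_pos_of_neg hρ hx)

namespace Params

variable (P : Params)

/-- The square root of the base. -/
def root : ℝ := P.q ^ ((P.s : ℝ) / 2)

lemma root_pos : 0 < P.root := Real.rpow_pos_of_pos P.q_pos _

lemma root_lt_one : P.root < 1 := by
  have : (0 : ℝ) < P.s := by exact_mod_cast P.s_pos
  exact Real.rpow_lt_one P.q_pos.le P.q_lt_one (by linarith)

lemma base_eq_root_sq : P.base = ((P.root ^ 2 : ℝ) : ℂ) := by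
  rw [root, ← Real.rpow_natCast, ← Real.rpow_mul P.q_pos.le, ← qexp_ofReal, base]
  push_cast
  congr 1
  ring

lemma root_zpow (n : ℤ) : (P.root : ℂ) ^ n = P.qexp (n * (P.s / 2)) := by
  rw [qexp_int_mul, root, ← qexp_ofReal]
  push_cast
  rfl

/-- The signs of the parameters. -/
lemma exists_real_params : ∃ a b c d k : ℝ, P.a = a ∧ P.b = b ∧ P.c = c ∧ P.d = d ∧
    P.dual.a = k ∧ 0 < a ∧ b < 0 ∧ 0 < c ∧ d < 0 ∧ 0 < k := by
  have h := fun t : ℝ => Real.rpow_pos_of_pos P.q_pos t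
  refine ⟨P.q ^ (P.kap + P.lam), -P.q ^ (P.kap - P.lam), P.q ^ ((P.s : ℝ) / 2 + P.ups + P.sig),
    -P.q ^ ((P.s : ℝ) / 2 + P.ups - P.sig), P.q ^ (P.kap + P.ups), ?_, ?_, ?_, ?_, ?_, h _,
    neg_lt_zero.mpr (h _), h _, neg_lt_zero.mpr (h _), h _⟩
  · rw [← qexp_ofReal, a]; push_cast; rfl
  · rw [Complex.ofReal_neg, ← qexp_ofReal, b]; push_cast; rfl
  · rw [← qexp_ofReal, c]; push_cast; rfl
  · rw [Complex.ofReal_neg, ← qexp_ofReal, d]; push_cast; rfl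
  · rw [← qexp_ofReal, a]; push_cast; rfl

lemma root_mul_zpow_ne_one (n : ℤ) : (P.root : ℂ) * P.base ^ n ≠ 1 := by
  intro h
  have h0 := P.root_pos
  rw [base_eq_root_sq] at h
  have h1 : P.root * (P.root ^ 2) ^ n = 1 := by exact_mod_cast h
  have h2 : P.root ^ (2 * n + 1) = P.root ^ (0 : ℤ) := by
    rw [zpow_zero, zpow_add₀ h0.ne', zpow_one, zpow_mul, mul_comm]
    exact_mod_cast h1
  have := zpow_right_injective₀ h0 P.root_lt_one.ne h2
  omega

/-- The zeros of the theta functions restrict the parameters. -/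
lemma exists_zpow_of_cross (H : ∀ u v : ℂ, u ≠ 0 → v ≠ 0 →
    P.par.cnum u v * P.par.dual.cden v u = P.par.dual.cnum v u * P.par.cden u v) {v : ℝ}
    (hv : 0 < v) (hv' : theta (1 / (v : ℂ) ^ 2) P.base = 0) :
    (∃ n : ℤ, P.par.k / v = P.base ^ n) ∨ ∃ n : ℤ, P.par.dual.c / v = P.base ^ n := by
  have hp0 := P.base_ne_zero
  have hp := P.norm_base_lt_one
  have hvc : (v : ℂ) ≠ 0 := by exact_mod_cast hv.ne'
  -- A value of u is fixed at which both theta factors depending on u are nonzero.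
  obtain ⟨-, y, hy⟩ := (P.isNonzeroEntire_theta_zpow (P.par.d / v / P.par.k) (i := 1) (j := 0)
    (by norm_num)).mul (P.isNonzeroEntire_theta_zpow 1 (i := -2) (j := 0) (by norm_num))
  have hu := P.qexp_ne_zero y.1
  have h := H (P.qexp y.1) v hu hvc
  obtain ⟨a, b, c, d, k, ea, eb, ec, ed, ek, ha, hb, hc, hd, hk⟩ := P.exists_real_params
  have hr := P.root_pos
  have hρ : 0 < P.root ^ 2 := by positivity
  have hρ1 : P.root ^ 2 < 1 := pow_lt_one₀ hr.le P.root_lt_one two_ne_zero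
  have n1 : theta (P.par.dual.b / v) P.base ≠ 0 := by
    rw [show P.par.dual.b = P.a * P.b / P.dual.a from rfl, ea, eb, ek, base_eq_root_sq]
    have := theta_ofReal_ne_zero hρ hρ1 (x := a * b / k / v)
      (div_neg_of_neg_of_pos (div_neg_of_neg_of_pos (mul_neg_of_pos_of_neg ha hb) hk) hv)
    exact_mod_cast this
  have n2 : theta (P.par.dual.d * v) P.base ≠ 0 := by
    rw [show P.par.dual.d = P.a * P.d / P.dual.a from rfl, ea, ed, ek, base_eq_root_sq]
    have := theta_ofReal_ne_zero hρ hρ1 (x := a * d / k * v)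
      (mul_neg_of_neg_of_pos (div_neg_of_neg_of_pos (mul_neg_of_pos_of_neg ha hd) hk) hv)
    exact_mod_cast this
  have n3 : theta (P.par.d * (P.qexp y.1 / v) / P.par.k) P.base ≠ 0 := by
    have := left_ne_zero_of_mul hy
    rwa [zpow_one, zpow_zero, mul_one, show P.par.d / v / P.par.k * P.qexp y.1 =
      P.par.d * (P.qexp y.1 / v) / P.par.k by ring] at this
  have n4 : theta (1 / P.qexp y.1 ^ 2) P.base ≠ 0 := by
    have := right_ne_zero_of_mul hy
    rw [zpow_zero, mul_one, one_mul, zpow_neg] at this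
    rw [one_div]
    exact_mod_cast this
  simp only [Par.cnum, Par.cden, show P.par.p = P.base from rfl,
    show P.par.dual.p = P.base from rfl] at h
  -- The right-hand side vanishes with θ(1/v²), so one theta factor on the left must vanish; the
  -- signs of the parameters and the choice of u leave only two candidates.
  rw [hv', zero_mul, mul_zero] at h
  simp only [mul_eq_zero, n1, n2, n3, n4, or_false] at h
  exact h.imp (exists_zpow_eq_of_theta_eq_zero hp0 hp) (exists_zpow_eq_of_theta_eq_zero hp0 hp)

/-- The functional equation of the `c`-function excludes degenerate parameters. -/
lemma exists_root_mul_zpow_of_cross (H : ∀ u v : ℂ, u ≠ 0 → v ≠ 0 →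
    P.par.cnum u v * P.par.dual.cden v u = P.par.dual.cnum v u * P.par.cden u v) :
    (∃ n : ℤ, P.a * P.c = P.root * P.base ^ n) ∧
      ∃ n : ℤ, P.par.dual.c / P.par.k = P.root * P.base ^ n := by
  have hp0 := P.base_ne_zero
  have hp := P.norm_base_lt_one
  have hr : (P.root : ℂ) ≠ 0 := by exact_mod_cast P.root_pos.ne'
  have hk := P.par.hk
  have hc := P.par.dual.hc
  have hr2 : (P.root : ℂ) ^ 2 = P.base := by rw [base_eq_root_sq]; push_cast; rfl
  have hac : P.a * P.c = P.par.k * P.par.dual.c := by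
    rw [show P.par.dual.c = P.par.a * P.par.c / P.par.k from rfl]
    exact (mul_div_cancel₀ _ hk).symm
  have h1 := P.exists_zpow_of_cross H one_pos (by
    rw [Complex.ofReal_one, one_pow, div_one, theta_one hp])
  -- At v = 1 and at v = p^(1/2) the function θ(1/v²) vanishes. The two evaluations together locate
  -- both k and c̃.
  have h2 := P.exists_zpow_of_cross H P.root_pos (by
    rw [hr2, theta, qPochInf_eq_zero hp (i := 1) (by field_simp), zero_mul])
  rw [Complex.ofReal_one, div_one, div_one] at h1
  -- The same parameter cannot account for both zeros, since p^(1/2) is not an integral power of p.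
  have excl : ∀ {X : ℂ} {m n : ℤ}, X = P.base ^ m → X / P.root = P.base ^ n → False := by
    intro X m n e1 e2
    refine P.root_mul_zpow_ne_one (n - m) ?_
    rw [e1, div_eq_iff hr] at e2
    rw [zpow_sub₀ hp0, e2]
    have := zpow_ne_zero n hp0
    field_simp
  rcases h1 with ⟨m, h1⟩ | ⟨m, h1⟩ <;> rcases h2 with ⟨n, h2⟩ | ⟨n, h2⟩
  · exact (excl h1 h2).elim
  · rw [div_eq_iff hr] at h2
    refine ⟨⟨m + n, ?_⟩, ⟨n - m, ?_⟩⟩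
    · rw [hac, h1, h2, zpow_add₀ hp0]; ring
    · rw [h1, h2, zpow_sub₀ hp0]; ring
  · rw [div_eq_iff hr] at h2
    refine ⟨⟨m + n, ?_⟩, ⟨m - n - 1, ?_⟩⟩
    · rw [hac, h1, h2, zpow_add₀ hp0]; ring
    · rw [h1, h2, zpow_sub₀ hp0, zpow_sub₀ hp0, zpow_one, ← hr2]
      have := zpow_ne_zero n hp0
      rw [← hr2] at this
      field_simp
  · exact (excl h1 h2).elim

/-- A zero would make a half-odd power of p equal to 1. -/
lemma qPochInf_ne_zero_of_eq_root {X : ℂ} (h : ∃ n : ℤ, X = P.root * P.base ^ n) :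
    qPochInf X P.base ≠ 0 := by
  obtain ⟨n, rfl⟩ := h
  refine qPochInf_ne_zero P.norm_base_lt_one fun i hi => P.root_mul_zpow_ne_one (n + i) ?_
  rw [zpow_add₀ P.base_ne_zero, zpow_natCast, ← hi]
  ring

/-! ## Half-integral parameters -/

/-- Among four integers an even number of even ones means an even number of odd ones. -/
lemma even_sum_of_even_card {K : Fin 4 → ℤ}
    (h : Even {i : Fin 4 | Even (K i)}.ncard) : Even (K 0 + K 1 + K 2 + K 3) := by
  classical
  rw [Set.ncard_eq_toFinset_card', Set.toFinset_ofPred, Finset.card_filter, Fin.sum_univ_four] at h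
  simp only [Int.even_iff, Nat.even_iff] at *
  split_ifs at h <;> omega

variable {P} in
lemma HalfIntegral.exists_int (h : P.HalfIntegral) : ∃ K L U S M : ℤ, K + L + U + S = 2 * M ∧
    P.kap = K * (P.s / 2) ∧ P.lam = L * (P.s / 2) ∧ P.ups = U * (P.s / 2) ∧
      P.sig = S * (P.s / 2) := by
  obtain ⟨h1, h2⟩ := h
  choose K hK using h1
  have hs : (P.s : ℝ) ≠ 0 := by exact_mod_cast P.s_pos.ne'
  have e : ∀ i, (∃ n : ℤ, P.ratio i = n) ↔ Even (K i) := fun i => by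
    rw [hK i]
    constructor
    · rintro ⟨n, hn⟩
      refine ⟨n, ?_⟩
      have : (K i : ℝ) = n + n := by linarith
      exact_mod_cast this
    · rintro ⟨n, hn⟩
      exact ⟨n, by rw [hn]; push_cast; ring⟩
  simp only [e] at h2
  obtain ⟨M, hM⟩ := even_sum_of_even_card h2
  have k0 := hK 0; have k1 := hK 1; have k2 := hK 2; have k3 := hK 3
  simp only [ratio, Matrix.cons_val_zero, Matrix.cons_val_one, Matrix.cons_val] at k0 k1 k2 k3
  refine ⟨K 0, K 1, K 2, K 3, M, by omega, ?_, ?_, ?_, ?_⟩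
  all_goals
    rw [div_eq_iff hs] at k0 k1 k2 k3
    linarith

end Params

/-- The product formula for half-integral parameters. -/
lemma theta_prod_of_even {r v : ℂ} (hr0 : r ≠ 0) (hr : ‖r‖ < 1) (hv : v ≠ 0) {K L U S M : ℤ}
    (h : K + L + U + S = 2 * M) : theta (r ^ (K + U) / v) (r ^ 2) *
      theta (-r ^ (K - U) / v) (r ^ 2) * theta (r ^ (1 + L + S) / v) (r ^ 2) *
      theta (-r ^ (1 + L - S) * v) (r ^ 2) =
    (-1) ^ M * v ^ (K + S) * r ^ (K - 2 * M ^ 2 + (K * L + K * U + K * S + L * U + L * S + U * S)) *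
      theta (1 / v ^ 2) (r ^ 2) := by
  have hp0 : r ^ 2 ≠ 0 := pow_ne_zero 2 hr0
  have hp : ‖r ^ 2‖ < 1 := by
    rw [norm_pow]; exact pow_lt_one₀ (norm_nonneg _) hr two_ne_zero
  have hsq := theta_sq hr0 hr (inv_ne_zero hv)
  rw [show 1 / v ^ 2 = v⁻¹ ^ 2 by rw [inv_pow, one_div], hsq]
  have T : ∀ (N : ℤ) (X : ℂ), X ≠ 0 → theta (r ^ (2 * N) * X) (r ^ 2) =
      (-1) ^ N * X ^ (-N) * r ^ (-(N * (N - 1))) * theta X (r ^ 2) := fun N X hX => by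
    have := theta_zpow_mul hp0 hp rfl hX N
    rwa [show ((r ^ 2) ^ N : ℂ) = r ^ (2 * N) by rw [zpow_mul]; norm_cast] at this
  have hm1 : (-1 : ℂ) ≠ 0 := by norm_num
  have T' : ∀ (N : ℤ) (X : ℂ), X ≠ 0 → theta (r ^ (2 * N) * -X) (r ^ 2) =
      X ^ (-N) * r ^ (-(N * (N - 1))) * theta (-X) (r ^ 2) := fun N X hX => by
    rw [T N _ (neg_ne_zero.mpr hX), neg_eq_neg_one_mul X, mul_zpow, ← mul_assoc ((-1) ^ N),
      ← zpow_add₀ hm1, add_neg_cancel, zpow_zero, one_mul]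
  have hv' := inv_ne_zero hv
  -- K + U and L + S have the same parity. In either case the four arguments are, up to powers of r²
  -- and inversion, ±1/v and ±r/v, the factors of the duplication formula; the parity decides which
  -- parameter yields which.
  rcases Int.even_or_odd' (K + U) with ⟨m, hm | hm⟩
  · obtain ⟨n, hn⟩ : ∃ n, L + S = 2 * n := ⟨M - m, by omega⟩
    obtain rfl : U = 2 * m - K := by omega
    obtain rfl : S = 2 * n - L := by omega
    obtain rfl : M = m + n := by omega
    have e1 : r ^ (K + (2 * m - K)) / v = r ^ (2 * m) * v⁻¹ := by
      rw [div_eq_mul_inv, add_sub_cancel]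
    have e2 : -r ^ (K - (2 * m - K)) / v = r ^ (2 * (K - m)) * -v⁻¹ := by
      rw [show K - (2 * m - K) = 2 * (K - m) by ring]; ring
    have e3 : r ^ (1 + L + (2 * n - L)) / v = r ^ (2 * n) * (r * v⁻¹) := by
      rw [show 1 + L + (2 * n - L) = 2 * n + 1 by ring, zpow_add_one₀ hr0]; ring
    have e4 : -r ^ (1 + L - (2 * n - L)) * v = r ^ (2 * (L - n)) * -(r * v) := by
      rw [show 1 + L - (2 * n - L) = 2 * (L - n) + 1 by ring, zpow_add_one₀ hr0]; ring
    have e5 : theta (-(r * v)) (r ^ 2) = theta (-(r * v⁻¹)) (r ^ 2) := by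
      rw [← theta_div hp0, show r ^ 2 / -(r * v) = -(r * v⁻¹) by field_simp]
    rw [e1, e2, e3, e4, T _ _ hv', T' _ _ hv', T _ _ (mul_ne_zero hr0 hv'),
      T' _ _ (mul_ne_zero hr0 hv), e5,
      show K - 2 * (m + n) ^ 2 + (K * L + K * (2 * m - K) + K * (2 * n - L) + L * (2 * m - K) +
        L * (2 * n - L) + (2 * m - K) * (2 * n - L)) = -(m * (m - 1)) + -((K - m) * (K - m - 1)) +
        -n + -(n * (n - 1)) + -(L - n) + -((L - n) * (L - n - 1)) by ring,
      show K + (2 * n - L) = m + (K - m) + n + -(L - n) by ring]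
    simp only [mul_zpow, inv_zpow', neg_neg, zpow_add₀ hr0, zpow_add₀ hv, zpow_add₀ hm1]
    ring
  · obtain ⟨n, hn⟩ : ∃ n, L + S = 2 * n + 1 := ⟨M - m - 1, by omega⟩
    obtain rfl : U = 2 * m + 1 - K := by omega
    obtain rfl : S = 2 * n + 1 - L := by omega
    obtain rfl : M = m + n + 1 := by omega
    have e1 : r ^ (K + (2 * m + 1 - K)) / v = r ^ (2 * m) * (r * v⁻¹) := by
      rw [show K + (2 * m + 1 - K) = 2 * m + 1 by ring, zpow_add_one₀ hr0]; ring
    have e2 : -r ^ (K - (2 * m + 1 - K)) / v = r ^ (2 * (K - m - 1)) * -(r * v⁻¹) := by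
      rw [show K - (2 * m + 1 - K) = 2 * (K - m - 1) + 1 by ring, zpow_add_one₀ hr0]; ring
    have e3 : r ^ (1 + L + (2 * n + 1 - L)) / v = r ^ (2 * (n + 1)) * v⁻¹ := by
      rw [show 1 + L + (2 * n + 1 - L) = 2 * (n + 1) by ring, div_eq_mul_inv]
    have e4 : -r ^ (1 + L - (2 * n + 1 - L)) * v = r ^ (2 * (L - n)) * -v := by
      rw [show 1 + L - (2 * n + 1 - L) = 2 * (L - n) by ring]; ring
    have e5 : theta (-v) (r ^ 2) = v * theta (-v⁻¹) (r ^ 2) := by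
      have := theta_inv hp0 hp (neg_ne_zero.mpr hv')
      rw [inv_neg, inv_inv, neg_neg] at this
      exact this
    rw [e1, e2, e3, e4, T _ _ hv', T' _ _ hv, T _ _ (mul_ne_zero hr0 hv'),
      T' _ _ (mul_ne_zero hr0 hv'), e5,
      show K - 2 * (m + n + 1) ^ 2 + (K * L + K * (2 * m + 1 - K) + K * (2 * n + 1 - L) +
        L * (2 * m + 1 - K) + L * (2 * n + 1 - L) + (2 * m + 1 - K) * (2 * n + 1 - L)) =
        -m + -(m * (m - 1)) + -(K - m - 1) + -((K - m - 1) * (K - m - 1 - 1)) +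
        -((n + 1) * (n + 1 - 1)) + -((L - n) * (L - n - 1)) by ring,
      show K + (2 * n + 1 - L) = m + (K - m - 1) + (n + 1) + -(L - n) + 1 by ring,
      zpow_add_one₀ hv, show m + n + 1 = m + (n + 1) by ring]
    simp only [mul_zpow, inv_zpow', neg_neg, zpow_add₀ hr0, zpow_add₀ hv, zpow_add₀ hm1]
    ring

namespace Params

variable {P : Params}

/-- The symmetry of the `c`-function for half-integral parameters. -/
theorem meroEq_cfun_of_halfIntegral (hP : P.HalfIntegral) :
    MeroEq (cfun P) fun x z => cfun P.dual z x := by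
  obtain ⟨K, L, U, S, M, hM, hK, hL, hU, hS⟩ := hP.exists_int
  refine P.meroEq_of_cross fun u v hu hv => ?_
  have hr0 : (P.root : ℂ) ≠ 0 := by exact_mod_cast P.root_pos.ne'
  have hr : ‖(P.root : ℂ)‖ < 1 := by
    rw [Complex.norm_of_nonneg P.root_pos.le]; exact P.root_lt_one
  have hr2 : P.base = (P.root : ℂ) ^ 2 := by rw [base_eq_root_sq]; push_cast; rfl
  have hKc : (P.kap : ℂ) = K * (P.s / 2) := by rw [hK]; push_cast; rfl
  have hLc : (P.lam : ℂ) = L * (P.s / 2) := by rw [hL]; push_cast; rfl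
  have hUc : (P.ups : ℂ) = U * (P.s / 2) := by rw [hU]; push_cast; rfl
  have hSc : (P.sig : ℂ) = S * (P.s / 2) := by rw [hS]; push_cast; rfl
  have ea : P.a = (P.root : ℂ) ^ (K + L) := by
    rw [root_zpow, a, hKc, hLc]; congr 1; push_cast; ring
  have eb : P.b = -(P.root : ℂ) ^ (K - L) := by
    rw [root_zpow, b, hKc, hLc]; congr 2; push_cast; ring
  have ec : P.c = (P.root : ℂ) ^ (1 + U + S) := by
    rw [root_zpow, c, hUc, hSc]; congr 1; push_cast; ring
  have ed : P.d = -(P.root : ℂ) ^ (1 + U - S) := by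
    rw [root_zpow, d, hUc, hSc]; congr 2; push_cast; ring
  have ek : P.dual.a = (P.root : ℂ) ^ (K + U) := by
    rw [root_zpow, a, show P.dual.kap = P.kap from rfl, show P.dual.lam = P.ups from rfl, hKc, hUc]
    show P.qexp _ = _
    congr 1; push_cast; ring
  have ebt : P.a * P.b / P.dual.a = -(P.root : ℂ) ^ (K - U) := by
    rw [ea, eb, ek, mul_neg, neg_div, ← zpow_add₀ hr0, ← zpow_sub₀ hr0]; congr 2; ring
  have ect : P.a * P.c / P.dual.a = (P.root : ℂ) ^ (1 + L + S) := by
    rw [ea, ec, ek, ← zpow_add₀ hr0, ← zpow_sub₀ hr0]; congr 1; ring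
  have edt : P.a * P.d / P.dual.a = -(P.root : ℂ) ^ (1 + L - S) := by
    rw [ea, ed, ek, mul_neg, neg_div, ← zpow_add₀ hr0, ← zpow_sub₀ hr0]; congr 2; ring
  have q1 := theta_prod_of_even hr0 hr hv (K := K) (L := L) (U := U) (S := S) (M := M) hM
  have q2 := theta_prod_of_even hr0 hr hu (K := K) (L := U) (U := L) (S := S) (M := M) (by omega)
  rw [← ebt, ← ect, ← edt, ← ek, ← hr2] at q1
  rw [← eb, ← ec, ← ed, ← ea, ← hr2] at q2
  -- The remaining theta factors have arguments reciprocal up to a power of p. Inversion and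
  -- quasi-periodicity produce (u/v)^(K+S), which balances the monomials of the two product
  -- formulas.
  have q3 : v ^ (K + S) * theta (P.d * (u / v) / P.dual.a) P.base =
      u ^ (K + S) * theta (P.a * P.d / P.dual.a * (v / u) / P.a) P.base := by
    have g : P.d / P.dual.a = -(P.root : ℂ) ^ (1 - (K + S)) := by
      rw [ed, ek, neg_div, ← zpow_sub₀ hr0]; congr 2; ring
    obtain ⟨N, hN⟩ : ∃ N, N = K + S := ⟨_, rfl⟩
    have ha0 : P.a ≠ 0 := P.par.ha
    have hg0 : -(P.root : ℂ) ^ (1 - N) ≠ 0 := neg_ne_zero.mpr (zpow_ne_zero _ hr0)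
    rw [← hN] at g ⊢
    rw [show P.d * (u / v) / P.dual.a = P.d / P.dual.a * (u / v) by ring,
      show P.a * P.d / P.dual.a * (v / u) / P.a = P.d / P.dual.a * (v / u) by field_simp, g,
      ← theta_div P.base_ne_zero (-(P.root : ℂ) ^ (1 - N) * (v / u)),
      show P.base / (-(P.root : ℂ) ^ (1 - N) * (v / u)) =
        P.base ^ N * (-(P.root : ℂ) ^ (1 - N) * (u / v)) by
          rw [hr2, ← zpow_natCast, ← zpow_mul, div_eq_iff (mul_ne_zero hg0 (div_ne_zero hv hu)),
            show (P.root : ℂ) ^ (((2 : ℕ) : ℤ) * N) * (-(P.root : ℂ) ^ (1 - N) * (u / v)) *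
              (-(P.root : ℂ) ^ (1 - N) * (v / u)) = (P.root : ℂ) ^ (((2 : ℕ) : ℤ) * N) *
              ((P.root : ℂ) ^ (1 - N) * (P.root : ℂ) ^ (1 - N)) by field_simp,
            ← zpow_add₀ hr0, ← zpow_add₀ hr0]
          congr 1; push_cast; ring,
      theta_zpow_mul P.base_ne_zero P.norm_base_lt_one hr2.symm
        (mul_ne_zero hg0 (div_ne_zero hu hv)) N, mul_zpow, ← neg_one_mul, mul_zpow, ← zpow_mul,
      zpow_neg (-1 : ℂ), div_zpow, zpow_neg u, zpow_neg v,
      show -(N * (N - 1)) = -((1 - N) * -N) by ring, zpow_neg (P.root : ℂ) ((1 - N) * -N)]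
    have n1 := zpow_ne_zero N hu
    have n2 := zpow_ne_zero N hv
    have n3 : ((-1 : ℂ)) ^ N ≠ 0 := zpow_ne_zero N (by norm_num)
    have n4 := zpow_ne_zero ((1 - N) * -N) hr0
    generalize theta _ _ = Θ
    field_simp
  have b1 : P.par.dual.dual.b = P.b := P.par.dual_dual_b
  have b2 : P.par.dual.dual.c = P.c := P.par.dual_dual_c
  rw [Par.cnum, Par.cnum, Par.cden, Par.cden, b1, b2]
  simp only [show P.par.dual.p = P.base from rfl, show P.par.p = P.base from rfl,
    show P.par.k = P.dual.a from rfl, show P.par.dual.k = P.a from rfl,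
    show P.par.dual.b = P.a * P.b / P.dual.a from rfl,
    show P.par.dual.c = P.a * P.c / P.dual.a from rfl,
    show P.par.dual.d = P.a * P.d / P.dual.a from rfl, show P.par.d = P.d from rfl]
  -- The exponent of r is symmetric under L ↔ U, so the dual product formula carries the same
  -- constant.
  rw [show K - 2 * M ^ 2 + (K * U + K * L + K * S + U * L + U * S + L * S) =
    K - 2 * M ^ 2 + (K * L + K * U + K * S + L * U + L * S + U * S) by ring] at q2
  generalize (P.root : ℂ) ^ (K - 2 * M ^ 2 + (K * L + K * U + K * S + L * U + L * S + U * S)) = R at *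
  linear_combination (theta (P.d * (u / v) / P.dual.a) P.base * theta (1 / u ^ 2) P.base) * q1 -
    (theta (P.a * P.d / P.dual.a * (v / u) / P.a) P.base * theta (1 / v ^ 2) P.base) * q2 +
    ((-1) ^ M * R * theta (1 / v ^ 2) P.base * theta (1 / u ^ 2) P.base) * q3

end Params

end AskeyWilson

end

/-! ### Identification and symmetries of the Askey–Wilson function -/

noncomputable section
namespace AskeyWilson
open Filter Topology Finset

namespace Par

variable (D : Par)

lemma aw_eq_dual {u v : ℂ} (h : qPochInf (D.p / (D.dual.d * v)) D.p *
      qPochInf (D.k * D.a / D.dual.d * u) D.p * D.awSum u v =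
      qPochInf (D.a * D.k / D.d * v) D.p * qPochInf (D.p / (D.d * u)) D.p * D.dual.awSum v u)
    (k1 : qPochInf (D.a * D.k / D.d * v) D.p ≠ 0)
    (k2 : qPochInf (D.k * D.a / D.dual.d * u) D.p ≠ 0)
    (k3 : qPochInf (D.p / (D.d * u)) D.p ≠ 0) (k4 : qPochInf (D.p / (D.dual.d * v)) D.p ≠ 0)
    (k5 : qPochInf (D.p * u / D.d) D.p ≠ 0) (k6 : qPochInf (D.p * v / D.dual.d) D.p ≠ 0) :
    D.aw u v = D.dual.aw v u := by
  rw [aw, aw, dual_dual_d, show D.dual.p = D.p from rfl, show D.dual.a = D.k from rfl,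
    show D.dual.k = D.a from rfl, div_eq_div_iff (by simp [*]) (by simp [*])]
  linear_combination (qPochInf (D.p * u / D.d) D.p * qPochInf (D.p * v / D.dual.d) D.p) * h

end Par

namespace Params

variable {P : Params}

/-! ## The Askey–Wilson function -/

/-- The shifted factorials in front of the ₈W₇ are exactly those that regularise it. Nonvanishing of
the constants ab, ac and pa/d factorials is essential, because ₈W₇ divides by their finite parts. -/
lemma awSeries_eq {x z : ℂ} (g1 : qPochInf (P.a * P.b) P.base ≠ 0)
    (g2 : qPochInf (P.a * P.c) P.base ≠ 0) (g3 : qPochInf (P.base * P.a / P.d) P.base ≠ 0)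
    (k1 : qPochInf (P.base * P.dual.a / P.d * (P.qexp x ^ (-1 : ℤ) * P.qexp z ^ (1 : ℤ))) P.base ≠ 0)
    (k2 : qPochInf (P.base * P.dual.a / P.d * (P.qexp x ^ (1 : ℤ) * P.qexp z ^ (1 : ℤ))) P.base ≠ 0) :
    awSeries P x z = P.par.aw (P.qexp x) (P.qexp z) := by
  have hp := P.norm_base_lt_one
  have hp0 := P.base_ne_zero
  have ha : P.a ≠ 0 := P.par.ha
  have hb : P.b ≠ 0 := P.par.hb
  have hc : P.c ≠ 0 := P.par.hc
  have hd : P.d ≠ 0 := P.par.hd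
  have hk : P.dual.a ≠ 0 := P.par.hk
  have habcd : P.a * P.b * P.c * P.d = P.base * P.dual.a ^ 2 := P.par.habcd
  have hu := P.qexp_ne_zero x
  have hv := P.qexp_ne_zero z
  have eA : P.dual.a * P.dual.b * P.dual.c * P.qexp (-P.s + z) =
      P.a * P.dual.a / P.d * P.qexp z := by
    rw [dual_b, dual_c, qexp_add, qexp_neg, ← base]; field_simp; linear_combination habcd
  have eA' : P.dual.a * P.dual.b * P.dual.c * P.qexp z =
      P.a * P.dual.a / P.d * P.qexp z * P.base := by
    rw [dual_b, dual_c]; field_simp; linear_combination habcd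
  have et : P.qexp (P.s - z) / P.dual.d = P.base / (P.dual.d * P.qexp z) := by
    rw [qexp_sub, ← base]; field_simp
  rw [awSeries, eA, eA', et, P.qexp_neg x, P.qexp_sub (P.s + z) x, P.qexp_add (P.s + z) x,
    P.qexp_add P.s z, P.qexp_add P.s x, P.qexp_sub P.s x, ← base, Par.aw, Par.awSum]
  simp only [show P.par.p = P.base from rfl, show P.par.a = P.a from rfl,
    show P.par.k = P.dual.a from rfl, show P.par.d = P.d from rfl,
    show P.par.dual.b = P.dual.b from P.dual_b.symm,
    show P.par.dual.c = P.dual.c from P.dual_c.symm,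
    show P.par.dual.d = P.dual.d from P.dual_d.symm]
  obtain ⟨A, hA⟩ : ∃ A, A = P.a * P.dual.a / P.d * P.qexp z := ⟨_, rfl⟩
  have hA0 : A ≠ 0 := by rw [hA]; simp [*]
  have y1 : A * P.base / (P.a * P.qexp x) = P.dual.a * (P.base * P.qexp z / P.qexp x) / P.d := by
    rw [hA]; field_simp
  have y2 : A * P.base / (P.a / P.qexp x) = P.dual.a * (P.base * P.qexp z * P.qexp x) / P.d := by
    rw [hA]; field_simp
  have y3 : A * P.base / (P.dual.a * P.qexp z) = P.base * P.a / P.d := by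
    rw [hA]; field_simp
  have y4 : A * P.base / (P.dual.b * P.qexp z) = P.a * P.c := by
    rw [hA, dual_b]; field_simp; linear_combination -habcd
  have y5 : A * P.base / (P.dual.c * P.qexp z) = P.a * P.b := by
    rw [hA, dual_c]; field_simp; linear_combination -habcd
  have k1' : qPochInf (P.dual.a * (P.base * P.qexp z / P.qexp x) / P.d) P.base ≠ 0 := by
    rwa [zpow_neg_one, zpow_one, show P.base * P.dual.a / P.d * ((P.qexp x)⁻¹ * P.qexp z) =
      P.dual.a * (P.base * P.qexp z / P.qexp x) / P.d by field_simp] at k1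
  have k2' : qPochInf (P.dual.a * (P.base * P.qexp z * P.qexp x) / P.d) P.base ≠ 0 := by
    rwa [zpow_one, zpow_one, show P.base * P.dual.a / P.d * (P.qexp x * P.qexp z) =
      P.dual.a * (P.base * P.qexp z * P.qexp x) / P.d by field_simp] at k2
  rw [← hA, vwp_eq hp (y1 ▸ k1') (y2 ▸ k2') (y3 ▸ g3) (y4 ▸ g2) (y5 ▸ g1), y1, y2, y3, y4, y5,
    qPochInf_eq_one_sub_mul hp A]
  have hW : W87 ![A, P.a * P.qexp x, P.a * (P.qexp x)⁻¹, P.dual.a * P.qexp z, P.dual.b * P.qexp z,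
      P.dual.c * P.qexp z] P.base (P.base / (P.dual.d * P.qexp z)) =
      (1 - A)⁻¹ * ∑' r, vwpTerm P.base A (P.a * P.qexp x) (P.a / P.qexp x) (P.dual.a * P.qexp z)
        (P.dual.b * P.qexp z) (P.dual.c * P.qexp z) r * (P.base / (P.dual.d * P.qexp z)) ^ r := by
    rw [W87, ← tsum_mul_left]
    refine tsum_congr fun r => ?_
    rw [Fin.prod_univ_six, vwpTerm]
    simp only [Matrix.cons_val_zero, Matrix.cons_val_one, Matrix.cons_val]
    rw [mul_div_cancel_right₀ _ hA0, ← div_eq_mul_inv P.a]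
    simp only [mul_comm P.base A, pow_mul', div_eq_mul_inv, mul_inv]
    ring
  rw [hW]
  generalize ∑' r, vwpTerm P.base A (P.a * P.qexp x) (P.a / P.qexp x) (P.dual.a * P.qexp z)
        (P.dual.b * P.qexp z) (P.dual.c * P.qexp z) r * (P.base / (P.dual.d * P.qexp z)) ^ r = S
  rw [show P.base / P.qexp x / P.d = P.base / (P.d * P.qexp x) by rw [div_div, mul_comm P.d]]
  simp only [div_eq_mul_inv, mul_inv]
  ring

/-- The constants of mixed sign are negative reals. The remaining two, ac and c̃/(kp), lie in
p^(1/2) p^ℤ by the symmetry of c. -/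
lemma constants_ne_zero (h : MeroEq (cfun P) fun x z => cfun P.dual z x) :
    qPochInf (P.a * P.b) P.base ≠ 0 ∧ qPochInf (P.a * P.c) P.base ≠ 0 ∧
      qPochInf (P.base * P.a / P.d) P.base ≠ 0 ∧ qPochInf (P.base * P.c / P.d) P.base ≠ 0 ∧
      qPochInf (P.b * P.c) P.base ≠ 0 ∧
      qPochInf (P.par.dual.c / (P.par.k * P.base)) P.base ≠ 0 := by
  obtain ⟨h1, n, h2⟩ := P.exists_root_mul_zpow_of_cross fun _ _ => P.cross_of_meroEq h
  obtain ⟨a, b, c, d, k, ea, eb, ec, ed, ek, ha, hb, hc, hd, hk⟩ := P.exists_real_params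
  have hr := P.root_pos
  have hρ : 0 < P.root ^ 2 := by positivity
  have key : ∀ x : ℝ, x < 0 → qPochInf (x : ℂ) P.base ≠ 0 := fun x hx => by
    rw [base_eq_root_sq]
    exact qPochInf_ofReal_ne_zero hρ (pow_lt_one₀ hr.le P.root_lt_one two_ne_zero) hx
  refine ⟨?_, P.qPochInf_ne_zero_of_eq_root h1, ?_, ?_, ?_, P.qPochInf_ne_zero_of_eq_root
    ⟨n - 1, ?_⟩⟩
  · have := key (a * b) (mul_neg_of_pos_of_neg ha hb)
    rw [ea, eb]
    exact_mod_cast this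
  · have := key (P.root ^ 2 * a / d) (div_neg_of_pos_of_neg (by positivity) hd)
    rw [Complex.ofReal_div, Complex.ofReal_mul, ← base_eq_root_sq] at this
    rwa [ea, ed]
  · have := key (P.root ^ 2 * c / d) (div_neg_of_pos_of_neg (by positivity) hd)
    rw [Complex.ofReal_div, Complex.ofReal_mul, ← base_eq_root_sq] at this
    rwa [ec, ed]
  · have := key (b * c) (mul_neg_of_neg_of_pos hb hc)
    rw [eb, ec]
    exact_mod_cast this
  · rw [← div_div, h2, zpow_sub₀ P.base_ne_zero, zpow_one, mul_div_assoc]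

/-- The combination of asymptotically free solutions that represents the Askey–Wilson function. -/
def awCombination (P : Params) (x z : ℂ) : ℂ := PhiTilde P x (-z) + PhiTilde P (-x) (-z)

lemma isMeromorphic_awCombination (P : Params) : IsMeromorphic (awCombination P) := by
  have h1 := P.isMeromorphic_PhiTilde.comp (φ := fun y => (y.1, -y.2)) (ψ := fun y => (y.1, -y.2))
    (by fun_prop) fun _ => by simp
  have h2 := P.isMeromorphic_PhiTilde.comp (φ := fun y => (-y.1, -y.2))
    (ψ := fun y => (-y.1, -y.2)) (by fun_prop) fun _ => by simp
  exact h1.add h2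

/-- The connection formula at w = q^(-z). Symmetry of c replaces the dual c-functions in it by c
itself. -/
lemma eventually_awCombination_eq (h : MeroEq (cfun P) fun x z => cfun P.dual z x) :
    ∀ᶠ y : ℂ × ℂ in generic, ‖P.base / (P.par.dual.d * P.qexp y.2)‖ < 1 →
      awCombination P y.1 y.2 = P.par.aw (P.qexp y.1) (P.qexp y.2) := by
  have tn := tendsto_neg_left_generic.comp tendsto_neg_right_generic
  have c1 := tendsto_neg_right_generic.eventually (P.eventually_cth_eq h)
  have c2 := tn.eventually (P.eventually_cth_eq h)
  have s1 := P.isNonzeroEntire_stp_fst.eventually_ne_zero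
  have s2 := tendsto_neg_left_generic.eventually s1
  have s3 := tendsto_neg_right_generic.eventually P.isNonzeroEntire_dual_stp_snd.eventually_ne_zero
  obtain ⟨δ, hδ⟩ : ∃ δ, δ = P.par.dual.d := ⟨_, rfl⟩
  have hδ0 : δ ≠ 0 := hδ ▸ P.par.dual.hd
  have ha : P.a ≠ 0 := P.par.ha
  have hp0 := P.base_ne_zero
  filter_upwards [c1, c2, s1, s2, s3,
    P.eventually_qPochInf_zpow_ne_zero (δ / P.base) 0 (-1) (by norm_num),
    P.eventually_qPochInf_zpow_ne_zero P.base 0 (-2) (by norm_num),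
    P.eventually_qPochInf_zpow_ne_zero δ 2 (-1) (by norm_num),
    P.eventually_qPochInf_zpow_ne_zero δ (-2) (-1) (by norm_num),
    P.eventually_theta_zpow_ne_zero δ 0 (-1) (by norm_num),
    P.eventually_qPochInf_zpow_ne_zero P.a 1 0 (by norm_num),
    P.eventually_qPochInf_zpow_ne_zero P.a (-1) 0 (by norm_num),
    P.eventually_qPochInf_zpow_ne_zero (P.a ^ 2 / δ) 0 1 (by norm_num),
    P.eventually_theta_zpow_ne_zero 1 2 0 (by norm_num),
    P.eventually_theta_zpow_ne_zero 1 (-2) 0 (by norm_num),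
    P.eventually_theta_zpow_ne_zero (δ / P.a) (-1) (-1) (by norm_num),
    P.eventually_theta_zpow_ne_zero (δ / P.a) 1 (-1) (by norm_num)] with
    y c1 c2 s1 s2 s3 e1 e2 e3 e4 e5 e6 e7 e8 e9 e10 e11 e12 ht
  have hu := P.qexp_ne_zero y.1
  have hv := P.qexp_ne_zero y.2
  simp only [Function.comp_apply, qexp_neg] at c1 c2 s2 s3
  have nz : ∀ {x y : ℂ}, qPochInf x P.base ≠ 0 → y = x → qPochInf y P.base ≠ 0 :=
    fun hx hy => hy ▸ hx
  have tz : ∀ {x y : ℂ}, theta x P.base ≠ 0 → y = x → theta y P.base ≠ 0 := fun hx hy => hy ▸ hx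
  have e5a := left_ne_zero_of_mul e5
  have e5b := right_ne_zero_of_mul e5
  have key := P.par.aw_eq (u := P.qexp y.1) (w := (P.qexp y.2)⁻¹) (τ := δ * (P.qexp y.2)⁻¹)
    (by rw [hδ]) hu (inv_ne_zero hv)
    (by rwa [← div_eq_mul_inv, div_div, mul_comm (P.qexp y.2)])
    (nz e1 (by simp only [show P.par.p = P.base from rfl]; field_simp))
    (nz e2 (by simp only [show P.par.p = P.base from rfl]; field_simp))
    (nz e3 (by field_simp)) (nz e4 (by field_simp)) (nz e5a (by field_simp))
    (nz e5b (by simp only [show P.par.p = P.base from rfl]; field_simp))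
    (nz e6 (by simp only [show P.par.a = P.a from rfl]; field_simp))
    (nz e7 (by simp only [show P.par.a = P.a from rfl]; field_simp))
    (nz e8 (by simp only [show P.par.a = P.a from rfl]; field_simp))
    (tz e9 (by field_simp)) (tz e10 (by field_simp))
    (tz e11 (by simp only [show P.par.a = P.a from rfl]; field_simp))
    (tz e12 (by simp only [show P.par.a = P.a from rfl]; field_simp)) s1 s2 s3
  rw [inv_inv] at key
  rw [key, awCombination, PhiTilde_eq, PhiTilde_eq]
  simp only [qexp_neg]
  rw [c1, c2]

lemma eventually_awSeries_eq (h : MeroEq (cfun P) fun x z => cfun P.dual z x) :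
    ∀ᶠ y : ℂ × ℂ in generic, awSeries P y.1 y.2 = P.par.aw (P.qexp y.1) (P.qexp y.2) := by
  obtain ⟨g1, g2, g3, -⟩ := constants_ne_zero h
  filter_upwards [P.eventually_qPochInf_zpow_ne_zero (P.base * P.dual.a / P.d) (-1) 1 (by norm_num),
    P.eventually_qPochInf_zpow_ne_zero (P.base * P.dual.a / P.d) 1 1 (by norm_num)] with y k1 k2
  exact awSeries_eq g1 g2 g3 k1 k2

lemma qexp_sub_div_eq (z : ℂ) :
    P.qexp (P.s - z) / P.dual.d = P.base / (P.par.dual.d * P.qexp z) := by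
  rw [qexp_sub, ← base, div_div, mul_comm, show P.dual.d = P.par.dual.d from P.dual_d]

/-- Provides the meromorphic continuation of the series, hence the existence behind the choice of
`awFun`. -/
lemma isAWFunction_awCombination (h : MeroEq (cfun P) fun x z => cfun P.dual z x) :
    IsAWFunction P (awCombination P) := by
  refine ⟨P.isMeromorphic_awCombination, ?_⟩
  have h1 : ∀ᶠ y : ℂ × ℂ in generic, ‖P.qexp (P.s - y.2) / P.dual.d‖ < 1 →
      awCombination P y.1 y.2 = awSeries P y.1 y.2 := by
    filter_upwards [eventually_awSeries_eq h, eventually_awCombination_eq h] with y e1 e2 hy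
    rw [e1, e2 (by rwa [qexp_sub_div_eq] at hy)]
  obtain ⟨g, hg, H⟩ := h1
  exact ⟨g, hg, fun x z hxz hgz => H (x, z) hgz hxz⟩

lemma exists_norm_div_qexp_lt (c : ℂ) : ∃ t, ∀ c' : ℂ, ‖c'‖ ≤ ‖c‖ → ‖c' / P.qexp t‖ < 1 := by
  have hpos : (0 : ℝ) < ‖c‖ + 1 := by positivity
  obtain ⟨t, ht⟩ := P.exists_qexp_eq (u := ((‖c‖ + 1 : ℝ) : ℂ)) (by exact_mod_cast hpos.ne')
  refine ⟨t, fun c' hc' => ?_⟩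
  rw [ht, norm_div, Complex.norm_of_nonneg hpos.le, div_lt_one hpos]
  linarith

/-- Two meromorphic functions given by the same series on a nonempty open set coincide. -/
lemma meroEq_awFun (h : MeroEq (cfun P) fun x z => cfun P.dual z x) :
    MeroEq (awFun P) (awCombination P) := by
  obtain ⟨m1, g1, hg1, H1⟩ : IsAWFunction P (awFun P) :=
    Classical.epsilon_spec ⟨_, isAWFunction_awCombination h⟩
  obtain ⟨m2, g2, hg2, H2⟩ := isAWFunction_awCombination h
  refine m1.meroEq_of_isOpen m2 (U := {y | ‖P.qexp (P.s - y.2) / P.dual.d‖ < 1}) ?_ ?_ ?_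
  · have := P.differentiable_qexp.continuous
    exact isOpen_lt (by fun_prop) (by fun_prop)
  · obtain ⟨t, ht⟩ := exists_norm_div_qexp_lt (P := P) (P.base / P.par.dual.d)
    refine ⟨(0, t), ?_⟩
    show ‖P.qexp (P.s - t) / P.dual.d‖ < 1
    rw [qexp_sub_div_eq, ← div_div]
    exact ht _ le_rfl
  · filter_upwards [hg1.eventually_ne_zero, hg2.eventually_ne_zero] with y n1 n2 hy
    rw [H1 y.1 y.2 hy n1, H2 y.1 y.2 hy n2]

lemma meroEq_dual (h : MeroEq (cfun P) fun x z => cfun P.dual z x) :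
    MeroEq (cfun P.dual) fun x z => cfun P.dual.dual z x := by
  rw [meroEq_iff] at h ⊢
  exact (tendsto_swap_generic.eventually h).mono fun y hy => hy.symm

/-- The three norm conditions are those of convergence of the initial, the intermediate and the
final series in the two Bailey transformations. -/
lemma eventually_aw_eq_dual (h : MeroEq (cfun P) fun x z => cfun P.dual z x) :
    ∀ᶠ y : ℂ × ℂ in generic, ‖P.base / (P.par.dual.d * P.qexp y.2)‖ < 1 →
      ‖P.b / P.qexp y.1‖ < 1 → ‖P.base / (P.d * P.qexp y.1)‖ < 1 →
      P.par.aw (P.qexp y.1) (P.qexp y.2) = P.par.dual.aw (P.qexp y.2) (P.qexp y.1) := by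
  obtain ⟨g3, g2, g1, g4, g5, g6⟩ := constants_ne_zero h
  have hp0 := P.base_ne_zero
  have hp := P.norm_base_lt_one
  have hd : P.d ≠ 0 := P.par.hd
  have hc : P.c ≠ 0 := P.par.hc
  have hδ0 : P.par.dual.d ≠ 0 := P.par.dual.hd
  filter_upwards [
    P.eventually_qPochInf_zpow_ne_zero (P.a * P.dual.a / P.d) 0 1 (by norm_num),
    P.eventually_qPochInf_zpow_ne_zero (P.a * P.c / P.d) 1 0 (by norm_num),
    P.eventually_qPochInf_zpow_ne_zero (P.dual.a * P.a / P.par.dual.d) 1 0 (by norm_num),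
    P.eventually_qPochInf_zpow_ne_zero (P.base * P.dual.a / P.d) 1 1 (by norm_num),
    P.eventually_qPochInf_zpow_ne_zero (P.base * P.dual.a / P.d) (-1) 1 (by norm_num),
    P.eventually_qPochInf_zpow_ne_zero (P.base * P.dual.a / P.d) 1 (-1) (by norm_num),
    P.eventually_qPochInf_zpow_ne_zero (P.b / P.base) (-1) 0 (by norm_num),
    P.eventually_qPochInf_zpow_ne_zero (1 / P.par.dual.d) 0 (-1) (by norm_num),
    P.eventually_qPochInf_zpow_ne_zero (P.dual.a / (P.c * P.base)) (-1) 1 (by norm_num),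
    P.eventually_qPochInf_zpow_ne_zero (1 / P.d) (-1) 0 (by norm_num),
    P.eventually_qPochInf_zpow_ne_zero (P.base / P.d) 1 0 (by norm_num),
    P.eventually_qPochInf_zpow_ne_zero (P.base / P.par.dual.d) 0 1 (by norm_num)] with
    y k1 k2 k3 k4 k5 k6 k7 k8 k9 k10 k11 k12 t1 t2 t3
  have hu := P.qexp_ne_zero y.1
  have hv := P.qexp_ne_zero y.2
  have nz : ∀ {x y : ℂ}, qPochInf x P.base ≠ 0 → y = x → qPochInf y P.base ≠ 0 :=
    fun hx hy => hy ▸ hx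
  have n1 : qPochInf (P.a * P.dual.a / P.d * P.qexp y.2) P.base ≠ 0 := nz k1 (by simp)
  have n3 : qPochInf (P.dual.a * P.a / P.par.dual.d * P.qexp y.1) P.base ≠ 0 := nz k3 (by simp)
  have key := P.par.awSum_dual hu hv g1 g2 g3 g4 g5 g6 n1 (nz k2 (by rw [zpow_one, zpow_zero, mul_one]; rfl)) n3
    (nz k4 (by rw [zpow_one, zpow_one]; rfl))
    (nz k5 (by rw [zpow_neg_one, zpow_one, div_eq_inv_mul (P.qexp y.2)]; rfl))
    (nz k6 (by rw [zpow_neg_one, zpow_one, div_eq_mul_inv (P.qexp y.1)]; rfl))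
    (nz k7 (by rw [zpow_neg_one, zpow_zero, mul_one, ← div_eq_mul_inv, div_div]; rfl))
    (nz k8 (by rw [zpow_neg_one, zpow_zero, one_mul, ← div_eq_mul_inv, div_div]))
    (nz k9 (by rw [zpow_neg_one, zpow_one, div_eq_inv_mul (P.qexp y.2)]; rfl))
    (nz k10 (by rw [zpow_neg_one, zpow_zero, mul_one, ← div_eq_mul_inv, div_div]; rfl)) t1 t2 t3
  exact P.par.aw_eq_dual key n1 n3 (qPochInf_ne_zero_of_norm_lt hp t3)
    (qPochInf_ne_zero_of_norm_lt hp t1)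
    (nz k11 (by rw [zpow_one, zpow_zero, mul_one, div_mul_eq_mul_div]; rfl))
    (nz k12 (by rw [zpow_one, zpow_zero, one_mul, div_mul_eq_mul_div]; rfl))

/-- Self-duality of 𝓔 is checked on the nonempty open set where all series involved converge, and
then extended by the identity theorem. -/
lemma meroEq_awCombination_dual (h : MeroEq (cfun P) fun x z => cfun P.dual z x) :
    MeroEq (awCombination P) fun x z => awCombination P.dual z x := by
  have m2 := P.dual.isMeromorphic_awCombination.comp (φ := fun y => (y.2, y.1))
    (ψ := fun y => (y.2, y.1)) (by fun_prop) fun _ => rfl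
  refine P.isMeromorphic_awCombination.meroEq_of_isOpen m2
    (U := {y | ‖P.base / (P.par.dual.d * P.qexp y.2)‖ < 1} ∩ ({y | ‖P.b / P.qexp y.1‖ < 1} ∩
      {y | ‖P.base / (P.d * P.qexp y.1)‖ < 1})) ?_ ?_ ?_
  · have hq := P.differentiable_qexp.continuous
    have hδ0 : P.par.dual.d ≠ 0 := P.par.dual.hd
    have hd : P.d ≠ 0 := P.par.hd
    have n := P.qexp_ne_zero
    refine (isOpen_lt ?_ continuous_const).inter
      ((isOpen_lt ?_ continuous_const).inter (isOpen_lt ?_ continuous_const))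
    · exact (Continuous.div (by fun_prop) (by fun_prop) fun y => mul_ne_zero hδ0 (n _)).norm
    · exact (Continuous.div (by fun_prop) (by fun_prop) fun y => n _).norm
    · exact (Continuous.div (by fun_prop) (by fun_prop) fun y => mul_ne_zero hd (n _)).norm
  · obtain ⟨z, hz⟩ := exists_norm_div_qexp_lt (P := P) (P.base / P.par.dual.d)
    obtain ⟨x, hx⟩ := exists_norm_div_qexp_lt (P := P)
      ((max ‖P.b‖ ‖P.base / P.d‖ : ℝ) : ℂ)
    rw [Complex.norm_of_nonneg (le_max_of_le_left (norm_nonneg _))] at hx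
    refine ⟨(x, z), ?_, hx _ (le_max_left _ _), ?_⟩
    · show ‖P.base / (P.par.dual.d * P.qexp z)‖ < 1
      rw [← div_div]; exact hz _ le_rfl
    · show ‖P.base / (P.d * P.qexp x)‖ < 1
      rw [← div_div]; exact hx _ (le_max_right _ _)
  · have d2 := tendsto_swap_generic.eventually (eventually_awCombination_eq (meroEq_dual h))
    filter_upwards [eventually_awCombination_eq h, d2, eventually_aw_eq_dual h] with y e1 e2 e3 hy
    obtain ⟨h1, h2, h3⟩ := hy
    rw [e1 h1, e3 h1 h2 h3]
    rw [par_dual, Par.dual_dual_d] at e2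
    exact (e2 h3).symm

/-! ## The main results -/

lemma meroEq_PhiTilde_dual (h : MeroEq (cfun P) fun x z => cfun P.dual z x) :
    MeroEq (PhiTilde P) fun x z => PhiTilde P.dual z x := by
  rw [meroEq_iff] at h ⊢
  filter_upwards [h] with y hy
  rw [PhiTilde, PhiTilde, hy, Phi_dual]

/-- Self-duality of 𝓔, with (ii) applied to its dual expansion, compares two sums sharing the
summand Φ̃(-x, -z); cancelling it leaves the assertion. -/
lemma meroEq_PhiTilde_neg (h : MeroEq (cfun P) fun x z => cfun P.dual z x) :
    MeroEq (fun x z => PhiTilde P (-x) z) fun x z => PhiTilde P x (-z) := by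
  have h2 := meroEq_iff.mp (meroEq_PhiTilde_dual h)
  rw [meroEq_iff]
  filter_upwards [meroEq_iff.mp (meroEq_awCombination_dual h),
    tendsto_neg_left_generic.eventually h2,
    (tendsto_neg_left_generic.comp tendsto_neg_right_generic).eventually h2] with y e1 e2 e3
  simp only [Function.comp_apply, awCombination] at e1 e2 e3
  linear_combination e2 - e1 + e3

/-- In the connection formula both summands carry -z; the reflection property, used at z and at -z,
moves the sign to x. -/
lemma meroEq_awFun_add (h : MeroEq (cfun P) fun x z => cfun P.dual z x) :
    MeroEq (awFun P) fun x z => PhiTilde P x z + PhiTilde P (-x) z := by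
  have h2 := meroEq_iff.mp (meroEq_PhiTilde_neg h)
  rw [meroEq_iff]
  filter_upwards [meroEq_iff.mp (meroEq_awFun h), h2,
    tendsto_neg_right_generic.eventually h2] with y e1 e2 e3
  simp only [awCombination, neg_neg] at e1 e2 e3
  linear_combination e1 - e2 + e3

end Params

end AskeyWilson

end

theorem mainTheorem7 :
    (∀ P : AskeyWilson.Params, P.HalfIntegral →
      AskeyWilson.MeroEq (AskeyWilson.cfun P) (fun x z => AskeyWilson.cfun P.dual z x)) ∧
    (∀ P : AskeyWilson.Params,
      AskeyWilson.MeroEq (AskeyWilson.cfun P) (fun x z => AskeyWilson.cfun P.dual z x) →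
        AskeyWilson.MeroEq (AskeyWilson.PhiTilde P)
          (fun x z => AskeyWilson.PhiTilde P.dual z x) ∧
        AskeyWilson.MeroEq (fun x z => AskeyWilson.PhiTilde P (-x) z)
          (fun x z => AskeyWilson.PhiTilde P x (-z)) ∧
        AskeyWilson.MeroEq (AskeyWilson.awFun P)
          (fun x z => AskeyWilson.PhiTilde P x z + AskeyWilson.PhiTilde P (-x) z)) := by
  exact ⟨fun P hP => AskeyWilson.Params.meroEq_cfun_of_halfIntegral hP, fun P h =>
    ⟨AskeyWilson.Params.meroEq_PhiTilde_dual h, AskeyWilson.Params.meroEq_PhiTilde_neg h,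
      AskeyWilson.Params.meroEq_awFun_add h⟩⟩
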